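/- Let $h,\alpha,\,$ and the colours $z,z_1,z_2$ be arbitrary complex numbers, and let $j,j_1,j_2\in\{0,\tfrac12,1,\dots\}$. **Algebras.** $\mathrm{Fun}_{h,\alpha}(GL(2))$ is the complex algebra generated by $a,b,c,d$ and powers $D^w$ ($w\in\mathbb C$) of the determinant $D=ad-bc-h(1+\alpha)ac$, with $D^{w+w'}=D^wD^{w'}$, $D^0=1$, $D^1=D$ and $$[a,b]=h(1+\alpha)(a^2-D),\quad [a,c]=-h(1-\alpha)c^2,\quad [b,d]=-h(1-\alpha)(d^2-D),\quad [c,d]=h(1+\alpha)c^2,$$ $$[a,d]=h(1+\alpha)ac-h(1-\alpha)dc,\qquad [b,c]=-h(1+\alpha)ac-h(1-\alpha)cd,$$ $$aD^w=D^w(a+sc),\quad bD^w=D^w\bigl(b+s(d-a)-s^2c\bigr),\quad cD^w=D^wc,\quad dD^w=D^w(d-sc),\qquad s=2h\alpha w.$$ $\mathrm{Fun}_{q,\lambda}(GL(2))$, with $\lambda=q^\alpha$ and $\lambda^x:=q^{\alpha x}$ (principal branch near $q=1$), is generated by $\hat a,\hat b,\hat c,\hat d$ and powers $\hat D^w$ ($w\in\mathbb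 C$) of $\hat D=\hat a\hat d-q^{-1}\lambda^{-1}\hat b\hat c$ (again $\hat D^{w+w'}=\hat D^w\hat D^{w'}$, $\hat D^0=1$, $\hat D^1=\hat D$), with $$\hat a\hat b=q^{-1}\lambda^{-1}\hat b\hat a,\quad \hat a\hat c=q^{-1}\lambda\hat c\hat a,\quad \hat b\hat d=q^{-1}\lambda\hat d\hat b,\quad \hat c\hat d=q^{-1}\lambda^{-1}\hat d\hat c,\quad [\hat a,\hat d]=(q^{-1}-q)\lambda^{-1}\hat b\hat c,\quad \lambda^{-1}\hat b\hat c=\lambda\hat c\hat b,$$ $$[\hat a,\hat D^w]=[\hat d,\hat D^w]=0,\qquad \hat b\hat D^w=\lambda^{2w}\hat D^w\hat b,\qquad \hat c\hat D^w=\lambda^{-2w}\hat D^w\hat c;$$ $\hat a^{-1}$ is adjoined to it. **Matrices.** In the spin-$j$ representation with basis $|jm\rangle$ ($m=j,\dots,-j$), put $J_0|jm\rangle=2m|jm\rangle$, $\hat J_+|jm\rangle=[j-m]_q[j+m+1]_q|j\,m{+}1\rangle$, $\hat J_-|jm\rangle=|j\,m{-}1\rangle$, where $[x]_q=\frac{q^x-q^{-x}}{q-q^{-1}}$,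 and let $J_+$ be $\hat J_+$ at $q=1$, i.e. $J_+|jm\rangle=(j-m)(j+m+1)|j\,m{+}1\rangle$. Let $M_j=\sum_t(\eta\hat J_+)^t/[t]_q!$ with $\eta=h/(q-1)$. The standard coloured matrix is $$T_{q,\lambda}^{j,z}=\exp_{q^2}(\hat\gamma\hat{\mathcal J}_-)\;\hat a^{J_0}\hat D^{z-J_0/2}\;\exp_{q^{-2}}(\hat\beta\hat{\mathcal J}_+),$$ $$\hat\gamma=\hat c\hat a^{-1},\quad \hat\beta=\hat a^{-1}\hat b,\quad \hat{\mathcal J}_+=\hat J_+q^{(J_0+1)/2}\lambda^{z-1/2},\quad \hat{\mathcal J}_-=q^{-(J_0+1)/2}\lambda^{z-1/2}\hat J_-,$$ where $\exp_Q(x)=\sum_t x^t/\{t\}_Q!$, $\{t\}_Q=\frac{1-Q^t}{1-Q}$ (this is the universal $\mathcal T_{q,\lambda}$ matrix in the representation $(j,z)$). With $X=h^{-1}\operatorname{arcsinh}(hJ_+)$, $T=e^{hX}$, $H=(1+h^2J_+^2)^{1/2}J_0$, and with the central element $Z$ acting as $z_1$, $z_2$ in the two factors, let $R_{h,\alpha}^{j_1,z_1;j_2,z_2}$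 be the matrix of $$F^{-1}\,\exp(-hX\otimes TH)\exp(hTH\otimes X)\,F^{-1},\qquad F^{-1}=\exp[-\alpha h(X\otimes Z-Z\otimes X)]$$ (for $h=0$, $X=J_+$). **Limits.** Let $\tilde a,\tilde b,\tilde c,\tilde d$ be the entries of $M_{1/2}^{-1}\begin{pmatrix}\hat a&\hat b\\ \hat c&\hat d\end{pmatrix}M_{1/2}$. A family $x_q\in\mathrm{Fun}_{q,\lambda=q^\alpha}(GL(2))[\hat a^{-1}]$ tends to $y\in\mathrm{Fun}_{h,\alpha}(GL(2))$ as $q\to1$, $q\ne1$, if there are finitely many noncommutative polynomials $p_i$ in the symbols $a,b,c,d,D^w$, independent of $q$, and functions $f_i(q)$ with finite limits $f_i(1)$, such that $x_q=\sum_if_i(q)\,p_i(\tilde a,\tilde b,\tilde c,\tilde d,\hat D^w)$ for $q\neq 1$ near $1$ and $y=\sum_if_i(1)\,p_i(a,b,c,d,D^w)$. **Claim.** For all $j,z$ the entrywise limit $$T_{h,\alpha}^{j,z}=\lim_{q\to1}M_j^{-1}\,T_{q,\lambda=q^\alpha}^{j,z}\,M_j$$ exists, as a matrix with entries in $\mathrm{Fun}_{h,\alpha}(GL(2))$,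 and is unique. For all $j_1,z_1,j_2,z_2$, $$R_{h,\alpha}^{j_1,z_1;j_2,z_2}\bigl(T_{h,\alpha}^{j_1,z_1}\otimes1\bigr)\bigl(1\otimes T_{h,\alpha}^{j_2,z_2}\bigr)=\bigl(1\otimes T_{h,\alpha}^{j_2,z_2}\bigr)\bigl(T_{h,\alpha}^{j_1,z_1}\otimes1\bigr)R_{h,\alpha}^{j_1,z_1;j_2,z_2}.$$ Moreover, for all $z$, with rows and columns ordered by decreasing $m$: $$T_{h,\alpha}^{\frac12,z}=D^{z-\frac12}\begin{pmatrix}a+h\alpha(z-\frac12)c& b-h\alpha(z-\frac12)(a-d)-h^2\alpha^2(z-\frac12)^2c\\ c& d-h\alpha(z-\frac12)c\end{pmatrix},\qquad T_{h,\alpha}^{1,z}=D^{z-1}\bigl(U^z_{ik}\bigr)_{1\le i,k\le3},$$ where $$\begin{aligned} U^z_{11}={}&a^2+2h\alpha(z-1)ac+\tfrac14h^2[1+\alpha(2z-3)]^2c^2,\\ U^z_{12}={}&2ab-h[1+\alpha(2z-1)](a^2-ad)-h[1-\alpha(2z-3)]bc-h^2[1+2\alpha+\alpha^2(4z^2-8z+5)]ac\\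 &+\tfrac12h^2[1+\alpha(2z-3)]^2cd-\tfrac14h^3[1+\alpha(6z-7)+\alpha^2(12z^2-28z+15)+\alpha^3(8z^3-28z^2+30z-9)]c^2,\\ U^z_{13}={}&2b^2-4h\alpha(z-1)(ab-bd)-\tfrac12h^2[3-2\alpha(2z-1)-\alpha^2(2z-1)^2]a^2\\ &+h^2[1-4\alpha(z-1)-\alpha^2(4z^2-8z+5)]ad-h^2[1-4\alpha(z-1)+\alpha^2(4z^2-8z+3)]bc\\ &+\tfrac12h^2[1+\alpha(2z-3)]^2d^2-h^3[1-\alpha(z-2)-\alpha^2(6z-5)-\alpha^3(4z^3-12z^2+13z-4)]ac\\ &-h^3[\alpha(z-1)+2\alpha^2(2z^2-5z+3)+\alpha^3(4z^3-16z^2+21z-9)]cd\\ &-\tfrac18h^4[3+8\alpha(z-2)-2\alpha^2(4z^2-7)-8\alpha^3(4z^3-12z^2+11z-3)-\alpha^4(16z^4-64z^3+88z^2-48z+9)]c^2,\\ U^z_{21}={}&ac+\tfrac12h[1+\alpha(2z-3)]c^2,\\ U^z_{22}={}&ad+bc-2h\alpha(z-1)ac+h[1+\alpha(2z-3)]cd-\tfrac12h^2[1+4\alpha(z-1)+\alpha^2(4z^2-8z+3)]c^2,\\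 U^z_{23}={}&2bd+h[1+\alpha(2z-3)](d^2-ad)+h[1-\alpha(2z-1)]bc-\tfrac12h^2[1-2\alpha-\alpha^2(4z^2-8z+3)]ac\\ &-2h^2\alpha[z-1+\alpha(2z^2-5z+3)]cd-\tfrac14h^3[3+\alpha(2z-7)-\alpha^2(12z^2-20z+7)-\alpha^3(8z^3-20z^2+14z-3)]c^2,\\ U^z_{31}={}&\tfrac12c^2,\qquad U^z_{32}=cd-\tfrac12h[1+\alpha(2z-1)]c^2,\\ U^z_{33}={}&d^2-2h\alpha(z-1)cd-\tfrac14h^2[3-2\alpha(2z-1)-\alpha^2(2z-1)^2]c^2. \end{aligned}$$ In the case $\alpha=0$, $z=\frac12$ one has, with $\{x,y\}=xy+yx$, $$T_{h,0}^{1,\frac12}=D^{-1/2}\begin{pmatrix}a^2+\frac14h^2c^2&\{a,b\}+\frac14h^2\{c,d\}&2b^2+\frac12h^2(2D-3a^2+d^2)-\frac38h^4c^2\\ \frac12\{a,c\}&\frac12(\{a,d\}+\{b,c\})&\{b,d\}-\frac34h^2\{a,c\}\\ \frac12c^2&\frac12\{c,d\}&d^2-\frac34h^2c^2\end{pmatrix}.$$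 -/

import Mathlib

open Filter Topology
open scoped Kronecker

noncomputable section

namespace Jordanian

/-! ## The Jordanian quantum group -/

/-- Generators of the Jordanian quantum group: the four matrix entries `a, b, c, d` and the
powers `D ^ w` (`w ∈ ℂ`) of the quantum determinant. -/
inductive HGen
  | a | b | c | d
  | D (w : ℂ)

namespace HWord
abbrev a : FreeAlgebra ℂ HGen := FreeAlgebra.ι ℂ HGen.a
abbrev b : FreeAlgebra ℂ HGen := FreeAlgebra.ι ℂ HGen.b
abbrev c : FreeAlgebra ℂ HGen := FreeAlgebra.ι ℂ HGen.c
abbrev d : FreeAlgebra ℂ HGen := FreeAlgebra.ι ℂ HGen.d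
abbrev D (w : ℂ) : FreeAlgebra ℂ HGen := FreeAlgebra.ι ℂ (HGen.D w)
end HWord

open HWord in
/-- Defining relations of `Fun_{h,α}(GL(2))`. The first six are the commutation relations of
`a, b, c, d`, with `D = ad - bc - h(1+α)ac`; the others say that `w ↦ D ^ w` is a
one-parameter group through `D` and that
`D ^ (-w) * (a, b; c, d) * D ^ w = (1, s; 0, 1) * (a, b; c, d) * (1, -s; 0, 1)`, `s = 2hαw`
(for `w = 1` these are the commutation relations of `D` with `a, b, c, d`, and for general `w`
they are the relations of `exp (w log D)`, where `[a, log D] = 2hαc`,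
`[b, log D] = 2hα(d - a)`, `[c, log D] = 0`, `[d, log D] = -2hαc`). -/
inductive HRel (h α : ℂ) : FreeAlgebra ℂ HGen → FreeAlgebra ℂ HGen → Prop
  | ab : HRel h α (a * b - b * a) ((h * (1 + α)) • (a ^ 2 - D 1))
  | ac : HRel h α (a * c - c * a) (-((h * (1 - α)) • c ^ 2))
  | bd : HRel h α (b * d - d * b) (-((h * (1 - α)) • (d ^ 2 - D 1)))
  | cd : HRel h α (c * d - d * c) ((h * (1 + α)) • c ^ 2)
  | ad : HRel h α (a * d - d * a) ((h * (1 + α)) • (a * c) - (h * (1 - α)) • (d * c))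
  | bc : HRel h α (b * c - c * b) (-((h * (1 + α)) • (a * c)) - (h * (1 - α)) • (c * d))
  | det : HRel h α (D 1) (a * d - b * c - (h * (1 + α)) • (a * c))
  | D_zero : HRel h α (D 0) 1
  | D_add (w w' : ℂ) : HRel h α (D (w + w')) (D w * D w')
  | a_D (w : ℂ) : HRel h α (a * D w) (D w * (a + (2 * h * α * w) • c))
  | b_D (w : ℂ) : HRel h α (b * D w)
      (D w * (b + (2 * h * α * w) • (d - a) - ((2 * h * α * w) ^ 2) • c))
  | c_D (w : ℂ) : HRel h α (c * D w) (D w * c)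
  | d_D (w : ℂ) : HRel h α (d * D w) (D w * (d - (2 * h * α * w) • c))

/-- The Jordanian quantum group `Fun_{h,α}(GL(2))`, with all complex powers of the (invertible)
quantum determinant. -/
abbrev FunH (h α : ℂ) : Type := RingQuot (HRel h α)

/-- The value in `Fun_{h,α}(GL(2))` of a noncommutative polynomial in the generators. -/
def evalH (h α : ℂ) : FreeAlgebra ℂ HGen →ₐ[ℂ] FunH h α := RingQuot.mkAlgHom ℂ (HRel h α)

/-! ## The standard quantum group -/

/-- Generators of the standard quantum group: the matrix entries `a, b, c, d` (with hats), the
inverse of `a` and the powers `D ^ w` of the quantum determinant. -/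
inductive QGen
  | a | ainv | b | c | d
  | D (w : ℂ)

namespace QWord
abbrev a : FreeAlgebra ℂ QGen := FreeAlgebra.ι ℂ QGen.a
abbrev ainv : FreeAlgebra ℂ QGen := FreeAlgebra.ι ℂ QGen.ainv
abbrev b : FreeAlgebra ℂ QGen := FreeAlgebra.ι ℂ QGen.b
abbrev c : FreeAlgebra ℂ QGen := FreeAlgebra.ι ℂ QGen.c
abbrev d : FreeAlgebra ℂ QGen := FreeAlgebra.ι ℂ QGen.d
abbrev D (w : ℂ) : FreeAlgebra ℂ QGen := FreeAlgebra.ι ℂ (QGen.D w)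
end QWord

open QWord in
/-- Defining relations of `Fun_{q,λ}(GL(2))` at `λ = q ^ α`, with `a` invertible and with all
complex powers of `D = ad - q⁻¹ λ⁻¹ bc`. Powers `λ ^ x` are written `q ^ (α * x)`. -/
inductive QRel (q α : ℂ) : FreeAlgebra ℂ QGen → FreeAlgebra ℂ QGen → Prop
  | ab : QRel q α (a * b) ((q⁻¹ * q ^ (-α)) • (b * a))
  | ac : QRel q α (a * c) ((q⁻¹ * q ^ α) • (c * a))
  | bd : QRel q α (b * d) ((q⁻¹ * q ^ α) • (d * b))
  | cd : QRel q α (c * d) ((q⁻¹ * q ^ (-α)) • (d * c))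
  | ad : QRel q α (a * d - d * a) (((q⁻¹ - q) * q ^ (-α)) • (b * c))
  | bc : QRel q α (q ^ (-α) • (b * c)) (q ^ α • (c * b))
  | det : QRel q α (D 1) (a * d - (q⁻¹ * q ^ (-α)) • (b * c))
  | a_ainv : QRel q α (a * ainv) 1
  | ainv_a : QRel q α (ainv * a) 1
  | D_zero : QRel q α (D 0) 1
  | D_add (w w' : ℂ) : QRel q α (D (w + w')) (D w * D w')
  | a_D (w : ℂ) : QRel q α (a * D w) (D w * a)
  | b_D (w : ℂ) : QRel q α (b * D w) (q ^ (2 * α * w) • (D w * b))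
  | c_D (w : ℂ) : QRel q α (c * D w) (q ^ (-(2 * α * w)) • (D w * c))
  | d_D (w : ℂ) : QRel q α (d * D w) (D w * d)

/-- The standard quantum group `Fun_{q,λ}(GL(2))`, `λ = q ^ α`, localized at `a`. Inverting `a` is
what the Gauss decomposition in the universal `T` matrix needs. -/
abbrev FunQ (q α : ℂ) : Type := RingQuot (QRel q α)

namespace FunQ
variable (q α : ℂ)
/-- The image of a generator in the algebra. -/
def gen (g : QGen) : FunQ q α := RingQuot.mkAlgHom ℂ (QRel q α) (FreeAlgebra.ι ℂ g)

/-- The generator `a` as a unit. -/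
def aUnit : (FunQ q α)ˣ where
  val := gen q α QGen.a
  inv := gen q α QGen.ainv
  val_inv := by
    have := RingQuot.mkAlgHom_rel ℂ (QRel.a_ainv (q := q) (α := α))
    simpa [gen] using this
  inv_val := by
    have := RingQuot.mkAlgHom_rel ℂ (QRel.ainv_a (q := q) (α := α))
    simpa [gen] using this

/-- `b = a β̂`, i.e. `β̂ = a⁻¹ b`. -/
def beta : FunQ q α := gen q α QGen.ainv * gen q α QGen.b

/-- `c = γ̂ a`, i.e. `γ̂ = c a⁻¹`. -/
def gamma : FunQ q α := gen q α QGen.c * gen q α QGen.ainv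
end FunQ

/-! ## Quantum numbers, quantum exponentials and representations

Throughout `n = 2j`, and the index `k : Fin (n + 1)` stands for the weight vector `|j m⟩` with
`m = j - k`; thus `J₀ |j m⟩ = 2m |j m⟩ = (n - 2k) |j m⟩`. -/

/-- `[m]_q = (q ^ m - q ^ (-m)) / (q - q ^ (-1))`. -/
def qBracket (q : ℂ) (m : ℕ) : ℂ := (q ^ m - q⁻¹ ^ m) / (q - q⁻¹)

/-- `[m]_q! = [m]_q ⋯ [1]_q`. -/
def qBracketFactorial (q : ℂ) (m : ℕ) : ℂ := ∏ i ∈ Finset.range m, qBracket q (i + 1)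

/-- `{m}_Q = (1 - Q ^ m) / (1 - Q)`. -/
def qBrace (Q : ℂ) (m : ℕ) : ℂ := (1 - Q ^ m) / (1 - Q)

/-- `{m}_Q! = {m}_Q ⋯ {1}_Q`. -/
def qBraceFactorial (Q : ℂ) (m : ℕ) : ℂ := ∏ i ∈ Finset.range m, qBrace Q (i + 1)

/-- `J₊` of `U_q(sl(2))` in spin `j = n / 2`:
`J₊ |j m⟩ = [j - m]_q [j + m + 1]_q |j, m + 1⟩`. -/
def JplusQ (q : ℂ) (n : ℕ) : Matrix (Fin (n + 1)) (Fin (n + 1)) ℂ :=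
  Matrix.of fun i k => if (i : ℕ) + 1 = (k : ℕ) then qBracket q k * qBracket q (n + 1 - k) else 0

/-- `J₋ |j m⟩ = |j, m - 1⟩`. -/
def Jminus (n : ℕ) : Matrix (Fin (n + 1)) (Fin (n + 1)) ℂ :=
  Matrix.of fun i k => if (i : ℕ) = (k : ℕ) + 1 then 1 else 0

/-- The transforming matrix `M_j = E_q(η J₊)`, `η = h / (q - 1)`; the series
`E_q(x) = ∑ x ^ t / [t]_q!` stops because `J₊ ^ (n + 1) = 0`. -/
def transM (h q : ℂ) (n : ℕ) : Matrix (Fin (n + 1)) (Fin (n + 1)) ℂ :=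
  ∑ t ∈ Finset.range (n + 1), (qBracketFactorial q t)⁻¹ • ((h / (q - 1)) • JplusQ q n) ^ t

/-- The similarity transformation `X ↦ M_j⁻¹ X M_j` on matrices over the quantum group. -/
def conjM (h q α : ℂ) (n : ℕ) (X : Matrix (Fin (n + 1)) (Fin (n + 1)) (FunQ q α)) :
    Matrix (Fin (n + 1)) (Fin (n + 1)) (FunQ q α) :=
  (transM h q n)⁻¹.map (algebraMap ℂ (FunQ q α)) * X *
    (transM h q n).map (algebraMap ℂ (FunQ q α))

/-- `𝒥₊ = J₊ q ^ ((J₀ + 1) / 2) λ ^ (Z - 1/2)` at `Z = z`, `λ = q ^ α`. -/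
def calJplus (q α : ℂ) (n : ℕ) (z : ℂ) : Matrix (Fin (n + 1)) (Fin (n + 1)) ℂ :=
  q ^ (α * (z - 1 / 2)) •
    (JplusQ q n * Matrix.diagonal fun k : Fin (n + 1) => q ^ (((n : ℂ) - 2 * (k : ℕ) + 1) / 2))

/-- `𝒥₋ = q ^ (-(J₀ + 1) / 2) λ ^ (Z - 1/2) J₋` at `Z = z`, `λ = q ^ α`. -/
def calJminus (q α : ℂ) (n : ℕ) (z : ℂ) : Matrix (Fin (n + 1)) (Fin (n + 1)) ℂ :=
  q ^ (α * (z - 1 / 2)) •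
    ((Matrix.diagonal fun k : Fin (n + 1) => q ^ (-((n : ℂ) - 2 * (k : ℕ) + 1) / 2)) * Jminus n)

/-- `exp_Q(x J) = ∑ (x J) ^ t / {t}_Q!` for `x` in the quantum group and a matrix `J` of size
`n + 1` with `J ^ (n + 1) = 0`. -/
def qExp {q α : ℂ} {n : ℕ} (Q : ℂ) (x : FunQ q α) (J : Matrix (Fin (n + 1)) (Fin (n + 1)) ℂ) :
    Matrix (Fin (n + 1)) (Fin (n + 1)) (FunQ q α) :=
  ∑ t ∈ Finset.range (n + 1),
    (qBraceFactorial Q t)⁻¹ • (x • J.map (algebraMap ℂ (FunQ q α))) ^ t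

/-- The standard coloured matrix `T_{q,λ}^{j,z}`, `λ = q ^ α`, `n = 2j`: the universal `T` matrix
`exp_{q²}(γ̂ 𝒥₋) exp[α̂ (J₀/2 + Z) + δ̂ (J₀/2 - Z)] exp_{q⁻²}(β̂ 𝒥₊)` in the representation `(j, z)`.
Here `a = exp α̂`, and `D = a exp (-δ̂)`, where `α̂` and `δ̂` commute. So, on the vector with
`J₀ / 2 = m`, the middle factor is `a ^ (m + z) (a D⁻¹) ^ (m - z) = a ^ (2m) D ^ (z - m)`. -/
def stdT (q α : ℂ) (n : ℕ) (z : ℂ) : Matrix (Fin (n + 1)) (Fin (n + 1)) (FunQ q α) :=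
  qExp (q ^ 2) (FunQ.gamma q α) (calJminus q α n z) *
    (Matrix.diagonal fun k : Fin (n + 1) =>
      ((FunQ.aUnit q α ^ ((n : ℤ) - 2 * (k : ℕ)) : (FunQ q α)ˣ) : FunQ q α) *
        FunQ.gen q α (QGen.D (z - ((n : ℂ) - 2 * (k : ℕ)) / 2))) *
    qExp (q ^ 2)⁻¹ (FunQ.beta q α) (calJplus q α n z)

/-- The transformed matrix `M_j⁻¹ T_{q,λ}^{j,z} M_j`, `λ = q ^ α`, `n = 2j`. -/
def tildeT (h q α : ℂ) (n : ℕ) (z : ℂ) : Matrix (Fin (n + 1)) (Fin (n + 1)) (FunQ q α) :=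
  conjM h q α n (stdT q α n z)

/-! ## The limit `q → 1` -/

/-- The new generators of the standard quantum group: `a, b, c, d` (with tildes) are the entries
of `M_{1/2}⁻¹ (a, b; c, d) M_{1/2}`, and the determinant is kept. -/
def tildeGen (h q α : ℂ) : HGen → FunQ q α
  | HGen.a => tildeMat 0 0
  | HGen.b => tildeMat 0 1
  | HGen.c => tildeMat 1 0
  | HGen.d => tildeMat 1 1
  | HGen.D w => FunQ.gen q α (QGen.D w)
where tildeMat : Matrix (Fin 2) (Fin 2) (FunQ q α) :=
  conjM h q α 1 !![FunQ.gen q α QGen.a, FunQ.gen q α QGen.b;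
    FunQ.gen q α QGen.c, FunQ.gen q α QGen.d]

/-- The value of a noncommutative polynomial at the new generators. -/
def evalTilde (h q α : ℂ) : FreeAlgebra ℂ HGen →ₐ[ℂ] FunQ q α :=
  FreeAlgebra.lift ℂ (tildeGen h q α)

/-- `x q ∈ Fun_{q,λ}(GL(2))` tends to `y ∈ Fun_{h,α}(GL(2))` as `q → 1` (`q ≠ 1`): for `q` near
`1`, the element `x q` is a combination of finitely many fixed polynomials in the new generators,
whose coefficients converge, and `y` is obtained by replacing the coefficients by their limits and
the new generators by those of `Fun_{h,α}(GL(2))`. -/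
def TendsToFunH (h α : ℂ) (x : (q : ℂ) → FunQ q α) (y : FunH h α) : Prop :=
  ∃ (r : ℕ) (p : Fin r → FreeAlgebra ℂ HGen) (f : Fin r → ℂ → ℂ) (f₁ : Fin r → ℂ),
    (∀ i, Tendsto (f i) (𝓝[≠] 1) (𝓝 (f₁ i))) ∧
    (∀ᶠ q in 𝓝[≠] (1 : ℂ), x q = ∑ i, f i q • evalTilde h q α (p i)) ∧
    y = ∑ i, f₁ i • evalH h α (p i)

/-- `T = lim_{q → 1} M_j⁻¹ T_{q,λ}^{j,z} M_j`, entry by entry (`n = 2j`). -/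
def IsContraction (h α : ℂ) (n : ℕ) (z : ℂ)
    (T : Matrix (Fin (n + 1)) (Fin (n + 1)) (FunH h α)) : Prop :=
  ∀ i k, TendsToFunH h α (fun q => tildeT h q α n z i k) (T i k)

/-! ## The coloured Jordanian `R` matrices -/

/-- `J₀` in spin `j = n / 2`. -/
def J0 (n : ℕ) : Matrix (Fin (n + 1)) (Fin (n + 1)) ℂ :=
  Matrix.diagonal fun k : Fin (n + 1) => (n : ℂ) - 2 * (k : ℕ)

/-- Classical `J₊` in spin `j = n / 2`: `J₊ |j m⟩ = (j - m)(j + m + 1) |j, m + 1⟩`. -/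
def Jplus (n : ℕ) : Matrix (Fin (n + 1)) (Fin (n + 1)) ℂ :=
  Matrix.of fun i k => if (i : ℕ) + 1 = (k : ℕ) then ((k : ℕ) : ℂ) * ((n : ℂ) + 1 - ((k : ℕ) : ℂ)) else 0

/-- The generalized binomial coefficient `x (x - 1) ⋯ (x - t + 1) / t!`. -/
def genBinom (x : ℂ) (t : ℕ) : ℂ := ∏ i ∈ Finset.range t, (x - i) / (i + 1)

/-- `(1 + (h J₊)²) ^ (1/2)`; the binomial series stops because `J₊ ^ (n + 1) = 0`. -/
def sqrtMat (h : ℂ) (n : ℕ) : Matrix (Fin (n + 1)) (Fin (n + 1)) ℂ :=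
  ∑ t ∈ Finset.range (n + 1), genBinom (1 / 2) t • (h • Jplus n) ^ (2 * t)

/-- The Jordanian generator `H = (1 + (h J₊)²) ^ (1/2) J₀` in spin `j = n / 2`. -/
def Hmat (h : ℂ) (n : ℕ) : Matrix (Fin (n + 1)) (Fin (n + 1)) ℂ := sqrtMat h n * J0 n

/-- `T = h J₊ + (1 + (h J₊)²) ^ (1/2)` in spin `j = n / 2`. -/
def Tmat (h : ℂ) (n : ℕ) : Matrix (Fin (n + 1)) (Fin (n + 1)) ℂ := h • Jplus n + sqrtMat h n

/-- The Jordanian generator `X = h⁻¹ log T = h⁻¹ arcsinh (h J₊)` in spin `j = n / 2`, by the series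
`arcsinh x = ∑ binom(-1/2, t) x ^ (2t + 1) / (2t + 1)`, divided by `h`. -/
def Xmat (h : ℂ) (n : ℕ) : Matrix (Fin (n + 1)) (Fin (n + 1)) ℂ :=
  ∑ t ∈ Finset.range (n + 1),
    (genBinom (-1 / 2) t * h ^ (2 * t) / (2 * t + 1)) • Jplus n ^ (2 * t + 1)

/-- The inverse `F_α⁻¹ = exp [-α h (X ⊗ Z - Z ⊗ X)]` of the twist in
`(j₁, z₁) ⊗ (j₂, z₂)`, `nᵢ = 2jᵢ`, `Z = zᵢ`. -/
def twistInv (h α : ℂ) (n₁ : ℕ) (z₁ : ℂ) (n₂ : ℕ) (z₂ : ℂ) :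
    Matrix (Fin (n₁ + 1) × Fin (n₂ + 1)) (Fin (n₁ + 1) × Fin (n₂ + 1)) ℂ :=
  NormedSpace.exp (-(α * h) • (Xmat h n₁ ⊗ₖ (z₂ • (1 : Matrix (Fin (n₂ + 1)) (Fin (n₂ + 1)) ℂ)) -
    (z₁ • (1 : Matrix (Fin (n₁ + 1)) (Fin (n₁ + 1)) ℂ)) ⊗ₖ Xmat h n₂))

/-- `R_h = exp (-h X ⊗ T H) exp (h T H ⊗ X)` in `j₁ ⊗ j₂`. -/
def RhMat (h : ℂ) (n₁ n₂ : ℕ) :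
    Matrix (Fin (n₁ + 1) × Fin (n₂ + 1)) (Fin (n₁ + 1) × Fin (n₂ + 1)) ℂ :=
  NormedSpace.exp (-h • (Xmat h n₁ ⊗ₖ (Tmat h n₂ * Hmat h n₂))) *
    NormedSpace.exp (h • ((Tmat h n₁ * Hmat h n₁) ⊗ₖ Xmat h n₂))

/-- The coloured matrix `R_{h,α}^{j₁,z₁;j₂,z₂}`: the universal `F_α⁻¹ R_h F_α⁻¹` in the
representation `(j₁, z₁) ⊗ (j₂, z₂)`. -/
def Rmat (h α : ℂ) (n₁ : ℕ) (z₁ : ℂ) (n₂ : ℕ) (z₂ : ℂ) :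
    Matrix (Fin (n₁ + 1) × Fin (n₂ + 1)) (Fin (n₁ + 1) × Fin (n₂ + 1)) ℂ :=
  twistInv h α n₁ z₁ n₂ z₂ * RhMat h n₁ n₂ * twistInv h α n₁ z₁ n₂ z₂

/-- The coloured equation `R (T₁ ⊗ 1) (1 ⊗ T₂) = (1 ⊗ T₂) (T₁ ⊗ 1) R` over a (noncommutative)
algebra. -/
def RTT {A : Type*} [Ring A] [Algebra ℂ A] {n₁ n₂ : ℕ}
    (R : Matrix (Fin (n₁ + 1) × Fin (n₂ + 1)) (Fin (n₁ + 1) × Fin (n₂ + 1)) ℂ)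
    (T₁ : Matrix (Fin (n₁ + 1)) (Fin (n₁ + 1)) A) (T₂ : Matrix (Fin (n₂ + 1)) (Fin (n₂ + 1)) A) :
    Prop :=
  R.map (algebraMap ℂ A) * (T₁ ⊗ₖ (1 : Matrix (Fin (n₂ + 1)) (Fin (n₂ + 1)) A)) *
      ((1 : Matrix (Fin (n₁ + 1)) (Fin (n₁ + 1)) A) ⊗ₖ T₂) =
    ((1 : Matrix (Fin (n₁ + 1)) (Fin (n₁ + 1)) A) ⊗ₖ T₂) *
      (T₁ ⊗ₖ (1 : Matrix (Fin (n₂ + 1)) (Fin (n₂ + 1)) A)) * R.map (algebraMap ℂ A)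

/-! ## The closed forms -/

/-- `T^{1/2,z}` without the factor `D ^ (z - 1/2)`, as noncommutative polynomials. -/
def halfForm (h α z : ℂ) : Matrix (Fin 2) (Fin 2) (FreeAlgebra ℂ HGen) :=
  open HWord in
  !![a + (h * α * (z - 1 / 2)) • c,
      b - (h * α * (z - 1 / 2)) • (a - d) - (h ^ 2 * α ^ 2 * (z - 1 / 2) ^ 2) • c;
    c, d - (h * α * (z - 1 / 2)) • c]

/-- `U^z`: the matrix `T^{1,z}` without the factor `D ^ (z - 1)`, as noncommutative
polynomials. -/
def oneForm (h α z : ℂ) : Matrix (Fin 3) (Fin 3) (FreeAlgebra ℂ HGen) :=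
  open HWord in
  !![a ^ 2 + (2 * h * α * (z - 1)) • (a * c)
        + (1 / 4 * h ^ 2 * (1 + α * (2 * z - 3)) ^ 2) • c ^ 2,
      (2 : ℂ) • (a * b) - (h * (1 + α * (2 * z - 1))) • (a ^ 2 - a * d)
        - (h * (1 - α * (2 * z - 3))) • (b * c)
        - (h ^ 2 * (1 + 2 * α + α ^ 2 * (4 * z ^ 2 - 8 * z + 5))) • (a * c)
        + (1 / 2 * h ^ 2 * (1 + α * (2 * z - 3)) ^ 2) • (c * d)
        - (1 / 4 * h ^ 3 * (1 + α * (6 * z - 7) + α ^ 2 * (12 * z ^ 2 - 28 * z + 15)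
            + α ^ 3 * (8 * z ^ 3 - 28 * z ^ 2 + 30 * z - 9))) • c ^ 2,
      (2 : ℂ) • b ^ 2 - (4 * h * α * (z - 1)) • (a * b - b * d)
        - (1 / 2 * h ^ 2 * (3 - 2 * α * (2 * z - 1) - α ^ 2 * (2 * z - 1) ^ 2)) • a ^ 2
        + (h ^ 2 * (1 - 4 * α * (z - 1) - α ^ 2 * (4 * z ^ 2 - 8 * z + 5))) • (a * d)
        - (h ^ 2 * (1 - 4 * α * (z - 1) + α ^ 2 * (4 * z ^ 2 - 8 * z + 3))) • (b * c)
        + (1 / 2 * h ^ 2 * (1 + α * (2 * z - 3)) ^ 2) • d ^ 2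
        - (h ^ 3 * (1 - α * (z - 2) - α ^ 2 * (6 * z - 5)
            - α ^ 3 * (4 * z ^ 3 - 12 * z ^ 2 + 13 * z - 4))) • (a * c)
        - (h ^ 3 * (α * (z - 1) + 2 * α ^ 2 * (2 * z ^ 2 - 5 * z + 3)
            + α ^ 3 * (4 * z ^ 3 - 16 * z ^ 2 + 21 * z - 9))) • (c * d)
        - (1 / 8 * h ^ 4 * (3 + 8 * α * (z - 2) - 2 * α ^ 2 * (4 * z ^ 2 - 7)
            - 8 * α ^ 3 * (4 * z ^ 3 - 12 * z ^ 2 + 11 * z - 3)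
            - α ^ 4 * (16 * z ^ 4 - 64 * z ^ 3 + 88 * z ^ 2 - 48 * z + 9))) • c ^ 2;
    a * c + (1 / 2 * h * (1 + α * (2 * z - 3))) • c ^ 2,
      a * d + b * c - (2 * h * α * (z - 1)) • (a * c) + (h * (1 + α * (2 * z - 3))) • (c * d)
        - (1 / 2 * h ^ 2 * (1 + 4 * α * (z - 1) + α ^ 2 * (4 * z ^ 2 - 8 * z + 3))) • c ^ 2,
      (2 : ℂ) • (b * d) + (h * (1 + α * (2 * z - 3))) • (d ^ 2 - a * d)
        + (h * (1 - α * (2 * z - 1))) • (b * c)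
        - (1 / 2 * h ^ 2 * (1 - 2 * α - α ^ 2 * (4 * z ^ 2 - 8 * z + 3))) • (a * c)
        - (2 * h ^ 2 * α * (z - 1 + α * (2 * z ^ 2 - 5 * z + 3))) • (c * d)
        - (1 / 4 * h ^ 3 * (3 + α * (2 * z - 7) - α ^ 2 * (12 * z ^ 2 - 20 * z + 7)
            - α ^ 3 * (8 * z ^ 3 - 20 * z ^ 2 + 14 * z - 3))) • c ^ 2;
    (1 / 2 : ℂ) • c ^ 2,
      c * d - (1 / 2 * h * (1 + α * (2 * z - 1))) • c ^ 2,
      d ^ 2 - (2 * h * α * (z - 1)) • (c * d)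
        - (1 / 4 * h ^ 2 * (3 - 2 * α * (2 * z - 1) - α ^ 2 * (2 * z - 1) ^ 2)) • c ^ 2]

/-- The matrix `T_h^{1}` (`α = 0`, `z = 1/2`) without the factor `D ^ (-1/2)`, in terms of `D` and
the anticommutators `x * y + y * x`, as noncommutative polynomials. -/
def oneFormAlphaZero (h : ℂ) : Matrix (Fin 3) (Fin 3) (FreeAlgebra ℂ HGen) :=
  open HWord in
  !![a ^ 2 + (1 / 4 * h ^ 2) • c ^ 2,
      (a * b + b * a) + (1 / 4 * h ^ 2) • (c * d + d * c),
      (2 : ℂ) • b ^ 2 + (1 / 2 * h ^ 2) • ((2 : ℂ) • D 1 - (3 : ℂ) • a ^ 2 + d ^ 2)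
        - (3 / 8 * h ^ 4) • c ^ 2;
    (1 / 2 : ℂ) • (a * c + c * a),
      (1 / 2 : ℂ) • ((a * d + d * a) + (b * c + c * b)),
      (b * d + d * b) - (3 / 4 * h ^ 2) • (a * c + c * a);
    (1 / 2 : ℂ) • c ^ 2,
      (1 / 2 : ℂ) • (c * d + d * c),
      d ^ 2 - (3 / 4 * h ^ 2) • c ^ 2]

end Jordanian

end

/-! The recursion. Spin (n+1)/2 is a quotient of the tensor product of spin n/2 with spin 1/2, just
as binary forms of degree n+1 are spanned by products of forms of degree n with the coordinates x
and y. Hence a matrix of size n+2 is determined by its products with the two maps "multiply by x"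
and "multiply by y" (`exists_mul_sect`, `ext_of_mul`), and most statements about all spins are
inductions along these maps. A family `T` with `IsFusion` is one whose members are all generated in
this way by the matrix (A, B; C, E) of size 2.

The contraction. Rescaling by powers of the determinant and of λ turns the Gauss decomposition of
the standard coloured matrix into one of determinant 1 with λ-free relations, and the colour
survives only as a factor D^z and a conjugation by powers of q (`stdT_apply`). The determinant-1
matrices satisfy q-deformed fusion relations (`IsGauss.mat_fusion_x`, `IsGauss.mat_fusion_y`), which
reduce to [a+b] = [a]q^b + [b]q^(-a). The matrix M_j itself has coefficients that may be singular at
q = 1, but in the new basis the multiplication maps contain it only through M⁻¹ q^(-wk) M, and the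
remaining singular factor h/(q-1) multiplies a difference that vanishes at q = 1 (`tMulX_eq`,
`tMulY_eq`). An induction on n shows that M⁻¹ q^(-wk) M tends to exp(hwX) (`tendsto_conjDiag`). So
the multiplication maps converge, together with a right inverse of their sum, and the limits of all
spins follow from that of spin 1/2 (`exists_isFusion`). In the limit the conjugation carrying the
colour becomes one by exp(hαzX), which gives `colT`.

The RTT relation. With respect to the limiting maps X is primitive, T is group-like, and H has the
Jordanian coproduct. From this R_h satisfies the fusion rule (Δ⊗1)R = R₁₃R₂₃, its spin-1/2 instance
being (T, -hL; 0, T⁻¹) with L = H - hJ₊ (`RhMat_mul_mulX`, `RhMat_mul_mulY`). One induction lifts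
the relations of A, B, C, E to RTT between spin 1/2 and any spin (`IsFusion.rtt_one`); a second
lifts it to two arbitrary spins (`IsFusion.rtt`). The colours are added by commuting powers of D to
the left: this produces exponentials of X, which combine with the twists into exp(sX)⊗exp(sX), and
R_h commutes with that (`RhMat_mul_expX`, `IsFusion.rtt_coloured`).

Uniqueness. Every word in the new generators is a combination of the ordered monomials D^w c^k a^i
b^j and D^w c^k d^i b^j, with coefficients that converge as q → 1 and whose limits give the same
expansion in the Jordanian algebra (`inSpan_allNormalWords`). For q near 1 these monomials are
independent in the standard algebra, as an explicit representation shows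
(`normalWord_linearIndependent`). A family that vanishes near q = 1 thus has vanishing coefficients,
hence limit 0. Independence in the Jordanian algebra is never needed.

The closed forms are the fusion recursion for n = 0 and n = 1, followed by reordering of quadratic
monomials. -/

namespace Jordanian

open PowerSeries (coeff trunc rescale)
open scoped PowerSeries

/-! ### Power series evaluated at nilpotent matrices -/

section Ev

variable {m m' : Type*} [Fintype m] [DecidableEq m] [Fintype m'] [DecidableEq m']

/-- The value at `J` of the power series `f`, truncated at degree `N`. -/
noncomputable def ev (J : Matrix m m ℂ) (N : ℕ) (f : ℂ⟦X⟧) : Matrix m m ℂ :=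
  Polynomial.aeval J (trunc N f)

theorem ev_eq_sum (J : Matrix m m ℂ) (N : ℕ) (f : ℂ⟦X⟧) :
    ev J N f = ∑ t ∈ Finset.range N, coeff t f • J ^ t := by
  rw [ev, PowerSeries.trunc_apply, map_sum, Nat.Ico_zero_eq_range]
  refine Finset.sum_congr rfl fun t _ => ?_
  rw [Polynomial.aeval_monomial, Algebra.smul_def]

/-- The difference of the polynomials is divisible by X^N, and J^N = 0. This makes evaluation of
truncated series independent of the truncation and multiplicative. -/
theorem aeval_eq_of_coeff_eq {J : Matrix m m ℂ} {N : ℕ} (hJ : J ^ N = 0) {p r : Polynomial ℂ}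
    (h : ∀ t < N, p.coeff t = r.coeff t) : Polynomial.aeval J p = Polynomial.aeval J r := by
  rw [← sub_eq_zero, ← map_sub]
  obtain ⟨s, hs⟩ := (Polynomial.X_pow_dvd_iff (f := p - r) (n := N)).2
    fun t ht => by simp [h t ht]
  rw [hs, map_mul, map_pow, Polynomial.aeval_X, hJ, zero_mul]

theorem ev_congr {J : Matrix m m ℂ} {N N' : ℕ} (hJ : J ^ N = 0) (hN : N ≤ N') (f : ℂ⟦X⟧) :
    ev J N' f = ev J N f :=
  aeval_eq_of_coeff_eq hJ fun t ht => by
    rw [PowerSeries.coeff_trunc, PowerSeries.coeff_trunc, if_pos ht, if_pos (ht.trans_le hN)]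

theorem ev_mul {J : Matrix m m ℂ} {N : ℕ} (hJ : J ^ N = 0) (f g : ℂ⟦X⟧) :
    ev J N (f * g) = ev J N f * ev J N g := by
  rw [ev, ev, ev, ← map_mul]
  refine aeval_eq_of_coeff_eq hJ fun t ht => ?_
  rw [PowerSeries.coeff_trunc, if_pos ht, PowerSeries.coeff_mul, Polynomial.coeff_mul]
  refine Finset.sum_congr rfl fun x hx => ?_
  have h0 := Finset.HasAntidiagonal.mem_antidiagonal.1 hx
  have h1 : x.1 ≤ t := by omega
  have h2 : x.2 ≤ t := by omega
  rw [PowerSeries.coeff_trunc, PowerSeries.coeff_trunc, if_pos (h1.trans_lt ht),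
    if_pos (h2.trans_lt ht)]

theorem ev_add (J : Matrix m m ℂ) (N : ℕ) (f g : ℂ⟦X⟧) : ev J N (f + g) = ev J N f + ev J N g := by
  simp [ev_eq_sum, add_smul, Finset.sum_add_distrib]

theorem ev_smul (J : Matrix m m ℂ) (N : ℕ) (c : ℂ) (f : ℂ⟦X⟧) : ev J N (c • f) = c • ev J N f := by
  simp [ev_eq_sum, mul_smul, Finset.smul_sum]

theorem ev_neg (J : Matrix m m ℂ) (N : ℕ) (f : ℂ⟦X⟧) : ev J N (-f) = -ev J N f := by
  simp [ev_eq_sum]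

theorem ev_sub (J : Matrix m m ℂ) (N : ℕ) (f g : ℂ⟦X⟧) : ev J N (f - g) = ev J N f - ev J N g := by
  rw [sub_eq_add_neg, ev_add, ev_neg, sub_eq_add_neg]

theorem ev_one {J : Matrix m m ℂ} {N : ℕ} (hJ : J ^ N = 0) : ev J N 1 = 1 := by
  rw [ev, ← map_one (Polynomial.aeval (R := ℂ) J)]
  refine aeval_eq_of_coeff_eq hJ fun t ht => ?_
  rw [PowerSeries.coeff_trunc, if_pos ht, PowerSeries.coeff_one, Polynomial.coeff_one]

theorem ev_X {J : Matrix m m ℂ} {N : ℕ} (hJ : J ^ N = 0) : ev J N PowerSeries.X = J := by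
  rw [ev]
  conv_rhs => rw [← Polynomial.aeval_X (R := ℂ) J]
  refine aeval_eq_of_coeff_eq hJ fun t ht => ?_
  rw [PowerSeries.coeff_trunc, if_pos ht, PowerSeries.coeff_X, Polynomial.coeff_X]
  simp [eq_comm]

theorem ev_commute {J : Matrix m m ℂ} {N : ℕ} (hJ : J ^ N = 0) (f g : ℂ⟦X⟧) :
    ev J N f * ev J N g = ev J N g * ev J N f := by
  rw [← ev_mul hJ, mul_comm, ev_mul hJ]

/-- A power series in `J` and a matrix `Q` with `Q J = c J Q`. -/
theorem ev_semiconj {J : Matrix m m ℂ} {J' : Matrix m' m' ℂ} {Q : Matrix m' m ℂ} {c : ℂ}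
    (h : J' * Q = c • (Q * J)) (N : ℕ) (f : ℂ⟦X⟧) :
    ev J' N f * Q = Q * ev J N (rescale c f) := by
  have key : ∀ t : ℕ, J' ^ t * Q = c ^ t • (Q * J ^ t) := by
    intro t
    induction t with
    | zero => simp
    | succ t ih =>
      rw [pow_succ', Matrix.mul_assoc, ih, Matrix.mul_smul, ← Matrix.mul_assoc, h, Matrix.smul_mul,
        smul_smul, Matrix.mul_assoc, ← pow_succ', ← pow_succ]
  simp only [ev_eq_sum, Matrix.sum_mul, Matrix.mul_sum, Matrix.smul_mul, Matrix.mul_smul, key,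
    PowerSeries.coeff_rescale, smul_smul]
  exact Finset.sum_congr rfl fun t _ => by rw [mul_comm]

/-- A power series in `J` acts on `Y` by the Leibniz rule if `J` does. -/
theorem ev_leibniz {J : Matrix m m ℂ} {J' : Matrix m' m' ℂ} {x y : Matrix m' m ℂ}
    (hx : J' * x = x * J) (hy : J' * y = y * J + x) (N : ℕ) (f : ℂ⟦X⟧) :
    ev J' (N + 1) f * y = y * ev J (N + 1) f + x * ev J N (PowerSeries.derivative ℂ f) := by
  have keyx : ∀ t : ℕ, J' ^ t * x = x * J ^ t := by
    intro t
    induction t with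
    | zero => simp
    | succ t ih =>
      rw [pow_succ', Matrix.mul_assoc, ih, ← Matrix.mul_assoc, hx, Matrix.mul_assoc, ← pow_succ']
  have key : ∀ t : ℕ, J' ^ (t + 1) * y = y * J ^ (t + 1) + ((t : ℂ) + 1) • (x * J ^ t) := by
    intro t
    induction t with
    | zero => simp [hy]
    | succ t ih =>
      rw [pow_succ', Matrix.mul_assoc, ih, Matrix.mul_add, ← Matrix.mul_assoc, hy, Matrix.add_mul,
        Matrix.mul_smul, ← Matrix.mul_assoc J', hx, Matrix.mul_assoc, ← pow_succ',
        Matrix.mul_assoc, ← pow_succ']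
      push_cast
      module
  simp only [ev_eq_sum, Finset.sum_range_succ' _ N, Matrix.add_mul, Matrix.sum_mul,
    Matrix.smul_mul, key, Matrix.mul_add, Matrix.mul_sum, Matrix.mul_smul, smul_add,
    Finset.sum_add_distrib, PowerSeries.coeff_derivative, smul_smul, pow_zero, Matrix.one_mul,
    Matrix.mul_one]
  abel

/-- The Euler operator on power series in `J`. -/
theorem ev_euler {J J0 : Matrix m m ℂ} (h : J0 * J = J * J0 + (2 : ℂ) • J) (N : ℕ) (f : ℂ⟦X⟧) :
    J0 * ev J N f = ev J N f * J0
      + (2 : ℂ) • ev J N (PowerSeries.X * PowerSeries.derivative ℂ f) := by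
  have key : ∀ t : ℕ, J0 * J ^ t = J ^ t * J0 + (2 * t : ℂ) • J ^ t := by
    intro t
    induction t with
    | zero => simp
    | succ t ih =>
      rw [pow_succ, ← Matrix.mul_assoc, ih, Matrix.add_mul, Matrix.mul_assoc, h, Matrix.mul_add,
        ← Matrix.mul_assoc, Matrix.mul_smul, Matrix.smul_mul, ← pow_succ]
      push_cast
      module
  simp only [ev_eq_sum, Matrix.mul_sum, Matrix.sum_mul, Matrix.mul_smul, Matrix.smul_mul, key,
    smul_add, Finset.sum_add_distrib, Finset.smul_sum, smul_smul]
  congr 1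
  refine Finset.sum_congr rfl fun t _ => ?_
  congr 1
  rcases t with _ | t
  · simp
  · rw [PowerSeries.coeff_succ_X_mul, PowerSeries.coeff_derivative]
    push_cast
    ring

end Ev

/-! ### The series `√(1 + h²X²)`, `hX + √(1 + h²X²)` and `h⁻¹ arcsinh (hX)` -/

theorem genBinom_zero (x : ℂ) : genBinom x 0 = 1 := by simp [genBinom]

theorem genBinom_succ (x : ℂ) (t : ℕ) :
    genBinom x (t + 1) * (t + 1) = genBinom x t * (x - t) := by
  have : (t : ℂ) + 1 ≠ 0 := Nat.cast_add_one_ne_zero t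
  rw [genBinom, Finset.prod_range_succ, ← genBinom]
  field_simp

/-- `(1 + h²X²) ^ r`. -/
noncomputable def evenBinom (h r : ℂ) : ℂ⟦X⟧ :=
  PowerSeries.mk fun m => if Even m then genBinom r (m / 2) * h ^ m else 0

theorem coeff_evenBinom_even (h r : ℂ) (t : ℕ) :
    coeff (2 * t) (evenBinom h r) = genBinom r t * h ^ (2 * t) := by
  simp [evenBinom]

theorem coeff_evenBinom_odd (h r : ℂ) (t : ℕ) : coeff (2 * t + 1) (evenBinom h r) = 0 := by
  simp [evenBinom]

/-- `1 + h²X²`. -/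
noncomputable def quadSer (h : ℂ) : ℂ⟦X⟧ := 1 + (h ^ 2) • PowerSeries.X ^ 2

theorem constantCoeff_evenBinom (h r : ℂ) :
    PowerSeries.constantCoeff (evenBinom h r) = 1 := by
  rw [← PowerSeries.coeff_zero_eq_constantCoeff_apply]
  simpa [genBinom_zero] using coeff_evenBinom_even h r 0

/-- The differential equation of (1 + h²X²)^r. Both sides are odd series, and in odd degrees the
equation is the recursion (t + 1) binom(r, t + 1) = (r - t) binom(r, t). The algebraic identities
below follow from this equation and the constant term, without further comparison of coefficients.
-/
theorem quadSer_mul_derivative_evenBinom (h r : ℂ) :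
    quadSer h * PowerSeries.derivative ℂ (evenBinom h r)
      = (2 * r * h ^ 2) • (PowerSeries.X * evenBinom h r) := by
  ext m
  rw [quadSer, add_mul, one_mul, smul_mul_assoc, map_add, PowerSeries.coeff_smul,
    PowerSeries.coeff_smul, PowerSeries.coeff_derivative]
  rcases m with _ | m
  · have := coeff_evenBinom_odd h r 0
    simp only [mul_zero, zero_add] at this
    simp [this, pow_two, mul_assoc]
  rw [PowerSeries.coeff_succ_X_mul, pow_two PowerSeries.X, mul_assoc PowerSeries.X, PowerSeries.coeff_succ_X_mul]
  rcases Nat.even_or_odd' m with ⟨t, rfl | rfl⟩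
  · rw [show 2 * t + 1 + 1 = 2 * (t + 1) by ring, coeff_evenBinom_even, coeff_evenBinom_even]
    rcases t with _ | t
    · have := genBinom_succ r 0
      simp at this ⊢
      rw [this, genBinom_zero]
      ring
    · rw [show 2 * (t + 1) = (2 * t + 1) + 1 by ring, PowerSeries.coeff_succ_X_mul,
        PowerSeries.coeff_derivative, show 2 * t + 1 + 1 = 2 * (t + 1) by ring,
        coeff_evenBinom_even]
      have := genBinom_succ r (t + 1)
      push_cast at this ⊢
      simp only [smul_eq_mul]
      linear_combination 2 * h ^ (2 * (t + 1) + 2) * this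
  · rw [show 2 * t + 1 + 1 + 1 = 2 * (t + 1) + 1 by ring, coeff_evenBinom_odd, coeff_evenBinom_odd,
      PowerSeries.coeff_succ_X_mul, PowerSeries.coeff_derivative, coeff_evenBinom_odd]
    simp

theorem quadSer_ne_zero (h : ℂ) : quadSer h ≠ 0 := by
  intro e
  have := congrArg (PowerSeries.constantCoeff) e
  simp [quadSer] at this

theorem derivative_quadSer (h : ℂ) :
    PowerSeries.derivative ℂ (quadSer h) = (2 * h ^ 2) • PowerSeries.X := by
  rw [quadSer, map_add, PowerSeries.derivative_one, zero_add, Derivation.map_smul,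
    PowerSeries.derivative_pow, PowerSeries.derivative_X]
  simp only [Nat.cast_ofNat, Nat.add_one_sub_one, pow_one, mul_one]
  rw [mul_comm 2 (h ^ 2), mul_smul]
  congr 1
  ext m
  rw [PowerSeries.coeff_smul, smul_eq_mul,
    show (2 : ℂ⟦X⟧) = PowerSeries.C 2 from (map_ofNat _ 2).symm, PowerSeries.coeff_C_mul]

noncomputable def sqrtSer (h : ℂ) : ℂ⟦X⟧ := evenBinom h (1 / 2)

/-- `(1 + h²X²) ^ (-1/2)`. -/
noncomputable def sqrtInvSer (h : ℂ) : ℂ⟦X⟧ := evenBinom h (-1 / 2)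

/-- Power series over ℂ form a domain, so the factor 1 + h²X² that comes with the differential
equation can be cancelled; a series with zero derivative is its constant term. -/
theorem eq_one_of_quadSer_mul_derivative {h : ℂ} {f : ℂ⟦X⟧}
    (hf : quadSer h * PowerSeries.derivative ℂ f = 0)
    (h0 : PowerSeries.constantCoeff f = 1) : f = 1 := by
  have h1 := (mul_eq_zero.1 hf).resolve_left (quadSer_ne_zero h)
  exact PowerSeries.derivative.ext (by simp [h1]) (by simp [h0])

theorem sqrtSer_mul_sqrtInvSer (h : ℂ) : sqrtSer h * sqrtInvSer h = 1 := by
  refine eq_one_of_quadSer_mul_derivative (h := h) ?_ ?_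
  · have h1 := quadSer_mul_derivative_evenBinom h (1 / 2)
    have h2 := quadSer_mul_derivative_evenBinom h (-1 / 2)
    rw [show (2 * (1 / 2) * h ^ 2 : ℂ) = h ^ 2 by ring] at h1
    rw [show (2 * (-1 / 2) * h ^ 2 : ℂ) = -h ^ 2 by ring, neg_smul] at h2
    rw [Derivation.leibniz, smul_eq_mul, smul_eq_mul, sqrtSer, sqrtInvSer]
    simp only [Algebra.smul_def] at h1 h2
    linear_combination (evenBinom h (1 / 2)) * h2 + evenBinom h (-1 / 2) * h1
  · rw [map_mul, sqrtSer, sqrtInvSer, constantCoeff_evenBinom, constantCoeff_evenBinom, one_mul]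

theorem sqrtSer_sq (h : ℂ) : sqrtSer h * sqrtSer h = quadSer h := by
  have h3 : sqrtInvSer h * sqrtInvSer h * quadSer h = 1 := by
    refine eq_one_of_quadSer_mul_derivative (h := h) ?_ ?_
    · have h2 := quadSer_mul_derivative_evenBinom h (-1 / 2)
      rw [show (2 * (-1 / 2) * h ^ 2 : ℂ) = -h ^ 2 by ring, neg_smul] at h2
      have h4 := derivative_quadSer h
      rw [mul_smul, ofNat_smul_eq_nsmul, nsmul_eq_mul] at h4
      simp only [Derivation.leibniz, smul_eq_mul]
      simp only [Algebra.smul_def, sqrtInvSer] at h2 h4 ⊢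
      rw [Nat.cast_ofNat] at h4
      rw [h4]
      linear_combination 2 * quadSer h * evenBinom h (-1 / 2) * h2
    · simp [sqrtInvSer, constantCoeff_evenBinom, quadSer]
  have h5 := sqrtSer_mul_sqrtInvSer h
  linear_combination -(sqrtSer h * sqrtSer h) * h3
    + quadSer h * (sqrtSer h * sqrtInvSer h + 1) * h5

theorem sqrtInvSer_sq_mul (h : ℂ) : sqrtInvSer h * sqrtInvSer h * quadSer h = 1 := by
  rw [← sqrtSer_sq]
  linear_combination (sqrtSer h * sqrtInvSer h + 1) * sqrtSer_mul_sqrtInvSer h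

theorem derivative_sqrtSer (h : ℂ) :
    PowerSeries.derivative ℂ (sqrtSer h) = (h ^ 2) • (PowerSeries.X * sqrtInvSer h) := by
  have h1 := quadSer_mul_derivative_evenBinom h (1 / 2)
  rw [show (2 * (1 / 2) * h ^ 2 : ℂ) = h ^ 2 by ring, ← sqrtSer] at h1
  simp only [Algebra.smul_def] at h1 ⊢
  have h2 := sqrtInvSer_sq_mul h
  have h3 := sqrtSer_mul_sqrtInvSer h
  linear_combination (sqrtInvSer h * sqrtInvSer h) * h1
    - PowerSeries.derivative ℂ (sqrtSer h) * h2
    + (algebraMap ℂ ℂ⟦X⟧ (h ^ 2) * PowerSeries.X * sqrtInvSer h) * h3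

/-- `hX + √(1 + h²X²)`. -/
noncomputable def jordSer (h : ℂ) : ℂ⟦X⟧ := h • PowerSeries.X + sqrtSer h

/-- `√(1 + h²X²) - hX`, the inverse of `jordSer h`. -/
noncomputable def jordInvSer (h : ℂ) : ℂ⟦X⟧ := sqrtSer h - h • PowerSeries.X

theorem jordSer_mul_jordInvSer (h : ℂ) : jordSer h * jordInvSer h = 1 := by
  have := sqrtSer_sq h
  rw [quadSer] at this
  simp only [jordSer, jordInvSer, Algebra.smul_def, map_pow] at this ⊢
  linear_combination this

/-- This is the equation satisfied by exp(arcsinh(hX)), so T has logarithmic derivative h/√(1 +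
h²X²). -/
theorem derivative_jordSer (h : ℂ) :
    PowerSeries.derivative ℂ (jordSer h) = h • (sqrtInvSer h * jordSer h) := by
  have h3 := sqrtSer_mul_sqrtInvSer h
  rw [jordSer, map_add, Derivation.map_smul, PowerSeries.derivative_X, derivative_sqrtSer]
  simp only [Algebra.smul_def, map_pow] at h3 ⊢
  linear_combination -algebraMap ℂ ℂ⟦X⟧ h * h3

/-- `h⁻¹ arcsinh (hX)`. -/
noncomputable def arcsinhSer (h : ℂ) : ℂ⟦X⟧ :=
  PowerSeries.mk fun m =>
    if Odd m then genBinom (-1 / 2) (m / 2) * h ^ (2 * (m / 2)) / (2 * (m / 2 : ℕ) + 1) else 0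

theorem coeff_arcsinhSer_odd (h : ℂ) (t : ℕ) : coeff (2 * t + 1) (arcsinhSer h) =
    genBinom (-1 / 2) t * h ^ (2 * t) / (2 * t + 1) := by
  have : (2 * t + 1) / 2 = t := by omega
  simp [arcsinhSer, this]

theorem coeff_arcsinhSer_even (h : ℂ) (t : ℕ) : coeff (2 * t) (arcsinhSer h) = 0 := by
  simp [arcsinhSer]

theorem derivative_arcsinhSer (h : ℂ) :
    PowerSeries.derivative ℂ (arcsinhSer h) = sqrtInvSer h := by
  ext m
  rw [PowerSeries.coeff_derivative, sqrtInvSer]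
  rcases Nat.even_or_odd' m with ⟨t, rfl | rfl⟩
  · rw [coeff_arcsinhSer_odd, coeff_evenBinom_even]
    have : (2 * (t : ℂ) + 1) ≠ 0 := by exact_mod_cast Nat.succ_ne_zero (2 * t)
    push_cast
    field_simp
  · rw [show 2 * t + 1 + 1 = 2 * (t + 1) by ring, coeff_arcsinhSer_even, coeff_evenBinom_odd,
      zero_mul]

/-! ### Matrices with one superdiagonal -/

/-- `e_k ↦ w_k e_{k-1}`. -/
def superdiag (w : ℕ → ℂ) (n : ℕ) : Matrix (Fin n) (Fin n) ℂ :=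
  Matrix.of fun i k => if (i : ℕ) + 1 = (k : ℕ) then w k else 0

theorem superdiag_pow_apply (w : ℕ → ℂ) (n t : ℕ) (i k : Fin n) :
    (superdiag w n ^ t) i k =
      if (i : ℕ) + t = (k : ℕ) then ∏ r ∈ Finset.range t, w (i + r + 1) else 0 := by
  induction t generalizing k with
  | zero => simp [Matrix.one_apply, Fin.ext_iff]
  | succ t ih =>
    rw [pow_succ, Matrix.mul_apply]
    simp only [ih]
    by_cases h : (i : ℕ) + (t + 1) = k
    · have hk := k.isLt
      rw [if_pos h, Finset.sum_eq_single ⟨i + t, by omega⟩]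
      · simp only [superdiag, Matrix.of_apply, if_true, Finset.prod_range_succ]
        rw [if_pos (by omega), ← h]
        rfl
      · intro b _ hb
        rw [if_neg, zero_mul]
        intro e
        exact hb (Fin.ext e.symm)
      · simp
    · rw [if_neg h]
      refine Finset.sum_eq_zero fun b _ => ?_
      simp only [superdiag, Matrix.of_apply]
      split_ifs with h1 h2
      · omega
      all_goals simp

theorem superdiag_pow_eq_zero (w : ℕ → ℂ) (n : ℕ) : superdiag w n ^ n = 0 := by
  ext i k
  rw [superdiag_pow_apply, if_neg (by omega), Matrix.zero_apply]

end Jordanian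

/-! ### Exponentials of multiples of h⁻¹ arcsinh(hX), and the multiplication maps. -/

namespace Jordanian

open PowerSeries (coeff trunc rescale)
open scoped PowerSeries

/-- `exp (s h⁻¹ arcsinh (hX))`. -/
noncomputable def expArcsinhSer (h s : ℂ) : ℂ⟦X⟧ :=
  (PowerSeries.exp ℂ).subst (s • arcsinhSer h)

theorem constantCoeff_arcsinhSer (h : ℂ) : PowerSeries.constantCoeff (arcsinhSer h) = 0 := by
  rw [← PowerSeries.coeff_zero_eq_constantCoeff_apply]
  exact coeff_arcsinhSer_even h 0

theorem hasSubst_arcsinhSer (h s : ℂ) : PowerSeries.HasSubst (s • arcsinhSer h) :=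
  PowerSeries.HasSubst.of_constantCoeff_zero' (by simp [constantCoeff_arcsinhSer])

theorem derivative_expArcsinhSer (h s : ℂ) : PowerSeries.derivative ℂ (expArcsinhSer h s) =
    s • (sqrtInvSer h * expArcsinhSer h s) := by
  rw [expArcsinhSer, PowerSeries.derivative_subst (hasSubst_arcsinhSer h s), Derivation.map_smul,
    derivative_arcsinhSer, PowerSeries.derivative_exp, mul_smul_comm, mul_comm]

theorem constantCoeff_expArcsinhSer (h s : ℂ) :
    PowerSeries.constantCoeff (expArcsinhSer h s) = 1 := by
  have h1 := PowerSeries.constantCoeff_subst_eq_zero (a := s • arcsinhSer h)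
    (show PowerSeries.constantCoeff (s • arcsinhSer h) = 0 by simp [constantCoeff_arcsinhSer]) (PowerSeries.exp ℂ - 1)
    (by simp [PowerSeries.constantCoeff_exp])
  rw [← PowerSeries.coe_substAlgHom (hasSubst_arcsinhSer h s), map_sub, map_sub, map_one, map_one,
    sub_eq_zero] at h1
  rw [expArcsinhSer, ← PowerSeries.coe_substAlgHom (hasSubst_arcsinhSer h s)]
  exact h1

theorem expArcsinhSer_mul_neg (h s : ℂ) : expArcsinhSer h s * expArcsinhSer h (-s) = 1 := by
  refine PowerSeries.derivative.ext ?_ (by simp [constantCoeff_expArcsinhSer])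
  rw [Derivation.leibniz, derivative_expArcsinhSer, derivative_expArcsinhSer]
  simp [Algebra.smul_def]
  ring

/-- The logarithmic derivatives of the two sides agree: T times the square of the inverse half
exponential has derivative 0 and constant term 1. -/
theorem expArcsinhSer_half_sq (h : ℂ) :
    expArcsinhSer h (h / 2) * expArcsinhSer h (h / 2) = jordSer h := by
  have h1 : expArcsinhSer h (-(h / 2)) * expArcsinhSer h (-(h / 2)) * jordSer h = 1 := by
    refine PowerSeries.derivative.ext ?_ (by
      simp [constantCoeff_expArcsinhSer, jordSer, sqrtSer, constantCoeff_evenBinom])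
    simp only [Derivation.leibniz, derivative_expArcsinhSer, derivative_jordSer,
      PowerSeries.derivative_one, smul_eq_mul]
    have e : algebraMap ℂ ℂ⟦X⟧ h = -(2 * algebraMap ℂ ℂ⟦X⟧ (-(h / 2))) := by
      rw [← map_ofNat (algebraMap ℂ ℂ⟦X⟧) 2, ← map_mul, ← map_neg]
      congr 1
      ring
    simp only [Algebra.smul_def, e]
    ring
  have h2 := expArcsinhSer_mul_neg h (h / 2)
  linear_combination -(expArcsinhSer h (h / 2) * expArcsinhSer h (h / 2)) * h1 +
    jordSer h * (expArcsinhSer h (h / 2) * expArcsinhSer h (-(h / 2)) + 1) * h2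

/-! ### The limit of the multiplication maps `V_n ⊗ V_1 → V_{n+1}` -/

/-- A power series in the classical `J₊`. -/
noncomputable def evJ (n : ℕ) (f : ℂ⟦X⟧) : Matrix (Fin (n + 1)) (Fin (n + 1)) ℂ :=
  ev (Jplus n) (n + 1) f

theorem Jplus_eq_superdiag (n : ℕ) :
    Jplus n = superdiag (fun k => (k : ℂ) * ((n : ℂ) + 1 - k)) (n + 1) := rfl

theorem Jplus_pow (n : ℕ) : Jplus n ^ (n + 1) = 0 := by
  rw [Jplus_eq_superdiag, superdiag_pow_eq_zero]

theorem evJ_mul (n : ℕ) (f g : ℂ⟦X⟧) : evJ n (f * g) = evJ n f * evJ n g := ev_mul (Jplus_pow n) f g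

theorem evJ_add (n : ℕ) (f g : ℂ⟦X⟧) : evJ n (f + g) = evJ n f + evJ n g := ev_add _ _ f g

theorem evJ_sub (n : ℕ) (f g : ℂ⟦X⟧) : evJ n (f - g) = evJ n f - evJ n g := ev_sub _ _ f g

theorem evJ_smul (n : ℕ) (c : ℂ) (f : ℂ⟦X⟧) : evJ n (c • f) = c • evJ n f := ev_smul _ _ c f

theorem evJ_one (n : ℕ) : evJ n 1 = 1 := ev_one (Jplus_pow n)

theorem evJ_X (n : ℕ) : evJ n PowerSeries.X = Jplus n := ev_X (Jplus_pow n)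

theorem evJ_comm (n : ℕ) (f g : ℂ⟦X⟧) : evJ n f * evJ n g = evJ n g * evJ n f :=
  ev_commute (Jplus_pow n) f g

/-- Multiplication of binary forms by the highest weight vector. -/
def mulXcl (n : ℕ) : Matrix (Fin (n + 1 + 1)) (Fin (n + 1)) ℂ :=
  Matrix.of fun i k => if (i : ℕ) = k then (n : ℂ) + 1 - (k : ℕ) else 0

/-- Multiplication of binary forms by the lowest weight vector. -/
def mulYcl (n : ℕ) : Matrix (Fin (n + 1 + 1)) (Fin (n + 1)) ℂ :=
  Matrix.of fun i k => if (i : ℕ) = k + 1 then 1 else 0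

theorem superdiag_mul_apply {m : Type*} (w : ℕ → ℂ) (n : ℕ) (N : Matrix (Fin n) m ℂ) (i : Fin n)
    (k : m) : (superdiag w n * N) i k =
      if hi : (i : ℕ) + 1 < n then w (i + 1) * N ⟨i + 1, hi⟩ k else 0 := by
  rw [Matrix.mul_apply]
  split_ifs with hi
  · rw [Finset.sum_eq_single ⟨i + 1, hi⟩]
    · simp [superdiag]
    · intro b _ hb
      simp only [superdiag, Matrix.of_apply]
      rw [if_neg, zero_mul]
      intro e
      exact hb (Fin.ext e.symm)
    · simp
  · refine Finset.sum_eq_zero fun b _ => ?_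
    simp only [superdiag, Matrix.of_apply]
    rw [if_neg (by omega), zero_mul]

theorem mul_superdiag_apply {m : Type*} (w : ℕ → ℂ) (n : ℕ) (N : Matrix m (Fin n) ℂ) (i : m)
    (k : Fin n) : (N * superdiag w n) i k =
      if 0 < (k : ℕ) then N i ⟨k - 1, by omega⟩ * w k else 0 := by
  rw [Matrix.mul_apply]
  split_ifs with hk
  · rw [Finset.sum_eq_single ⟨k - 1, by omega⟩]
    · simp only [superdiag, Matrix.of_apply]
      rw [if_pos (by omega)]
    · intro b _ hb
      simp only [superdiag, Matrix.of_apply]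
      rw [if_neg, mul_zero]
      intro e
      exact hb (Fin.ext (by simp; omega))
    · simp
  · refine Finset.sum_eq_zero fun b _ => ?_
    simp only [superdiag, Matrix.of_apply]
    rw [if_neg (by omega), mul_zero]

/-- The basis is e_k = n!/(n-k)! x^(n-k) y^k, in which lowering sends e_k to e_{k+1}, and both
multiplication maps carry a common factor n + 1. In this model J₊ is the derivation x ∂/∂y, which
kills x and sends y to x; this and the analogous rule for y are its Leibniz rule. -/
theorem Jplus_mul_mulXcl (n : ℕ) : Jplus (n + 1) * mulXcl n = mulXcl n * Jplus n := by
  ext i k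
  rw [Jplus_eq_superdiag, Jplus_eq_superdiag, superdiag_mul_apply, mul_superdiag_apply]
  have hi := i.isLt
  have hk := k.isLt
  simp only [mulXcl, Matrix.of_apply]
  by_cases h : (i : ℕ) + 1 = k
  · rw [dif_pos (by omega), if_pos h, if_pos (by omega), if_pos (by omega)]
    have h' : ((i : ℕ) : ℂ) + 1 = (k : ℕ) := by exact_mod_cast h
    rw [Nat.cast_sub (by omega)]
    push_cast
    rw [h']
    ring
  · split_ifs <;> first | omega | simp

theorem Jplus_mul_mulYcl (n : ℕ) :
    Jplus (n + 1) * mulYcl n = mulYcl n * Jplus n + mulXcl n := by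
  ext i k
  rw [Matrix.add_apply, Jplus_eq_superdiag, Jplus_eq_superdiag, superdiag_mul_apply,
    mul_superdiag_apply]
  have hi := i.isLt
  have hk := k.isLt
  simp only [mulXcl, mulYcl, Matrix.of_apply]
  by_cases h : (i : ℕ) = k
  · rw [dif_pos (by omega), if_pos (by omega), if_pos h]
    have h' : ((i : ℕ) : ℂ) = (k : ℕ) := by exact_mod_cast h
    split_ifs
    · push_cast; rw [h']; ring
    · omega
    · push_cast; rw [h']
      have : (k : ℕ) = 0 := by omega
      rw [this]; simp
  · split_ifs <;> first | omega | simp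

theorem J0_mul_mulXcl (n : ℕ) : J0 (n + 1) * mulXcl n = mulXcl n * (J0 n + 1) := by
  ext i k
  rw [Matrix.mul_add, Matrix.mul_one, Matrix.add_apply, J0, J0, Matrix.diagonal_mul,
    Matrix.mul_diagonal]
  simp only [mulXcl, Matrix.of_apply]
  split_ifs with h
  · rw [h]; push_cast; ring
  · simp

theorem J0_mul_mulYcl (n : ℕ) : J0 (n + 1) * mulYcl n = mulYcl n * (J0 n - 1) := by
  ext i k
  rw [Matrix.mul_sub, Matrix.mul_one, Matrix.sub_apply, J0, J0, Matrix.diagonal_mul,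
    Matrix.mul_diagonal]
  simp only [mulYcl, Matrix.of_apply]
  split_ifs with h
  · rw [h]; push_cast; ring
  · simp

theorem J0_mul_Jplus (n : ℕ) : J0 n * Jplus n = Jplus n * J0 n + (2 : ℂ) • Jplus n := by
  ext i k
  rw [Matrix.add_apply, Matrix.smul_apply, J0, Matrix.diagonal_mul, Matrix.mul_diagonal]
  simp only [Jplus, Matrix.of_apply]
  split_ifs with h
  · rw [← h]; push_cast; simp only [smul_eq_mul]; ring
  · simp

theorem J0_mul_evJ (n : ℕ) (f : ℂ⟦X⟧) : J0 n * evJ n f = evJ n f * J0 n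
    + (2 : ℂ) • evJ n (PowerSeries.X * PowerSeries.derivative ℂ f) :=
  ev_euler (J0_mul_Jplus n) _ f

theorem evJ_mul_mulXcl (n : ℕ) (f : ℂ⟦X⟧) : evJ (n + 1) f * mulXcl n = mulXcl n * evJ n f := by
  rw [evJ, evJ, ev_semiconj (c := 1) (by rw [one_smul, Jplus_mul_mulXcl]), PowerSeries.rescale_one,
    RingHom.id_apply, ev_congr (Jplus_pow n) (Nat.le_succ _)]

theorem evJ_mul_mulYcl (n : ℕ) (f : ℂ⟦X⟧) : evJ (n + 1) f * mulYcl n = mulYcl n * evJ n f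
    + mulXcl n * evJ n (PowerSeries.derivative ℂ f) := by
  rw [evJ, evJ, ev_leibniz (Jplus_mul_mulXcl n) (Jplus_mul_mulYcl n),
    ev_congr (Jplus_pow n) (Nat.le_succ _)]
  rfl

theorem sum_range_two_mul {M : Type*} [AddCommMonoid M] (f : ℕ → M) (N : ℕ) :
    ∑ t ∈ Finset.range (2 * N), f t = ∑ t ∈ Finset.range N, (f (2 * t) + f (2 * t + 1)) := by
  induction N with
  | zero => simp
  | succ N ih => rw [Nat.mul_succ, Finset.sum_range_succ, Finset.sum_range_succ, ih,
      Finset.sum_range_succ, add_assoc]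

theorem sqrtMat_eq (h : ℂ) (n : ℕ) : sqrtMat h n = evJ n (sqrtSer h) := by
  -- The defining sum runs to t = n, hence to degree 2n; the truncation is raised to 2(n + 1), which
  -- changes nothing by nilpotency, and the terms are paired by parity.
  rw [evJ, ← ev_congr (Jplus_pow n) (show n + 1 ≤ 2 * (n + 1) by omega), ev_eq_sum,
    sum_range_two_mul, sqrtMat]
  refine Finset.sum_congr rfl fun t _ => ?_
  rw [sqrtSer, coeff_evenBinom_even, coeff_evenBinom_odd, zero_smul, add_zero, smul_pow, smul_smul]

theorem Xmat_eq (h : ℂ) (n : ℕ) : Xmat h n = evJ n (arcsinhSer h) := by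
  rw [evJ, ← ev_congr (Jplus_pow n) (show n + 1 ≤ 2 * (n + 1) by omega), ev_eq_sum,
    sum_range_two_mul, Xmat]
  refine Finset.sum_congr rfl fun t _ => ?_
  rw [coeff_arcsinhSer_even, coeff_arcsinhSer_odd, zero_smul, zero_add]

theorem Tmat_eq (h : ℂ) (n : ℕ) : Tmat h n = evJ n (jordSer h) := by
  rw [Tmat, sqrtMat_eq, jordSer, evJ_add, evJ_smul, evJ_X]

/-- The inverse of `Tmat`. -/
noncomputable def TinvMat (h : ℂ) (n : ℕ) : Matrix (Fin (n + 1)) (Fin (n + 1)) ℂ :=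
  evJ n (jordInvSer h)

theorem Tmat_mul_TinvMat (h : ℂ) (n : ℕ) : Tmat h n * TinvMat h n = 1 := by
  rw [Tmat_eq, TinvMat, ← evJ_mul, jordSer_mul_jordInvSer, evJ_one]

theorem TinvMat_mul_Tmat (h : ℂ) (n : ℕ) : TinvMat h n * Tmat h n = 1 := by
  rw [Tmat_eq, TinvMat, ← evJ_mul, mul_comm, jordSer_mul_jordInvSer, evJ_one]

/-- `h J₊ / √(1 + h²J₊²)`. -/
noncomputable def tanhMat (h : ℂ) (n : ℕ) : Matrix (Fin (n + 1)) (Fin (n + 1)) ℂ :=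
  evJ n (h • (PowerSeries.X * sqrtInvSer h))

/-- The derivative at `q = 1` of the correction to the multiplication by `y`. -/
noncomputable def omegaMat (h : ℂ) (n : ℕ) : Matrix (Fin (n + 1)) (Fin (n + 1)) ℂ :=
  (h / 2) • (J0 n + tanhMat h n)

/-- Right multiplication by `x` on the Jordanian plane. -/
noncomputable def mulX (h : ℂ) (n : ℕ) : Matrix (Fin (n + 1 + 1)) (Fin (n + 1)) ℂ :=
  mulXcl n * evJ n (expArcsinhSer h (-(h / 2)))

/-- Right multiplication by `y` on the Jordanian plane. -/
noncomputable def mulY (h : ℂ) (n : ℕ) : Matrix (Fin (n + 1 + 1)) (Fin (n + 1)) ℂ :=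
  mulYcl n * evJ n (expArcsinhSer h (h / 2)) + mulX h n * omegaMat h n

theorem evJ_mul_mulX (h : ℂ) (n : ℕ) (f : ℂ⟦X⟧) :
    evJ (n + 1) f * mulX h n = mulX h n * evJ n f := by
  rw [mulX, ← Matrix.mul_assoc, evJ_mul_mulXcl, Matrix.mul_assoc, Matrix.mul_assoc, evJ_comm]

/-- Only the J₀ part fails to commute with series in J₊, and [J₀, f(J₊)] = 2 J₊ f'(J₊). -/
theorem evJ_mul_omegaMat (h : ℂ) (n : ℕ) (f : ℂ⟦X⟧) : evJ n f * omegaMat h n =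
    omegaMat h n * evJ n f - h • evJ n (PowerSeries.X * PowerSeries.derivative ℂ f) := by
  have h1 := J0_mul_evJ n f
  rw [omegaMat, Matrix.mul_smul, Matrix.smul_mul, Matrix.mul_add, Matrix.add_mul, h1, tanhMat,
    evJ_comm n f]
  module

/-- The deformed Leibniz rule, from which the coproducts are read off. The part of `mulY` coming
from the classical y contributes f' T, because exp(hX/2) = exp(-hX/2) T, and the J₀ part of
`omegaMat` contributes -h J₊ f'. Their sum is f' (T - hJ₊) = f' √(1 + h²J₊²). -/
theorem evJ_mul_mulY (h : ℂ) (n : ℕ) (f : ℂ⟦X⟧) : evJ (n + 1) f * mulY h n = mulY h n * evJ n f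
    + mulX h n * evJ n (PowerSeries.derivative ℂ f * sqrtSer h) := by
  have h1 : PowerSeries.derivative ℂ f * sqrtSer h = PowerSeries.derivative ℂ f * jordSer h
      - h • (PowerSeries.X * PowerSeries.derivative ℂ f) := by
    rw [jordSer, mul_add, mul_smul_comm, mul_comm PowerSeries.X]
    abel
  have h2 : evJ n (expArcsinhSer h (-(h / 2))) * evJ n (PowerSeries.derivative ℂ f * jordSer h)
      = evJ n (PowerSeries.derivative ℂ f) * evJ n (expArcsinhSer h (h / 2)) := by
    rw [← evJ_mul, ← evJ_mul, ← expArcsinhSer_half_sq]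
    congr 1
    linear_combination (PowerSeries.derivative ℂ f * expArcsinhSer h (h / 2)) *
      expArcsinhSer_mul_neg h (h / 2)
  have h3 : mulXcl n * evJ n (PowerSeries.derivative ℂ f) * evJ n (expArcsinhSer h (h / 2))
      = mulX h n * evJ n (PowerSeries.derivative ℂ f * jordSer h) := by
    rw [mulX, Matrix.mul_assoc, Matrix.mul_assoc, h2]
  rw [mulY, Matrix.mul_add, ← Matrix.mul_assoc, evJ_mul_mulYcl, Matrix.add_mul, h3,
    ← Matrix.mul_assoc, evJ_mul_mulX, Matrix.mul_assoc (mulX h n), evJ_mul_omegaMat, h1, evJ_sub,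
    evJ_smul, Matrix.mul_sub, Matrix.mul_sub, Matrix.add_mul, Matrix.mul_assoc (mulYcl n),
    evJ_comm n f, Matrix.mul_assoc, Matrix.mul_assoc]
  abel

/-- Commuting J₀ past a series in J₊ costs twice the Euler operator of the series. On exp(-hX/2) the
Euler operator is multiplication by -½ hJ₊/√(1 + h²J₊²), which is the correction to the classical
weight shift by 1. -/
theorem J0_mul_mulX (h : ℂ) (n : ℕ) :
    J0 (n + 1) * mulX h n = mulX h n * (J0 n + 1 - tanhMat h n) := by
  have h1 : evJ n (PowerSeries.X * PowerSeries.derivative ℂ (expArcsinhSer h (-(h / 2)))) =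
      (-(1 / 2) : ℂ) • (evJ n (expArcsinhSer h (-(h / 2))) * tanhMat h n) := by
    rw [derivative_expArcsinhSer, tanhMat, ← evJ_mul, ← evJ_smul]
    congr 1
    rw [mul_smul_comm, mul_smul_comm, smul_smul]
    congr 1
    · ring
    · ring
  rw [mulX, ← Matrix.mul_assoc, J0_mul_mulXcl, Matrix.mul_assoc, Matrix.add_mul, J0_mul_evJ, h1,
    Matrix.mul_assoc]
  congr 1
  rw [Matrix.mul_sub, Matrix.mul_add, Matrix.one_mul, Matrix.mul_one]
  module

theorem J0_mul_mulY (h : ℂ) (n : ℕ) :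
    J0 (n + 1) * mulY h n = mulY h n * (J0 n - 1 + tanhMat h n)
      + h • (mulX h n * ((1 - tanhMat h n) * (J0 n + tanhMat h n))) := by
  have h1 : evJ n (PowerSeries.X * PowerSeries.derivative ℂ (expArcsinhSer h (h / 2))) =
      (1 / 2 : ℂ) • (evJ n (expArcsinhSer h (h / 2)) * tanhMat h n) := by
    rw [derivative_expArcsinhSer, tanhMat, ← evJ_mul, ← evJ_smul]
    congr 1
    rw [mul_smul_comm, mul_smul_comm, smul_smul]
    congr 1
    · ring
    · ring
  have h2 : J0 (n + 1) * (mulYcl n * evJ n (expArcsinhSer h (h / 2))) =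
      mulYcl n * evJ n (expArcsinhSer h (h / 2)) * (J0 n - 1 + tanhMat h n) := by
    rw [← Matrix.mul_assoc, J0_mul_mulYcl, Matrix.mul_assoc, Matrix.sub_mul, J0_mul_evJ, h1,
      Matrix.mul_assoc]
    congr 1
    rw [Matrix.mul_add, Matrix.mul_sub, Matrix.one_mul, Matrix.mul_one]
    module
  rw [mulY, Matrix.mul_add, h2, ← Matrix.mul_assoc, J0_mul_mulX, Matrix.mul_assoc (mulX h n),
    Matrix.add_mul, add_assoc (_ : Matrix (Fin (n + 1 + 1)) (Fin (n + 1)) ℂ),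
    Matrix.mul_assoc (mulX h n), ← Matrix.mul_smul, ← Matrix.mul_add]
  -- What remains is an identity in J₀ and `tanhMat` alone; the order of these two noncommuting
  -- factors is kept on both sides.
  congr 2
  rw [omegaMat]
  generalize J0 n = j
  generalize tanhMat h n = g
  simp only [Matrix.add_mul, Matrix.mul_add, Matrix.sub_mul, Matrix.mul_sub, Matrix.one_mul,
    Matrix.mul_one, Matrix.smul_mul, Matrix.mul_smul]
  module

theorem sqrtMat_mul_tanhMat (h : ℂ) (n : ℕ) : sqrtMat h n * tanhMat h n = h • Jplus n := by
  rw [sqrtMat_eq, tanhMat, ← evJ_mul, ← evJ_X, ← evJ_smul]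
  congr 1
  rw [mul_smul_comm]
  congr 1
  linear_combination PowerSeries.X * sqrtSer_mul_sqrtInvSer h

theorem TinvMat_eq (h : ℂ) (n : ℕ) : TinvMat h n = sqrtMat h n - h • Jplus n := by
  rw [TinvMat, jordInvSer, evJ_sub, evJ_smul, evJ_X, sqrtMat_eq]

theorem Xmat_mul_mulX (h : ℂ) (n : ℕ) : Xmat h (n + 1) * mulX h n = mulX h n * Xmat h n := by
  rw [Xmat_eq, Xmat_eq, evJ_mul_mulX]

/-- X is primitive: h⁻¹ arcsinh(hJ₊) is the series f with f' √(1 + h²J₊²) = 1, so the deformed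
Leibniz rule becomes the ordinary one. -/
theorem Xmat_mul_mulY (h : ℂ) (n : ℕ) :
    Xmat h (n + 1) * mulY h n = mulY h n * Xmat h n + mulX h n := by
  rw [Xmat_eq, Xmat_eq, evJ_mul_mulY, derivative_arcsinhSer, mul_comm, sqrtSer_mul_sqrtInvSer,
    evJ_one, Matrix.mul_one]

theorem Tmat_mul_mulX (h : ℂ) (n : ℕ) : Tmat h (n + 1) * mulX h n = mulX h n * Tmat h n := by
  rw [Tmat_eq, Tmat_eq, evJ_mul_mulX]

/-- T is group-like, acting on the spin-1/2 factor by x ↦ x and y ↦ y + hx. -/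
theorem Tmat_mul_mulY (h : ℂ) (n : ℕ) :
    Tmat h (n + 1) * mulY h n = (mulY h n + h • mulX h n) * Tmat h n := by
  rw [Tmat_eq, Tmat_eq, evJ_mul_mulY, derivative_jordSer, Matrix.add_mul, Matrix.smul_mul,
    ← Matrix.mul_smul, ← evJ_smul]
  congr 3
  rw [smul_mul_assoc]
  congr 1
  linear_combination jordSer h * sqrtSer_mul_sqrtInvSer h

theorem TinvMat_mul_mulX (h : ℂ) (n : ℕ) :
    TinvMat h (n + 1) * mulX h n = mulX h n * TinvMat h n := evJ_mul_mulX ..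

theorem TinvMat_mul_mulY (h : ℂ) (n : ℕ) :
    TinvMat h (n + 1) * mulY h n = (mulY h n - h • mulX h n) * TinvMat h n := by
  have h1 := congrArg (fun N => TinvMat h (n + 1) * (N * TinvMat h n)) (Tmat_mul_mulY h n)
  simp only [Matrix.mul_assoc, Tmat_mul_TinvMat, Matrix.mul_one] at h1
  rw [← Matrix.mul_assoc, TinvMat_mul_Tmat, Matrix.one_mul, Matrix.mul_add, Matrix.mul_smul,
    TinvMat_mul_mulX] at h1
  rw [Matrix.sub_mul, h1, Matrix.smul_mul]
  abel

theorem sqrtMat_mul_mulX (h : ℂ) (n : ℕ) :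
    sqrtMat h (n + 1) * mulX h n = mulX h n * sqrtMat h n := by
  rw [sqrtMat_eq, sqrtMat_eq, evJ_mul_mulX]

theorem sqrtMat_mul_mulY (h : ℂ) (n : ℕ) : sqrtMat h (n + 1) * mulY h n =
    mulY h n * sqrtMat h n + h ^ 2 • (mulX h n * Jplus n) := by
  rw [sqrtMat_eq, sqrtMat_eq, evJ_mul_mulY, derivative_sqrtSer, ← Matrix.mul_smul, ← evJ_X,
    ← evJ_smul]
  congr 3
  rw [smul_mul_assoc]
  congr 1
  linear_combination PowerSeries.X * sqrtSer_mul_sqrtInvSer h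

theorem Hmat_mul_mulX (h : ℂ) (n : ℕ) :
    Hmat h (n + 1) * mulX h n = mulX h n * (Hmat h n + TinvMat h n) := by
  rw [Hmat, Matrix.mul_assoc, J0_mul_mulX, ← Matrix.mul_assoc, sqrtMat_mul_mulX, Matrix.mul_assoc,
    Matrix.mul_sub, sqrtMat_mul_tanhMat, TinvMat_eq, Hmat, Matrix.mul_add, Matrix.mul_one]
  congr 1
  abel

/-- Together with the rule for x this is the coproduct H ⊗ T + T⁻¹ ⊗ H, evaluated on a second factor
of spin 1/2 where H x = x, H y = -y, T x = x, T y = y + hx. -/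
theorem Hmat_mul_mulY (h : ℂ) (n : ℕ) : Hmat h (n + 1) * mulY h n =
    mulY h n * (Hmat h n - TinvMat h n) + h • (mulX h n * Hmat h n) := by
  have h1 := sqrtMat_mul_tanhMat h n
  rw [Hmat, Matrix.mul_assoc, J0_mul_mulY, Matrix.mul_add, ← Matrix.mul_assoc, sqrtMat_mul_mulY,
    Matrix.mul_smul, ← Matrix.mul_assoc (sqrtMat h (n + 1)), sqrtMat_mul_mulX, TinvMat_eq, Hmat,
    Matrix.add_mul, Matrix.smul_mul, Matrix.mul_assoc, Matrix.mul_assoc (mulX h n),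
    Matrix.mul_assoc (mulX h n), add_assoc (_ : Matrix (Fin (n + 1 + 1)) (Fin (n + 1)) ℂ)]
  have h2 : sqrtMat h n * (J0 n - 1 + tanhMat h n)
      = sqrtMat h n * J0 n - (sqrtMat h n - h • Jplus n) := by
    rw [Matrix.mul_add, Matrix.mul_sub, h1, Matrix.mul_one]
    abel
  have h3 : sqrtMat h n * ((1 - tanhMat h n) * (J0 n + tanhMat h n)) =
      sqrtMat h n * J0 n + h • Jplus n - h • (Jplus n * (J0 n + tanhMat h n)) := by
    rw [← Matrix.mul_assoc, Matrix.mul_sub, h1, Matrix.mul_one, Matrix.sub_mul, Matrix.mul_add, h1,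
      Matrix.smul_mul]
  rw [h2, h3]
  simp only [Matrix.mul_add, Matrix.mul_sub, Matrix.mul_smul, Matrix.mul_one]
  module

/-- `H - h J₊`, the off-diagonal entry of the fundamental `R` matrix. -/
noncomputable def Lmat (h : ℂ) (n : ℕ) : Matrix (Fin (n + 1)) (Fin (n + 1)) ℂ :=
  Hmat h n - h • Jplus n

theorem Jplus_mul_mulX (h : ℂ) (n : ℕ) : Jplus (n + 1) * mulX h n = mulX h n * Jplus n := by
  rw [← evJ_X, ← evJ_X, evJ_mul_mulX]

theorem Jplus_mul_mulY (h : ℂ) (n : ℕ) :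
    Jplus (n + 1) * mulY h n = mulY h n * Jplus n + mulX h n * sqrtMat h n := by
  rw [← evJ_X, ← evJ_X, evJ_mul_mulY, PowerSeries.derivative_X, one_mul, sqrtMat_eq]

theorem Lmat_mul_mulX (h : ℂ) (n : ℕ) :
    Lmat h (n + 1) * mulX h n = mulX h n * (Lmat h n + TinvMat h n) := by
  rw [Lmat, Lmat, Matrix.sub_mul, Hmat_mul_mulX, Matrix.smul_mul, Jplus_mul_mulX, ← Matrix.mul_smul,
    ← Matrix.mul_sub]
  congr 1
  abel

theorem Lmat_mul_mulY (h : ℂ) (n : ℕ) :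
    Lmat h (n + 1) * mulY h n = (mulY h n + h • mulX h n) * (Lmat h n - TinvMat h n) := by
  rw [Lmat, Lmat, Matrix.sub_mul, Hmat_mul_mulY, Matrix.smul_mul, Jplus_mul_mulY, TinvMat_eq]
  simp only [Matrix.add_mul, Matrix.mul_sub, Matrix.smul_mul, Matrix.mul_smul]
  module

end Jordanian

namespace Jordanian

open PowerSeries (coeff trunc rescale)
open scoped PowerSeries

/-! ### Exponentials of intertwined matrices -/

section Exp

variable {m m' : Type*} [Fintype m] [Fintype m']

theorem hasSum_iff_of_eq {M : Type*} [AddCommMonoid M] [TopologicalSpace M] {f g : ℕ → M} {a : M}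
    (h : ∀ k, f k = g k) : HasSum f a ↔ HasSum g a := by rw [funext h]

theorem hasSum_exp [DecidableEq m] (P : Matrix m m ℂ) :
    HasSum (fun k : ℕ => ((k.factorial : ℂ)⁻¹) • P ^ k) (NormedSpace.exp P) := by
  open scoped Matrix.Norms.Operator in
  exact NormedSpace.exp_series_hasSum_exp' (𝕂 := ℂ) P

theorem hasSum_mul_left {ι l : Type*} {f : ι → Matrix m m ℂ} {a : Matrix m m ℂ}
    (hf : HasSum f a) (x : Matrix l m ℂ) : HasSum (fun i => x * f i) (x * a) :=
  hf.map (AddMonoidHom.mk' (fun N => x * N) (Matrix.mul_add x)) (by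
    change Continuous fun N : Matrix m m ℂ => x * N
    fun_prop)

theorem hasSum_mul_right {ι l : Type*} {f : ι → Matrix m m ℂ} {a : Matrix m m ℂ}
    (hf : HasSum f a) (x : Matrix m l ℂ) : HasSum (fun i => f i * x) (a * x) :=
  hf.map (AddMonoidHom.mk' (fun N => N * x) (fun N N' => Matrix.add_mul N N' x)) (by
    change Continuous fun N : Matrix m m ℂ => N * x
    fun_prop)

variable [DecidableEq m] [DecidableEq m']

/-- On the pair (x, y) the matrix P' acts as the block (P, Q; 0, P). Since P and Q commute, the
exponential of this block is (e^P, Q e^P; 0, e^P). -/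
theorem exp_mul_of_jordan {P : Matrix m m ℂ} {P' : Matrix m' m' ℂ} {Q : Matrix m m ℂ}
    {x y : Matrix m' m ℂ} (hx : P' * x = x * P) (hy : P' * y = y * P + x * Q)
    (hQ : P * Q = Q * P) :
    NormedSpace.exp P' * y = y * NormedSpace.exp P + x * (Q * NormedSpace.exp P) := by
  have keyx : ∀ k : ℕ, P' ^ k * x = x * P ^ k := by
    intro k
    induction k with
    | zero => simp
    | succ k ih =>
      rw [pow_succ', Matrix.mul_assoc, ih, ← Matrix.mul_assoc, hx, Matrix.mul_assoc, ← pow_succ']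
  have hQk : ∀ k : ℕ, P ^ k * Q = Q * P ^ k := fun k => (Commute.pow_left hQ k)
  have key : ∀ k : ℕ, P' ^ (k + 1) * y = y * P ^ (k + 1) + ((k : ℂ) + 1) • (x * (Q * P ^ k)) := by
    intro k
    induction k with
    | zero => simp [hy]
    | succ k ih =>
      rw [pow_succ', Matrix.mul_assoc, ih, Matrix.mul_add, ← Matrix.mul_assoc, hy, Matrix.add_mul,
        Matrix.mul_smul, ← Matrix.mul_assoc P', hx, Matrix.mul_assoc, ← pow_succ',
        Matrix.mul_assoc, Matrix.mul_assoc x P, ← Matrix.mul_assoc P, hQ, Matrix.mul_assoc Q,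
        ← pow_succ']
      push_cast
      module
  have h1 := hasSum_mul_right (hasSum_exp P') y
  have h2 := hasSum_mul_left (hasSum_exp P) y
  have h3 := hasSum_mul_left (hasSum_mul_left (hasSum_exp P) Q) x
  -- The term k = 0 vanishes, so the sum is shifted by one; (k + 1)/(k + 1)! = 1/k! then gives the
  -- exponential series again.
  have h4 : HasSum (fun k : ℕ => ((k.factorial : ℂ)⁻¹) • (P' ^ k * y - y * P ^ k))
      (x * (Q * NormedSpace.exp P)) := by
    rw [← hasSum_nat_add_iff' 1]
    simp only [Finset.range_one, Finset.sum_singleton, pow_zero, Matrix.one_mul, Matrix.mul_one,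
      sub_self, smul_zero, sub_zero]
    refine (hasSum_iff_of_eq fun k => ?_).2 h3
    rw [key, add_sub_cancel_left, smul_smul, Nat.factorial_succ, Matrix.mul_smul, Matrix.mul_smul]
    congr 1
    have : (k : ℂ) + 1 ≠ 0 := Nat.cast_add_one_ne_zero k
    push_cast
    field_simp
  have h5 := h2.add h4
  refine h1.unique ?_
  refine (hasSum_iff_of_eq fun k => ?_).2 h5
  rw [Matrix.smul_mul, Matrix.mul_smul, smul_sub]
  abel

theorem exp_mul_of_intertwine {P : Matrix m m ℂ} {P' : Matrix m' m' ℂ} {x : Matrix m' m ℂ}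
    (hx : P' * x = x * P) : NormedSpace.exp P' * x = x * NormedSpace.exp P := by
  have := exp_mul_of_jordan (x := (0 : Matrix m' m ℂ)) (Q := 0) (P := P) (P' := P') (y := x)
    (by simp) (by simp [hx]) (by simp)
  simpa using this

theorem exp_one_kronecker (B : Matrix m' m' ℂ) :
    NormedSpace.exp ((1 : Matrix m m ℂ) ⊗ₖ B) = (1 : Matrix m m ℂ) ⊗ₖ NormedSpace.exp B := by
  have h1 := (hasSum_exp B).map (AddMonoidHom.mk' (fun N => (1 : Matrix m m ℂ) ⊗ₖ N)
    (Matrix.kronecker_add 1)) (by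
      change Continuous fun N : Matrix m' m' ℂ => (1 : Matrix m m ℂ) ⊗ₖ N
      exact continuous_matrix fun i j => by
        simp only [Matrix.kroneckerMap_apply]
        fun_prop)
  refine (hasSum_exp _).unique ?_
  refine (hasSum_iff_of_eq fun k => ?_).2 h1
  have : ∀ k : ℕ, ((1 : Matrix m m ℂ) ⊗ₖ B) ^ k = (1 : Matrix m m ℂ) ⊗ₖ (B ^ k) := by
    intro k
    induction k with
    | zero => simp
    | succ k ih => rw [pow_succ, ih, ← Matrix.mul_kronecker_mul, Matrix.one_mul, pow_succ]
  simp [this, Matrix.kronecker_smul]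

theorem exp_kronecker_one (B : Matrix m m ℂ) :
    NormedSpace.exp (B ⊗ₖ (1 : Matrix m' m' ℂ)) = NormedSpace.exp B ⊗ₖ (1 : Matrix m' m' ℂ) := by
  have h1 := (hasSum_exp B).map (AddMonoidHom.mk' (fun N => N ⊗ₖ (1 : Matrix m' m' ℂ))
    (fun N N' => Matrix.add_kronecker N N' 1)) (by
      change Continuous fun N : Matrix m m ℂ => N ⊗ₖ (1 : Matrix m' m' ℂ)
      exact continuous_matrix fun i j => by
        simp only [Matrix.kroneckerMap_apply]
        fun_prop)
  refine (hasSum_exp _).unique ?_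
  refine (hasSum_iff_of_eq fun k => ?_).2 h1
  have : ∀ k : ℕ, (B ⊗ₖ (1 : Matrix m' m' ℂ)) ^ k = (B ^ k) ⊗ₖ (1 : Matrix m' m' ℂ) := by
    intro k
    induction k with
    | zero => simp
    | succ k ih => rw [pow_succ, ih, ← Matrix.mul_kronecker_mul, Matrix.one_mul, pow_succ]
  simp [this, Matrix.smul_kronecker]

end Exp

/-! ### Joint surjectivity of the two multiplications -/

/-- A left inverse of `mulXcl`. -/
noncomputable def sectX (n : ℕ) : Matrix (Fin (n + 1)) (Fin (n + 1 + 1)) ℂ :=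
  Matrix.of fun i k => if (i : ℕ) = k then ((n : ℂ) + 1 - (k : ℕ))⁻¹ else 0

/-- `e_{n+1} ↦ e_n`. -/
def sectY (n : ℕ) : Matrix (Fin (n + 1)) (Fin (n + 1 + 1)) ℂ :=
  Matrix.of fun i k => if (i : ℕ) = n ∧ (k : ℕ) = n + 1 then 1 else 0

theorem sect_spec_of {n : ℕ} {x y : Matrix (Fin (n + 1 + 1)) (Fin (n + 1)) ℂ}
    {s : Matrix (Fin (n + 1)) (Fin (n + 1 + 1)) ℂ} {ξ υ : ℕ → ℂ} (hξ : ∀ k ≤ n, ξ k ≠ 0)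
    (hυ : υ n = 1)
    (hx : x = Matrix.of fun i k : Fin _ => if (i : ℕ) = k then ξ k else 0)
    (hy : y = Matrix.of fun i k : Fin _ => if (i : ℕ) = k + 1 then υ k else 0)
    (hs : s = Matrix.of fun i k : Fin _ => if (i : ℕ) = k then (ξ k)⁻¹ else 0) :
    x * s + y * sectY n = 1 := by
  ext i k
  have hi := i.isLt
  have hk := k.isLt
  rw [Matrix.add_apply, Matrix.mul_apply, Matrix.mul_apply, Matrix.one_apply]
  by_cases h : (k : ℕ) = n + 1
  · rw [Finset.sum_eq_zero, zero_add, Finset.sum_eq_single ⟨n, by omega⟩]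
    · simp only [hy, sectY, Matrix.of_apply, h, hυ]
      by_cases h' : (i : ℕ) = n + 1
      · simp [h', Fin.ext_iff, h]
      · simp [h', Fin.ext_iff, h]
    · intro b _ hb
      have : (b : ℕ) ≠ n := fun e => hb (Fin.ext e)
      simp [sectY, this]
    · simp
    · intro b _
      have := b.isLt
      simp only [hs, Matrix.of_apply]
      rw [if_neg (by omega), mul_zero]
  · rw [Finset.sum_eq_single ⟨k, by omega⟩, Finset.sum_eq_zero (s := Finset.univ), add_zero]
    · simp only [hx, hs, Matrix.of_apply, if_true, Fin.ext_iff]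
      split_ifs
      · exact mul_inv_cancel₀ (hξ _ (by omega))
      · simp
    · intro b _
      simp [sectY, h]
    · intro b _ hb
      have : (b : ℕ) ≠ k := fun e => hb (Fin.ext e)
      simp [hs, this]
    · simp

theorem mulXcl_sect (n : ℕ) : mulXcl n * sectX n + mulYcl n * sectY n = 1 := by
  refine sect_spec_of (ξ := fun k => (n : ℂ) + 1 - k) (υ := fun _ => 1) ?_ rfl rfl rfl rfl
  intro k hk
  have : (n : ℂ) + 1 - k = ((n + 1 - k : ℕ) : ℂ) := by
    rw [Nat.cast_sub (by omega)]; push_cast; ring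
  rw [this]
  exact_mod_cast (by omega : n + 1 - k ≠ 0)

/-- Classically every form is a sum of a multiple of x and a multiple of y. The deformed maps differ
from the classical ones by invertible exponentials and by adding to y a multiple of x, so they
remain jointly surjective. -/
theorem exists_mul_sect (h : ℂ) (n : ℕ) : ∃ s t : Matrix (Fin (n + 1)) (Fin (n + 1 + 1)) ℂ,
    mulX h n * s + mulY h n * t = 1 := by
  have e1 : evJ n (expArcsinhSer h (-(h / 2))) * evJ n (expArcsinhSer h (h / 2)) = 1 := by
    rw [← evJ_mul, mul_comm, expArcsinhSer_mul_neg, evJ_one]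
  have hx : mulX h n * evJ n (expArcsinhSer h (h / 2)) = mulXcl n := by
    rw [mulX, Matrix.mul_assoc, e1, Matrix.mul_one]
  have hy : mulY h n * evJ n (expArcsinhSer h (-(h / 2))) =
      mulYcl n + mulX h n * (omegaMat h n * evJ n (expArcsinhSer h (-(h / 2)))) := by
    rw [mulY, Matrix.add_mul, Matrix.mul_assoc, evJ_comm, e1, Matrix.mul_one, Matrix.mul_assoc]
  refine ⟨evJ n (expArcsinhSer h (h / 2)) * sectX n -
    omegaMat h n * evJ n (expArcsinhSer h (-(h / 2))) * sectY n,
    evJ n (expArcsinhSer h (-(h / 2))) * sectY n, ?_⟩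
  rw [← mulXcl_sect n, ← hx, Matrix.mul_sub, ← Matrix.mul_assoc, ← Matrix.mul_assoc (mulY h n), hy,
    Matrix.add_mul, Matrix.mul_assoc (mulX h n) (omegaMat h n * _)]
  abel

/-- The uniqueness half of every recursion in the spin: two matrices that agree after multiplication
by x and by y are equal. -/
theorem ext_of_mul {A l : Type*} [Ring A] [Algebra ℂ A] (h : ℂ) {n : ℕ}
    {N N' : Matrix l (Fin (n + 1 + 1)) A}
    (hx : N * (mulX h n).map (algebraMap ℂ A) = N' * (mulX h n).map (algebraMap ℂ A))
    (hy : N * (mulY h n).map (algebraMap ℂ A) = N' * (mulY h n).map (algebraMap ℂ A)) : N = N' := by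
  obtain ⟨s, t, hst⟩ := exists_mul_sect h n
  have h1 : ((mulX h n).map (algebraMap ℂ A)) * s.map (algebraMap ℂ A) +
      ((mulY h n).map (algebraMap ℂ A)) * t.map (algebraMap ℂ A) = 1 := by
    rw [← Matrix.map_mul, ← Matrix.map_mul, ← Matrix.map_add _ (map_add _), hst,
      Matrix.map_one _ (map_zero _) (map_one _)]
  rw [← Matrix.mul_one N, ← Matrix.mul_one N', ← h1, Matrix.mul_add, Matrix.mul_add,
    ← Matrix.mul_assoc, ← Matrix.mul_assoc, ← Matrix.mul_assoc, ← Matrix.mul_assoc, hx, hy]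

theorem ext_of_mul_complex {l : Type*} (h : ℂ) {n : ℕ} {N N' : Matrix l (Fin (n + 1 + 1)) ℂ}
    (hx : N * mulX h n = N' * mulX h n) (hy : N * mulY h n = N' * mulY h n) : N = N' :=
  ext_of_mul h (by simpa using hx) (by simpa using hy)

/-! ### The one-parameter group generated by `X` -/

theorem exp_Xmat_mul_mulX (h s : ℂ) (n : ℕ) : NormedSpace.exp (s • Xmat h (n + 1)) * mulX h n =
    mulX h n * NormedSpace.exp (s • Xmat h n) :=
  exp_mul_of_intertwine (by rw [Matrix.smul_mul, Xmat_mul_mulX, Matrix.mul_smul])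

theorem exp_Xmat_mul_mulY (h s : ℂ) (n : ℕ) : NormedSpace.exp (s • Xmat h (n + 1)) * mulY h n =
    (mulY h n + s • mulX h n) * NormedSpace.exp (s • Xmat h n) := by
  rw [exp_mul_of_jordan (P := s • Xmat h n) (x := mulX h n) (Q := s • 1)]
  · simp [Matrix.add_mul]
  · rw [Matrix.smul_mul, Xmat_mul_mulX, Matrix.mul_smul]
  · rw [Matrix.smul_mul, Xmat_mul_mulY]
    simp
  · simp

/-- A family of matrices satisfying the recursion of `exp (s X)` is `exp (s X)`. -/
theorem eq_exp_Xmat (h s : ℂ) (G : (n : ℕ) → Matrix (Fin (n + 1)) (Fin (n + 1)) ℂ) (h0 : G 0 = 1)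
    (hx : ∀ n, G (n + 1) * mulX h n = mulX h n * G n)
    (hy : ∀ n, G (n + 1) * mulY h n = (mulY h n + s • mulX h n) * G n) (n : ℕ) :
    G n = NormedSpace.exp (s • Xmat h n) := by
  induction n with
  | zero =>
    have : Xmat h 0 = 0 := by
      rw [Xmat_eq, evJ, ev_eq_sum, Finset.sum_range_one, ← zero_mul 2, mul_comm,
        coeff_arcsinhSer_even, zero_smul]
    rw [this, smul_zero, NormedSpace.exp_zero, h0]
  | succ n ih =>
    refine ext_of_mul_complex h ?_ ?_
    · rw [hx, ih, exp_Xmat_mul_mulX]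
    · rw [hy, ih, exp_Xmat_mul_mulY]

/-- T satisfies the recursion characterizing exp(hX), so no logarithm of matrices has to be
compared. -/
theorem exp_Xmat (h : ℂ) (n : ℕ) : NormedSpace.exp (h • Xmat h n) = Tmat h n := by
  refine (eq_exp_Xmat h h (Tmat h) ?_ (Tmat_mul_mulX h) (Tmat_mul_mulY h) n).symm
  rw [Tmat_eq, evJ, ev_eq_sum, Finset.sum_range_one, PowerSeries.coeff_zero_eq_constantCoeff_apply]
  simp [jordSer, sqrtSer, constantCoeff_evenBinom]

theorem exp_neg_Xmat (h : ℂ) (n : ℕ) : NormedSpace.exp (-(h • Xmat h n)) = TinvMat h n := by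
  have h1 : NormedSpace.exp (-(h • Xmat h n)) * Tmat h n = 1 := by
    rw [← exp_Xmat, ← Matrix.exp_add_of_commute _ _ ((Commute.refl (h • Xmat h n)).neg_left), neg_add_cancel,
      NormedSpace.exp_zero]
  rw [← Matrix.mul_one (NormedSpace.exp _), ← Tmat_mul_TinvMat h n, ← Matrix.mul_assoc, h1,
    Matrix.one_mul]

end Jordanian

namespace Jordanian

open PowerSeries (coeff trunc rescale)
open scoped PowerSeries

/-! ### The `R` matrix is compatible with multiplication in the first factor -/

theorem Hmat_mul_evJ (h : ℂ) (n : ℕ) (f : ℂ⟦X⟧) : Hmat h n * evJ n f = evJ n f * Hmat h n +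
    (2 : ℂ) • evJ n (sqrtSer h * (PowerSeries.X * PowerSeries.derivative ℂ f)) := by
  rw [Hmat, Matrix.mul_assoc, J0_mul_evJ, Matrix.mul_add, ← Matrix.mul_assoc, sqrtMat_eq, evJ_comm,
    Matrix.mul_assoc, Matrix.mul_smul, ← evJ_mul]

theorem Hmat_mul_Xmat (h : ℂ) (n : ℕ) :
    Hmat h n * Xmat h n = Xmat h n * Hmat h n + (2 : ℂ) • Jplus n := by
  rw [Xmat_eq, Hmat_mul_evJ, derivative_arcsinhSer, ← evJ_X]
  congr 3
  linear_combination PowerSeries.X * sqrtSer_mul_sqrtInvSer h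

theorem Hmat_mul_Tmat (h : ℂ) (n : ℕ) :
    Hmat h n * Tmat h n = Tmat h n * Hmat h n + (2 * h) • (Jplus n * Tmat h n) := by
  rw [Tmat_eq, Hmat_mul_evJ, derivative_jordSer, ← evJ_X, ← evJ_mul, mul_smul, ← evJ_smul n h]
  congr 3
  rw [mul_smul_comm, mul_smul_comm]
  congr 1
  linear_combination PowerSeries.X * jordSer h * sqrtSer_mul_sqrtInvSer h

theorem Tmat_sub_TinvMat (h : ℂ) (n : ℕ) : Tmat h n - TinvMat h n = (2 * h) • Jplus n := by
  rw [Tmat, TinvMat_eq]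
  module

/-- `T H`. -/
noncomputable def Amat (h : ℂ) (n : ℕ) : Matrix (Fin (n + 1)) (Fin (n + 1)) ℂ :=
  Tmat h n * Hmat h n

theorem Amat_mul_mulX (h : ℂ) (n : ℕ) :
    Amat h (n + 1) * mulX h n = mulX h n * (Amat h n + 1) := by
  rw [Amat, Matrix.mul_assoc, Hmat_mul_mulX, ← Matrix.mul_assoc, Tmat_mul_mulX, Matrix.mul_assoc,
    Matrix.mul_add, Tmat_mul_TinvMat, Amat]

theorem Amat_mul_mulY (h : ℂ) (n : ℕ) : Amat h (n + 1) * mulY h n =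
    mulY h n * (Amat h n - 1) + h • (mulX h n * ((2 : ℂ) • Amat h n - 1)) := by
  rw [Amat, Matrix.mul_assoc, Hmat_mul_mulY, Matrix.mul_add, ← Matrix.mul_assoc, Tmat_mul_mulY,
    Matrix.mul_smul, ← Matrix.mul_assoc, Tmat_mul_mulX, Matrix.mul_assoc, Matrix.mul_sub,
    Tmat_mul_TinvMat, Matrix.add_mul, Matrix.mul_assoc, ← Amat, Matrix.smul_mul]
  simp only [Matrix.mul_sub, Matrix.mul_smul, Matrix.mul_one]
  module

theorem Xmat_mul_Amat (h : ℂ) (n : ℕ) :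
    Xmat h n * Amat h n = Amat h n * Xmat h n - (2 : ℂ) • (Jplus n * Tmat h n) := by
  have h1 : Xmat h n * Tmat h n = Tmat h n * Xmat h n := by rw [Xmat_eq, Tmat_eq, evJ_comm]
  have h2 : Jplus n * Tmat h n = Tmat h n * Jplus n := by rw [← evJ_X, Tmat_eq, evJ_comm]
  rw [Amat, ← Matrix.mul_assoc, h1, Matrix.mul_assoc, Matrix.mul_assoc, Hmat_mul_Xmat,
    Matrix.mul_add, h2, Matrix.mul_smul]
  abel

/-- T H T⁻¹ differs from H by -2hJ₊, because [H, T] = 2hJ₊T; half of that is absorbed in L = H -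
hJ₊. -/
theorem Amat_mul_TinvMat (h : ℂ) (n : ℕ) :
    Amat h n * TinvMat h n = Lmat h n - h • Jplus n := by
  have h1 : Tmat h n * Hmat h n = Hmat h n * Tmat h n - (2 * h) • (Jplus n * Tmat h n) := by
    rw [Hmat_mul_Tmat]
    abel
  rw [Amat, h1, Matrix.sub_mul, Matrix.mul_assoc, Tmat_mul_TinvMat, Matrix.mul_one,
    Matrix.smul_mul, Matrix.mul_assoc, Tmat_mul_TinvMat, Matrix.mul_one, Lmat]
  module

/-- The eigenvector combination of the two multiplications for the adjoint action of `T H`. -/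
noncomputable def mulZ (h : ℂ) (n : ℕ) : Matrix (Fin (n + 1 + 1)) (Fin (n + 1)) ℂ :=
  mulY h n - h • (mulX h n * (Amat h n - (1 / 2 : ℂ) • 1))

/-- With A = TH, the x-terms match because (2A - 1) - (A + 1)(A - ½) = -(A - ½)(A - 1). This
diagonalizes the action of A on the pair (x, y). -/
theorem Amat_mul_mulZ (h : ℂ) (n : ℕ) :
    Amat h (n + 1) * mulZ h n = mulZ h n * (Amat h n - 1) := by
  rw [mulZ, Matrix.mul_sub, Amat_mul_mulY, Matrix.mul_smul, ← Matrix.mul_assoc, Amat_mul_mulX,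
    Matrix.mul_assoc, Matrix.sub_mul, Matrix.smul_mul, Matrix.mul_assoc, add_sub_assoc]
  rw [← smul_sub, ← Matrix.mul_sub, sub_eq_add_neg (mulY h n * _), ← smul_neg, ← Matrix.mul_neg]
  congr 3
  simp only [Matrix.mul_sub, Matrix.sub_mul, Matrix.add_mul, Matrix.mul_smul, Matrix.smul_mul,
    Matrix.mul_one, Matrix.one_mul]
  module

theorem kron_mul {l m n l' m' n' : Type*} [Fintype m] [Fintype m'] {R : Type*} [CommRing R]
    (a : Matrix l m R) (b : Matrix m n R) (a' : Matrix l' m' R) (b' : Matrix m' n' R) :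
    (a ⊗ₖ a') * (b ⊗ₖ b') = (a * b) ⊗ₖ (a' * b') := (Matrix.mul_kronecker_mul a b a' b').symm

section RFusion

local notation "𝕀[" m "]" => (1 : Matrix (Fin (m + 1)) (Fin (m + 1)) ℂ)

variable (h : ℂ) (n n' : ℕ)

/-- `exp (-h X ⊗ T H)`. -/
noncomputable def RhLeft : Matrix (Fin (n + 1) × Fin (n' + 1)) (Fin (n + 1) × Fin (n' + 1)) ℂ :=
  NormedSpace.exp (-h • (Xmat h n ⊗ₖ Amat h n'))

/-- `exp (h T H ⊗ X)`. -/
noncomputable def RhRight : Matrix (Fin (n + 1) × Fin (n' + 1)) (Fin (n + 1) × Fin (n' + 1)) ℂ :=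
  NormedSpace.exp (h • (Amat h n ⊗ₖ Xmat h n'))

theorem RhMat_eq : RhMat h n n' = RhLeft h n n' * RhRight h n n' := rfl

theorem RhLeft_mul_mulX : RhLeft h (n + 1) n' * (mulX h n ⊗ₖ 𝕀[n']) =
    (mulX h n ⊗ₖ 𝕀[n']) * RhLeft h n n' := by
  refine exp_mul_of_intertwine ?_
  rw [Matrix.smul_mul, Matrix.mul_smul, kron_mul, kron_mul, Xmat_mul_mulX, Matrix.mul_one,
    Matrix.one_mul]

theorem RhLeft_mul_mulY : RhLeft h (n + 1) n' * (mulY h n ⊗ₖ 𝕀[n']) =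
    (mulY h n ⊗ₖ 𝕀[n']) * RhLeft h n n' -
      h • ((mulX h n ⊗ₖ 𝕀[n']) * ((𝕀[n] ⊗ₖ Amat h n') * RhLeft h n n')) := by
  rw [RhLeft, exp_mul_of_jordan (P := -h • (Xmat h n ⊗ₖ Amat h n')) (x := mulX h n ⊗ₖ 𝕀[n'])
    (Q := -h • (𝕀[n] ⊗ₖ Amat h n'))]
  · rw [RhLeft, Matrix.smul_mul, Matrix.mul_smul]
    module
  · rw [Matrix.smul_mul, Matrix.mul_smul, kron_mul, kron_mul, Xmat_mul_mulX, Matrix.mul_one,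
      Matrix.one_mul]
  · rw [Matrix.smul_mul, Matrix.mul_smul, Matrix.mul_smul, kron_mul, kron_mul, kron_mul,
      Xmat_mul_mulY, Matrix.mul_one, Matrix.mul_one, Matrix.one_mul, Matrix.add_kronecker, smul_add]
  · rw [Matrix.smul_mul, Matrix.mul_smul, Matrix.smul_mul, Matrix.mul_smul, kron_mul, kron_mul,
      Matrix.mul_one, Matrix.one_mul]

theorem one_kron_Amat_mul_RhLeft :
    (𝕀[n] ⊗ₖ Amat h n') * RhLeft h n n' = RhLeft h n n' * (𝕀[n] ⊗ₖ Amat h n') := by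
  refine (exp_mul_of_intertwine ?_).symm
  rw [Matrix.smul_mul, Matrix.mul_smul, kron_mul, kron_mul, Matrix.mul_one, Matrix.one_mul]

/-- Moving m through h A ⊗ X adds the term ch 1 ⊗ X, which commutes with the exponent and can be
exponentiated separately. For c = 1 and c = -1 it gives T and T⁻¹. -/
theorem RhRight_mul_eigen {m : Matrix (Fin (n + 1 + 1)) (Fin (n + 1)) ℂ} {c : ℂ}
    (hm : Amat h (n + 1) * m = m * (Amat h n + c • 1)) :
    RhRight h (n + 1) n' * (m ⊗ₖ 𝕀[n']) =
      (m ⊗ₖ 𝕀[n']) * (RhRight h n n' * (𝕀[n] ⊗ₖ NormedSpace.exp ((c * h) • Xmat h n'))) := by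
  rw [RhRight, exp_mul_of_intertwine (P := h • (Amat h n ⊗ₖ Xmat h n') +
    𝕀[n] ⊗ₖ ((c * h) • Xmat h n')), Matrix.exp_add_of_commute, exp_one_kronecker, RhRight]
  · rw [Commute, SemiconjBy, Matrix.smul_mul, Matrix.mul_smul, kron_mul, kron_mul, Matrix.mul_one,
      Matrix.one_mul, Matrix.mul_smul, Matrix.smul_mul]
  · rw [Matrix.mul_add, Matrix.smul_mul, Matrix.mul_smul, kron_mul, kron_mul, kron_mul, hm,
      Matrix.mul_add, Matrix.add_kronecker, Matrix.one_mul, Matrix.mul_one, Matrix.mul_smul,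
      Matrix.mul_one, Matrix.one_mul, Matrix.smul_kronecker, Matrix.kronecker_smul]
    module

theorem RhRight_mul_mulX : RhRight h (n + 1) n' * (mulX h n ⊗ₖ 𝕀[n']) =
    (mulX h n ⊗ₖ 𝕀[n']) * (RhRight h n n' * (𝕀[n] ⊗ₖ Tmat h n')) := by
  have := RhRight_mul_eigen h n n' (m := mulX h n) (c := 1) (by rw [Amat_mul_mulX, one_smul])
  rwa [one_mul, exp_Xmat] at this

theorem RhRight_mul_mulZ : RhRight h (n + 1) n' * (mulZ h n ⊗ₖ 𝕀[n']) =
    (mulZ h n ⊗ₖ 𝕀[n']) * (RhRight h n n' * (𝕀[n] ⊗ₖ TinvMat h n')) := by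
  have := RhRight_mul_eigen h n n' (m := mulZ h n) (c := -1) (by
    rw [Amat_mul_mulZ, neg_one_smul, sub_eq_add_neg])
  rwa [neg_one_mul, neg_smul, exp_neg_Xmat] at this

theorem RhRight_mul_kron_one {B : Matrix (Fin (n + 1)) (Fin (n + 1)) ℂ}
    (hB : Amat h n * B = B * Amat h n) :
    RhRight h n n' * (B ⊗ₖ 𝕀[n']) = (B ⊗ₖ 𝕀[n']) * RhRight h n n' := by
  refine exp_mul_of_intertwine ?_
  rw [Matrix.smul_mul, Matrix.mul_smul, kron_mul, kron_mul, Matrix.mul_one, Matrix.one_mul, hB]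

/-- In terms of the eigenvectors y = z + h x (A - ½). The two summands acquire T⁻¹ and T
respectively, and the discrepancy T - T⁻¹ = 2hJ₊ produces the second term. -/
theorem RhRight_mul_mulY : RhRight h (n + 1) n' * (mulY h n ⊗ₖ 𝕀[n']) =
    (mulY h n ⊗ₖ 𝕀[n']) * (RhRight h n n' * (𝕀[n] ⊗ₖ TinvMat h n')) + (2 * h ^ 2) •
      ((mulX h n ⊗ₖ 𝕀[n']) * (RhRight h n n' * ((Amat h n - (1 / 2 : ℂ) • 1) ⊗ₖ Jplus n'))) := by
  set B := Amat h n - (1 / 2 : ℂ) • (1 : Matrix (Fin (n + 1)) (Fin (n + 1)) ℂ) with hB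
  have hc : RhRight h n n' * (B ⊗ₖ 𝕀[n']) = (B ⊗ₖ 𝕀[n']) * RhRight h n n' :=
    RhRight_mul_kron_one h n n' (by simp [hB, Matrix.mul_sub, Matrix.sub_mul])
  have hz : mulY h n ⊗ₖ 𝕀[n'] =
      mulZ h n ⊗ₖ 𝕀[n'] + h • ((mulX h n ⊗ₖ 𝕀[n']) * (B ⊗ₖ 𝕀[n'])) := by
    rw [kron_mul, Matrix.mul_one, ← Matrix.smul_kronecker, ← Matrix.add_kronecker, mulZ,
      sub_add_cancel]
  have hJ : B ⊗ₖ ((2 * h) • Jplus n') = (B ⊗ₖ 𝕀[n']) * (𝕀[n] ⊗ₖ Tmat h n')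
      - (B ⊗ₖ 𝕀[n']) * (𝕀[n] ⊗ₖ TinvMat h n') := by
    rw [← Tmat_sub_TinvMat, kron_mul, kron_mul, Matrix.one_mul, Matrix.one_mul, Matrix.mul_one,
      sub_eq_add_neg, Matrix.kronecker_add, sub_eq_add_neg]
    congr 1
    ext i k
    simp [Matrix.kroneckerMap_apply]
  have hT : (𝕀[n] ⊗ₖ Tmat h n') * (B ⊗ₖ 𝕀[n']) = (B ⊗ₖ 𝕀[n']) * (𝕀[n] ⊗ₖ Tmat h n') := by
    rw [kron_mul, kron_mul, Matrix.one_mul, Matrix.mul_one, Matrix.one_mul, Matrix.mul_one]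
  rw [hz, Matrix.mul_add, RhRight_mul_mulZ, Matrix.mul_smul,
    ← Matrix.mul_assoc (RhRight h (n + 1) n'), RhRight_mul_mulX,
    Matrix.add_mul]
  have e : (2 * h ^ 2) • ((mulX h n ⊗ₖ 𝕀[n']) *
      (RhRight h n n' * (B ⊗ₖ Jplus n'))) = h • ((mulX h n ⊗ₖ 𝕀[n']) *
        (RhRight h n n' * (B ⊗ₖ ((2 * h) • Jplus n')))) := by
    rw [Matrix.kronecker_smul, Matrix.mul_smul, Matrix.mul_smul, smul_smul]
    congr 1
    ring
  rw [e, hJ, Matrix.mul_sub, Matrix.mul_sub, ← hT, smul_sub,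
    ← Matrix.mul_assoc (RhRight h n n') (Matrix.kroneckerMap _ B _), hc]
  simp only [Matrix.mul_assoc, Matrix.smul_mul]
  abel

/-- [X, A] = -2J₊T commutes with X, so the commutator series of 1 ⊗ A with h A ⊗ X stops after one
step. This is the Jordan block formula with x = 1. -/
theorem one_kron_Amat_mul_RhRight : (𝕀[n] ⊗ₖ Amat h n') * RhRight h n n' = RhRight h n n' *
    (𝕀[n] ⊗ₖ Amat h n' + (2 * h) • (Amat h n ⊗ₖ (Jplus n' * Tmat h n'))) := by
  have hXJ : Xmat h n' * (Jplus n' * Tmat h n') = Jplus n' * Tmat h n' * Xmat h n' := by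
    rw [← evJ_X, Tmat_eq, ← evJ_mul, Xmat_eq, evJ_comm]
  have hQ : (h • (Amat h n ⊗ₖ Xmat h n')) * ((-2 * h) • (Amat h n ⊗ₖ (Jplus n' * Tmat h n'))) =
      ((-2 * h) • (Amat h n ⊗ₖ (Jplus n' * Tmat h n'))) * (h • (Amat h n ⊗ₖ Xmat h n')) := by
    rw [Matrix.smul_mul, Matrix.mul_smul, Matrix.smul_mul, Matrix.mul_smul, kron_mul, kron_mul, hXJ,
      smul_comm]
  have h1 := exp_mul_of_jordan (P := h • (Amat h n ⊗ₖ Xmat h n'))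
    (P' := h • (Amat h n ⊗ₖ Xmat h n')) (x := 1) (y := 𝕀[n] ⊗ₖ Amat h n')
    (Q := (-2 * h) • (Amat h n ⊗ₖ (Jplus n' * Tmat h n'))) (by simp) (by
      rw [Matrix.smul_mul, Matrix.mul_smul, kron_mul, kron_mul, Xmat_mul_Amat, Matrix.one_mul,
        Matrix.mul_one, Matrix.one_mul, sub_eq_add_neg, ← neg_smul, Matrix.kronecker_add,
        Matrix.kronecker_smul]
      module) hQ
  have h2 := exp_mul_of_intertwine hQ
  rw [← RhRight, Matrix.one_mul] at h1
  rw [← RhRight] at h2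
  rw [Matrix.mul_add, h1, ← h2, Matrix.mul_smul, Matrix.mul_smul]
  module

/-- The first column of the fusion rule (Δ⊗1)R = R₁₃R₂₃, where R between spin 1/2 and spin n'/2 is
(T, -hL; 0, T⁻¹). -/
theorem RhMat_mul_mulX : RhMat h (n + 1) n' * (mulX h n ⊗ₖ 𝕀[n']) =
    (mulX h n ⊗ₖ 𝕀[n']) * (RhMat h n n' * (𝕀[n] ⊗ₖ Tmat h n')) := by
  rw [RhMat_eq, Matrix.mul_assoc, RhRight_mul_mulX, ← Matrix.mul_assoc, RhLeft_mul_mulX, RhMat_eq]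
  simp only [Matrix.mul_assoc]

/-- The second column of the fusion rule. Both exponentials create terms containing (A - ½) ⊗ J₊:
the right one directly, the left one when A is carried through the right one. These cancel, and A
T⁻¹ = L - hJ₊ leaves L. -/
theorem RhMat_mul_mulY : RhMat h (n + 1) n' * (mulY h n ⊗ₖ 𝕀[n']) =
    (mulY h n ⊗ₖ 𝕀[n']) * (RhMat h n n' * (𝕀[n] ⊗ₖ TinvMat h n')) -
      h • ((mulX h n ⊗ₖ 𝕀[n']) * (RhMat h n n' * (𝕀[n] ⊗ₖ Lmat h n'))) := by
  have key : (𝕀[n] ⊗ₖ Amat h n') * RhRight h n n' * (𝕀[n] ⊗ₖ TinvMat h n') =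
      RhRight h n n' * (𝕀[n] ⊗ₖ Lmat h n') +
      (2 * h) • (RhRight h n n' * ((Amat h n - (1 / 2 : ℂ) • 1) ⊗ₖ Jplus n')) := by
    rw [one_kron_Amat_mul_RhRight, Matrix.mul_assoc, Matrix.add_mul, Matrix.smul_mul, kron_mul,
      kron_mul, Matrix.one_mul, Amat_mul_TinvMat, Matrix.mul_assoc (Jplus n'), Tmat_mul_TinvMat,
      Matrix.mul_one, Matrix.mul_one, ← Matrix.mul_smul, ← Matrix.mul_add]
    congr 1
    ext ⟨i, i'⟩ ⟨k, k'⟩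
    simp only [Matrix.add_apply, Matrix.smul_apply, Matrix.kroneckerMap_apply, Matrix.sub_apply,
      smul_eq_mul]
    ring
  have key2 : (𝕀[n] ⊗ₖ Amat h n') * (RhLeft h n n' * (RhRight h n n' * (𝕀[n] ⊗ₖ TinvMat h n'))) =
      RhLeft h n n' * (RhRight h n n' * (𝕀[n] ⊗ₖ Lmat h n')) + (2 * h) •
        (RhLeft h n n' * (RhRight h n n' * ((Amat h n - (1 / 2 : ℂ) • 1) ⊗ₖ Jplus n'))) := by
    rw [← Matrix.mul_assoc, one_kron_Amat_mul_RhLeft, Matrix.mul_assoc,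
      ← Matrix.mul_assoc (𝕀[n] ⊗ₖ Amat h n'), key, Matrix.mul_add, Matrix.mul_smul]
  rw [RhMat_eq, Matrix.mul_assoc, RhRight_mul_mulY, Matrix.mul_add, ← Matrix.mul_assoc,
    RhLeft_mul_mulY, Matrix.mul_smul, ← Matrix.mul_assoc (RhLeft h (n + 1) n'), RhLeft_mul_mulX,
    RhMat_eq]
  simp only [Matrix.sub_mul, Matrix.smul_mul, Matrix.mul_assoc, key2, Matrix.mul_add,
    Matrix.mul_smul]
  module

/-- The coproduct of `X`. -/
noncomputable def coprodX : Matrix (Fin (n + 1) × Fin (n' + 1)) (Fin (n + 1) × Fin (n' + 1)) ℂ :=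
  Xmat h n ⊗ₖ 𝕀[n'] + 𝕀[n] ⊗ₖ Xmat h n'

theorem Lmat_mul_Xmat : Lmat h n' * Xmat h n' = Xmat h n' * Lmat h n' + (2 : ℂ) • Jplus n' := by
  have h1 : Jplus n' * Xmat h n' = Xmat h n' * Jplus n' := by rw [← evJ_X, Xmat_eq, evJ_comm]
  rw [Lmat, Matrix.sub_mul, Matrix.mul_sub, Hmat_mul_Xmat, Matrix.smul_mul, h1, Matrix.mul_smul]
  abel

theorem ext_of_mul_kron {l : Type*} {M M' : Matrix l (Fin (n + 1 + 1) × Fin (n' + 1)) ℂ}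
    (hx : M * (mulX h n ⊗ₖ 𝕀[n']) = M' * (mulX h n ⊗ₖ 𝕀[n']))
    (hy : M * (mulY h n ⊗ₖ 𝕀[n']) = M' * (mulY h n ⊗ₖ 𝕀[n'])) : M = M' := by
  obtain ⟨s, t, hst⟩ := exists_mul_sect h n
  have h1 : (mulX h n ⊗ₖ 𝕀[n']) * (s ⊗ₖ 𝕀[n']) + (mulY h n ⊗ₖ 𝕀[n']) * (t ⊗ₖ 𝕀[n']) = 1 := by
    rw [kron_mul, kron_mul, Matrix.one_mul, ← Matrix.add_kronecker, hst, Matrix.one_kronecker_one]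
  rw [← Matrix.mul_one M, ← Matrix.mul_one M', ← h1, Matrix.mul_add, Matrix.mul_add,
    ← Matrix.mul_assoc, ← Matrix.mul_assoc, ← Matrix.mul_assoc, ← Matrix.mul_assoc, hx, hy]

theorem Xmat_zero : Xmat h 0 = 0 := by
  ext i k
  fin_cases i; fin_cases k
  simp [Xmat, Jplus]

theorem Hmat_zero : Hmat h 0 = 0 := by
  ext i k
  fin_cases i; fin_cases k
  simp [Hmat, J0]

theorem RhMat_zero : RhMat h 0 n' = 1 := by
  rw [RhMat, Xmat_zero, Hmat_zero]
  simp

theorem coprodX_mul_mulX : coprodX h (n + 1) n' * (mulX h n ⊗ₖ 𝕀[n']) =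
    (mulX h n ⊗ₖ 𝕀[n']) * coprodX h n n' := by
  rw [coprodX, coprodX, Matrix.add_mul, Matrix.mul_add, kron_mul, kron_mul, kron_mul, kron_mul,
    Xmat_mul_mulX]
  simp

theorem coprodX_mul_mulY : coprodX h (n + 1) n' * (mulY h n ⊗ₖ 𝕀[n']) =
    (mulY h n ⊗ₖ 𝕀[n']) * coprodX h n n' + mulX h n ⊗ₖ 𝕀[n'] := by
  rw [coprodX, coprodX, Matrix.add_mul, Matrix.mul_add, kron_mul, kron_mul, kron_mul, kron_mul,
    Xmat_mul_mulY, Matrix.add_kronecker]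
  simp only [Matrix.one_mul, Matrix.mul_one]
  abel

theorem coprodX_mul_one_kron {B C : Matrix (Fin (n' + 1)) (Fin (n' + 1)) ℂ}
    (hB : B * Xmat h n' = Xmat h n' * B + C) :
    (𝕀[n] ⊗ₖ B) * coprodX h n n' = coprodX h n n' * (𝕀[n] ⊗ₖ B) + 𝕀[n] ⊗ₖ C := by
  rw [coprodX, Matrix.mul_add, Matrix.add_mul, kron_mul, kron_mul, kron_mul, kron_mul, hB,
    Matrix.kronecker_add]
  simp only [Matrix.one_mul, Matrix.mul_one]
  abel

/-- The `R` matrix commutes with the coproduct of `X`. -/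
theorem RhMat_mul_coprodX : RhMat h n n' * coprodX h n n' = coprodX h n n' * RhMat h n n' := by
  induction n with
  | zero => rw [RhMat_zero, Matrix.one_mul, Matrix.mul_one]
  | succ n ih =>
    have hT := coprodX_mul_one_kron h n n' (B := Tmat h n') (C := 0)
      (by rw [Xmat_eq, Tmat_eq, evJ_comm, add_zero])
    have hTi := coprodX_mul_one_kron h n n' (B := TinvMat h n') (C := 0)
      (by rw [Xmat_eq, TinvMat, evJ_comm, add_zero])
    have hL := coprodX_mul_one_kron h n n' (Lmat_mul_Xmat h n')
    rw [Matrix.kronecker_zero, add_zero] at hT hTi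
    refine ext_of_mul_kron h n n' ?_ ?_
    · rw [Matrix.mul_assoc, coprodX_mul_mulX, ← Matrix.mul_assoc, RhMat_mul_mulX, Matrix.mul_assoc,
        Matrix.mul_assoc, hT, ← Matrix.mul_assoc (RhMat h n n'), ih, Matrix.mul_assoc,
        Matrix.mul_assoc (coprodX h (n + 1) n'), RhMat_mul_mulX, ← Matrix.mul_assoc (coprodX h (n + 1) n'), coprodX_mul_mulX]
      simp only [Matrix.mul_assoc]
    -- Carrying X through L leaves the commutator 2J₊, while the x-component of the coproduct brings
    -- T where T⁻¹ is expected. By T - T⁻¹ = 2hJ₊ the two effects balance.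
    · have hTT : 𝕀[n] ⊗ₖ Tmat h n' = 𝕀[n] ⊗ₖ TinvMat h n' + h • (𝕀[n] ⊗ₖ ((2 : ℂ) • Jplus n')) := by
        rw [← Matrix.kronecker_smul, ← Matrix.kronecker_add, smul_smul, mul_comm h,
          ← Tmat_sub_TinvMat, add_sub_cancel]
      rw [Matrix.mul_assoc, Matrix.mul_assoc, coprodX_mul_mulY, RhMat_mul_mulY, Matrix.mul_add,
        Matrix.mul_sub, ← Matrix.mul_assoc (RhMat h (n + 1) n'), RhMat_mul_mulY, RhMat_mul_mulX,
        ← Matrix.mul_assoc (coprodX h (n + 1) n'), coprodX_mul_mulY, Matrix.mul_smul,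
        ← Matrix.mul_assoc (coprodX h (n + 1) n'), coprodX_mul_mulX, Matrix.sub_mul,
        Matrix.smul_mul, Matrix.mul_assoc, Matrix.mul_assoc, Matrix.mul_assoc, Matrix.mul_assoc,
        hTi, hL, Matrix.mul_add (RhMat h n n'), ← Matrix.mul_assoc (RhMat h n n'),
        ← Matrix.mul_assoc (RhMat h n n') (coprodX h n n'), ih, hTT]
      simp only [Matrix.mul_add, Matrix.add_mul, Matrix.mul_assoc, Matrix.mul_smul, smul_add]
      abel

end RFusion

end Jordanian

namespace Jordanian

open PowerSeries (coeff trunc rescale)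
open scoped PowerSeries

/-! ### Complex matrices with coefficients in an algebra -/

section Tens

variable {R : Type*} [Ring R] [Algebra ℂ R] {l m n : Type*}

/-- The matrix `x ⊗ N` over an algebra, for `x` in the algebra and a complex matrix `N`. -/
def tens (x : R) (N : Matrix l m ℂ) : Matrix l m R := N.map fun t => t • x

theorem tens_one_eq_map (N : Matrix l m ℂ) : tens (1 : R) N = N.map (algebraMap ℂ R) := by
  ext i k
  simp [tens, Algebra.algebraMap_eq_smul_one]

theorem tens_mul_tens [Fintype m] (x y : R) (N : Matrix l m ℂ) (N' : Matrix m n ℂ) :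
    tens x N * tens y N' = tens (x * y) (N * N') := by
  ext i k
  simp [tens, Matrix.mul_apply, Finset.sum_smul, smul_smul, mul_comm]

theorem tens_mul_tens_assoc [Fintype m] {p : Type*} [Fintype n] (x y : R) (N : Matrix l m ℂ) (N' : Matrix m n ℂ)
    (M : Matrix n p R) : tens x N * (tens y N' * M) = tens (x * y) (N * N') * M := by
  rw [← Matrix.mul_assoc, tens_mul_tens]

theorem tens_add_left (x y : R) (N : Matrix l m ℂ) : tens (x + y) N = tens x N + tens y N := by
  ext i k
  simp [tens]

theorem tens_sub_left (x y : R) (N : Matrix l m ℂ) : tens (x - y) N = tens x N - tens y N := by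
  ext i k
  simp [tens, smul_sub]

theorem tens_smul_left (t : ℂ) (x : R) (N : Matrix l m ℂ) : tens (t • x) N = t • tens x N := by
  ext i k
  exact smul_comm _ _ _

theorem tens_add_right (x : R) (N N' : Matrix l m ℂ) : tens x (N + N') = tens x N + tens x N' := by
  ext i k
  simp [tens, add_smul]

theorem tens_sub_right (x : R) (N N' : Matrix l m ℂ) : tens x (N - N') = tens x N - tens x N' := by
  ext i k
  simp [tens, sub_smul]

theorem tens_smul_right (t : ℂ) (x : R) (N : Matrix l m ℂ) : tens x (t • N) = t • tens x N := by
  ext i k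
  simp [tens, mul_smul]

theorem tens_one_one [DecidableEq m] : tens (1 : R) (1 : Matrix m m ℂ) = 1 := by
  rw [tens_one_eq_map, Matrix.map_one _ (map_zero _) (map_one _)]

end Tens

/-! ### Fusion families of `T` matrices -/

section Fusion

variable {R : Type*} [Ring R] [Algebra ℂ R] {h : ℂ}

/-- The relations of `Fun_h(SL(2))`. -/
structure IsSLh (h : ℂ) (A B C E : R) : Prop where
  CA : C * A = A * C + h • (C * C)
  CE : C * E = E * C + h • (C * C)
  EA : E * A = A * E - h • (A * C) + h • (E * C)
  CB : C * B = B * C + h • (A * C) + h • (E * C) + h ^ 2 • (C * C)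
  BA : B * A = A * B - h • (A * A) + h • (1 : R)
  EB : E * B = B * E + h • (E * E) - h • (1 : R)
  det : A * E = 1 + B * C + h • (A * C)

/-- A sequence of square matrices that multiplies like the irreducible corepresentations of a
quantum group of type `SL(2)`, the matrix of size `2` being `(A, B; C, E)`. -/
structure IsFusion (h : ℂ) (A B C E : R) (T : (n : ℕ) → Matrix (Fin (n + 1)) (Fin (n + 1)) R) :
    Prop where
  zero : T 0 = 1
  mul_x (n : ℕ) : T (n + 1) * tens (1 : R) (mulX h n) =
    tens (1 : R) (mulX h n) * (T n * tens A 1) + tens (1 : R) (mulY h n) * (T n * tens C 1)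
  mul_y (n : ℕ) : T (n + 1) * tens (1 : R) (mulY h n) =
    tens (1 : R) (mulX h n) * (T n * tens B 1) + tens (1 : R) (mulY h n) * (T n * tens E 1)

theorem ext_of_tens_mul {l : Type*} (h : ℂ) {n : ℕ} {N N' : Matrix l (Fin (n + 1 + 1)) R}
    (hx : N * tens (1 : R) (mulX h n) = N' * tens (1 : R) (mulX h n))
    (hy : N * tens (1 : R) (mulY h n) = N' * tens (1 : R) (mulY h n)) : N = N' := by
  rw [tens_one_eq_map] at hx hy
  exact ext_of_mul h hx hy

variable {A B C E : R} {T : (n : ℕ) → Matrix (Fin (n + 1)) (Fin (n + 1)) R}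

theorem Tmat_zero : Tmat h 0 = 1 := by
  rw [← exp_Xmat, Xmat_zero, smul_zero, NormedSpace.exp_zero]

theorem TinvMat_zero : TinvMat h 0 = 1 := by
  rw [← exp_neg_Xmat, Xmat_zero, smul_zero, neg_zero, NormedSpace.exp_zero]

theorem Lmat_zero : Lmat h 0 = 0 := by
  have h1 : Jplus 0 = 0 := by
    ext i k
    fin_cases i; fin_cases k
    simp [Jplus]
  rw [Lmat, Hmat_zero, h1, smul_zero, sub_zero]

/-- The `RTT` relations between the matrix of size `2` and the matrix of size `n + 1`. -/
theorem IsFusion.rtt_one (hT : IsFusion h A B C E T) (hS : IsSLh h A B C E) (n : ℕ) :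
    (tens A (Tmat h n) - h • tens C (Lmat h n)) * T n = T n * tens A (Tmat h n) ∧
    (tens B (Tmat h n) - h • tens E (Lmat h n)) * T n =
      T n * (tens B (TinvMat h n) - h • tens A (Lmat h n)) ∧
    tens C (TinvMat h n) * T n = T n * tens C (Tmat h n) ∧
    tens E (TinvMat h n) * T n = T n * (tens E (TinvMat h n) - h • tens C (Lmat h n)) := by
  -- The four equations are the entries of R₁₂T₁T₂ = T₂T₁R₁₂ with T₁ = (A, B; C, E) and R₁₂ = (T,
  -- -hL; 0, T⁻¹). Spin 0 is trivial; to raise n, the second factor is fused with another spin 1/2,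
  -- and the relations among A, B, C, E are exactly what is needed to exchange the two copies of
  -- spin 1/2.
  induction n with
  | zero =>
    have hz : ∀ x : R, tens x (0 : Matrix (Fin (0 + 1)) (Fin (0 + 1)) ℂ) = 0 := fun x => by
      ext; simp [tens]
    simp [hT.zero, Tmat_zero, TinvMat_zero, Lmat_zero, hz]
  | succ n ih =>
    obtain ⟨h1, h2, h3, h4⟩ := ih
    have px (x : R) (N : Matrix (Fin (n + 1 + 1)) (Fin (n + 1 + 1)) ℂ) :
        tens x N * tens (1 : R) (mulX h n) = tens x (N * mulX h n) := by rw [tens_mul_tens, mul_one]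
    -- The induction hypotheses are oriented as rewriting rules that move the spin-1/2 entries from
    -- the left of `T n` to its right. Terms with L on the left are not moved; they cancel.
    have e1 : ∀ y : R, (tens A (Tmat h n)) * (T n * tens y 1) =
        T n * tens (A * y) (Tmat h n) + h • (tens C (Lmat h n) * (T n * tens y 1)) := by
      intro y
      rw [sub_mul, sub_eq_iff_eq_add] at h1
      rw [← Matrix.mul_assoc, h1, Matrix.add_mul, Matrix.mul_assoc, tens_mul_tens, Matrix.mul_one]
      simp only [Matrix.smul_mul, Matrix.mul_assoc]
    have e2 : ∀ y : R, (tens B (Tmat h n)) * (T n * tens y 1) =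
        T n * tens (B * y) (TinvMat h n) - h • (T n * tens (A * y) (Lmat h n)) +
        h • (tens E (Lmat h n) * (T n * tens y 1)) := by
      intro y
      rw [sub_mul, sub_eq_iff_eq_add] at h2
      rw [← Matrix.mul_assoc, h2, Matrix.add_mul, Matrix.mul_assoc, Matrix.sub_mul, tens_mul_tens,
        Matrix.mul_one, Matrix.smul_mul, tens_mul_tens, Matrix.mul_one]
      simp only [Matrix.smul_mul, Matrix.mul_assoc, Matrix.mul_sub, Matrix.mul_smul]
    have e3 : ∀ y : R, (tens C (TinvMat h n)) * (T n * tens y 1) =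
        T n * tens (C * y) (Tmat h n) := by
      intro y
      rw [← Matrix.mul_assoc, h3, Matrix.mul_assoc, tens_mul_tens, Matrix.mul_one]
    have e4 : ∀ y : R, (tens E (TinvMat h n)) * (T n * tens y 1) =
        T n * tens (E * y) (TinvMat h n) - h • (T n * tens (C * y) (Lmat h n)) := by
      intro y
      rw [← Matrix.mul_assoc, h4, Matrix.mul_assoc, Matrix.sub_mul, tens_mul_tens, Matrix.mul_one,
        Matrix.smul_mul, tens_mul_tens, Matrix.mul_one, Matrix.mul_sub, Matrix.mul_smul]
    have cx (x : R) (N : Matrix (Fin (n + 1)) (Fin (n + 1)) ℂ) :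
        tens x (mulX h n * N) = tens (1 : R) (mulX h n) * tens x N := by rw [tens_mul_tens, one_mul]
    have cy (x : R) (N : Matrix (Fin (n + 1)) (Fin (n + 1)) ℂ) :
        tens x (mulY h n * N) = tens (1 : R) (mulY h n) * tens x N := by rw [tens_mul_tens, one_mul]
    have f : ∀ (x y : R) (N : Matrix (Fin (n + 1)) (Fin (n + 1)) ℂ), tens x 1 * tens y N =
        tens (x * y) N := fun x y N => by rw [tens_mul_tens, Matrix.one_mul]
    have sx : ∀ (x : R) (N : Matrix (Fin (n + 1 + 1)) (Fin (n + 1 + 1)) ℂ)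
      (M : Matrix (Fin (n + 1)) (Fin (n + 1)) R), tens x N * (tens (1 : R) (mulX h n) * M) =
        tens x (N * mulX h n) * M := fun x N M => by rw [tens_mul_tens_assoc, mul_one]
    have sy : ∀ (x : R) (N : Matrix (Fin (n + 1 + 1)) (Fin (n + 1 + 1)) ℂ)
      (M : Matrix (Fin (n + 1)) (Fin (n + 1)) R), tens x N * (tens (1 : R) (mulY h n) * M) =
        tens x (N * mulY h n) * M := fun x N M => by rw [tens_mul_tens_assoc, mul_one]
    have py (x : R) (N : Matrix (Fin (n + 1 + 1)) (Fin (n + 1 + 1)) ℂ) :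
        tens x N * tens (1 : R) (mulY h n) = tens x (N * mulY h n) := by rw [tens_mul_tens, mul_one]
    have fx (M : Matrix (Fin (n + 1)) (Fin (n + 1)) R) : T (n + 1) * (tens (1 : R) (mulX h n) * M) =
        tens (1 : R) (mulX h n) * (T n * (tens A 1 * M)) + tens (1 : R) (mulY h n) * (T n * (tens C 1 * M)) := by
      rw [← Matrix.mul_assoc, hT.mul_x, Matrix.add_mul]
      simp only [Matrix.mul_assoc]
    have fy (M : Matrix (Fin (n + 1)) (Fin (n + 1)) R) : T (n + 1) * (tens (1 : R) (mulY h n) * M) =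
        tens (1 : R) (mulX h n) * (T n * (tens B 1 * M)) + tens (1 : R) (mulY h n) * (T n * (tens E 1 * M)) := by
      rw [← Matrix.mul_assoc, hT.mul_y, Matrix.add_mul]
      simp only [Matrix.mul_assoc]
    -- All complex matrices are carried to the right of the multiplication maps, and products of A,
    -- B, C, E are brought to a fixed order; both sides are then the same linear combination.
    refine ⟨ext_of_tens_mul h ?_ ?_, ext_of_tens_mul h ?_ ?_, ext_of_tens_mul h ?_ ?_,
      ext_of_tens_mul h ?_ ?_⟩ <;>
    · rw [Matrix.mul_assoc, Matrix.mul_assoc (T (n + 1))]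
      simp only [hT.mul_x, hT.mul_y, Matrix.sub_mul, Matrix.mul_add, Matrix.mul_sub, Matrix.mul_smul,
        Matrix.smul_mul, sx, sy, px, py, Tmat_mul_mulX, Tmat_mul_mulY, TinvMat_mul_mulX,
        TinvMat_mul_mulY, Lmat_mul_mulX, Lmat_mul_mulY, Matrix.add_mul, tens_add_right,
        tens_sub_right, tens_smul_right, cx, cy, fx, fy, f, e1, e2, e3, e4, Matrix.mul_assoc,
        smul_add, smul_sub, hS.CA, hS.CB, hS.CE, hS.EA, hS.BA, hS.EB, hS.det, tens_add_left,
        tens_sub_left, tens_smul_left]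
      module

end Fusion

end Jordanian

namespace Jordanian

/-! ### Kronecker products over a noncommutative ring -/

section Kron

variable {R : Type*} [Ring R] {l m n l' m' n' : Type*}

theorem matrix_mul_congr_left {p : Type*} [Fintype m] {N N' : Matrix l m R} (h : N = N')
    (M : Matrix m p R) : N * M = N' * M := by rw [h]

theorem kronecker_one_mul [Fintype m] [Fintype m'] [DecidableEq m'] (N : Matrix l m R)
    (N' : Matrix m n R) : (N ⊗ₖ (1 : Matrix m' m' R)) * (N' ⊗ₖ (1 : Matrix m' m' R)) =
      (N * N') ⊗ₖ (1 : Matrix m' m' R) := by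
  ext ⟨i, i'⟩ ⟨k, k'⟩
  simp [Matrix.mul_apply, Fintype.sum_prod_type, Matrix.kroneckerMap_apply, Matrix.one_apply]

theorem one_kronecker_mul [Fintype m] [Fintype m'] [DecidableEq m] (N : Matrix l' m' R)
    (N' : Matrix m' n' R) : ((1 : Matrix m m R) ⊗ₖ N) * ((1 : Matrix m m R) ⊗ₖ N') =
      (1 : Matrix m m R) ⊗ₖ (N * N') := by
  ext ⟨i, i'⟩ ⟨k, k'⟩
  simp [Matrix.mul_apply, Fintype.sum_prod_type, Matrix.kroneckerMap_apply, Matrix.one_apply,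
    Finset.mul_sum]

theorem kronecker_comm_of_commute [Fintype m] [Fintype l] [Fintype m'] [Fintype l'] [DecidableEq m]
    [DecidableEq m'] [DecidableEq l] [DecidableEq l'] (N : Matrix l m R) (N' : Matrix l' m' R)
    (hN : ∀ i k i' k', N i k * N' i' k' = N' i' k' * N i k) :
    (N ⊗ₖ (1 : Matrix l' l' R)) * ((1 : Matrix m m R) ⊗ₖ N') =
      ((1 : Matrix l l R) ⊗ₖ N') * (N ⊗ₖ (1 : Matrix m' m' R)) := by
  ext ⟨i, i'⟩ ⟨k, k'⟩
  simp [Matrix.mul_apply, Fintype.sum_prod_type, Matrix.kroneckerMap_apply, Matrix.one_apply, hN]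

variable [Algebra ℂ R]

theorem tens_kronecker_one [DecidableEq m'] (x : R) (N : Matrix l m ℂ) :
    tens x N ⊗ₖ (1 : Matrix m' m' R) = tens x (N ⊗ₖ (1 : Matrix m' m' ℂ)) := by
  ext ⟨i, i'⟩ ⟨k, k'⟩
  by_cases h : i' = k' <;> simp [tens, Matrix.kroneckerMap_apply, h]

theorem one_kronecker_tens [DecidableEq m'] (x : R) (N : Matrix l m ℂ) :
    (1 : Matrix m' m' R) ⊗ₖ tens x N = tens x ((1 : Matrix m' m' ℂ) ⊗ₖ N) := by
  ext ⟨i, i'⟩ ⟨k, k'⟩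
  by_cases h : i = k <;> simp [tens, Matrix.kroneckerMap_apply, h]

theorem tens_one_kronecker_comm [Fintype m] [Fintype l] [Fintype m'] [Fintype l'] [DecidableEq m]
    [DecidableEq m'] [DecidableEq l] [DecidableEq l'] (N : Matrix l m ℂ) (N' : Matrix l' m' R) :
    tens (1 : R) (N ⊗ₖ (1 : Matrix l' l' ℂ)) * ((1 : Matrix m m R) ⊗ₖ N') =
      ((1 : Matrix l l R) ⊗ₖ N') * tens (1 : R) (N ⊗ₖ (1 : Matrix m' m' ℂ)) := by
  rw [← tens_kronecker_one, ← tens_kronecker_one]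
  exact kronecker_comm_of_commute _ _ fun i k i' k' => by simp [tens]

theorem one_kronecker_mul_tens {p : Type*} [Fintype m] [Fintype l] [Fintype m'] [Fintype l']
    [DecidableEq m] [DecidableEq m'] [DecidableEq l] [DecidableEq l'] (N : Matrix l m ℂ)
    (N' : Matrix l' m' R) (M : Matrix (m × m') p R) :
    ((1 : Matrix l l R) ⊗ₖ N') * (tens (1 : R) (N ⊗ₖ (1 : Matrix m' m' ℂ)) * M) =
      tens (1 : R) (N ⊗ₖ (1 : Matrix l' l' ℂ)) * (((1 : Matrix m m R) ⊗ₖ N') * M) := by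
  rw [← Matrix.mul_assoc, ← tens_one_kronecker_comm, Matrix.mul_assoc]

theorem kronecker_tens_one_comm [Fintype m] [Fintype l] [Fintype m'] [Fintype l'] [DecidableEq m]
    [DecidableEq m'] [DecidableEq l] [DecidableEq l'] (N : Matrix l m R) (N' : Matrix l' m' ℂ) :
    (N ⊗ₖ (1 : Matrix l' l' R)) * tens (1 : R) ((1 : Matrix m m ℂ) ⊗ₖ N') =
      tens (1 : R) ((1 : Matrix l l ℂ) ⊗ₖ N') * (N ⊗ₖ (1 : Matrix m' m' R)) := by
  rw [← one_kronecker_tens, ← one_kronecker_tens]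
  exact kronecker_comm_of_commute _ _ fun i k i' k' => by simp [tens]

theorem tens_comm_one [Fintype m] [DecidableEq m] [Fintype l] [DecidableEq l] (x : R)
    (N : Matrix l m ℂ) : tens x (1 : Matrix l l ℂ) * tens (1 : R) N =
      tens (1 : R) N * tens x (1 : Matrix m m ℂ) := by
  rw [tens_mul_tens, tens_mul_tens, mul_one, one_mul, Matrix.one_mul, Matrix.mul_one]

end Kron

/-! ### RTT relations between arbitrary spins, and the colours. -/

section RTTh

variable {R : Type*} [Ring R] [Algebra ℂ R] {h : ℂ} {A B C E : R}
  {T : (n : ℕ) → Matrix (Fin (n + 1)) (Fin (n + 1)) R}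

local notation "𝕀[" m "]" => (1 : Matrix (Fin (m + 1)) (Fin (m + 1)) R)
local notation "𝕁[" m "]" => (1 : Matrix (Fin (m + 1)) (Fin (m + 1)) ℂ)

theorem ext_of_tens_mul_kron {l : Type*} {n n' : ℕ}
    {M M' : Matrix l (Fin (n + 1 + 1) × Fin (n' + 1)) R}
    (hx : M * tens (1 : R) (mulX h n ⊗ₖ 𝕁[n']) = M' * tens (1 : R) (mulX h n ⊗ₖ 𝕁[n']))
    (hy : M * tens (1 : R) (mulY h n ⊗ₖ 𝕁[n']) = M' * tens (1 : R) (mulY h n ⊗ₖ 𝕁[n'])) :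
    M = M' := by
  obtain ⟨s, t, hst⟩ := exists_mul_sect h n
  have h1 : (mulX h n ⊗ₖ 𝕁[n']) * (s ⊗ₖ 𝕁[n']) + (mulY h n ⊗ₖ 𝕁[n']) * (t ⊗ₖ 𝕁[n']) = 1 := by
    rw [kron_mul, kron_mul, Matrix.one_mul, ← Matrix.add_kronecker, hst, Matrix.one_kronecker_one]
  rw [← Matrix.mul_one M, ← Matrix.mul_one M', ← tens_one_one, ← h1, tens_add_right,
    ← one_mul (1 : R), ← tens_mul_tens, ← tens_mul_tens, Matrix.mul_add, Matrix.mul_add,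
    ← Matrix.mul_assoc, ← Matrix.mul_assoc, ← Matrix.mul_assoc, ← Matrix.mul_assoc, hx, hy]

/-- The `RTT` relations between two members of a fusion family. -/
theorem IsFusion.rtt (hT : IsFusion h A B C E T) (hS : IsSLh h A B C E) (n n' : ℕ) :
    tens (1 : R) (RhMat h n n') * ((T n ⊗ₖ 𝕀[n']) * (𝕀[n] ⊗ₖ T n')) =
      (𝕀[n] ⊗ₖ T n') * ((T n ⊗ₖ 𝕀[n']) * tens (1 : R) (RhMat h n n')) := by
  induction n with
  | zero => rw [RhMat_zero, tens_one_one, hT.zero]; simp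
  | succ n ih =>
    -- The first factor is fused from spin n/2 and spin 1/2. The induction hypothesis exchanges the
    -- spin-n/2 part with `T n'`, and these relations exchange the spin-1/2 part.
    obtain ⟨h1, h2, h3, h4⟩ := hT.rtt_one hS n'
    have kx : (T (n + 1) ⊗ₖ 𝕀[n']) * tens (1 : R) (mulX h n ⊗ₖ 𝕁[n']) =
        tens (1 : R) (mulX h n ⊗ₖ 𝕁[n']) * ((T n ⊗ₖ 𝕀[n']) * tens A 1) +
        tens (1 : R) (mulY h n ⊗ₖ 𝕁[n']) * ((T n ⊗ₖ 𝕀[n']) * tens C 1) := by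
      rw [← Matrix.one_kronecker_one, ← tens_kronecker_one, ← tens_kronecker_one,
        ← tens_kronecker_one, ← tens_kronecker_one, kronecker_one_mul, hT.mul_x,
        Matrix.add_kronecker]
      simp only [kronecker_one_mul]
    have ky : (T (n + 1) ⊗ₖ 𝕀[n']) * tens (1 : R) (mulY h n ⊗ₖ 𝕁[n']) =
        tens (1 : R) (mulX h n ⊗ₖ 𝕁[n']) * ((T n ⊗ₖ 𝕀[n']) * tens B 1) +
        tens (1 : R) (mulY h n ⊗ₖ 𝕁[n']) * ((T n ⊗ₖ 𝕀[n']) * tens E 1) := by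
      rw [← Matrix.one_kronecker_one, ← tens_kronecker_one, ← tens_kronecker_one,
        ← tens_kronecker_one, ← tens_kronecker_one, kronecker_one_mul, hT.mul_y,
        Matrix.add_kronecker]
      simp only [kronecker_one_mul]
    have rx : tens (1 : R) (RhMat h (n + 1) n') * tens (1 : R) (mulX h n ⊗ₖ 𝕁[n']) =
        tens (1 : R) (mulX h n ⊗ₖ 𝕁[n']) * (tens (1 : R) (RhMat h n n') * tens (1 : R) (𝕁[n] ⊗ₖ Tmat h n')) := by
      simp only [tens_mul_tens, RhMat_mul_mulX, mul_one]
    have ry : tens (1 : R) (RhMat h (n + 1) n') * tens (1 : R) (mulY h n ⊗ₖ 𝕁[n']) =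
        tens (1 : R) (mulY h n ⊗ₖ 𝕁[n']) * (tens (1 : R) (RhMat h n n') * tens (1 : R) (𝕁[n] ⊗ₖ TinvMat h n')) -
        h • (tens (1 : R) (mulX h n ⊗ₖ 𝕁[n']) *
          (tens (1 : R) (RhMat h n n') * tens (1 : R) (𝕁[n] ⊗ₖ Lmat h n'))) := by
      simp only [tens_mul_tens, RhMat_mul_mulY, mul_one, tens_sub_right, tens_smul_right]
    -- The complex matrix acts on the second factor and `T n` on the first, so they commute; N then
    -- meets the second `T` together with the coefficient x.
    have tk (x : R) (N : Matrix (Fin (n' + 1)) (Fin (n' + 1)) ℂ) (M : Matrix _ (Fin (n' + 1)) R) :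
        tens (1 : R) (𝕁[n] ⊗ₖ N) * ((T n ⊗ₖ 𝕀[n']) * (tens x 1 * (𝕀[n] ⊗ₖ M))) =
        (T n ⊗ₖ 𝕀[n']) * (𝕀[n] ⊗ₖ (tens x N * M)) := by
      rw [← Matrix.mul_assoc, ← kronecker_tens_one_comm, Matrix.mul_assoc,
        ← Matrix.mul_assoc (tens (1 : R) _), tens_mul_tens, Matrix.mul_one, one_mul, ← one_kronecker_tens,
        one_kronecker_mul]
    have hc (x : R) (N : Matrix (Fin (n' + 1)) (Fin (n' + 1)) ℂ) :
        tens (1 : R) (RhMat h n n') * ((T n ⊗ₖ 𝕀[n']) * (𝕀[n] ⊗ₖ (T n' * tens x N))) =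
        (𝕀[n] ⊗ₖ T n') * ((T n ⊗ₖ 𝕀[n']) * (tens (1 : R) (RhMat h n n') * tens x (𝕁[n] ⊗ₖ N))) := by
      rw [← one_kronecker_mul, ← Matrix.mul_assoc (T n ⊗ₖ 𝕀[n']), ← Matrix.mul_assoc, ih,
        one_kronecker_tens]
      simp only [Matrix.mul_assoc]
    have dx (x : R) (N : Matrix (Fin (n' + 1)) (Fin (n' + 1)) ℂ) :
        tens x 1 * (tens (1 : R) (RhMat h n n') * tens (1 : R) (𝕁[n] ⊗ₖ N)) =
        tens (1 : R) (RhMat h n n') * tens x (𝕁[n] ⊗ₖ N) := by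
      simp only [tens_mul_tens, one_mul, mul_one]
    have kx' := matrix_mul_congr_left (p := Fin (n + 1) × Fin (n' + 1)) kx
    have ky' := matrix_mul_congr_left (p := Fin (n + 1) × Fin (n' + 1)) ky
    have rx' := matrix_mul_congr_left (p := Fin (n + 1) × Fin (n' + 1)) rx
    have ry' := matrix_mul_congr_left (p := Fin (n + 1) × Fin (n' + 1)) ry
    simp only [Matrix.mul_assoc, Matrix.add_mul, Matrix.sub_mul, Matrix.smul_mul] at kx' ky' rx' ry'
    rw [sub_mul, sub_eq_iff_eq_add, smul_mul_assoc] at h1 h2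
    rw [mul_sub, mul_smul_comm] at h2 h4
    have ka (M M' : Matrix (Fin (n' + 1)) (Fin (n' + 1)) R) :
        𝕀[n] ⊗ₖ (M + M') = 𝕀[n] ⊗ₖ M + 𝕀[n] ⊗ₖ M' := by
      ext; simp [Matrix.kroneckerMap_apply, mul_add]
    have kb (M M' : Matrix (Fin (n' + 1)) (Fin (n' + 1)) R) :
        𝕀[n] ⊗ₖ (M - M') = 𝕀[n] ⊗ₖ M - 𝕀[n] ⊗ₖ M' := by
      ext; simp [Matrix.kroneckerMap_apply, mul_sub]
    have ks (M : Matrix (Fin (n' + 1)) (Fin (n' + 1)) R) :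
        𝕀[n] ⊗ₖ (h • M) = h • (𝕀[n] ⊗ₖ M) := by
      ext; simp [Matrix.kroneckerMap_apply]
    refine ext_of_tens_mul_kron (h := h) ?_ ?_ <;>
    · simp only [Matrix.mul_assoc, ← tens_one_kronecker_comm, kx', ky', rx, ry, Matrix.mul_add,
        Matrix.mul_sub, Matrix.mul_smul]
      simp only [rx', ry', tk, h1, h2, h3, h4, ka, kb, ks, dx, one_kronecker_mul_tens, Matrix.mul_add, Matrix.mul_sub,
        Matrix.mul_smul, hc]
      module

/-- `exp (s X)`. -/
noncomputable def expX (h : ℂ) (n : ℕ) (s : ℂ) : Matrix (Fin (n + 1)) (Fin (n + 1)) ℂ :=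
  NormedSpace.exp (s • Xmat h n)

theorem expX_add (n : ℕ) (s t : ℂ) : expX h n (s + t) = expX h n s * expX h n t := by
  rw [expX, add_smul, Matrix.exp_add_of_commute]
  · rfl
  · exact ((Commute.refl (Xmat h n)).smul_left s).smul_right t

theorem expX_zero_left (s : ℂ) : expX h 0 s = 1 := by
  rw [expX, Xmat_zero, smul_zero, NormedSpace.exp_zero]

theorem expX_mul_mulX (n : ℕ) (s : ℂ) : expX h (n + 1) s * mulX h n = mulX h n * expX h n s :=
  exp_Xmat_mul_mulX h s n

theorem expX_mul_mulY (n : ℕ) (s : ℂ) :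
    expX h (n + 1) s * mulY h n = (mulY h n + s • mulX h n) * expX h n s :=
  exp_Xmat_mul_mulY h s n

/-- The central element acts by scalars, so the exponent is a sum of two commuting terms, one in
each factor. -/
theorem twistInv_eq (α : ℂ) (n : ℕ) (z : ℂ) (n' : ℕ) (z' : ℂ) :
    twistInv h α n z n' z' = expX h n (-(h * α * z')) ⊗ₖ expX h n' (h * α * z) := by
  have h1 : -(α * h) • (Xmat h n ⊗ₖ (z' • 𝕁[n']) - (z • 𝕁[n]) ⊗ₖ Xmat h n') =
      ((-(h * α * z')) • Xmat h n) ⊗ₖ 𝕁[n'] + 𝕁[n] ⊗ₖ ((h * α * z) • Xmat h n') := by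
    simp only [Matrix.kronecker_smul, Matrix.smul_kronecker]
    module
  rw [twistInv, h1, Matrix.exp_add_of_commute, exp_kronecker_one, exp_one_kronecker, kron_mul,
    Matrix.mul_one, Matrix.one_mul]
  · rfl
  · rw [Commute, SemiconjBy, kron_mul, kron_mul]
    simp

/-- The tensor square of exp(sX) is the exponential of s times the coproduct of X, with which R_h
commutes. -/
theorem RhMat_mul_expX (n n' : ℕ) (s : ℂ) : RhMat h n n' * (expX h n s ⊗ₖ expX h n' s) =
    (expX h n s ⊗ₖ expX h n' s) * RhMat h n n' := by
  have h1 : expX h n s ⊗ₖ expX h n' s = NormedSpace.exp (s • coprodX h n n') := by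
    rw [coprodX, smul_add, Matrix.exp_add_of_commute, ← Matrix.smul_kronecker, exp_kronecker_one,
      ← Matrix.kronecker_smul, exp_one_kronecker, kron_mul, Matrix.mul_one, Matrix.one_mul]
    · rfl
    · refine Commute.smul_left (Commute.smul_right ?_ s) s
      rw [Commute, SemiconjBy, kron_mul, kron_mul]
      simp
  rw [h1]
  refine (exp_mul_of_intertwine ?_).symm
  rw [Matrix.smul_mul, Matrix.mul_smul, RhMat_mul_coprodX]

/-- The powers of the determinant and the conditions on them for a coloured fusion family. -/
structure IsDetPow (h α : ℂ) (A B C E : R) (D : ℂ → R) : Prop where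
  add (w w' : ℂ) : D (w + w') = D w * D w'
  A_mul (w : ℂ) : A * D w = D w * (A + (2 * h * α * w) • C)
  B_mul (w : ℂ) : B * D w = D w * (B + (2 * h * α * w) • (E - A) - ((2 * h * α * w) ^ 2) • C)
  C_mul (w : ℂ) : C * D w = D w * C
  E_mul (w : ℂ) : E * D w = D w * (E - (2 * h * α * w) • C)

variable {α : ℂ} {D : ℂ → R}

/-- Conjugation by D^w acts on the spin-1/2 matrix as conjugation by the unipotent matrix
exp(2hαwX), and fusion carries this to every spin. -/
theorem IsFusion.mul_detPow (hT : IsFusion h A B C E T) (hD : IsDetPow h α A B C E D) (n : ℕ)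
    (w : ℂ) : T n * tens (D w) 1 = tens (D w) (expX h n (2 * h * α * w)) *
      (T n * tens 1 (expX h n (-(2 * h * α * w)))) := by
  induction n with
  | zero =>
    rw [hT.zero, Matrix.one_mul, Matrix.one_mul, tens_mul_tens, expX_zero_left, expX_zero_left,
      mul_one, Matrix.one_mul]
  | succ n ih =>
    set s := 2 * h * α * w with hs
    have ih' (x : R) : T n * tens (D w * x) 1 = tens (D w) (expX h n s) *
        (T n * tens x (expX h n (-s))) := by
      rw [← Matrix.mul_one (1 : Matrix (Fin (n + 1)) (Fin (n + 1)) ℂ), ← tens_mul_tens,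
        ← Matrix.mul_assoc, ih, Matrix.mul_assoc, Matrix.mul_assoc, tens_mul_tens, one_mul,
        Matrix.mul_one]
    have fx := matrix_mul_congr_left (p := Fin (n + 1)) (hT.mul_x n)
    have fy := matrix_mul_congr_left (p := Fin (n + 1)) (hT.mul_y n)
    simp only [Matrix.mul_assoc, Matrix.add_mul] at fx fy
    have c1 (x : R) (N : Matrix (Fin (n + 1 + 1)) (Fin (n + 1)) ℂ) :
        tens x (1 : Matrix (Fin (n + 1 + 1)) (Fin (n + 1 + 1)) ℂ) * tens (1 : R) N =
        tens (1 : R) N * tens x (1 : Matrix (Fin (n + 1)) (Fin (n + 1)) ℂ) := tens_comm_one x N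
    have d1 : tens (1 : R) (expX h (n + 1) (-s)) * tens (1 : R) (mulX h n) =
        tens (1 : R) (mulX h n) * tens (1 : R) (expX h n (-s)) := by
      rw [tens_mul_tens, tens_mul_tens, expX_mul_mulX]
    have d2 : tens (1 : R) (expX h (n + 1) (-s)) * tens (1 : R) (mulY h n) =
        tens (1 : R) (mulY h n) * tens (1 : R) (expX h n (-s)) -
        s • (tens (1 : R) (mulX h n) * tens (1 : R) (expX h n (-s))) := by
      rw [tens_mul_tens, tens_mul_tens, tens_mul_tens, expX_mul_mulY, Matrix.add_mul,
        Matrix.smul_mul, tens_add_right, tens_smul_right, mul_one]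
      module
    have g1 (M : Matrix (Fin (n + 1)) (Fin (n + 1)) R) :
        tens (D w) (expX h (n + 1) s) * (tens (1 : R) (mulX h n) * M) =
        tens (1 : R) (mulX h n) * (tens (D w) (expX h n s) * M) := by
      rw [tens_mul_tens_assoc, tens_mul_tens_assoc, expX_mul_mulX, one_mul, mul_one]
    have g2 (M : Matrix (Fin (n + 1)) (Fin (n + 1)) R) :
        tens (D w) (expX h (n + 1) s) * (tens (1 : R) (mulY h n) * M) =
        tens (1 : R) (mulY h n) * (tens (D w) (expX h n s) * M) +
        s • (tens (1 : R) (mulX h n) * (tens (D w) (expX h n s) * M)) := by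
      rw [tens_mul_tens_assoc, tens_mul_tens_assoc, tens_mul_tens_assoc, expX_mul_mulY, one_mul,
        mul_one, Matrix.add_mul, Matrix.smul_mul, tens_add_right, tens_smul_right, Matrix.add_mul,
        Matrix.smul_mul]
    have f (x y : R) : tens x 1 * tens y (1 : Matrix (Fin (n + 1)) (Fin (n + 1)) ℂ) =
        tens (x * y) 1 := by rw [tens_mul_tens, Matrix.one_mul]
    have f' (x : R) (N : Matrix (Fin (n + 1)) (Fin (n + 1)) ℂ) : tens x 1 * tens (1 : R) N =
        tens x N := by rw [tens_mul_tens, Matrix.one_mul, mul_one]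
    refine ext_of_tens_mul h ?_ ?_ <;>
    · rw [Matrix.mul_assoc, c1]
      simp only [Matrix.mul_assoc, fx, fy, d1, d2, g1, g2, f, f', hD.A_mul, hD.B_mul, hD.C_mul,
        hD.E_mul, ih', ← hs, Matrix.mul_add, Matrix.mul_sub, Matrix.mul_smul, smul_add, smul_sub,
        tens_add_left, tens_sub_left, tens_smul_left]
      module

/-- The coloured matrices built from a fusion family. -/
noncomputable def colT (h α : ℂ) (D : ℂ → R) (T : (n : ℕ) → Matrix (Fin (n + 1)) (Fin (n + 1)) R)
    (n : ℕ) (z : ℂ) : Matrix (Fin (n + 1)) (Fin (n + 1)) R :=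
  tens (D z) (expX h n (h * α * z)) * (T n * tens 1 (expX h n (-(h * α * z))))

theorem IsFusion.mul_tens_detPow (hT : IsFusion h A B C E T) (hD : IsDetPow h α A B C E D) (n : ℕ)
    (w s : ℂ) : T n * tens (D w) (expX h n s) = tens (D w) (expX h n (2 * h * α * w)) *
      (T n * tens 1 (expX h n (s - 2 * h * α * w))) := by
  have h1 : tens (D w) (expX h n s) = tens (D w) 1 * tens (1 : R) (expX h n s) := by
    rw [tens_mul_tens, Matrix.one_mul, mul_one]
  rw [h1, ← Matrix.mul_assoc, hT.mul_detPow hD, Matrix.mul_assoc, Matrix.mul_assoc, tens_mul_tens,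
    mul_one, ← expX_add, neg_add_eq_sub]

/-- Collecting the determinants on the left moves D^z' through the first `T`, which adds 2hαz' to
the exponent in the first factor. In the opposite product the second factor acquires 2hαz instead;
the twist has to account for this asymmetry. -/
theorem IsFusion.colT_kronecker (hT : IsFusion h A B C E T) (hD : IsDetPow h α A B C E D)
    (n n' : ℕ) (z z' : ℂ) :
    (colT h α D T n z ⊗ₖ 𝕀[n']) * (𝕀[n] ⊗ₖ colT h α D T n' z') =
      tens (D (z + z')) (expX h n (h * α * z + 2 * (h * α * z')) ⊗ₖ expX h n' (h * α * z')) *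
      (((T n ⊗ₖ 𝕀[n']) * (𝕀[n] ⊗ₖ T n')) *
        tens 1 (expX h n (-(h * α * z + 2 * (h * α * z'))) ⊗ₖ expX h n' (-(h * α * z')))) := by
  have h0 : tens (1 : R) (expX h n (-(h * α * z)) ⊗ₖ 𝕁[n']) *
      tens (D z') (𝕁[n] ⊗ₖ expX h n' (h * α * z')) =
      tens (D z') (expX h n (-(h * α * z)) ⊗ₖ 𝕁[n']) *
        tens (1 : R) (𝕁[n] ⊗ₖ expX h n' (h * α * z')) := by
    simp only [tens_mul_tens, kron_mul, Matrix.one_mul, Matrix.mul_one, mul_one, one_mul]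
  have h1 : (T n ⊗ₖ 𝕀[n']) * tens (D z') (expX h n (-(h * α * z)) ⊗ₖ 𝕁[n']) =
      tens (D z') (expX h n (2 * h * α * z') ⊗ₖ 𝕁[n']) * ((T n ⊗ₖ 𝕀[n']) *
        tens (1 : R) (expX h n (-(h * α * z + 2 * (h * α * z'))) ⊗ₖ 𝕁[n'])) := by
    rw [← tens_kronecker_one, kronecker_one_mul, hT.mul_tens_detPow hD, ← kronecker_one_mul,
      ← kronecker_one_mul, tens_kronecker_one, tens_kronecker_one]
    congr 6
    ring
  have h2 : tens (1 : R) (expX h n (-(h * α * z + 2 * (h * α * z'))) ⊗ₖ 𝕁[n']) *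
      (tens (1 : R) (𝕁[n] ⊗ₖ expX h n' (h * α * z')) * ((𝕀[n] ⊗ₖ T n') *
        tens (1 : R) (𝕁[n] ⊗ₖ expX h n' (-(h * α * z'))))) =
      tens (1 : R) (𝕁[n] ⊗ₖ expX h n' (h * α * z')) * ((𝕀[n] ⊗ₖ T n') *
        tens (1 : R) (expX h n (-(h * α * z + 2 * (h * α * z'))) ⊗ₖ expX h n' (-(h * α * z')))) := by
    have e1 : tens (1 : R) (expX h n (-(h * α * z + 2 * (h * α * z'))) ⊗ₖ expX h n' (-(h * α * z')))
        = tens (1 : R) (expX h n (-(h * α * z + 2 * (h * α * z'))) ⊗ₖ 𝕁[n']) *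
          tens (1 : R) (𝕁[n] ⊗ₖ expX h n' (-(h * α * z'))) := by
      simp only [tens_mul_tens, kron_mul, Matrix.one_mul, mul_one]
    rw [e1, ← Matrix.mul_assoc (𝕀[n] ⊗ₖ T n'), ← tens_one_kronecker_comm]
    simp only [← Matrix.mul_assoc, tens_mul_tens, kron_mul, Matrix.one_mul, mul_one]
  rw [colT, colT, ← kronecker_one_mul, ← kronecker_one_mul, ← one_kronecker_mul,
    ← one_kronecker_mul, tens_kronecker_one, tens_kronecker_one, one_kronecker_tens,
    one_kronecker_tens, Matrix.mul_assoc, Matrix.mul_assoc,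
    ← Matrix.mul_assoc (tens (1 : R) (expX h n (-(h * α * z)) ⊗ₖ 𝕁[n'])), h0,
    Matrix.mul_assoc (tens (D z') _), ← Matrix.mul_assoc (T n ⊗ₖ 𝕀[n']), h1,
    Matrix.mul_assoc (tens (D z') _), Matrix.mul_assoc (T n ⊗ₖ 𝕀[n']), h2,
    ← Matrix.mul_assoc (T n ⊗ₖ 𝕀[n']), kronecker_tens_one_comm, Matrix.mul_assoc (tens (1 : R) _),
    ← Matrix.mul_assoc (tens (D z') _), ← Matrix.mul_assoc (tens (D z) _), tens_mul_tens,
    tens_mul_tens, kron_mul, kron_mul, Matrix.mul_one, Matrix.one_mul, Matrix.one_mul, mul_one,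
    ← hD.add, ← expX_add, Matrix.mul_assoc]
  simp only [mul_assoc]

theorem IsFusion.kronecker_colT (hT : IsFusion h A B C E T) (hD : IsDetPow h α A B C E D)
    (n n' : ℕ) (z z' : ℂ) :
    (𝕀[n] ⊗ₖ colT h α D T n' z') * (colT h α D T n z ⊗ₖ 𝕀[n']) =
      tens (D (z + z')) (expX h n (h * α * z) ⊗ₖ expX h n' (h * α * z' + 2 * (h * α * z))) *
      (((𝕀[n] ⊗ₖ T n') * (T n ⊗ₖ 𝕀[n'])) *
        tens 1 (expX h n (-(h * α * z)) ⊗ₖ expX h n' (-(h * α * z' + 2 * (h * α * z))))) := by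
  have h0 : tens (1 : R) (𝕁[n] ⊗ₖ expX h n' (-(h * α * z'))) *
      tens (D z) (expX h n (h * α * z) ⊗ₖ 𝕁[n']) =
      tens (D z) (𝕁[n] ⊗ₖ expX h n' (-(h * α * z'))) *
        tens (1 : R) (expX h n (h * α * z) ⊗ₖ 𝕁[n']) := by
    simp only [tens_mul_tens, kron_mul, Matrix.one_mul, Matrix.mul_one, mul_one, one_mul]
  have h1 : (𝕀[n] ⊗ₖ T n') * tens (D z) (𝕁[n] ⊗ₖ expX h n' (-(h * α * z'))) =
      tens (D z) (𝕁[n] ⊗ₖ expX h n' (2 * h * α * z)) * ((𝕀[n] ⊗ₖ T n') *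
        tens (1 : R) (𝕁[n] ⊗ₖ expX h n' (-(h * α * z' + 2 * (h * α * z))))) := by
    rw [← one_kronecker_tens, one_kronecker_mul, hT.mul_tens_detPow hD, ← one_kronecker_mul,
      ← one_kronecker_mul, one_kronecker_tens, one_kronecker_tens]
    congr 6
    ring
  have h2 : tens (1 : R) (𝕁[n] ⊗ₖ expX h n' (-(h * α * z' + 2 * (h * α * z)))) *
      (tens (1 : R) (expX h n (h * α * z) ⊗ₖ 𝕁[n']) * ((T n ⊗ₖ 𝕀[n']) *
        tens (1 : R) (expX h n (-(h * α * z)) ⊗ₖ 𝕁[n']))) =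
      tens (1 : R) (expX h n (h * α * z) ⊗ₖ 𝕁[n']) * ((T n ⊗ₖ 𝕀[n']) *
        tens (1 : R) (expX h n (-(h * α * z)) ⊗ₖ expX h n' (-(h * α * z' + 2 * (h * α * z))))) := by
    have e1 : tens (1 : R) (expX h n (-(h * α * z)) ⊗ₖ expX h n' (-(h * α * z' + 2 * (h * α * z))))
        = tens (1 : R) (𝕁[n] ⊗ₖ expX h n' (-(h * α * z' + 2 * (h * α * z)))) *
          tens (1 : R) (expX h n (-(h * α * z)) ⊗ₖ 𝕁[n']) := by
      simp only [tens_mul_tens, kron_mul, Matrix.one_mul, mul_one]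
    rw [e1, ← Matrix.mul_assoc (T n ⊗ₖ 𝕀[n']), kronecker_tens_one_comm]
    simp only [← Matrix.mul_assoc, tens_mul_tens, kron_mul, Matrix.one_mul, mul_one]
  rw [colT, colT, ← kronecker_one_mul, ← kronecker_one_mul, ← one_kronecker_mul,
    ← one_kronecker_mul, tens_kronecker_one, tens_kronecker_one, one_kronecker_tens,
    one_kronecker_tens, Matrix.mul_assoc, Matrix.mul_assoc,
    ← Matrix.mul_assoc (tens (1 : R) (𝕁[n] ⊗ₖ expX h n' (-(h * α * z')))), h0,
    Matrix.mul_assoc (tens (D z) _), ← Matrix.mul_assoc (𝕀[n] ⊗ₖ T n'), h1,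
    Matrix.mul_assoc (tens (D z) _), Matrix.mul_assoc (𝕀[n] ⊗ₖ T n'), h2,
    ← Matrix.mul_assoc (𝕀[n] ⊗ₖ T n'), ← tens_one_kronecker_comm, Matrix.mul_assoc (tens (1 : R) _),
    ← Matrix.mul_assoc (tens (D z) _), ← Matrix.mul_assoc (tens (D z') _), tens_mul_tens,
    tens_mul_tens, kron_mul, kron_mul, Matrix.mul_one, Matrix.one_mul, Matrix.one_mul, mul_one,
    ← hD.add, ← expX_add, Matrix.mul_assoc, add_comm z']
  simp only [mul_assoc]

/-- Write s = hαz, s' = hαz'. The inner twist turns exp((s + 2s')X) ⊗ exp(s'X) into exp((s + s')X) ⊗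
exp((s + s')X), which passes through R_h; the outer twist then gives exp(sX) ⊗ exp((s' + 2s)X), the
factor of the opposite product. The right-hand exponentials behave in the same way, and the
uncoloured relation remains. -/
theorem IsFusion.rtt_coloured (hT : IsFusion h A B C E T) (hS : IsSLh h A B C E)
    (hD : IsDetPow h α A B C E D) (n n' : ℕ) (z z' : ℂ) :
    RTT (Rmat h α n z n' z') (colT h α D T n z) (colT h α D T n' z') := by
  rw [RTT, ← tens_one_eq_map, Matrix.mul_assoc, hT.colT_kronecker hD, hT.kronecker_colT hD]
  have l1 : tens (1 : R) (Rmat h α n z n' z') *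
      tens (D (z + z')) (expX h n (h * α * z + 2 * (h * α * z')) ⊗ₖ expX h n' (h * α * z')) =
      tens (D (z + z')) (expX h n (h * α * z) ⊗ₖ expX h n' (h * α * z' + 2 * (h * α * z))) *
        tens 1 (RhMat h n n') := by
    rw [Rmat, tens_mul_tens, tens_mul_tens, one_mul, mul_one, twistInv_eq, Matrix.mul_assoc, kron_mul,
      ← expX_add, ← expX_add]
    have : -(h * α * z') + (h * α * z + 2 * (h * α * z')) = h * α * z + h * α * z' := by ring
    rw [this, Matrix.mul_assoc, RhMat_mul_expX, ← Matrix.mul_assoc, kron_mul, ← expX_add,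
      ← expX_add]
    congr 4 <;> ring
  have l2 : tens (1 : R) (expX h n (-(h * α * z)) ⊗ₖ expX h n' (-(h * α * z' + 2 * (h * α * z)))) *
      tens 1 (Rmat h α n z n' z') =
      tens 1 (RhMat h n n') *
      tens 1 (expX h n (-(h * α * z + 2 * (h * α * z'))) ⊗ₖ expX h n' (-(h * α * z'))) := by
    rw [Rmat, tens_mul_tens, tens_mul_tens, twistInv_eq, ← Matrix.mul_assoc, ← Matrix.mul_assoc, kron_mul,
      ← expX_add, ← expX_add]
    have e1 : -(h * α * z) + -(h * α * z') = -(h * α * z + h * α * z') := by ring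
    have e2 : -(h * α * z' + 2 * (h * α * z)) + h * α * z = -(h * α * z + h * α * z') := by ring
    rw [e1, e2, ← RhMat_mul_expX, Matrix.mul_assoc, kron_mul, ← expX_add, ← expX_add]
    congr 4 <;> ring
  have hR := matrix_mul_congr_left (p := Fin (n + 1) × Fin (n' + 1)) (hT.rtt hS n n')
  simp only [Matrix.mul_assoc] at hR
  rw [← Matrix.mul_assoc, l1]
  simp only [Matrix.mul_assoc, l2, hR]

end RTTh

end Jordanian

namespace Jordanian

/-! ### Relations of the standard quantum group in the new generators -/

section QRelations

variable {h q α : ℂ}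

namespace FunQ

variable (q α)

abbrev a : FunQ q α := gen q α QGen.a
abbrev b : FunQ q α := gen q α QGen.b
abbrev c : FunQ q α := gen q α QGen.c
abbrev d : FunQ q α := gen q α QGen.d
abbrev D (w : ℂ) : FunQ q α := gen q α (QGen.D w)

theorem mkAlgHom_gen (g : QGen) :
    RingQuot.mkAlgHom ℂ (QRel q α) (FreeAlgebra.ι ℂ g) = gen q α g := rfl

theorem ab : a q α * b q α = (q⁻¹ * q ^ (-α)) • (b q α * a q α) := by
  simpa [mkAlgHom_gen] using RingQuot.mkAlgHom_rel ℂ (QRel.ab (q := q) (α := α))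

theorem ac : a q α * c q α = (q⁻¹ * q ^ α) • (c q α * a q α) := by
  simpa [mkAlgHom_gen] using RingQuot.mkAlgHom_rel ℂ (QRel.ac (q := q) (α := α))

theorem bd : b q α * d q α = (q⁻¹ * q ^ α) • (d q α * b q α) := by
  simpa [mkAlgHom_gen] using RingQuot.mkAlgHom_rel ℂ (QRel.bd (q := q) (α := α))

theorem cd : c q α * d q α = (q⁻¹ * q ^ (-α)) • (d q α * c q α) := by
  simpa [mkAlgHom_gen] using RingQuot.mkAlgHom_rel ℂ (QRel.cd (q := q) (α := α))

theorem ad : a q α * d q α - d q α * a q α = ((q⁻¹ - q) * q ^ (-α)) • (b q α * c q α) := by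
  simpa [mkAlgHom_gen] using RingQuot.mkAlgHom_rel ℂ (QRel.ad (q := q) (α := α))

theorem bc : q ^ (-α) • (b q α * c q α) = q ^ α • (c q α * b q α) := by
  simpa [mkAlgHom_gen] using RingQuot.mkAlgHom_rel ℂ (QRel.bc (q := q) (α := α))

theorem det : D q α 1 = a q α * d q α - (q⁻¹ * q ^ (-α)) • (b q α * c q α) := by
  simpa [mkAlgHom_gen] using RingQuot.mkAlgHom_rel ℂ (QRel.det (q := q) (α := α))

theorem D_zero : D q α 0 = 1 := by
  simpa [mkAlgHom_gen] using RingQuot.mkAlgHom_rel ℂ (QRel.D_zero (q := q) (α := α))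

theorem D_add (w w' : ℂ) : D q α (w + w') = D q α w * D q α w' := by
  simpa [mkAlgHom_gen] using RingQuot.mkAlgHom_rel ℂ (QRel.D_add (q := q) (α := α) w w')

theorem a_D (w : ℂ) : a q α * D q α w = D q α w * a q α := by
  simpa [mkAlgHom_gen] using RingQuot.mkAlgHom_rel ℂ (QRel.a_D (q := q) (α := α) w)

theorem b_D (w : ℂ) : b q α * D q α w = q ^ (2 * α * w) • (D q α w * b q α) := by
  simpa [mkAlgHom_gen] using RingQuot.mkAlgHom_rel ℂ (QRel.b_D (q := q) (α := α) w)

theorem c_D (w : ℂ) : c q α * D q α w = q ^ (-(2 * α * w)) • (D q α w * c q α) := by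
  simpa [mkAlgHom_gen] using RingQuot.mkAlgHom_rel ℂ (QRel.c_D (q := q) (α := α) w)

theorem d_D (w : ℂ) : d q α * D q α w = D q α w * d q α := by
  simpa [mkAlgHom_gen] using RingQuot.mkAlgHom_rel ℂ (QRel.d_D (q := q) (α := α) w)

variable {q}

theorem dc (hq : q ≠ 0) : d q α * c q α = (q * q ^ α) • (c q α * d q α) := by
  rw [cd, smul_smul, Complex.cpow_neg]
  have := Complex.cpow_ne_zero_iff (x := q) (y := α) |>.2 (Or.inl hq)
  field_simp
  rw [one_smul]

theorem ba (hq : q ≠ 0) : b q α * a q α = (q * q ^ α) • (a q α * b q α) := by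
  rw [ab, smul_smul, Complex.cpow_neg]
  have := Complex.cpow_ne_zero_iff (x := q) (y := α) |>.2 (Or.inl hq)
  field_simp
  rw [one_smul]

theorem bc_eq (hq : q ≠ 0) : b q α * c q α = (q ^ α * q ^ α) • (c q α * b q α) := by
  have := Complex.cpow_ne_zero_iff (x := q) (y := α) |>.2 (Or.inl hq)
  rw [mul_smul, ← bc, smul_smul, Complex.cpow_neg, mul_inv_cancel₀ this, one_smul]

theorem ad_eq (hq : q ≠ 0) : a q α * d q α = D q α 1 + (q⁻¹ * q ^ α) • (c q α * b q α) := by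
  have := Complex.cpow_ne_zero_iff (x := q) (y := α) |>.2 (Or.inl hq)
  rw [det, bc_eq α hq, smul_smul, Complex.cpow_neg]
  field_simp
  module

theorem da_eq (hq : q ≠ 0) : d q α * a q α = D q α 1 + (q * q ^ α) • (c q α * b q α) := by
  have := Complex.cpow_ne_zero_iff (x := q) (y := α) |>.2 (Or.inl hq)
  have h1 : d q α * a q α = a q α * d q α - ((q⁻¹ - q) * q ^ (-α)) • (b q α * c q α) := by
    rw [← ad]; abel
  have e : (q⁻¹ - q) * (q ^ α)⁻¹ * (q ^ α * q ^ α) = q⁻¹ * q ^ α - q * q ^ α := by field_simp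
  rw [h1, ad_eq α hq, bc_eq α hq, smul_smul, Complex.cpow_neg, e]
  module

end FunQ

theorem qBracket_one (hq : q - q⁻¹ ≠ 0) : qBracket q 1 = 1 := by
  rw [qBracket, pow_one, pow_one, div_self hq]

theorem transM_one (h : ℂ) (hq : q - q⁻¹ ≠ 0) : transM h q 1 = !![1, h / (q - 1); 0, 1] := by
  ext i k
  fin_cases i <;> fin_cases k <;>
    simp [transM, Finset.sum_range_succ, qBracketFactorial, qBracket_one hq, JplusQ]

theorem transM_one_inv (h : ℂ) (hq : q - q⁻¹ ≠ 0) :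
    (transM h q 1)⁻¹ = !![1, -(h / (q - 1)); 0, 1] := by
  refine Matrix.inv_eq_left_inv ?_
  rw [transM_one h hq]
  ext i k
  fin_cases i <;> fin_cases k <;> simp [Matrix.mul_apply, Fin.sum_univ_two]

open FunQ

theorem tildeGen_eq (h α : ℂ) (hq : q - q⁻¹ ≠ 0) :
    tildeGen h q α HGen.a = a q α - (h / (q - 1)) • c q α ∧
    tildeGen h q α HGen.b = b q α + (h / (q - 1)) • a q α - (h / (q - 1)) • d q α
      - ((h / (q - 1)) * (h / (q - 1))) • c q α ∧
    tildeGen h q α HGen.c = c q α ∧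
    tildeGen h q α HGen.d = d q α + (h / (q - 1)) • c q α := by
  have e : conjM h q α 1 !![a q α, b q α; c q α, d q α] =
      !![a q α - (h / (q - 1)) • c q α, b q α + (h / (q - 1)) • a q α - (h / (q - 1)) • d q α
      - ((h / (q - 1)) * (h / (q - 1))) • c q α; c q α, d q α + (h / (q - 1)) • c q α] := by
    rw [conjM, transM_one_inv h hq, transM_one h hq]
    ext i k
    fin_cases i <;> fin_cases k <;>
    simp [Matrix.mul_apply, Fin.sum_univ_two, Algebra.algebraMap_eq_smul_one, -map_div₀]
    · module
    · module
    · module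
  simp only [tildeGen, tildeGen.tildeMat]
  simp only [e]
  simp

/-! The relations of the new generators; they hold for every value of the parameter `η`. -/

section

variable (α) (η : ℂ)

namespace FunQ

/-- The new generator `a`. -/
noncomputable def ta (q α η : ℂ) : FunQ q α := a q α - η • c q α

/-- The new generator `b`. -/
noncomputable def tb (q α η : ℂ) : FunQ q α :=
  b q α + η • a q α - η • d q α - (η * η) • c q α

/-- The new generator `d`. -/
noncomputable def td (q α η : ℂ) : FunQ q α := d q α + η • c q α

/-- In this and the following relations the coefficients are grouped into powers of q and products
of factors η(q^x - q^y), so that each has a finite limit for η = h/(q - 1). -/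
theorem ta_c : ta q α η * c q α =
    (q⁻¹ * q ^ α) • (c q α * ta q α η) + (η * (q⁻¹ * q ^ α - 1)) • (c q α * c q α) := by
  simp only [ta, sub_mul, mul_sub, smul_mul_assoc, mul_smul_comm, ac]
  module

theorem td_c (hq : q ≠ 0) : td q α η * c q α =
    (q * q ^ α) • (c q α * td q α η) + (η * (1 - q * q ^ α)) • (c q α * c q α) := by
  simp only [td, add_mul, mul_add, smul_mul_assoc, mul_smul_comm, dc α hq]
  module

theorem tb_c (hq : q ≠ 0) : tb q α η * c q α =
    (q ^ α * q ^ α) • (c q α * tb q α η) + (η * (q⁻¹ * q ^ α - q ^ α * q ^ α)) • (c q α * ta q α η)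
      + (η * (q ^ α * q ^ α - q * q ^ α)) • (c q α * td q α η) -
      ((η * (q ^ α - q)) * (η * (q ^ α - q⁻¹))) • (c q α * c q α) := by
  simp only [ta, tb, td, add_mul, mul_add, sub_mul, mul_sub, smul_mul_assoc, mul_smul_comm, ac,
    dc α hq, bc_eq α hq]
  match_scalars <;> field_simp <;> ring

theorem ta_td (hq : q ≠ 0) : ta q α η * td q α η = D q α 1 + (q⁻¹ * q ^ α) • (c q α * tb q α η) +
    (η * (q⁻¹ * q ^ α - 1)) • (c q α * td q α η) := by
  simp only [ta, tb, td, add_mul, mul_add, sub_mul, mul_sub, smul_mul_assoc, mul_smul_comm, ac,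
    ad_eq α hq]
  module

theorem td_ta (hq : q ≠ 0) : td q α η * ta q α η = D q α 1 + (q * q ^ α) • (c q α * tb q α η) +
    (η * (1 - q * q ^ α)) • (c q α * ta q α η) := by
  simp only [ta, tb, td, add_mul, mul_add, sub_mul, mul_sub, smul_mul_assoc, mul_smul_comm, dc α hq,
    da_eq α hq]
  module

theorem tb_ta (hq : q ≠ 0) : tb q α η * ta q α η = (q * q ^ α) • (ta q α η * tb q α η) +
    (η * (1 - q * q ^ α)) • (ta q α η * ta q α η) - (η * (1 - q * q ^ α)) • D q α 1 := by
  simp only [ta, tb, add_mul, mul_add, sub_mul, mul_sub, smul_mul_assoc, mul_smul_comm, ac,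
    dc α hq, da_eq α hq, ad_eq α hq, bc_eq α hq, ba α hq, smul_add, smul_sub, smul_smul]
  match_scalars <;> field_simp <;> ring

theorem tb_td (hq : q ≠ 0) : tb q α η * td q α η = (q⁻¹ * q ^ α) • (td q α η * tb q α η) +
    (η * (q⁻¹ * q ^ α - 1)) • (td q α η * td q α η) - (η * (q⁻¹ * q ^ α - 1)) • D q α 1 := by
  simp only [td, tb, add_mul, mul_add, sub_mul, mul_sub, smul_mul_assoc, mul_smul_comm, ac,
    dc α hq, da_eq α hq, ad_eq α hq, bc_eq α hq, bd, smul_add, smul_sub, smul_smul]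
  match_scalars <;> field_simp <;> ring

theorem ta_D (w : ℂ) : ta q α η * D q α w = D q α w * ta q α η +
    (η * (1 - q ^ (-(2 * α * w)))) • (D q α w * c q α) := by
  simp only [ta, sub_mul, mul_sub, smul_mul_assoc, mul_smul_comm, a_D, c_D]
  module

theorem td_D (w : ℂ) : td q α η * D q α w = D q α w * td q α η -
    (η * (1 - q ^ (-(2 * α * w)))) • (D q α w * c q α) := by
  simp only [td, add_mul, mul_add, smul_mul_assoc, mul_smul_comm, d_D, c_D]
  module

theorem tb_D (hq : q ≠ 0) (w : ℂ) : tb q α η * D q α w = q ^ (2 * α * w) • (D q α w * tb q α η) +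
    (η * (1 - q ^ (2 * α * w))) • (D q α w * ta q α η) -
    (η * (1 - q ^ (2 * α * w))) • (D q α w * td q α η) +
    ((η * (1 - q ^ (2 * α * w))) * (η * (1 - q ^ (-(2 * α * w))))) • (D q α w * c q α) := by
  have := Complex.cpow_ne_zero_iff (x := q) (y := 2 * α * w) |>.2 (Or.inl hq)
  simp only [ta, tb, td, add_mul, mul_add, sub_mul, mul_sub, smul_mul_assoc, mul_smul_comm, a_D,
    b_D, c_D, d_D, Complex.cpow_neg]
  match_scalars <;> field_simp <;> ring

end FunQ

end

end QRelations

end Jordanian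

namespace Jordanian

/-! ### Families with a limit -/

section LimSpan

variable {h α : ℂ}

/-- Families in the span of the values of given words, with convergent coefficients, and their
limits. -/
inductive LimSpan (h α : ℂ) (S : Set (FreeAlgebra ℂ HGen)) :
    ((q : ℂ) → FunQ q α) → FunH h α → Prop
  | zero : LimSpan h α S (fun _ => 0) 0
  | add {x x' : (q : ℂ) → FunQ q α} {y y' : FunH h α} : LimSpan h α S x y → LimSpan h α S x' y' →
      LimSpan h α S (fun q => x q + x' q) (y + y')
  | word {p : FreeAlgebra ℂ HGen} (hp : p ∈ S) {f : ℂ → ℂ} {l : ℂ}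
      (hf : Tendsto f (𝓝[≠] 1) (𝓝 l)) :
      LimSpan h α S (fun q => f q • evalTilde h q α p) (l • evalH h α p)
  | congr {x x' : (q : ℂ) → FunQ q α} {y : FunH h α} (hx : ∀ᶠ q in 𝓝[≠] (1 : ℂ), x' q = x q) :
      LimSpan h α S x y → LimSpan h α S x' y

variable {S S' : Set (FreeAlgebra ℂ HGen)} {x x' : (q : ℂ) → FunQ q α} {y y' : FunH h α}

namespace LimSpan

theorem smul (hx : LimSpan h α S x y) {f : ℂ → ℂ} {l : ℂ} (hf : Tendsto f (𝓝[≠] 1) (𝓝 l)) :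
    LimSpan h α S (fun q => f q • x q) (l • y) := by
  induction hx with
  | zero => simpa using LimSpan.zero
  | add _ _ ih1 ih2 => simpa only [smul_add] using ih1.add ih2
  | word hp hg => simpa only [smul_smul] using LimSpan.word hp (hf.mul hg)
  | congr hx _ ih => exact .congr (by filter_upwards [hx] with q hq; rw [hq]) ih

theorem const_smul (hx : LimSpan h α S x y) (t : ℂ) : LimSpan h α S (fun q => t • x q) (t • y) :=
  hx.smul tendsto_const_nhds

theorem neg (hx : LimSpan h α S x y) : LimSpan h α S (fun q => -x q) (-y) := by
  have h1 := hx.const_smul (-1)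
  have h2 : ∀ q, (-1 : ℂ) • x q = -x q := fun q => by module
  have h3 : (-1 : ℂ) • y = -y := by module
  simpa only [h2, h3] using h1

theorem sub (hx : LimSpan h α S x y) (hx' : LimSpan h α S x' y') :
    LimSpan h α S (fun q => x q - x' q) (y - y') := by
  simpa only [sub_eq_add_neg] using hx.add hx'.neg

theorem sum {ι : Type*} (s : Finset ι) {x : ι → (q : ℂ) → FunQ q α} {y : ι → FunH h α}
    (hx : ∀ i ∈ s, LimSpan h α S (x i) (y i)) :
    LimSpan h α S (fun q => ∑ i ∈ s, x i q) (∑ i ∈ s, y i) := by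
  classical
  induction s using Finset.induction_on with
  | empty => simpa using LimSpan.zero
  | insert i s hi ih =>
    simp only [Finset.sum_insert hi]
    exact (hx i (by simp)).add (ih fun j hj => hx j (by simp [hj]))

theorem of_mem {p : FreeAlgebra ℂ HGen} (hp : p ∈ S) :
    LimSpan h α S (fun q => evalTilde h q α p) (evalH h α p) := by
  simpa using LimSpan.word (h := h) (α := α) hp (tendsto_const_nhds (x := (1 : ℂ)))

/-- Replace the words by families in the span of other words, after multiplication from both
sides. -/
theorem bind (hx : LimSpan h α S x y) {u v : (q : ℂ) → FunQ q α} {u' v' : FunH h α}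
    (hS : ∀ p ∈ S, LimSpan h α S' (fun q => u q * evalTilde h q α p * v q) (u' * evalH h α p * v')) :
    LimSpan h α S' (fun q => u q * x q * v q) (u' * y * v') := by
  induction hx with
  | zero => simpa using LimSpan.zero
  | add _ _ ih1 ih2 => simpa only [mul_add, add_mul] using ih1.add ih2
  | word hp hg => simpa only [mul_smul_comm, smul_mul_assoc] using (hS _ hp).smul hg
  | congr hx _ ih => exact .congr (by filter_upwards [hx] with q hq; rw [hq]) ih

theorem trans (hx : LimSpan h α S x y)
    (hS : ∀ p ∈ S, LimSpan h α S' (fun q => evalTilde h q α p) (evalH h α p)) :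
    LimSpan h α S' x y := by
  simpa using hx.bind (u := 1) (v := 1) (u' := 1) (v' := 1) (by simpa using hS)

theorem mul (hx : LimSpan h α Set.univ x y) (hx' : LimSpan h α Set.univ x' y') :
    LimSpan h α Set.univ (fun q => x q * x' q) (y * y') := by
  have := hx.bind (S' := Set.univ) (u := 1) (v := x') (u' := 1) (v' := y') fun p _ => by
    have := hx'.bind (S' := Set.univ) (u := fun q => evalTilde h q α p) (v := 1)
      (u' := evalH h α p) (v' := 1) fun p' _ => by
        simpa using of_mem (h := h) (α := α) (Set.mem_univ (p * p'))
    simpa using this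
  simpa using this

end LimSpan

/-- The inductive form of convergence is closed under sums and substitutions by structural
induction; concatenating the finite lists of words recovers the explicit form. -/
theorem tendsToFunH_iff : TendsToFunH h α x y ↔ LimSpan h α Set.univ x y := by
  constructor
  · rintro ⟨r, p, f, f₁, hf, hx, rfl⟩
    exact .congr hx (LimSpan.sum _ fun i _ => .word (Set.mem_univ _) (hf i))
  · intro hx
    induction hx with
    | zero => exact ⟨0, Fin.elim0, Fin.elim0, Fin.elim0, fun i => i.elim0, by simp, by simp⟩
    | add _ _ ih1 ih2 =>
      obtain ⟨r, p, f, l, hf, hx, rfl⟩ := ih1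
      obtain ⟨r', p', f', l', hf', hx', rfl⟩ := ih2
      refine ⟨r + r', Fin.append p p', Fin.append f f', Fin.append l l', ?_, ?_, ?_⟩
      · refine Fin.addCases (fun i => ?_) (fun i => ?_)
        · simpa using hf i
        · simpa using hf' i
      · filter_upwards [hx, hx'] with q h1 h2
        rw [h1, h2, Fin.sum_univ_add]
        simp
      · rw [Fin.sum_univ_add]
        simp
    | @word p _ f l hf =>
      exact ⟨1, fun _ => p, fun _ => f, fun _ => l, fun _ => hf, by simp, by simp⟩
    | congr hx _ ih =>
      obtain ⟨r, p, f, l, hf, hx', rfl⟩ := ih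
      exact ⟨r, p, f, l, hf, by filter_upwards [hx, hx'] with q h1 h2; rw [h1, h2], rfl⟩

/-! ### Coefficients of the relations -/

/-- The quotient is the slope at 1 of the principal branch of q^x, whose derivative there is x. -/
theorem tendsto_cpow_sub_one (x : ℂ) :
    Tendsto (fun q : ℂ => (q ^ x - 1) / (q - 1)) (𝓝[≠] 1) (𝓝 x) := by
  have h1 : HasDerivAt (fun q : ℂ => q ^ x) (x * 1 ^ (x - 1)) 1 := by
    simpa using (hasDerivAt_id (1 : ℂ)).cpow_const (c := x) (by simp)
  have := h1.tendsto_slope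
  simp only [Complex.one_cpow, mul_one] at this
  refine this.congr fun q => ?_
  rw [slope_def_field, Complex.one_cpow]

theorem tendsto_cpow_sub_cpow (h x x' : ℂ) :
    Tendsto (fun q : ℂ => h / (q - 1) * (q ^ x - q ^ x')) (𝓝[≠] 1) (𝓝 (h * (x - x'))) := by
  refine (((tendsto_cpow_sub_one x).sub (tendsto_cpow_sub_one x')).const_mul h).congr fun q => ?_
  ring

theorem tendsto_cpow (x : ℂ) : Tendsto (fun q : ℂ => q ^ x) (𝓝[≠] 1) (𝓝 1) := by
  have h1 : ContinuousAt (fun q : ℂ => q ^ x) 1 := continuousAt_id.cpow continuousAt_const (by simp)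
  have := h1.tendsto
  rw [Complex.one_cpow] at this
  exact this.mono_left nhdsWithin_le_nhds

theorem eventually_good : ∀ᶠ q in 𝓝[≠] (1 : ℂ), q ≠ 0 ∧ q - q⁻¹ ≠ 0 := by
  have h0 : ∀ᶠ q in 𝓝[≠] (1 : ℂ), q ≠ 0 :=
    nhdsWithin_le_nhds (isOpen_ne.mem_nhds one_ne_zero)
  have h1 : ∀ᶠ q in 𝓝[≠] (1 : ℂ), q ≠ -1 :=
    nhdsWithin_le_nhds (isOpen_ne.mem_nhds (by norm_num))
  filter_upwards [h0, h1, self_mem_nhdsWithin] with q hq hq1 hq2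
  refine ⟨hq, fun e => ?_⟩
  have : (q - 1) * (q + 1) = 0 := by
    field_simp at e
    linear_combination e
  rcases mul_eq_zero.1 this with h | h
  · exact hq2 (sub_eq_zero.1 h)
  · exact hq1 (eq_neg_of_add_eq_zero_left h)

end LimSpan

/-! ### Relations of the Jordanian quantum group -/

section HRelations

variable (h α : ℂ)

namespace FunH

/-- The image of a generator in the algebra. -/
noncomputable def gen (g : HGen) : FunH h α := evalH h α (FreeAlgebra.ι ℂ g)

noncomputable abbrev a : FunH h α := gen h α HGen.a
noncomputable abbrev b : FunH h α := gen h α HGen.b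
noncomputable abbrev c : FunH h α := gen h α HGen.c
noncomputable abbrev d : FunH h α := gen h α HGen.d
noncomputable abbrev D (w : ℂ) : FunH h α := gen h α (HGen.D w)

theorem evalH_ι (g : HGen) : evalH h α (FreeAlgebra.ι ℂ g) = gen h α g := rfl

theorem mkAlgHom_gen (g : HGen) :
    RingQuot.mkAlgHom ℂ (HRel h α) (FreeAlgebra.ι ℂ g) = gen h α g := rfl

theorem ab : a h α * b h α - b h α * a h α = (h * (1 + α)) • (a h α * a h α - D h α 1) := by
  simpa [mkAlgHom_gen, pow_two] using
    RingQuot.mkAlgHom_rel ℂ (HRel.ab (h := h) (α := α))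

theorem ac : a h α * c h α - c h α * a h α = -((h * (1 - α)) • (c h α * c h α)) := by
  simpa [mkAlgHom_gen, pow_two] using
    RingQuot.mkAlgHom_rel ℂ (HRel.ac (h := h) (α := α))

theorem bd : b h α * d h α - d h α * b h α = -((h * (1 - α)) • (d h α * d h α - D h α 1)) := by
  simpa [mkAlgHom_gen, pow_two] using
    RingQuot.mkAlgHom_rel ℂ (HRel.bd (h := h) (α := α))

theorem cd : c h α * d h α - d h α * c h α = (h * (1 + α)) • (c h α * c h α) := by
  simpa [mkAlgHom_gen, pow_two] using
    RingQuot.mkAlgHom_rel ℂ (HRel.cd (h := h) (α := α))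

theorem ad : a h α * d h α - d h α * a h α = (h * (1 + α)) • (a h α * c h α)
    - (h * (1 - α)) • (d h α * c h α) := by
  simpa [mkAlgHom_gen, pow_two] using
    RingQuot.mkAlgHom_rel ℂ (HRel.ad (h := h) (α := α))

theorem bc : b h α * c h α - c h α * b h α = -((h * (1 + α)) • (a h α * c h α))
    - (h * (1 - α)) • (c h α * d h α) := by
  simpa [mkAlgHom_gen, pow_two] using
    RingQuot.mkAlgHom_rel ℂ (HRel.bc (h := h) (α := α))

theorem det : D h α 1 = a h α * d h α - b h α * c h α - (h * (1 + α)) • (a h α * c h α) := by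
  simpa [mkAlgHom_gen, pow_two] using
    RingQuot.mkAlgHom_rel ℂ (HRel.det (h := h) (α := α))

theorem D_zero : D h α 0 = 1 := by
  simpa [mkAlgHom_gen, pow_two] using
    RingQuot.mkAlgHom_rel ℂ (HRel.D_zero (h := h) (α := α))

theorem D_add (w w' : ℂ) : D h α (w + w') = D h α w * D h α w' := by
  simpa [mkAlgHom_gen, pow_two] using
    RingQuot.mkAlgHom_rel ℂ (HRel.D_add (h := h) (α := α) w w')

theorem a_D (w : ℂ) : a h α * D h α w = D h α w * (a h α + (2 * h * α * w) • c h α) := by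
  simpa [mkAlgHom_gen, pow_two] using
    RingQuot.mkAlgHom_rel ℂ (HRel.a_D (h := h) (α := α) w)

theorem b_D (w : ℂ) : b h α * D h α w = D h α w *
    (b h α + (2 * h * α * w) • (d h α - a h α) - ((2 * h * α * w) ^ 2) • c h α) := by
  simpa only [map_mul, map_sub, map_add, map_smul, mkAlgHom_gen] using
    RingQuot.mkAlgHom_rel ℂ (HRel.b_D (h := h) (α := α) w)

theorem c_D (w : ℂ) : c h α * D h α w = D h α w * c h α := by
  simpa [mkAlgHom_gen, pow_two] using
    RingQuot.mkAlgHom_rel ℂ (HRel.c_D (h := h) (α := α) w)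

theorem d_D (w : ℂ) : d h α * D h α w = D h α w * (d h α - (2 * h * α * w) • c h α) := by
  simpa [mkAlgHom_gen, pow_two] using
    RingQuot.mkAlgHom_rel ℂ (HRel.d_D (h := h) (α := α) w)

/-! The same relations in the order of the normal monomials. -/

theorem a_c : a h α * c h α = c h α * a h α + (h * (α - 1)) • (c h α * c h α) := by
  rw [← sub_eq_iff_eq_add', ac]
  module

theorem d_c : d h α * c h α = c h α * d h α - (h * (1 + α)) • (c h α * c h α) := by
  rw [← cd]
  abel

theorem b_c : b h α * c h α = c h α * b h α - (h * (1 + α)) • (c h α * a h α)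
    + (h * (α - 1)) • (c h α * d h α) - ((h * (α - 1)) * (h * (α + 1))) • (c h α * c h α) := by
  have := bc h α
  rw [a_c, sub_eq_iff_eq_add] at this
  rw [this]
  module

theorem a_d : a h α * d h α = D h α 1 + c h α * b h α + (h * (α - 1)) • (c h α * d h α) := by
  have := det h α
  rw [b_c, a_c] at this
  rw [this]
  module

theorem d_a : d h α * a h α = D h α 1 + c h α * b h α - (h * (1 + α)) • (c h α * a h α) := by
  have := ad h α
  rw [a_c, d_c, a_d, sub_eq_iff_eq_add, ← sub_eq_iff_eq_add'] at this
  rw [← this]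
  module

theorem b_a : b h α * a h α = a h α * b h α - (h * (1 + α)) • (a h α * a h α) +
    (h * (1 + α)) • D h α 1 := by
  have := ab h α
  rw [sub_eq_iff_eq_add, ← sub_eq_iff_eq_add'] at this
  rw [← this]
  module

theorem b_d : b h α * d h α = d h α * b h α + (h * (α - 1)) • (d h α * d h α) -
    (h * (α - 1)) • D h α 1 := by
  have := bd h α
  rw [sub_eq_iff_eq_add] at this
  rw [this]
  module

end FunH

end HRelations

end Jordanian

namespace Jordanian

/-! ### Normal ordering -/

section Normal

variable {h α : ℂ}

/-- The word is in the span of given words, with convergent coefficients. -/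
def InSpan (h α : ℂ) (S : Set (FreeAlgebra ℂ HGen)) (p : FreeAlgebra ℂ HGen) : Prop :=
  LimSpan h α S (fun q => evalTilde h q α p) (evalH h α p)

variable {S S' : Set (FreeAlgebra ℂ HGen)} {p p' : FreeAlgebra ℂ HGen}

namespace InSpan

theorem of_mem (hp : p ∈ S) : InSpan h α S p := LimSpan.of_mem hp

theorem bind (hp : InSpan h α S p) {u v : FreeAlgebra ℂ HGen}
    (hS : ∀ s ∈ S, InSpan h α S' (u * s * v)) : InSpan h α S' (u * p * v) := by
  have := LimSpan.bind (u := fun q => evalTilde h q α u) (v := fun q => evalTilde h q α v)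
    (u' := evalH h α u) (v' := evalH h α v) hp fun s hs => by simpa [InSpan] using hS s hs
  simpa [InSpan] using this

theorem bind_left (hp : InSpan h α S p) {u : FreeAlgebra ℂ HGen}
    (hS : ∀ s ∈ S, InSpan h α S' (u * s)) : InSpan h α S' (u * p) := by
  simpa using hp.bind (u := u) (v := 1) (by simpa using hS)

theorem bind_right (hp : InSpan h α S p) {v : FreeAlgebra ℂ HGen}
    (hS : ∀ s ∈ S, InSpan h α S' (s * v)) : InSpan h α S' (p * v) := by
  simpa using hp.bind (u := 1) (v := v) (by simpa using hS)

theorem trans (hp : InSpan h α S p) (hS : ∀ s ∈ S, InSpan h α S' s) : InSpan h α S' p :=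
  LimSpan.trans hp hS

theorem add (hp : InSpan h α S p) (hp' : InSpan h α S p') : InSpan h α S (p + p') := by
  simpa [InSpan] using LimSpan.add hp hp'

theorem smul (hp : InSpan h α S p) (t : ℂ) : InSpan h α S (t • p) := by
  simpa [InSpan] using LimSpan.const_smul hp t

end InSpan

open FunQ in
theorem evalTilde_gen (h α : ℂ) {q : ℂ} (hq : q - q⁻¹ ≠ 0) :
    evalTilde h q α HWord.a = ta q α (h / (q - 1)) ∧
    evalTilde h q α HWord.b = tb q α (h / (q - 1)) ∧
    evalTilde h q α HWord.c = FunQ.c q α ∧ evalTilde h q α HWord.d = td q α (h / (q - 1)) ∧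
    ∀ w, evalTilde h q α (HWord.D w) = FunQ.D q α w := by
  obtain ⟨h1, h2, h3, h4⟩ := tildeGen_eq h α hq
  simp only [evalTilde, FreeAlgebra.lift_ι_apply]
  exact ⟨h1, h2, h3, h4, fun w => rfl⟩

/-! Limits of the coefficients. -/

section Coeff

theorem inv_mul_cpow {q : ℂ} (hq : q ≠ 0) (x : ℂ) : q⁻¹ * q ^ x = q ^ (x - 1) := by
  rw [Complex.cpow_sub _ _ hq, Complex.cpow_one]
  field_simp

theorem mul_cpow_eq {q : ℂ} (hq : q ≠ 0) (x : ℂ) : q * q ^ x = q ^ (x + 1) := by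
  rw [Complex.cpow_add _ _ hq, Complex.cpow_one, mul_comm]

theorem tendsto_of_cpow {f : ℂ → ℂ} (x : ℂ) (hf : ∀ q, q ≠ 0 → f q = q ^ x) :
    Tendsto f (𝓝[≠] 1) (𝓝 1) :=
  (tendsto_cpow x).congr' (by filter_upwards [eventually_good] with q hq; rw [hf q hq.1])

theorem tendsto_of_cpow_sub {f : ℂ → ℂ} {l : ℂ} (h x x' : ℂ)
    (hf : ∀ q, q ≠ 0 → f q = h / (q - 1) * (q ^ x - q ^ x')) (hl : l = h * (x - x')) :
    Tendsto f (𝓝[≠] 1) (𝓝 l) := by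
  rw [hl]
  exact (tendsto_cpow_sub_cpow h x x').congr'
    (by filter_upwards [eventually_good] with q hq; rw [hf q hq.1])

variable (h α : ℂ)

theorem tendsto_inv_mul : Tendsto (fun q : ℂ => q⁻¹ * q ^ α) (𝓝[≠] 1) (𝓝 1) :=
  tendsto_of_cpow (α - 1) fun _ hq => inv_mul_cpow hq α

theorem tendsto_mul : Tendsto (fun q : ℂ => q * q ^ α) (𝓝[≠] 1) (𝓝 1) :=
  tendsto_of_cpow (α + 1) fun _ hq => mul_cpow_eq hq α

theorem tendsto_mul_self : Tendsto (fun q : ℂ => q ^ α * q ^ α) (𝓝[≠] 1) (𝓝 1) :=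
  tendsto_of_cpow (α + α) fun _ hq => (Complex.cpow_add _ _ hq).symm

theorem tendsto_eta_inv_mul_sub_one :
    Tendsto (fun q : ℂ => h / (q - 1) * (q⁻¹ * q ^ α - 1)) (𝓝[≠] 1) (𝓝 (h * (α - 1))) :=
  tendsto_of_cpow_sub h (α - 1) 0 (fun _ hq => by rw [inv_mul_cpow hq, Complex.cpow_zero]) (by ring)

theorem tendsto_eta_one_sub_mul :
    Tendsto (fun q : ℂ => h / (q - 1) * (1 - q * q ^ α)) (𝓝[≠] 1) (𝓝 (-(h * (1 + α)))) :=
  tendsto_of_cpow_sub h 0 (α + 1) (fun _ hq => by rw [mul_cpow_eq hq, Complex.cpow_zero]) (by ring)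

theorem tendsto_eta_inv_mul_sub_mul_self :
    Tendsto (fun q : ℂ => h / (q - 1) * (q⁻¹ * q ^ α - q ^ α * q ^ α)) (𝓝[≠] 1)
      (𝓝 (-(h * (1 + α)))) :=
  tendsto_of_cpow_sub h (α - 1) (α + α)
    (fun _ hq => by rw [inv_mul_cpow hq, Complex.cpow_add _ _ hq]) (by ring)

theorem tendsto_eta_mul_self_sub_mul :
    Tendsto (fun q : ℂ => h / (q - 1) * (q ^ α * q ^ α - q * q ^ α)) (𝓝[≠] 1)
      (𝓝 (h * (α - 1))) :=
  tendsto_of_cpow_sub h (α + α) (α + 1)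
    (fun _ hq => by rw [mul_cpow_eq hq, ← Complex.cpow_add _ _ hq]) (by ring)

theorem tendsto_eta_sub :
    Tendsto (fun q : ℂ => h / (q - 1) * (q ^ α - q)) (𝓝[≠] 1) (𝓝 (h * (α - 1))) :=
  tendsto_of_cpow_sub h α 1 (fun _ hq => by rw [Complex.cpow_one]) (by ring)

theorem tendsto_eta_sub_inv :
    Tendsto (fun q : ℂ => h / (q - 1) * (q ^ α - q⁻¹)) (𝓝[≠] 1) (𝓝 (h * (α + 1))) :=
  tendsto_of_cpow_sub h α (-1) (fun _ hq => by rw [Complex.cpow_neg_one]) (by ring)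

theorem tendsto_eta_one_sub_cpow (x : ℂ) :
    Tendsto (fun q : ℂ => h / (q - 1) * (1 - q ^ x)) (𝓝[≠] 1) (𝓝 (-(h * x))) :=
  tendsto_of_cpow_sub h 0 x (fun _ hq => by rw [Complex.cpow_zero]) (by ring)

end Coeff

/-! The straightening relations. -/

section Straighten

set_option linter.unusedSimpArgs false

variable (h α : ℂ)

open HWord

/-- A straightening rule is two relations at once: one in the standard algebra for q near 1, and one
in the Jordanian algebra whose coefficients are the limits of the former. The other rules follow the
same pattern. -/
theorem inSpan_a_c : InSpan h α {c * a, c * c} (a * c) := by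
  have e : evalH h α (a * c) = (1 : ℂ) • evalH h α (c * a) + (h * (α - 1)) • evalH h α (c * c) := by
    simpa [FunH.evalH_ι] using FunH.a_c h α
  rw [InSpan, e]
  refine .congr ?_ (.add (.word (by simp) (tendsto_inv_mul α))
    (.word (by simp) (tendsto_eta_inv_mul_sub_one h α)))
  filter_upwards [eventually_good] with q hq
  obtain ⟨e1, e2, e3, e4, e5⟩ := evalTilde_gen h α hq.2
  simp only [map_mul, e1, e2, e3, e4, e5, FunQ.ta_c]

theorem inSpan_d_c : InSpan h α {c * d, c * c} (d * c) := by
  have e : evalH h α (d * c) =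
      (1 : ℂ) • evalH h α (c * d) + (-(h * (1 + α))) • evalH h α (c * c) := by
    simp only [map_mul, FunH.evalH_ι, FunH.d_c]
    module
  rw [InSpan, e]
  refine .congr ?_ (.add (.word (by simp) (tendsto_mul α))
    (.word (by simp) (tendsto_eta_one_sub_mul h α)))
  filter_upwards [eventually_good] with q hq
  obtain ⟨e1, e2, e3, e4, e5⟩ := evalTilde_gen h α hq.2
  simp only [map_mul, e1, e2, e3, e4, e5, FunQ.td_c _ _ hq.1]

theorem inSpan_b_c : InSpan h α {c * b, c * a, c * d, c * c} (b * c) := by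
  have e : evalH h α (b * c) = (1 : ℂ) • evalH h α (c * b) + (-(h * (1 + α))) • evalH h α (c * a)
      + (h * (α - 1)) • evalH h α (c * d) +
      (-((h * (α - 1)) * (h * (α + 1)))) • evalH h α (c * c) := by
    simp only [map_mul, FunH.evalH_ι, FunH.b_c]
    module
  rw [InSpan, e]
  refine .congr ?_ (.add (.add (.add (.word (by simp) (tendsto_mul_self α))
    (.word (by simp) (tendsto_eta_inv_mul_sub_mul_self h α)))
    (.word (by simp) (tendsto_eta_mul_self_sub_mul h α)))
    (.word (by simp) ((tendsto_eta_sub h α).mul (tendsto_eta_sub_inv h α)).neg))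
  filter_upwards [eventually_good] with q hq
  obtain ⟨e1, e2, e3, e4, e5⟩ := evalTilde_gen h α hq.2
  simp only [map_mul, e1, e2, e3, e4, e5, FunQ.tb_c _ _ hq.1]
  module

theorem inSpan_a_d : InSpan h α {D 1, c * b, c * d} (a * d) := by
  have e : evalH h α (a * d) = (1 : ℂ) • evalH h α (D 1) + (1 : ℂ) • evalH h α (c * b) +
      (h * (α - 1)) • evalH h α (c * d) := by
    simpa [FunH.evalH_ι] using FunH.a_d h α
  rw [InSpan, e]
  refine .congr ?_ (.add (.add (.word (by simp) tendsto_const_nhds)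
    (.word (by simp) (tendsto_inv_mul α)))
    (.word (by simp) (tendsto_eta_inv_mul_sub_one h α)))
  filter_upwards [eventually_good] with q hq
  obtain ⟨e1, e2, e3, e4, e5⟩ := evalTilde_gen h α hq.2
  simp only [map_mul, e1, e2, e3, e4, e5, FunQ.ta_td _ _ hq.1, one_smul]

theorem inSpan_d_a : InSpan h α {D 1, c * b, c * a} (d * a) := by
  have e : evalH h α (d * a) = (1 : ℂ) • evalH h α (D 1) + (1 : ℂ) • evalH h α (c * b) +
      (-(h * (1 + α))) • evalH h α (c * a) := by
    simp only [map_mul, FunH.evalH_ι, FunH.d_a]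
    module
  rw [InSpan, e]
  refine .congr ?_ (.add (.add (.word (by simp) tendsto_const_nhds)
    (.word (by simp) (tendsto_mul α)))
    (.word (by simp) (tendsto_eta_one_sub_mul h α)))
  filter_upwards [eventually_good] with q hq
  obtain ⟨e1, e2, e3, e4, e5⟩ := evalTilde_gen h α hq.2
  simp only [map_mul, e1, e2, e3, e4, e5, FunQ.td_ta _ _ hq.1, one_smul]

theorem inSpan_b_a : InSpan h α {a * b, a * a, D 1} (b * a) := by
  have e : evalH h α (b * a) = (1 : ℂ) • evalH h α (a * b) +
      (-(h * (1 + α))) • evalH h α (a * a) + (-(-(h * (1 + α)))) • evalH h α (D 1) := by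
    simp only [map_mul, FunH.evalH_ι, FunH.b_a]
    module
  rw [InSpan, e]
  refine .congr ?_ (.add (.add (.word (by simp) (tendsto_mul α))
    (.word (by simp) (tendsto_eta_one_sub_mul h α)))
    (.word (by simp) (tendsto_eta_one_sub_mul h α).neg))
  filter_upwards [eventually_good] with q hq
  obtain ⟨e1, e2, e3, e4, e5⟩ := evalTilde_gen h α hq.2
  simp only [map_mul, e1, e2, e3, e4, e5, FunQ.tb_ta _ _ hq.1]
  module

theorem inSpan_b_d : InSpan h α {d * b, d * d, D 1} (b * d) := by
  have e : evalH h α (b * d) = (1 : ℂ) • evalH h α (d * b) +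
      (h * (α - 1)) • evalH h α (d * d) + (-(h * (α - 1))) • evalH h α (D 1) := by
    simp only [map_mul, FunH.evalH_ι, FunH.b_d]
    module
  rw [InSpan, e]
  refine .congr ?_ (.add (.add (.word (by simp) (tendsto_inv_mul α))
    (.word (by simp) (tendsto_eta_inv_mul_sub_one h α)))
    (.word (by simp) (tendsto_eta_inv_mul_sub_one h α).neg))
  filter_upwards [eventually_good] with q hq
  obtain ⟨e1, e2, e3, e4, e5⟩ := evalTilde_gen h α hq.2
  simp only [map_mul, e1, e2, e3, e4, e5, FunQ.tb_td _ _ hq.1]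
  module

theorem inSpan_D_D (w w' : ℂ) : InSpan h α {D (w + w')} (D w * D w') := by
  have e : evalH h α (D w * D w') = (1 : ℂ) • evalH h α (D (w + w')) := by
    simpa [FunH.evalH_ι] using (FunH.D_add h α w w').symm
  rw [InSpan, e]
  refine .congr ?_ (.word (by simp) tendsto_const_nhds)
  filter_upwards [eventually_good] with q hq
  obtain ⟨e1, e2, e3, e4, e5⟩ := evalTilde_gen h α hq.2
  simp only [map_mul, e5, FunQ.D_add, one_smul]

theorem inSpan_one : InSpan h α {D 0} 1 := by
  have e : evalH h α 1 = (1 : ℂ) • evalH h α (D 0) := by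
    simpa [FunH.evalH_ι] using (FunH.D_zero h α).symm
  rw [InSpan, e]
  refine .congr ?_ (.word (by simp) tendsto_const_nhds)
  filter_upwards [eventually_good] with q hq
  obtain ⟨e1, e2, e3, e4, e5⟩ := evalTilde_gen h α hq.2
  simp only [map_one, e5, FunQ.D_zero, one_smul]

theorem inSpan_c_D (w : ℂ) : InSpan h α {D w * c} (c * D w) := by
  have e : evalH h α (c * D w) = (1 : ℂ) • evalH h α (D w * c) := by
    simpa [FunH.evalH_ι] using (FunH.c_D h α w)
  rw [InSpan, e]
  refine .congr ?_ (.word (by simp) (tendsto_cpow (-(2 * α * w))))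
  filter_upwards [eventually_good] with q hq
  obtain ⟨e1, e2, e3, e4, e5⟩ := evalTilde_gen h α hq.2
  simp only [map_mul, e3, e5, FunQ.c_D]

theorem inSpan_a_D (w : ℂ) : InSpan h α {D w * a, D w * c} (a * D w) := by
  have e : evalH h α (a * D w) = (1 : ℂ) • evalH h α (D w * a) +
      (-(h * (-(2 * α * w)))) • evalH h α (D w * c) := by
    simp only [map_mul, FunH.evalH_ι, FunH.a_D, mul_add, mul_smul_comm]
    module
  rw [InSpan, e]
  refine .congr ?_ (.add (.word (by simp) tendsto_const_nhds)
    (.word (by simp) (tendsto_eta_one_sub_cpow h _)))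
  filter_upwards [eventually_good] with q hq
  obtain ⟨e1, e2, e3, e4, e5⟩ := evalTilde_gen h α hq.2
  simp only [map_mul, e1, e3, e5, FunQ.ta_D, one_smul]

theorem inSpan_d_D (w : ℂ) : InSpan h α {D w * d, D w * c} (d * D w) := by
  have e : evalH h α (d * D w) = (1 : ℂ) • evalH h α (D w * d) +
      (-(-(h * (-(2 * α * w))))) • evalH h α (D w * c) := by
    simp only [map_mul, FunH.evalH_ι, FunH.d_D, mul_sub, mul_smul_comm]
    module
  rw [InSpan, e]
  refine .congr ?_ (.add (.word (by simp) tendsto_const_nhds)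
    (.word (by simp) (tendsto_eta_one_sub_cpow h _).neg))
  filter_upwards [eventually_good] with q hq
  obtain ⟨e1, e2, e3, e4, e5⟩ := evalTilde_gen h α hq.2
  simp only [map_mul, e4, e3, e5, FunQ.td_D]
  module

theorem inSpan_b_D (w : ℂ) : InSpan h α {D w * b, D w * a, D w * d, D w * c} (b * D w) := by
  have e : evalH h α (b * D w) = (1 : ℂ) • evalH h α (D w * b) +
      (-(h * (2 * α * w))) • evalH h α (D w * a) + (-(-(h * (2 * α * w)))) • evalH h α (D w * d) +
      ((-(h * (2 * α * w))) * (-(h * (-(2 * α * w))))) • evalH h α (D w * c) := by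
    simp only [map_mul, FunH.evalH_ι, FunH.b_D, mul_sub, mul_add, mul_smul_comm]
    module
  rw [InSpan, e]
  refine .congr ?_ (.add (.add (.add (.word (by simp) (tendsto_cpow (2 * α * w)))
    (.word (by simp) (tendsto_eta_one_sub_cpow h _)))
    (.word (by simp) (tendsto_eta_one_sub_cpow h _).neg))
    (.word (by simp) ((tendsto_eta_one_sub_cpow h _).mul (tendsto_eta_one_sub_cpow h _))))
  filter_upwards [eventually_good] with q hq
  obtain ⟨e1, e2, e3, e4, e5⟩ := evalTilde_gen h α hq.2
  simp only [map_mul, e1, e2, e4, e3, e5, FunQ.tb_D _ _ hq.1]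
  module

end Straighten

/-! The span of the normal monomials is stable under multiplication from the left. -/

section Stable

open HWord

/-- The words `D ^ w c ^ k x ^ i b ^ j`. -/
def normalWords (x : FreeAlgebra ℂ HGen) : Set (FreeAlgebra ℂ HGen) :=
  {p | ∃ (w : ℂ) (k i j : ℕ), p = D w * (c ^ k * (x ^ i * b ^ j))}

theorem InSpan.D_mul {x : FreeAlgebra ℂ HGen} (w : ℂ) (hp : InSpan h α (normalWords x) p) :
    InSpan h α (normalWords x) (D w * p) := by
  refine hp.bind_left ?_
  rintro _ ⟨w', k, i, j, rfl⟩
  rw [← mul_assoc]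
  refine (inSpan_D_D h α w w').bind_right ?_
  rintro _ rfl
  exact .of_mem ⟨_, _, _, _, rfl⟩

theorem InSpan.c_mul {x : FreeAlgebra ℂ HGen} (hp : InSpan h α (normalWords x) p) :
    InSpan h α (normalWords x) (c * p) := by
  refine hp.bind_left ?_
  rintro _ ⟨w, k, i, j, rfl⟩
  rw [← mul_assoc]
  refine (inSpan_c_D h α w).bind_right ?_
  rintro _ rfl
  refine .of_mem ⟨w, k + 1, i, j, ?_⟩
  rw [pow_succ', mul_assoc, mul_assoc]

theorem inSpan_normal (h α : ℂ) (x : FreeAlgebra ℂ HGen) (k i j : ℕ) :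
    InSpan h α (normalWords x) (c ^ k * (x ^ i * b ^ j)) := by
  have := (inSpan_one h α).bind_right (v := c ^ k * (x ^ i * b ^ j)) (S' := normalWords x) (by
    rintro _ rfl
    exact .of_mem ⟨_, _, _, _, rfl⟩)
  rwa [one_mul] at this

theorem inSpan_normal' (h α : ℂ) (x : FreeAlgebra ℂ HGen) (i j : ℕ) :
    InSpan h α (normalWords x) (x ^ i * b ^ j) := by
  simpa using inSpan_normal h α x 0 i j

theorem inSpan_mul_c_pow {x : FreeAlgebra ℂ HGen} (hc : InSpan h α {c * x, c * c} (x * c)) (k : ℕ) :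
    InSpan h α {c ^ k * x, c ^ (k + 1)} (x * c ^ k) := by
  induction k with
  | zero => simpa using InSpan.of_mem (by simp)
  | succ k ih =>
    rw [pow_succ, ← mul_assoc]
    refine ih.bind_right ?_
    rintro _ (rfl | rfl)
    · have : c ^ k * c * x = c ^ k * (c * x) := mul_assoc _ _ _
      rw [this, mul_assoc]
      refine hc.bind_left ?_
      rintro _ (rfl | rfl)
      · exact .of_mem (Or.inl rfl)
      · exact .of_mem (Or.inr (by rw [pow_succ, pow_succ, mul_assoc]; rfl))
    · exact .of_mem (by simp [pow_succ])

theorem InSpan.x_mul {x : FreeAlgebra ℂ HGen} (hc : InSpan h α {c * x, c * c} (x * c))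
    (hD : ∀ w, InSpan h α {D w * x, D w * c} (x * D w)) (hp : InSpan h α (normalWords x) p) :
    InSpan h α (normalWords x) (x * p) := by
  refine hp.bind_left ?_
  rintro _ ⟨w, k, i, j, rfl⟩
  rw [← mul_assoc]
  refine (hD w).bind_right ?_
  rintro _ (rfl | rfl)
  · rw [mul_assoc]
    refine InSpan.D_mul w ?_
    rw [← mul_assoc]
    refine (inSpan_mul_c_pow hc k).bind_right ?_
    rintro _ (rfl | rfl)
    · rw [mul_assoc, ← mul_assoc x, ← pow_succ']
      exact inSpan_normal h α x k (i + 1) j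
    · exact inSpan_normal h α x (k + 1) i j
  · rw [mul_assoc]
    exact (inSpan_normal h α x k i j).c_mul.D_mul w

/-- Here x is a or d. Moving b past one x leaves x b, a word without b, and a determinant, so
induction on the power of x applies. -/
theorem inSpan_b_mul {x : FreeAlgebra ℂ HGen} (hc : InSpan h α {c * x, c * c} (x * c))
    (hD : ∀ w, InSpan h α {D w * x, D w * c} (x * D w))
    (hb : InSpan h α {x * b, x * x, D 1} (b * x)) (i j : ℕ) :
    InSpan h α (normalWords x) (b * (x ^ i * b ^ j)) := by
  induction i with
  | zero => simpa [pow_succ'] using inSpan_normal' h α x 0 (j + 1)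
  | succ i ih =>
    rw [pow_succ', mul_assoc x, ← mul_assoc]
    refine hb.bind_right ?_
    rintro _ (rfl | rfl | rfl)
    · rw [mul_assoc]
      exact InSpan.x_mul hc hD ih
    · rw [mul_assoc]
      exact InSpan.x_mul hc hD (InSpan.x_mul hc hD (inSpan_normal' h α x i j))
    · exact (inSpan_normal' h α x i j).D_mul 1

/-- The normal monomials. -/
def allNormalWords : Set (FreeAlgebra ℂ HGen) := normalWords a ∪ normalWords d

theorem InSpan.D_mul' (w : ℂ) (hp : InSpan h α allNormalWords p) :
    InSpan h α allNormalWords (D w * p) := by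
  refine hp.bind_left ?_
  rintro s (hs | hs)
  · exact ((InSpan.of_mem hs).D_mul w).trans fun s hs => .of_mem (Or.inl hs)
  · exact ((InSpan.of_mem hs).D_mul w).trans fun s hs => .of_mem (Or.inr hs)

theorem InSpan.c_mul' (hp : InSpan h α allNormalWords p) : InSpan h α allNormalWords (c * p) := by
  refine hp.bind_left ?_
  rintro s (hs | hs)
  · exact (InSpan.of_mem hs).c_mul.trans fun s hs => .of_mem (Or.inl hs)
  · exact (InSpan.of_mem hs).c_mul.trans fun s hs => .of_mem (Or.inr hs)

/-- The products of the word with the matrix entries are in the span of the normal monomials. -/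
structure IsStable (h α : ℂ) (m : FreeAlgebra ℂ HGen) : Prop where
  a : InSpan h α allNormalWords (HWord.a * m)
  b : InSpan h α allNormalWords (HWord.b * m)
  c : InSpan h α allNormalWords (HWord.c * m)
  d : InSpan h α allNormalWords (HWord.d * m)

theorem IsStable.c_mul {m : FreeAlgebra ℂ HGen} (hm : IsStable h α m) :
    IsStable h α (HWord.c * m) where
  a := by
    rw [← mul_assoc]
    refine (inSpan_a_c h α).bind_right ?_
    rintro _ (rfl | rfl) <;> rw [mul_assoc]
    exacts [hm.a.c_mul', hm.c.c_mul']
  b := by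
    rw [← mul_assoc]
    refine (inSpan_b_c h α).bind_right ?_
    rintro _ (rfl | rfl | rfl | rfl) <;> rw [mul_assoc]
    exacts [hm.b.c_mul', hm.a.c_mul', hm.d.c_mul', hm.c.c_mul']
  c := hm.c.c_mul'
  d := by
    rw [← mul_assoc]
    refine (inSpan_d_c h α).bind_right ?_
    rintro _ (rfl | rfl) <;> rw [mul_assoc]
    exacts [hm.d.c_mul', hm.c.c_mul']

theorem IsStable.D_mul {m : FreeAlgebra ℂ HGen} (hm : IsStable h α m) (w : ℂ) :
    IsStable h α (HWord.D w * m) where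
  a := by
    rw [← mul_assoc]
    refine (inSpan_a_D h α w).bind_right ?_
    rintro _ (rfl | rfl) <;> rw [mul_assoc]
    exacts [hm.a.D_mul' w, hm.c.D_mul' w]
  b := by
    rw [← mul_assoc]
    refine (inSpan_b_D h α w).bind_right ?_
    rintro _ (rfl | rfl | rfl | rfl) <;> rw [mul_assoc]
    exacts [hm.b.D_mul' w, hm.a.D_mul' w, hm.d.D_mul' w, hm.c.D_mul' w]
  c := by
    rw [← mul_assoc]
    refine (inSpan_c_D h α w).bind_right ?_
    rintro _ rfl
    rw [mul_assoc]
    exact hm.c.D_mul' w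
  d := by
    rw [← mul_assoc]
    refine (inSpan_d_D h α w).bind_right ?_
    rintro _ (rfl | rfl) <;> rw [mul_assoc]
    exacts [hm.d.D_mul' w, hm.c.D_mul' w]

/-- A factor d in front is absorbed by one a through the rule for d a. If there is no a left, the
result lies in the family with powers of d, which is why the two families of monomials are treated
together. -/
theorem isStable_a (h α : ℂ) (i j : ℕ) : IsStable h α (HWord.a ^ i * HWord.b ^ j) := by
  have hb := inSpan_b_mul (inSpan_a_c h α) (inSpan_a_D h α) (inSpan_b_a h α)
  have up {p} (hp : InSpan h α (normalWords HWord.a) p) : InSpan h α allNormalWords p :=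
    hp.trans fun s hs => .of_mem (Or.inl hs)
  refine ⟨?_, up (hb i j), up (inSpan_normal' h α _ i j).c_mul, ?_⟩
  · rw [← mul_assoc, ← pow_succ']
    exact up (inSpan_normal' h α _ (i + 1) j)
  · cases i with
    | zero =>
      have := inSpan_normal' h α HWord.d 1 j
      rw [pow_zero, one_mul]
      rw [pow_one] at this
      exact this.trans fun s hs => .of_mem (Or.inr hs)
    | succ i =>
      rw [pow_succ', mul_assoc, ← mul_assoc]
      refine up ((inSpan_d_a h α).bind_right ?_)
      rintro _ (rfl | rfl | rfl)
      · exact (inSpan_normal' h α _ i j).D_mul 1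
      · rw [mul_assoc]
        exact (hb i j).c_mul
      · rw [mul_assoc, ← mul_assoc HWord.a, ← pow_succ']
        exact (inSpan_normal' h α _ (i + 1) j).c_mul

theorem isStable_d (h α : ℂ) (i j : ℕ) : IsStable h α (HWord.d ^ i * HWord.b ^ j) := by
  have hb := inSpan_b_mul (inSpan_d_c h α) (inSpan_d_D h α) (inSpan_b_d h α)
  have up {p} (hp : InSpan h α (normalWords HWord.d) p) : InSpan h α allNormalWords p :=
    hp.trans fun s hs => .of_mem (Or.inr hs)
  refine ⟨?_, up (hb i j), up (inSpan_normal' h α _ i j).c_mul, ?_⟩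
  · cases i with
    | zero =>
      have := inSpan_normal' h α HWord.a 1 j
      rw [pow_zero, one_mul]
      rw [pow_one] at this
      exact this.trans fun s hs => .of_mem (Or.inl hs)
    | succ i =>
      rw [pow_succ', mul_assoc, ← mul_assoc]
      refine up ((inSpan_a_d h α).bind_right ?_)
      rintro _ (rfl | rfl | rfl)
      · exact (inSpan_normal' h α _ i j).D_mul 1
      · rw [mul_assoc]
        exact (hb i j).c_mul
      · rw [mul_assoc, ← mul_assoc HWord.d, ← pow_succ']
        exact (inSpan_normal' h α _ (i + 1) j).c_mul
  · rw [← mul_assoc, ← pow_succ']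
    exact up (inSpan_normal' h α _ (i + 1) j)

theorem isStable_of_mem {m : FreeAlgebra ℂ HGen} (hm : m ∈ allNormalWords) : IsStable h α m := by
  have key (m : FreeAlgebra ℂ HGen) (hm : IsStable h α m) (w : ℂ) (k : ℕ) :
      IsStable h α (D w * (HWord.c ^ k * m)) := by
    refine IsStable.D_mul ?_ w
    induction k with
    | zero => simpa using hm
    | succ k ih =>
      rw [pow_succ', mul_assoc]
      exact ih.c_mul
  rcases hm with ⟨w, k, i, j, rfl⟩ | ⟨w, k, i, j, rfl⟩
  · exact key _ (isStable_a h α i j) w k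
  · exact key _ (isStable_d h α i j) w k

theorem InSpan.mul_left (hp : InSpan h α allNormalWords p) (u : FreeAlgebra ℂ HGen) :
    InSpan h α allNormalWords (u * p) := by
  induction u generalizing p with
  | grade0 t => simpa [Algebra.algebraMap_eq_smul_one] using hp.smul t
  | grade1 g =>
    cases g with
    | a => exact hp.bind_left fun s hs => (isStable_of_mem hs).a
    | b => exact hp.bind_left fun s hs => (isStable_of_mem hs).b
    | c => exact hp.bind_left fun s hs => (isStable_of_mem hs).c
    | d => exact hp.bind_left fun s hs => (isStable_of_mem hs).d
    | D w => exact hp.D_mul' w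
  | mul u u' ih ih' =>
    rw [mul_assoc]
    exact ih (ih' hp)
  | add u u' ih ih' =>
    rw [add_mul]
    exact (ih hp).add (ih' hp)

/-- Every word is in the span of the normal monomials. -/
theorem inSpan_allNormalWords (h α : ℂ) (p : FreeAlgebra ℂ HGen) :
    InSpan h α allNormalWords p := by
  have h1 : InSpan h α allNormalWords 1 :=
    (inSpan_one h α).trans fun s hs => .of_mem (Or.inl ⟨0, 0, 0, 0, by simpa using hs⟩)
  simpa using h1.mul_left p

end Stable

end Normal

end Jordanian

namespace Jordanian

/-! ### A representation of the standard quantum group -/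

section Rep

/-- The space of the representation: coefficients of `D ^ w c ^ k a ^ i b ^ j`. -/
abbrev RepSpace : Type := ℂ → ℤ → ℤ → ℤ → ℂ

variable (q α : ℂ)

/-- The action of `D ^ w`. -/
def repD (w₀ : ℂ) : Module.End ℂ RepSpace where
  toFun f := fun w k i j => f (w - w₀) k i j
  map_add' _ _ := rfl
  map_smul' _ _ := rfl

/-- The action of `c`. -/
noncomputable def repC : Module.End ℂ RepSpace where
  toFun f := fun w k i j => q ^ (-(2 * α * w)) * f w (k - 1) i j
  map_add' _ _ := by ext; simp [mul_add]
  map_smul' _ _ := by ext; simp [mul_left_comm]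

/-- The action of `a`. -/
noncomputable def repA : Module.End ℂ RepSpace where
  toFun f := fun w k i j => q ^ ((α - 1) * k) * f w k (i - 1) j
  map_add' _ _ := by ext; simp [mul_add]
  map_smul' _ _ := by ext; simp [mul_left_comm]

/-- The action of `a⁻¹`. -/
noncomputable def repAinv : Module.End ℂ RepSpace where
  toFun f := fun w k i j => q ^ (-((α - 1) * k)) * f w k (i + 1) j
  map_add' _ _ := by ext; simp [mul_add]
  map_smul' _ _ := by ext; simp [mul_left_comm]

/-- The action of `b`. -/
noncomputable def repB : Module.End ℂ RepSpace where
  toFun f := fun w k i j => q ^ (2 * α * w + 2 * α * k + (α + 1) * i) * f w k i (j - 1)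
  map_add' _ _ := by ext; simp [mul_add]
  map_smul' _ _ := by ext; simp [mul_left_comm]

/-- The action of `d`. -/
noncomputable def repDd : Module.End ℂ RepSpace where
  toFun f := fun w k i j => q ^ (-((α - 1) * k)) * f (w - 1) k (i + 1) j +
    q ^ ((α + 1) * k + (α + 1) * i) * f w (k - 1) (i + 1) (j - 1)
  map_add' _ _ := by ext; simp only [Pi.add_apply]; ring
  map_smul' _ _ := by ext; simp only [Pi.smul_apply, smul_eq_mul, RingHom.id_apply]; ring

/-- The actions of the generators. -/
noncomputable def repGen : QGen → Module.End ℂ RepSpace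
  | QGen.a => repA q α
  | QGen.ainv => repAinv q α
  | QGen.b => repB q α
  | QGen.c => repC q α
  | QGen.d => repDd q α
  | QGen.D w => repD w

variable {q}

theorem inv_eq_cpow (q : ℂ) : q⁻¹ = q ^ (-1 : ℂ) := (Complex.cpow_neg_one q).symm

theorem repGen_rel (hq : q ≠ 0) {x y : FreeAlgebra ℂ QGen} (hxy : QRel q α x y) :
    FreeAlgebra.lift ℂ (repGen q α) x = FreeAlgebra.lift ℂ (repGen q α) y := by
  have E (s t : ℂ) : q ^ s * q ^ t = q ^ (s + t) := (Complex.cpow_add _ _ hq).symm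
  have E' (s t u : ℂ) : q ^ s * (q ^ t * u) = q ^ (s + t) * u := by rw [← mul_assoc, E]
  have e0 : q ^ (0 : ℂ) = 1 := Complex.cpow_zero q
  -- The operators are left multiplications on formal combinations of D^w c^k a^i b^j with i of
  -- either sign, d being a⁻¹D plus a multiple of c a⁻¹ b. Each relation becomes an identity between
  -- powers of q with the same argument of f.
  cases hxy <;> simp only [map_mul, map_sub, map_smul, map_one, FreeAlgebra.lift_ι_apply, repGen] <;>
    ext f w k i j <;>
    simp only [repA, repAinv, repB, repC, repDd, repD, Module.End.mul_apply, LinearMap.coe_mk,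
      AddHom.coe_mk, LinearMap.smul_apply, LinearMap.sub_apply, Pi.smul_apply, Pi.sub_apply,
      smul_eq_mul, Module.End.one_apply, inv_eq_cpow q, E, E', mul_add]
  all_goals try (push_cast; ring_nf; done)
  all_goals simp only [sub_add_cancel, add_sub_cancel_right, add_neg_cancel, neg_add_cancel, e0,
    one_mul]
  -- The commutator of a and d: the D-terms cancel, and the coefficients of c b differ by q⁻¹ - q up
  -- to a common power.
  · have e1 : (α - 1) * (k : ℂ) + ((α + 1) * k + (α + 1) * ((i - 1 : ℤ) : ℂ)) =
        -1 + (-α + (2 * α * w + 2 * α * k + (α + 1) * i + -(2 * α * w))) := by push_cast; ring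
    have e2 : (α + 1) * (k : ℂ) + (α + 1) * i + (α - 1) * ((k - 1 : ℤ) : ℂ) =
        1 + (-α + (2 * α * w + 2 * α * k + (α + 1) * i + -(2 * α * w))) := by push_cast; ring
    rw [e1, e2, ← E, ← E 1, Complex.cpow_one, ← E (-α)]
    ring
  -- The determinant relation: the c b part of a d is q⁻¹λ⁻¹ b c.
  · have e1 : (α - 1) * (k : ℂ) + ((α + 1) * k + (α + 1) * ((i - 1 : ℤ) : ℂ)) =
        -1 + -α + (2 * α * w + 2 * α * k + (α + 1) * i + -(2 * α * w)) := by push_cast; ring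
    rw [e1]
    ring

/-- The representation. -/
noncomputable def rep (hq : q ≠ 0) : FunQ q α →ₐ[ℂ] Module.End ℂ RepSpace :=
  RingQuot.liftAlgHom ℂ ⟨FreeAlgebra.lift ℂ (repGen q α), fun _ _ hxy => repGen_rel α hq hxy⟩

theorem rep_gen (hq : q ≠ 0) (g : QGen) : rep α hq (FunQ.gen q α g) = repGen q α g := by
  rw [rep, FunQ.gen, RingQuot.liftAlgHom_mkAlgHom_apply, FreeAlgebra.lift_ι_apply]

/-- The vector has a nonzero coordinate at the given place, and the other nonzero coordinates have
a smaller value of `j - 2 k`. -/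
def IsLead (f : RepSpace) (w : ℂ) (k i j : ℤ) : Prop :=
  f w k i j ≠ 0 ∧ ∀ w' k' i' j', j - 2 * k ≤ j' - 2 * k' →
    ¬(w' = w ∧ k' = k ∧ i' = i ∧ j' = j) → f w' k' i' j' = 0

variable {α} {f : RepSpace} {w : ℂ} {k i j : ℤ}

theorem cpow_ne_zero' (hq : q ≠ 0) (s : ℂ) : q ^ s ≠ 0 :=
  Complex.cpow_ne_zero_iff.2 (Or.inl hq)

theorem IsLead.repD (hf : IsLead f w k i j) (w₀ : ℂ) : IsLead (repD w₀ f) (w + w₀) k i j := by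
  simp only [Jordanian.repD, LinearMap.coe_mk, AddHom.coe_mk]
  refine ⟨by simpa using hf.1, fun w' k' i' j' hr hne => hf.2 _ _ _ _ hr fun e => hne ?_⟩
  exact ⟨sub_eq_iff_eq_add.1 e.1, e.2⟩

theorem IsLead.repC (hq : q ≠ 0) (hf : IsLead f w k i j) :
    IsLead (repC q α f) w (k + 1) i j := by
  simp only [Jordanian.repC, LinearMap.coe_mk, AddHom.coe_mk]
  refine ⟨by simpa [cpow_ne_zero' hq] using hf.1, fun w' k' i' j' hr hne => ?_⟩
  change q ^ (-(2 * α * w')) * f w' (k' - 1) i' j' = 0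
  rw [hf.2 _ _ _ _ (by omega) (fun e => hne ⟨e.1, by omega, e.2.2⟩), mul_zero]

/-- With degree j - 2k, multiplication by a preserves the degree and c lowers it by 2, so the
correction -ηc cannot reach the leading coordinate. -/
theorem IsLead.ta (hq : q ≠ 0) (η : ℂ) (hf : IsLead f w k i j) :
    IsLead ((repA q α - η • Jordanian.repC q α) f) w k (i + 1) j := by
  simp only [Jordanian.repC, repA, LinearMap.coe_mk, AddHom.coe_mk, LinearMap.sub_apply,
    LinearMap.smul_apply]
  refine ⟨?_, fun w' k' i' j' hr hne => ?_⟩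
  · simp only [Pi.sub_apply, Pi.smul_apply]
    rw [hf.2 w (k - 1) (i + 1) j (by omega) (by omega)]
    simpa [cpow_ne_zero' hq] using hf.1
  · simp only [Pi.sub_apply, Pi.smul_apply]
    rw [hf.2 _ (k' - 1) _ _ (by omega) (by omega),
      hf.2 _ _ (i' - 1) _ (by omega) (fun e => hne ⟨e.1, e.2.1, by omega, e.2.2.2⟩)]
    simp

/-- The leading part of d is a⁻¹D, of degree 0; c a⁻¹ b has degree -1 and c has degree -2. -/
theorem IsLead.td (hq : q ≠ 0) (η : ℂ) (hf : IsLead f w k i j) :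
    IsLead ((repDd q α + η • Jordanian.repC q α) f) (w + 1) k (i - 1) j := by
  simp only [Jordanian.repC, repDd, LinearMap.coe_mk, AddHom.coe_mk, LinearMap.add_apply,
    LinearMap.smul_apply]
  refine ⟨?_, fun w' k' i' j' hr hne => ?_⟩
  · simp only [Pi.add_apply, Pi.smul_apply]
    rw [hf.2 _ (k - 1) (i - 1) j (by omega) (by omega),
      hf.2 _ (k - 1) _ (j - 1) (by omega) (by omega)]
    simpa [cpow_ne_zero' hq] using hf.1
  · simp only [Pi.add_apply, Pi.smul_apply]
    rw [hf.2 _ (k' - 1) _ j' (by omega) (by omega), hf.2 _ (k' - 1) _ (j' - 1) (by omega) (by omega),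
      hf.2 _ _ (i' + 1) _ (by omega)
        (fun e => hne ⟨sub_eq_iff_eq_add.1 e.1, e.2.1, by omega, e.2.2.2⟩)]
    simp

/-- Only b raises the degree j - 2k; a, d and c do not. -/
theorem IsLead.tb (hq : q ≠ 0) (η : ℂ) (hf : IsLead f w k i j) :
    IsLead ((repB q α + η • repA q α - η • repDd q α - (η * η) • Jordanian.repC q α) f) w k i
      (j + 1) := by
  simp only [Jordanian.repC, repDd, repA, repB, LinearMap.coe_mk, AddHom.coe_mk,
    LinearMap.add_apply, LinearMap.sub_apply, LinearMap.smul_apply]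
  refine ⟨?_, fun w' k' i' j' hr hne => ?_⟩
  · simp only [Pi.add_apply, Pi.sub_apply, Pi.smul_apply]
    rw [hf.2 _ k (i - 1) (j + 1) (by omega) (by omega), hf.2 _ k (i + 1) (j + 1) (by omega) (by omega),
      hf.2 _ (k - 1) (i + 1) (j + 1 - 1) (by omega) (by omega),
      hf.2 _ (k - 1) i (j + 1) (by omega) (by omega)]
    simpa [cpow_ne_zero' hq] using hf.1
  · simp only [Pi.add_apply, Pi.sub_apply, Pi.smul_apply]
    rw [hf.2 _ k' (i' - 1) j' (by omega) (by omega), hf.2 _ k' (i' + 1) j' (by omega) (by omega),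
      hf.2 _ (k' - 1) (i' + 1) (j' - 1) (by omega) (by omega),
      hf.2 _ (k' - 1) i' j' (by omega) (by omega),
      hf.2 _ _ _ (j' - 1) (by omega) (fun e => hne ⟨e.1, e.2.1, e.2.2.1, by omega⟩)]
    simp

/-- The vacuum vector. -/
noncomputable def vacuum : RepSpace := fun w k i j =>
  open Classical in if w = 0 ∧ k = 0 ∧ i = 0 ∧ j = 0 then 1 else 0

theorem isLead_vacuum : IsLead vacuum 0 0 0 0 := by
  refine ⟨by simp [vacuum], fun w k i j _ hne => ?_⟩
  simp only [vacuum, if_neg hne]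

/-- The powers `a ^ i` for `0 ≤ i` and `d ^ (-i)` for `i < 0`. -/
noncomputable def diagPow : ℤ → FreeAlgebra ℂ HGen
  | Int.ofNat n => HWord.a ^ n
  | Int.negSucc n => HWord.d ^ (n + 1)

/-- The normal monomials, with their indices. -/
noncomputable def normalWord (μ : ℂ × ℕ × ℤ × ℕ) : FreeAlgebra ℂ HGen :=
  HWord.D μ.1 * (HWord.c ^ μ.2.1 * (diagPow μ.2.2.1 * HWord.b ^ μ.2.2.2))

theorem allNormalWords_subset : allNormalWords ⊆ Set.range normalWord := by
  rintro _ (⟨w, k, i, j, rfl⟩ | ⟨w, k, i, j, rfl⟩)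
  · exact ⟨(w, k, Int.ofNat i, j), rfl⟩
  · cases i with
    | zero => exact ⟨(w, k, Int.ofNat 0, j), by simp [normalWord, diagPow]⟩
    | succ i => exact ⟨(w, k, Int.negSucc i, j), rfl⟩

/-- The power of the determinant in the leading term of a normal monomial. -/
def detShift : ℤ → ℕ
  | Int.ofNat _ => 0
  | Int.negSucc n => n + 1

/-- The value of a word in the representation. -/
noncomputable def repTilde (h α : ℂ) {q : ℂ} (hq : q ≠ 0) : FreeAlgebra ℂ HGen →ₐ[ℂ] Module.End ℂ RepSpace :=
  (rep α hq).comp (evalTilde h q α)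

/-- The letters are applied to the vacuum from right to left, each shifting the leading index. A
letter d contributes a⁻¹D, so the determinant exponent is shifted by the number of letters d. -/
theorem isLead_normalWord (h α : ℂ) {q : ℂ} (hq : q ≠ 0) (hq' : q - q⁻¹ ≠ 0) (μ : ℂ × ℕ × ℤ × ℕ) :
    IsLead (repTilde h α hq (normalWord μ) vacuum) (μ.1 + detShift μ.2.2.1) μ.2.1 μ.2.2.1
      μ.2.2.2 := by
  obtain ⟨w, k, i, j⟩ := μ
  obtain ⟨e1, e2, e3, e4, e5⟩ := evalTilde_gen h α hq'
  have ea : repTilde h α hq HWord.a = repA q α - (h / (q - 1)) • repC q α := by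
    simp only [repTilde, AlgHom.comp_apply, e1, FunQ.ta, map_sub, map_smul, rep_gen, repGen]
  have eb : repTilde h α hq HWord.b = repB q α + (h / (q - 1)) • repA q α -
      (h / (q - 1)) • repDd q α - (h / (q - 1) * (h / (q - 1))) • repC q α := by
    simp only [repTilde, AlgHom.comp_apply, e2, FunQ.tb, map_sub, map_add, map_smul, rep_gen, repGen]
  have ec : repTilde h α hq HWord.c = repC q α := by
    simp only [repTilde, AlgHom.comp_apply, e3, rep_gen, repGen]
  have ed : repTilde h α hq HWord.d = repDd q α + (h / (q - 1)) • repC q α := by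
    simp only [repTilde, AlgHom.comp_apply, e4, FunQ.td, map_add, map_smul, rep_gen, repGen]
  have eD : repTilde h α hq (HWord.D w) = repD w := by
    simp only [repTilde, AlgHom.comp_apply, e5, rep_gen, repGen]
  have hb : ∀ j : ℕ, IsLead ((repTilde h α hq HWord.b ^ j) vacuum) 0 0 0 j := by
    intro j
    induction j with
    | zero => simpa using isLead_vacuum
    | succ j ih =>
      rw [pow_succ', Module.End.mul_apply, Nat.cast_succ]
      nth_rewrite 1 [eb]
      exact ih.tb hq _
  have hd : IsLead (repTilde h α hq (diagPow i) ((repTilde h α hq HWord.b ^ j) vacuum))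
      (detShift i) 0 i j := by
    cases i with
    | ofNat n =>
      simp only [diagPow, detShift, map_pow]
      induction n with
      | zero => simpa using hb j
      | succ n ih =>
        rw [pow_succ', Module.End.mul_apply]
        nth_rewrite 1 [ea]
        exact ih.ta hq _
    | negSucc n =>
      simp only [diagPow, detShift, map_pow]
      induction n with
      | zero =>
        have := (hb j).td (α := α) hq (h / (q - 1))
        rw [← ed] at this
        simpa using this
      | succ n ih =>
        rw [pow_succ', Module.End.mul_apply]
        nth_rewrite 1 [ed]
        have := ih.td (α := α) hq (h / (q - 1))
        rw [Nat.cast_succ]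
        exact this
  have hc : IsLead ((repTilde h α hq HWord.c ^ k)
      (repTilde h α hq (diagPow i) ((repTilde h α hq HWord.b ^ j) vacuum))) (detShift i) k i j := by
    induction k with
    | zero => simpa using hd
    | succ k ih =>
      rw [pow_succ', Module.End.mul_apply, Nat.cast_succ]
      nth_rewrite 1 [ec]
      exact ih.repC hq
  have := hc.repD w
  rw [← eD] at this
  simpa [normalWord, add_comm w] using this

theorem detShift_lead_injective (μ ν : ℂ × ℕ × ℤ × ℕ)
    (hw : μ.1 + detShift μ.2.2.1 = ν.1 + detShift ν.2.2.1) (hk : (μ.2.1 : ℤ) = ν.2.1)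
    (hi : μ.2.2.1 = ν.2.2.1) (hj : (μ.2.2.2 : ℤ) = ν.2.2.2) : μ = ν := by
  obtain ⟨w, k, i, j⟩ := μ
  obtain ⟨w', k', i', j'⟩ := ν
  simp only at hw hk hi hj
  subst hi
  simp_all

/-- In a nontrivial relation choose a monomial of maximal j - 2k and look at its leading coordinate.
The other monomials vanish there: their degrees are not larger and their leading indices are
different. -/
theorem normalWord_linearIndependent (h α : ℂ) {q : ℂ} (hq : q ≠ 0) (hq' : q - q⁻¹ ≠ 0)
    (F : (ℂ × ℕ × ℤ × ℕ) →₀ ℂ)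
    (hF : Finsupp.linearCombination ℂ (fun μ => evalTilde h q α (normalWord μ)) F = 0) : F = 0 := by
  by_contra hne
  have hs : F.support.Nonempty := Finsupp.support_nonempty_iff.2 hne
  obtain ⟨μ, hμ, hmax⟩ := F.support.exists_max_image
    (fun μ => (μ.2.2.2 : ℤ) - 2 * (μ.2.1 : ℤ)) hs
  have h1 : Finsupp.linearCombination ℂ (fun ν => repTilde h α hq (normalWord ν) vacuum) F = 0 := by
    have := congrArg (fun x => rep α hq x vacuum) hF
    simp only [Finsupp.linearCombination_apply, Finsupp.sum, map_sum, map_smul, map_zero,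
      LinearMap.sum_apply, LinearMap.smul_apply, LinearMap.zero_apply] at this ⊢
    exact this
  have h2 := congrFun (congrFun (congrFun (congrFun h1 (μ.1 + detShift μ.2.2.1)) μ.2.1) μ.2.2.1)
    μ.2.2.2
  rw [Finsupp.linearCombination_apply, Finsupp.sum] at h2
  simp only [Finset.sum_apply, Pi.smul_apply, Pi.zero_apply] at h2
  rw [Finset.sum_eq_single μ] at h2
  · rcases smul_eq_zero.1 h2 with h3 | h3
    · exact Finsupp.mem_support_iff.1 hμ h3
    · exact (isLead_normalWord h α hq hq' μ).1 h3
  · intro ν hν hνμ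
    rw [(isLead_normalWord h α hq hq' ν).2 _ _ _ _ (hmax ν hν) fun e => hνμ ?_, smul_zero]
    exact (detShift_lead_injective _ _ e.1 e.2.1 e.2.2.1 e.2.2.2).symm
  · exact fun hμ' => absurd hμ hμ'

end Rep

/-! ### Uniqueness of limits. -/

section Unique

variable {h α : ℂ}

theorem LimSpan.exists_coeff {x : (q : ℂ) → FunQ q α} {y : FunH h α}
    (hx : LimSpan h α allNormalWords x y) :
    ∃ (F : ℂ → (ℂ × ℕ × ℤ × ℕ) →₀ ℂ) (L : (ℂ × ℕ × ℤ × ℕ) →₀ ℂ),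
      (∀ μ, Tendsto (fun q => F q μ) (𝓝[≠] 1) (𝓝 (L μ))) ∧
      (∀ᶠ q in 𝓝[≠] (1 : ℂ),
        x q = Finsupp.linearCombination ℂ (fun μ => evalTilde h q α (normalWord μ)) (F q)) ∧
      y = Finsupp.linearCombination ℂ (fun μ => evalH h α (normalWord μ)) L := by
  classical
  induction hx with
  | zero => exact ⟨fun _ => 0, 0, by simp, by simp, by simp⟩
  | add _ _ ih1 ih2 =>
    obtain ⟨F, L, h1, h2, rfl⟩ := ih1
    obtain ⟨F', L', h1', h2', rfl⟩ := ih2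
    refine ⟨fun q => F q + F' q, L + L', fun μ => (h1 μ).add (h1' μ), ?_, by rw [map_add]⟩
    filter_upwards [h2, h2'] with q e e'
    rw [e, e', map_add]
  | @word p hp f l hf =>
    obtain ⟨μ, rfl⟩ := allNormalWords_subset hp
    refine ⟨fun q => Finsupp.single μ (f q), Finsupp.single μ l, fun ν => ?_, by simp, by simp⟩
    by_cases hν : μ = ν
    · simpa [hν] using hf
    · simp [hν]
  | congr hx _ ih =>
    obtain ⟨F, L, h1, h2, h3⟩ := ih
    refine ⟨F, L, h1, ?_, h3⟩
    filter_upwards [hx, h2] with q e e'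
    rw [e, e']

/-- Expanded in ordered monomials, the zero family has zero coefficients for q near 1 by
independence in the standard algebra. Their limits are therefore 0, and these limits are the
coefficients of y. -/
theorem LimSpan.eq_zero {y : FunH h α} (hx : LimSpan h α Set.univ (fun _ => 0) y) : y = 0 := by
  have hx' : LimSpan h α allNormalWords (fun _ => 0) y :=
    hx.trans fun p _ => inSpan_allNormalWords h α p
  obtain ⟨F, L, h1, h2, rfl⟩ := hx'.exists_coeff
  have hF : ∀ᶠ q in 𝓝[≠] (1 : ℂ), F q = 0 := by
    filter_upwards [h2, eventually_good] with q e hq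
    exact normalWord_linearIndependent h α hq.1 hq.2 _ e.symm
  have hL : L = 0 := by
    ext μ
    refine tendsto_nhds_unique (h1 μ) ?_
    refine tendsto_const_nhds.congr' ?_
    filter_upwards [hF] with q e
    rw [e]
  rw [hL, map_zero]

/-- Limits are unique. -/
theorem LimSpan.unique {x : (q : ℂ) → FunQ q α} {y y' : FunH h α}
    (hx : LimSpan h α Set.univ x y) (hx' : LimSpan h α Set.univ x y') : y = y' := by
  have := hx.sub hx'
  simp only [sub_self] at this
  exact sub_eq_zero.1 this.eq_zero

end Unique

end Jordanian

namespace Jordanian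

/-! ### The Gauss decomposition and fusion in the standard quantum group -/

section QNumbers

/-- `[m]_q` for integers `m`. -/
noncomputable def qInt (q : ℂ) (m : ℤ) : ℂ := (q ^ m - q ^ (-m)) / (q - q⁻¹)

/-- `[m]_q!`, and `1` for negative `m`. -/
noncomputable def qFac (q : ℂ) (m : ℤ) : ℂ := qBracketFactorial q m.toNat

/-- `1 / [m]_q!`, and `0` for negative `m`. -/
noncomputable def qFacInv (q : ℂ) (m : ℤ) : ℂ := if 0 ≤ m then (qBracketFactorial q m.toNat)⁻¹ else 0

/-- The quantum numbers up to `N` do not vanish. -/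
def QGood (q : ℂ) (N : ℕ) : Prop := q ≠ 0 ∧ q - q⁻¹ ≠ 0 ∧ ∀ m < N, qBracket q (m + 1) ≠ 0

theorem QGood.mono {q : ℂ} {N N' : ℕ} (hq : QGood q N) (hN : N' ≤ N) : QGood q N' :=
  ⟨hq.1, hq.2.1, fun m hm => hq.2.2 m (by omega)⟩

variable {q : ℂ}

theorem qInt_natCast (m : ℕ) : qInt q m = qBracket q m := by
  simp [qInt, qBracket]

theorem qInt_zero : qInt q 0 = 0 := by simp [qInt]

/-- The only identity of quantum numbers behind the fusion relations, besides the recursion of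
factorials. -/
theorem qInt_add (hq : q ≠ 0) (a b : ℤ) : qInt q (a + b) = qInt q a * q ^ b + qInt q b * q ^ (-a) := by
  simp only [qInt, neg_add, zpow_add₀ hq, zpow_neg]
  ring

theorem qBracketFactorial_succ (m : ℕ) :
    qBracketFactorial q (m + 1) = qBracketFactorial q m * qBracket q (m + 1) := by
  rw [qBracketFactorial, Finset.prod_range_succ, ← qBracketFactorial]

theorem qFac_add_one {m : ℤ} (hm : 0 ≤ m) : qFac q (m + 1) = qInt q (m + 1) * qFac q m := by
  obtain ⟨m, rfl⟩ := Int.eq_ofNat_of_zero_le hm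
  have h1 : ((m : ℤ) + 1).toNat = m + 1 := by omega
  have h2 := qInt_natCast (q := q) (m + 1)
  push_cast at h2
  rw [qFac, qFac, h1, qBracketFactorial_succ, h2, Int.toNat_natCast, mul_comm]

/-- This convention makes out-of-range coefficients vanish, so that sums can be shifted and extended
without boundary cases. -/
theorem qFacInv_of_neg {m : ℤ} (hm : m < 0) : qFacInv q m = 0 := if_neg (by omega)

theorem qFacInv_sub_one {N : ℕ} (hq : QGood q N) {m : ℤ} (hm : m ≤ N) :
    qFacInv q (m - 1) = qInt q m * qFacInv q m := by
  rcases lt_trichotomy m 0 with h | rfl | h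
  · rw [qFacInv_of_neg h, qFacInv_of_neg (by omega), mul_zero]
  · rw [qFacInv_of_neg (by omega), qInt_zero, zero_mul]
  · obtain ⟨m, rfl⟩ : ∃ k : ℕ, m = k + 1 := ⟨(m - 1).toNat, by omega⟩
    have h1 : ((m : ℤ) + 1).toNat = m + 1 := by omega
    have h2 := qInt_natCast (q := q) (m + 1)
    push_cast at h2
    have h3 := hq.2.2 m (by omega)
    rw [qFacInv, qFacInv, if_pos (by omega), if_pos (by omega), add_sub_cancel_right,
      Int.toNat_natCast, h1, qBracketFactorial_succ, h2]
    field_simp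

/-- The coefficients of the Gauss decomposition. -/
noncomputable def gaussCoeff (p q : ℂ) (n i k s : ℤ) : ℂ :=
  p ^ ((k - i) * (n - 2 * s - 1)) * (qFac q k * qFac q (n - s) * qFacInv q (n - k)) *
    (qFacInv q s * qFacInv q (k - s) * qFacInv q (i - s))

variable {p : ℂ} {n i k s : ℤ}

theorem gaussCoeff_of_lt_left (hs : k < s) : gaussCoeff p q n i k s = 0 := by
  rw [gaussCoeff, qFacInv_of_neg (m := k - s) (by omega)]
  ring

theorem gaussCoeff_of_lt_right (hs : i < s) : gaussCoeff p q n i k s = 0 := by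
  rw [gaussCoeff, qFacInv_of_neg (m := i - s) (by omega)]
  ring

theorem gaussCoeff_of_neg (hs : s < 0) : gaussCoeff p q n i k s = 0 := by
  rw [gaussCoeff, qFacInv_of_neg (m := s) (by omega)]
  ring

/-- After cancelling factorials this is [n+1-s] = [n+1-i] q^(i-s) + [i-s] q^(-(n+1-i)), multiplied
by a common power of p = q^(1/2). -/
theorem gaussCoeff_mul_x {N : ℕ} (hq : QGood q N) (hp : p ^ 2 = q) (hn : n + 1 ≤ N) (hk : k ≤ n)
    (hk0 : 0 ≤ k) (hi : i ≤ n + 1) (hs : 0 ≤ s) :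
    gaussCoeff p q (n + 1) i k s * (qInt q (n + 1 - k) * p ^ k) =
      qInt q (n + 1 - i) * p ^ i * (q ^ (k - s) * gaussCoeff p q n i k s) +
      p ^ (-(n + 1 - i)) * (q ^ (-(n - 2 * s) + (k - s)) * gaussCoeff p q n (i - 1) k s) := by
  have hp0 : p ≠ 0 := by rintro rfl; exact hq.1 (by rw [← hp]; simp)
  rcases lt_or_ge k s with hks | hks
  · simp only [gaussCoeff_of_lt_left hks]
    ring
  have e1 : qFac q (n + 1 - s) = qInt q (n + 1 - s) * qFac q (n - s) := by
    have := qFac_add_one (q := q) (m := n - s) (by omega)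
    rwa [show n - s + 1 = n + 1 - s by ring] at this
  have e2 : qFacInv q (n - k) = qInt q (n + 1 - k) * qFacInv q (n + 1 - k) := by
    have := qFacInv_sub_one hq (m := n + 1 - k) (by omega)
    rwa [show n + 1 - k - 1 = n - k by ring] at this
  have e3 : qFacInv q (i - 1 - s) = qInt q (i - s) * qFacInv q (i - s) := by
    have := qFacInv_sub_one hq (m := i - s) (by omega)
    rwa [show i - s - 1 = i - 1 - s by ring] at this
  have e4 := qInt_add hq.1 (n + 1 - i) (i - s)
  rw [show n + 1 - i + (i - s) = n + 1 - s by ring] at e4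
  simp only [gaussCoeff]
  rw [e1, e2, e3, e4]
  have Q (m : ℤ) : q ^ m = p ^ (2 * m) := by
    rw [← hp, ← zpow_natCast, ← zpow_mul]; rfl
  simp only [Q]
  have P (a b : ℤ) : p ^ a * p ^ b = p ^ (a + b) := (zpow_add₀ hp0 _ _).symm
  set u := p ^ ((k - i) * (n - 2 * s - 1) + (2 * k - i)) with hu
  have w1 : p ^ ((k - i) * (n + 1 - 2 * s - 1)) * p ^ k = u := by
    rw [P, hu]; congr 1; ring
  have w2 : p ^ i * (p ^ ((2 : ℤ) * (k - s)) * p ^ ((k - i) * (n - 2 * s - 1))) =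
      u * p ^ ((2 : ℤ) * (i - s)) := by
    rw [P, P, hu, P]; congr 1; ring
  have w3 : p ^ (-(n + 1 - i)) * (p ^ ((2 : ℤ) * (-(n - 2 * s) + (k - s))) *
      p ^ ((k - (i - 1)) * (n - 2 * s - 1))) = u * p ^ ((2 : ℤ) * (-(n + 1 - i))) := by
    rw [P, P, hu, P]; congr 1; ring
  linear_combination (qFac q k * qFac q (n - s) * qFacInv q (n + 1 - k) * qInt q (n + 1 - k) *
    qFacInv q s * qFacInv q (k - s) * qFacInv q (i - s)) *
    ((qInt q (n + 1 - i) * p ^ (2 * (i - s)) + qInt q (i - s) * p ^ (2 * (-(n + 1 - i)))) * w1 -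
      qInt q (n + 1 - i) * w2 - qInt q (i - s) * w3)

/-- The first two terms on the right are the sum already found for x. What remains is [k+1] =
[k+1-s] q^s + [s] q^(-(k+1-s)), the last term coming from A⁻¹, which lowers s by one. -/
theorem gaussCoeff_mul_y {N : ℕ} (hq : QGood q N) (hp : p ^ 2 = q) (hn : n + 1 ≤ N) (hk : k ≤ n)
    (hk0 : 0 ≤ k) (hi : i ≤ n + 1) (hs : 0 ≤ s) :
    gaussCoeff p q (n + 1) i (k + 1) s * p ^ (-(n - k)) =
      qInt q (n + 1 - i) * p ^ i * (q ^ (k - s) * gaussCoeff p q n i k s) +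
      p ^ (-(n + 1 - i)) * (q ^ (-(n - 2 * s) + (k - s)) * gaussCoeff p q n (i - 1) k s) +
      p ^ (-(n + 1 - i)) * (q ^ (-(k - (s - 1))) * gaussCoeff p q n (i - 1) k (s - 1)) := by
  have hp0 : p ≠ 0 := by rintro rfl; exact hq.1 (by rw [← hp]; simp)
  rcases lt_or_ge (k + 1) s with hks | hks
  · rw [gaussCoeff_of_lt_left hks, gaussCoeff_of_lt_left (by omega), gaussCoeff_of_lt_left (by omega),
      gaussCoeff_of_lt_left (by omega)]
    ring
  rw [← gaussCoeff_mul_x hq hp hn hk hk0 hi hs]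
  have e1 : qFac q (n - (s - 1)) = qFac q (n + 1 - s) := by
    congr 1; ring
  have e2 : qFacInv q (n - k) = qInt q (n + 1 - k) * qFacInv q (n + 1 - k) := by
    have := qFacInv_sub_one hq (m := n + 1 - k) (by omega)
    rwa [show n + 1 - k - 1 = n - k by ring] at this
  have e3 : qFacInv q (k - s) = qInt q (k + 1 - s) * qFacInv q (k + 1 - s) := by
    have := qFacInv_sub_one hq (m := k + 1 - s) (by omega)
    rwa [show k + 1 - s - 1 = k - s by ring] at this
  have e4 := qInt_add hq.1 (k + 1 - s) s
  rw [show k + 1 - s + s = k + 1 by ring] at e4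
  have e5 := qFacInv_sub_one hq (m := s) (by omega)
  have e6 := qFac_add_one (q := q) hk0
  simp only [gaussCoeff]
  rw [e1, show n + 1 - (k + 1) = n - k by ring, show k - (s - 1) = k + 1 - s by ring,
    show i - 1 - (s - 1) = i - s by ring, e2, e3, e5, e6, e4]
  have Q (m : ℤ) : q ^ m = p ^ (2 * m) := by
    rw [← hp, ← zpow_natCast, ← zpow_mul]; rfl
  simp only [Q]
  have P (a b : ℤ) : p ^ a * p ^ b = p ^ (a + b) := (zpow_add₀ hp0 _ _).symm
  set u := p ^ ((k - i) * (n - 2 * s) + k) with hu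
  have w1 : p ^ ((k + 1 - i) * (n + 1 - 2 * s - 1)) * p ^ (-(n - k)) * p ^ (2 * s) = u := by
    rw [P, P, hu]; congr 1; ring
  have w2 : p ^ ((k - i) * (n + 1 - 2 * s - 1)) * p ^ k = u := by
    rw [P, hu]; congr 1; ring
  have w3 : p ^ (-(n + 1 - i)) * (p ^ (2 * -(k + 1 - s)) *
      p ^ ((k - (i - 1)) * (n - 2 * (s - 1) - 1))) =
      p ^ ((k + 1 - i) * (n + 1 - 2 * s - 1)) * p ^ (-(n - k)) * p ^ (2 * -(k + 1 - s)) := by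
    rw [P, P, P, P]; congr 1; ring
  linear_combination (qFac q k * qFac q (n + 1 - s) * qFacInv q (n + 1 - k) * qInt q (n + 1 - k) *
    qFacInv q s * qFacInv q (k + 1 - s) * qFacInv q (i - s)) *
    (qInt q (k + 1 - s) * (w1 - w2) - qInt q s * w3)

end QNumbers

end Jordanian

namespace Jordanian

/-- Multiplication by the highest weight vector, `q`-deformed. -/
noncomputable def qMulX (p q : ℂ) (n : ℕ) : Matrix (Fin (n + 1 + 1)) (Fin (n + 1)) ℂ :=
  Matrix.of fun i k => if (i : ℕ) = k then qInt q (n + 1 - (k : ℕ)) * p ^ ((k : ℕ) : ℤ) else 0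

/-- Multiplication by the lowest weight vector, `q`-deformed. -/
noncomputable def qMulY (p : ℂ) (n : ℕ) : Matrix (Fin (n + 1 + 1)) (Fin (n + 1)) ℂ :=
  Matrix.of fun i k => if (i : ℕ) = k + 1 then p ^ (-((n : ℤ) - (k : ℕ))) else 0

/-! ### Fusion for ordered Gauss monomials. -/

section Gauss

variable {R : Type*} [Ring R] [Algebra ℂ R]

/-- Ordered monomials. -/
def gaussWord (A : Rˣ) (γ β : R) (v m u : ℤ) : R := γ ^ v.toNat * ((A ^ m : Rˣ) * β ^ u.toNat)

/-- The relations of the elements of the Gauss decomposition. -/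
structure IsGauss (q : ℂ) (A : Rˣ) (γ β : R) : Prop where
  γ_A : γ * A = q • ((A : R) * γ)
  β_A : β * A = q • ((A : R) * β)
  β_γ : β * γ = γ * β

/-- The matrix entries of the product of the Gauss decomposition. -/
noncomputable def gaussEntry (p q : ℂ) (A : Rˣ) (γ β : R) (n : ℕ) (i k : ℤ) : R :=
  ∑ s ∈ Finset.range (n + 1),
    gaussCoeff p q n i k s • gaussWord A γ β (i - s) (n - 2 * s) (k - s)

variable {p q : ℂ} {A : Rˣ} {γ β : R}

theorem pow_mul_of_qcomm (h : β * A = q • ((A : R) * β)) (u : ℕ) : β ^ u * A = q ^ u • ((A : R) * β ^ u) := by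
  induction u with
  | zero => simp
  | succ u ih =>
    rw [pow_succ, mul_assoc, h, mul_smul_comm, ← mul_assoc, ih, smul_mul_assoc, smul_smul, mul_assoc,
      ← pow_succ, ← pow_succ']

theorem pow_mul_inv_of_qcomm (hq : q ≠ 0) (h : β * A = q • ((A : R) * β)) (u : ℕ) :
    β ^ u * (A⁻¹ : Rˣ) = (q ^ u)⁻¹ • (((A⁻¹ : Rˣ) : R) * β ^ u) := by
  have h1 := congrArg (fun x => (q ^ u)⁻¹ • (((A⁻¹ : Rˣ) : R) * (x * (A⁻¹ : Rˣ)))) (pow_mul_of_qcomm h u)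
  simp only [mul_assoc, Units.mul_inv, mul_one, smul_mul_assoc, mul_smul_comm, smul_smul,
    inv_mul_cancel₀ (pow_ne_zero u hq), one_smul] at h1
  rw [h1, ← mul_assoc, Units.inv_mul, one_mul]

theorem zpow_mul_of_qcomm (hq : q ≠ 0) (h : γ * A = q • ((A : R) * γ)) (m : ℤ) :
    ((A ^ m : Rˣ) : R) * γ = q ^ (-m) • (γ * (A ^ m : Rˣ)) := by
  have key : ∀ m : ℕ, ((A ^ m : Rˣ) : R) * γ = (q ^ m)⁻¹ • (γ * (A ^ m : Rˣ)) := by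
    intro m
    induction m with
    | zero => simp
    | succ m ih =>
      have h1 : (A : R) * γ = q⁻¹ • (γ * A) := by
        rw [h, smul_smul, inv_mul_cancel₀ hq, one_smul]
      rw [pow_succ, Units.val_mul, mul_assoc, h1, mul_smul_comm, ← mul_assoc, ih, smul_mul_assoc,
        smul_smul, mul_assoc, pow_succ, mul_inv_rev]
  cases m with
  | ofNat m => simpa using key m
  | negSucc m =>
    have h1 := congrArg (fun x => q ^ (m + 1) • ((((A ^ (m + 1))⁻¹ : Rˣ) : R) * (x * ((A ^ (m + 1))⁻¹ : Rˣ))))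
      (key (m + 1))
    simp only [mul_assoc, Units.mul_inv, mul_one, smul_mul_assoc, mul_smul_comm, smul_smul,
      mul_inv_cancel₀ (pow_ne_zero (m + 1) hq), one_smul] at h1
    rw [← mul_assoc, ← mul_assoc, Units.inv_mul, one_mul] at h1
    rw [zpow_negSucc, ← h1, Int.neg_negSucc, zpow_natCast]

theorem IsGauss.word_mul_A (hG : IsGauss q A γ β) {v m u : ℤ} (hu : 0 ≤ u) :
    gaussWord A γ β v m u * A = q ^ u • gaussWord A γ β v (m + 1) u := by
  obtain ⟨u, rfl⟩ := Int.eq_ofNat_of_zero_le hu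
  rw [gaussWord, gaussWord, mul_assoc, mul_assoc, Int.toNat_natCast, pow_mul_of_qcomm hG.β_A,
    mul_smul_comm, mul_smul_comm, zpow_add, zpow_one, Units.val_mul, mul_assoc, zpow_natCast]

theorem IsGauss.word_mul_A_inv (hG : IsGauss q A γ β) (hq : q ≠ 0) {v m u : ℤ} (hu : 0 ≤ u) :
    gaussWord A γ β v m u * (A⁻¹ : Rˣ) = q ^ (-u) • gaussWord A γ β v (m - 1) u := by
  obtain ⟨u, rfl⟩ := Int.eq_ofNat_of_zero_le hu
  rw [gaussWord, gaussWord, mul_assoc, mul_assoc, Int.toNat_natCast, pow_mul_inv_of_qcomm hq hG.β_A,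
    mul_smul_comm, mul_smul_comm, zpow_sub, zpow_one, Units.val_mul, mul_assoc, zpow_neg,
    zpow_natCast]

theorem IsGauss.word_mul_γ (hG : IsGauss q A γ β) (hq : q ≠ 0) {v m u : ℤ} (hv : 0 ≤ v) :
    gaussWord A γ β v m u * γ = q ^ (-m) • gaussWord A γ β (v + 1) m u := by
  obtain ⟨v, rfl⟩ := Int.eq_ofNat_of_zero_le hv
  have h1 : ((v : ℤ) + 1).toNat = v + 1 := by omega
  have h2 : β ^ u.toNat * γ = γ * β ^ u.toNat := (Commute.pow_left hG.β_γ _)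
  rw [gaussWord, gaussWord, mul_assoc, mul_assoc, Int.toNat_natCast, h1, h2, ← mul_assoc _ γ,
    zpow_mul_of_qcomm hq hG.γ_A, smul_mul_assoc, mul_smul_comm, pow_succ, mul_assoc, mul_assoc]

theorem word_mul_β {v m u : ℤ} (hu : 0 ≤ u) :
    gaussWord A γ β v m u * β = gaussWord A γ β v m (u + 1) := by
  obtain ⟨u, rfl⟩ := Int.eq_ofNat_of_zero_le hu
  have h1 : ((u : ℤ) + 1).toNat = u + 1 := by omega
  rw [gaussWord, gaussWord, mul_assoc, mul_assoc, Int.toNat_natCast, h1, pow_succ]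

theorem IsGauss.entry_mul_A (hG : IsGauss q A γ β) (n : ℕ) (i k : ℤ) :
    gaussEntry p q A γ β n i k * A = ∑ s ∈ Finset.range (n + 1),
      (q ^ (k - s) * gaussCoeff p q n i k s) • gaussWord A γ β (i - s) (n + 1 - 2 * s) (k - s) := by
  rw [gaussEntry, Finset.sum_mul]
  refine Finset.sum_congr rfl fun s _ => ?_
  rcases lt_or_ge k s with h | h
  · simp [gaussCoeff_of_lt_left h]
  · rw [smul_mul_assoc, hG.word_mul_A (by omega), smul_smul, mul_comm,
      show (n : ℤ) + 1 - 2 * s = n - 2 * s + 1 by ring]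

theorem IsGauss.entry_mul_C (hG : IsGauss q A γ β) (hq : q ≠ 0) (n : ℕ) (i k : ℤ) :
    gaussEntry p q A γ β n i k * (γ * A) = ∑ s ∈ Finset.range (n + 1),
      (q ^ (-(n - 2 * s) + (k - s)) * gaussCoeff p q n i k s) •
        gaussWord A γ β (i + 1 - s) (n + 1 - 2 * s) (k - s) := by
  rw [gaussEntry, Finset.sum_mul]
  refine Finset.sum_congr rfl fun s _ => ?_
  rcases lt_or_ge k s with h | h
  · simp [gaussCoeff_of_lt_left h]
  rcases lt_or_ge i s with h' | h'
  · simp [gaussCoeff_of_lt_right h']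
  · rw [smul_mul_assoc, ← mul_assoc, hG.word_mul_γ hq (by omega), smul_mul_assoc,
      hG.word_mul_A (by omega), smul_smul, smul_smul, zpow_add₀ hq,
      show (n : ℤ) + 1 - 2 * s = n - 2 * s + 1 by ring, show i + 1 - s = i - s + 1 by ring]
    congr 1
    ring

theorem IsGauss.entry_mul_A_inv (hG : IsGauss q A γ β) (hq : q ≠ 0) (n : ℕ) (i k : ℤ) :
    gaussEntry p q A γ β n i k * (A⁻¹ : Rˣ) = ∑ s ∈ Finset.range (n + 1),
      (q ^ (-(k - s)) * gaussCoeff p q n i k s) • gaussWord A γ β (i - s) (n - 1 - 2 * s) (k - s) := by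
  rw [gaussEntry, Finset.sum_mul]
  refine Finset.sum_congr rfl fun s _ => ?_
  rcases lt_or_ge k s with h | h
  · simp [gaussCoeff_of_lt_left h]
  · rw [smul_mul_assoc, hG.word_mul_A_inv hq (by omega), smul_smul, mul_comm,
      show (n : ℤ) - 1 - 2 * s = n - 2 * s - 1 by ring]

/-- Each s contributes one ordered monomial, and the two sides agree coefficient by coefficient. The
extra summand s = n + 1 on the left vanishes since it exceeds k. -/
theorem IsGauss.entry_fusion_x (hG : IsGauss q A γ β) {n : ℕ} (hq : QGood q (n + 1)) (hp : p ^ 2 = q)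
    {i k : ℤ} (hi : i ≤ n + 1) (hk0 : 0 ≤ k) (hk : k ≤ n) :
    (qInt q (n + 1 - k) * p ^ k) • gaussEntry p q A γ β (n + 1) i k =
      (qInt q (n + 1 - i) * p ^ i) • (gaussEntry p q A γ β n i k * A) +
      p ^ (-((n : ℤ) + 1 - i)) • (gaussEntry p q A γ β n (i - 1) k * (γ * A)) := by
  rw [hG.entry_mul_A, hG.entry_mul_C hq.1, gaussEntry, Finset.sum_range_succ,
    gaussCoeff_of_lt_left (by push_cast; omega), zero_smul, add_zero, Finset.smul_sum,
    Finset.smul_sum, Finset.smul_sum, ← Finset.sum_add_distrib]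
  refine Finset.sum_congr rfl fun s _ => ?_
  have := gaussCoeff_mul_x hq hp (n := n) (i := i) (k := k) (s := s) (by push_cast; omega) hk hk0 hi
    (by omega)
  rw [sub_add_cancel, smul_smul, smul_smul, smul_smul, ← add_smul]
  push_cast
  congr 1
  rw [← this, mul_comm]

theorem IsGauss.entry_fusion_y (hG : IsGauss q A γ β) {n : ℕ} (hq : QGood q (n + 1)) (hp : p ^ 2 = q)
    {i k : ℤ} (hi : i ≤ n + 1) (hk0 : 0 ≤ k) (hk : k ≤ n) :
    p ^ (-((n : ℤ) - k)) • gaussEntry p q A γ β (n + 1) i (k + 1) =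
      (qInt q (n + 1 - i) * p ^ i) • (gaussEntry p q A γ β n i k * (A * β)) +
      p ^ (-((n : ℤ) + 1 - i)) • (gaussEntry p q A γ β n (i - 1) k *
        ((A⁻¹ : Rˣ) + γ * A * β)) := by
  have e1 (f : ℤ → ℂ) (hf : ∀ s : ℤ, k < s → f s = 0) (v m : ℤ → ℤ) :
      (∑ s ∈ Finset.range (n + 1), f s • gaussWord A γ β (v s) (m s) (k - s)) * β =
      ∑ s ∈ Finset.range (n + 1), f s • gaussWord A γ β (v s) (m s) (k + 1 - s) := by
    rw [Finset.sum_mul]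
    refine Finset.sum_congr rfl fun s _ => ?_
    rcases lt_or_ge k s with h | h
    · simp [hf _ h]
    · rw [smul_mul_assoc, word_mul_β (by omega), show k - (s : ℤ) + 1 = k + 1 - s by ring]
  have e2 := e1 (fun s => q ^ (k - s) * gaussCoeff p q n i k s)
    (fun s hs => by simp [gaussCoeff_of_lt_left hs]) (fun s => i - s) (fun s => n + 1 - 2 * s)
  have e3 := e1 (fun s => q ^ (-(n - 2 * s) + (k - s)) * gaussCoeff p q n (i - 1) k s)
    (fun s hs => by simp [gaussCoeff_of_lt_left hs]) (fun s => i - 1 + 1 - s) (fun s => n + 1 - 2 * s)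
  -- The summand with A⁻¹ carries the power n - 1 - 2s of A, which is n + 1 - 2s after replacing s
  -- by s - 1. The shift brings in the index -1, where the coefficient is zero; the other sums are
  -- extended by the zero term s = n + 1.
  have e4 (f : ℤ → R) (h0 : f (-1) = 0) : ∑ s ∈ Finset.range (n + 1), f s =
      ∑ s ∈ Finset.range (n + 1 + 1), f (s - 1) := by
    rw [Finset.sum_range_succ' _ (n + 1)]
    simp [h0]
  have e5 (f : ℤ → R) (h0 : f (n + 1) = 0) : ∑ s ∈ Finset.range (n + 1), f s =
      ∑ s ∈ Finset.range (n + 1 + 1), f s := by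
    rw [Finset.sum_range_succ _ (n + 1)]
    simp [h0]
  rw [mul_add, ← mul_assoc, hG.entry_mul_A, ← mul_assoc, hG.entry_mul_C hq.1,
    hG.entry_mul_A_inv hq.1, e2, e3,
    e4 (fun s => (q ^ (-(k - s)) * gaussCoeff p q n (i - 1) k s) •
      gaussWord A γ β (i - 1 - s) (n - 1 - 2 * s) (k - s)) (by simp [gaussCoeff_of_neg]),
    e5 (fun s => (q ^ (k - s) * gaussCoeff p q n i k s) •
      gaussWord A γ β (i - s) (n + 1 - 2 * s) (k + 1 - s))
      (by simp [gaussCoeff_of_lt_left (show k < (n : ℤ) + 1 by omega)]),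
    e5 (fun s => (q ^ (-(n - 2 * s) + (k - s)) * gaussCoeff p q n (i - 1) k s) •
      gaussWord A γ β (i - 1 + 1 - s) (n + 1 - 2 * s) (k + 1 - s))
      (by simp [gaussCoeff_of_lt_left (show k < (n : ℤ) + 1 by omega)]),
    gaussEntry, ← Finset.sum_add_distrib, Finset.smul_sum, Finset.smul_sum, Finset.smul_sum,
    ← Finset.sum_add_distrib]
  refine Finset.sum_congr rfl fun s _ => ?_
  have := gaussCoeff_mul_y hq hp (n := n) (i := i) (k := k) (s := s) (by push_cast; omega) hk hk0 hi
    (by omega)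
  rw [sub_add_cancel, show i - 1 - ((s : ℤ) - 1) = i - s by ring,
    show (n : ℤ) - 1 - 2 * ((s : ℤ) - 1) = n + 1 - 2 * s by ring,
    show k - ((s : ℤ) - 1) = k + 1 - s by ring, smul_add, smul_smul, smul_smul, smul_smul, smul_smul,
    ← add_smul, ← add_smul]
  push_cast
  congr 1
  rw [mul_comm, this, show k - ((s : ℤ) - 1) = k + 1 - s by ring]
  ring

/-- The matrix of the Gauss decomposition. -/
noncomputable def gaussMat (p q : ℂ) (A : Rˣ) (γ β : R) (n : ℕ) :
    Matrix (Fin (n + 1)) (Fin (n + 1)) R :=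
  Matrix.of fun i k => gaussEntry p q A γ β n (i : ℕ) (k : ℕ)

theorem mul_tens_qMulX_apply {l : Type*} {n : ℕ} (N : Matrix l (Fin (n + 1 + 1)) R) (i : l)
    (k : Fin (n + 1)) : (N * tens (1 : R) (qMulX p q n)) i k =
      (qInt q (n + 1 - (k : ℕ)) * p ^ ((k : ℕ) : ℤ)) • N i k.castSucc := by
  rw [Matrix.mul_apply, Finset.sum_eq_single k.castSucc]
  · simp [tens, qMulX]
  · intro b _ hb
    have : (b : ℕ) ≠ k := fun e => hb (Fin.ext e)
    simp [tens, qMulX, this]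
  · simp

theorem mul_tens_qMulY_apply {l : Type*} {n : ℕ} (N : Matrix l (Fin (n + 1 + 1)) R) (i : l)
    (k : Fin (n + 1)) : (N * tens (1 : R) (qMulY p n)) i k =
      p ^ (-((n : ℤ) - (k : ℕ))) • N i k.succ := by
  rw [Matrix.mul_apply, Finset.sum_eq_single k.succ]
  · simp [tens, qMulY]
  · intro b _ hb
    have : (b : ℕ) ≠ k + 1 := fun e => hb (Fin.ext (by simpa using e))
    simp [tens, qMulY, this]
  · simp

theorem tens_qMulX_mul_gauss {n : ℕ} (a : R) (i : Fin (n + 1 + 1)) (k : Fin (n + 1)) :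
    (tens (1 : R) (qMulX p q n) * (gaussMat p q A γ β n * tens a (1 : Matrix (Fin (n + 1)) (Fin (n + 1)) ℂ))) i k =
      (qInt q (n + 1 - (i : ℕ)) * p ^ ((i : ℕ) : ℤ)) •
        (gaussEntry p q A γ β n (i : ℕ) (k : ℕ) * a) := by
  have h1 (j : Fin (n + 1)) : (gaussMat p q A γ β n * tens a (1 : Matrix (Fin (n + 1)) (Fin (n + 1)) ℂ)) j k =
      gaussEntry p q A γ β n (j : ℕ) (k : ℕ) * a := by
    rw [Matrix.mul_apply, Finset.sum_eq_single k]
    · simp [tens, gaussMat]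
    · intro b _ hb
      simp [tens, hb]
    · simp
  rw [Matrix.mul_apply]
  simp only [h1]
  by_cases hi : (i : ℕ) < n + 1
  · rw [Finset.sum_eq_single ⟨i, hi⟩]
    · simp [tens, qMulX]
    · intro b _ hb
      have : (i : ℕ) ≠ b := fun e => hb (Fin.ext e.symm)
      simp [tens, qMulX, this]
    · simp
  · have h2 : (i : ℕ) = n + 1 := by omega
    -- The last row of the multiplication map is empty; the formula still holds there because [0] =
    -- 0.
    rw [Finset.sum_eq_zero]
    · rw [h2]
      push_cast
      rw [sub_self, qInt_zero, zero_mul, zero_smul]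
    · intro b _
      have : (i : ℕ) ≠ b := by omega
      simp [tens, qMulX, this]

theorem tens_qMulY_mul_gauss {n : ℕ} (a : R) (i : Fin (n + 1 + 1)) (k : Fin (n + 1)) :
    (tens (1 : R) (qMulY p n) * (gaussMat p q A γ β n * tens a (1 : Matrix (Fin (n + 1)) (Fin (n + 1)) ℂ))) i k =
      p ^ (-((n : ℤ) + 1 - (i : ℕ))) • (gaussEntry p q A γ β n ((i : ℕ) - 1) (k : ℕ) * a) := by
  have h1 (j : Fin (n + 1)) : (gaussMat p q A γ β n * tens a (1 : Matrix (Fin (n + 1)) (Fin (n + 1)) ℂ)) j k =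
      gaussEntry p q A γ β n (j : ℕ) (k : ℕ) * a := by
    rw [Matrix.mul_apply, Finset.sum_eq_single k]
    · simp [tens, gaussMat]
    · intro b _ hb
      simp [tens, hb]
    · simp
  rw [Matrix.mul_apply]
  simp only [h1]
  by_cases hi : 0 < (i : ℕ)
  · rw [Finset.sum_eq_single ⟨i - 1, by omega⟩]
    · have h3 : (((i : ℕ) - 1 : ℕ) : ℤ) = (i : ℕ) - 1 := by omega
      have h2 : (i : ℕ) = i - 1 + 1 := by omega
      simp only [tens, qMulY, Matrix.map_apply, Matrix.of_apply, if_pos h2, h3, smul_mul_assoc,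
        one_mul]
      congr 2
      ring
    · intro b _ hb
      have : (i : ℕ) ≠ b + 1 := fun e => hb (Fin.ext (by simp; omega))
      simp [tens, qMulY, this]
    · simp
  · have h2 : (i : ℕ) = 0 := by omega
    -- The row i = 0 is empty, and the entry with row index -1 on the right vanishes as well.
    rw [Finset.sum_eq_zero]
    · rw [h2, gaussEntry, Finset.sum_eq_zero]
      · simp
      · intro s _
        rw [gaussCoeff_of_lt_right (by push_cast; omega), zero_smul]
    · intro b _
      have : (i : ℕ) ≠ b + 1 := by omega
      simp [tens, qMulY, this]

/-- The fundamental matrix here is (A, Aβ; γA, A⁻¹ + γAβ), the Gauss product in determinant 1. -/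
theorem IsGauss.mat_fusion_x (hG : IsGauss q A γ β) {n : ℕ} (hq : QGood q (n + 1)) (hp : p ^ 2 = q) :
    gaussMat p q A γ β (n + 1) * tens (1 : R) (qMulX p q n) =
      tens (1 : R) (qMulX p q n) * (gaussMat p q A γ β n * tens (A : R) (1 : Matrix (Fin (n + 1)) (Fin (n + 1)) ℂ)) +
      tens (1 : R) (qMulY p n) * (gaussMat p q A γ β n * tens (γ * A) (1 : Matrix (Fin (n + 1)) (Fin (n + 1)) ℂ)) := by
  ext i k
  rw [Matrix.add_apply, mul_tens_qMulX_apply, tens_qMulX_mul_gauss, tens_qMulY_mul_gauss,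
    ← hG.entry_fusion_x hq hp (by omega) (by omega) (by omega)]
  rfl

theorem IsGauss.mat_fusion_y (hG : IsGauss q A γ β) {n : ℕ} (hq : QGood q (n + 1)) (hp : p ^ 2 = q) :
    gaussMat p q A γ β (n + 1) * tens (1 : R) (qMulY p n) =
      tens (1 : R) (qMulX p q n) * (gaussMat p q A γ β n * tens ((A : R) * β) (1 : Matrix (Fin (n + 1)) (Fin (n + 1)) ℂ)) +
      tens (1 : R) (qMulY p n) * (gaussMat p q A γ β n * tens ((A⁻¹ : Rˣ) + γ * A * β) (1 : Matrix (Fin (n + 1)) (Fin (n + 1)) ℂ)) := by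
  ext i k
  rw [Matrix.add_apply, mul_tens_qMulY_apply, tens_qMulX_mul_gauss, tens_qMulY_mul_gauss,
    ← hG.entry_fusion_y hq hp (by omega) (by omega) (by omega)]
  simp [gaussMat]

theorem gaussMat_zero : gaussMat p q A γ β 0 = 1 := by
  ext i k
  fin_cases i
  fin_cases k
  simp [gaussMat, gaussEntry, gaussCoeff, gaussWord, qFac, qFacInv, qBracketFactorial]

end Gauss

end Jordanian

namespace Jordanian

/-! ### The Gauss coordinates of the standard quantum group. -/

section GaussHat

variable {q α : ℂ}

theorem qBrace_sq (hq : q ≠ 0) (hq' : q - q⁻¹ ≠ 0) (m : ℕ) :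
    qBrace (q ^ 2) (m + 1) = q ^ m * qBracket q (m + 1) := by
  have h1 : 1 - q ^ 2 ≠ 0 := by
    intro h
    apply hq'
    field_simp
    linear_combination -h
  have h2 : (q ^ 2 - 1) ≠ 0 := by
    intro h
    apply h1
    linear_combination -h
  simp only [qBrace, qBracket, inv_pow]
  field_simp
  ring

theorem qBrace_sq_inv (hq : q ≠ 0) (hq' : q - q⁻¹ ≠ 0) (m : ℕ) :
    qBrace (q ^ 2)⁻¹ (m + 1) = (q ^ m)⁻¹ * qBracket q (m + 1) := by
  have h1 : 1 - q ^ 2 ≠ 0 := by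
    intro h
    apply hq'
    field_simp
    linear_combination -h
  have h2 : (q ^ 2 - 1) ≠ 0 := by
    intro h
    apply h1
    linear_combination -h
  simp only [qBrace, qBracket, inv_pow]
  field_simp
  ring

variable {p : ℂ}

theorem pow_eq_zpow_of_sq (hp : p ^ 2 = q) (t : ℕ) : q ^ t = p ^ (2 * (t : ℤ)) := by
  rw [← hp, ← pow_mul, ← zpow_natCast]
  rfl

theorem qBraceFactorial_sq (hp : p ^ 2 = q) (hq : q ≠ 0) (hq' : q - q⁻¹ ≠ 0) (t : ℕ) :
    qBraceFactorial (q ^ 2) t = p ^ ((t : ℤ) * (t - 1)) * qBracketFactorial q t := by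
  have hp0 : p ≠ 0 := by rintro rfl; exact hq (by rw [← hp]; simp)
  induction t with
  | zero => simp [qBraceFactorial, qBracketFactorial]
  | succ t ih =>
    rw [qBraceFactorial, Finset.prod_range_succ, ← qBraceFactorial, ih, qBrace_sq hq hq',
      qBracketFactorial_succ, pow_eq_zpow_of_sq hp t]
    have : p ^ (((t + 1 : ℕ) : ℤ) * ((t + 1 : ℕ) - 1)) =
        p ^ ((t : ℤ) * (t - 1)) * p ^ (2 * (t : ℤ)) := by
      rw [← zpow_add₀ hp0]; congr 1; push_cast; ring
    rw [this]
    ring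

theorem qBraceFactorial_sq_inv (hp : p ^ 2 = q) (hq : q ≠ 0) (hq' : q - q⁻¹ ≠ 0) (t : ℕ) :
    qBraceFactorial (q ^ 2)⁻¹ t = p ^ (-((t : ℤ) * (t - 1))) * qBracketFactorial q t := by
  have hp0 : p ≠ 0 := by rintro rfl; exact hq (by rw [← hp]; simp)
  induction t with
  | zero => simp [qBraceFactorial, qBracketFactorial]
  | succ t ih =>
    rw [qBraceFactorial, Finset.prod_range_succ, ← qBraceFactorial, ih, qBrace_sq_inv hq hq',
      qBracketFactorial_succ, pow_eq_zpow_of_sq hp t]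
    have : p ^ (-(((t + 1 : ℕ) : ℤ) * ((t + 1 : ℕ) - 1))) =
        p ^ (-((t : ℤ) * (t - 1))) * (p ^ (2 * (t : ℤ)))⁻¹ := by
      rw [← zpow_neg, ← zpow_add₀ hp0]; congr 1; push_cast; ring
    rw [this]
    ring

theorem qExp_apply {n : ℕ} (Q : ℂ) (x : FunQ q α) (J : Matrix (Fin (n + 1)) (Fin (n + 1)) ℂ)
    (i k : Fin (n + 1)) : qExp Q x J i k =
      ∑ t ∈ Finset.range (n + 1), ((qBraceFactorial Q t)⁻¹ * (J ^ t) i k) • x ^ t := by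
  have key : ∀ t : ℕ, (x • J.map (algebraMap ℂ (FunQ q α))) ^ t = tens (x ^ t) (J ^ t) := by
    have h1 : x • J.map (algebraMap ℂ (FunQ q α)) = tens x J := by
      ext i k
      simp [tens, Algebra.smul_def, Algebra.commutes]
    intro t
    rw [h1]
    induction t with
    | zero => simp [tens_one_one]
    | succ t ih => rw [pow_succ, ih, tens_mul_tens, ← pow_succ, ← pow_succ]
  simp [qExp, Matrix.sum_apply, key, tens, smul_smul]

/-- `q ^ (x / 2)` for integers `x`. -/
theorem cpow_half_int (q : ℂ) (x : ℤ) {y : ℂ} (hy : y = x / 2) : q ^ y = (q ^ (1 / 2 : ℂ)) ^ x := by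
  rw [← Complex.cpow_mul_int, hy]
  congr 1
  ring

theorem calJminus_pow_apply (hq : q ≠ 0) (n t : ℕ) (z : ℂ) (i k : Fin (n + 1)) :
    (calJminus q α n z ^ t) i k = if (k : ℕ) + t = i then
      q ^ (α * (z - 1 / 2) * t) * (q ^ (1 / 2 : ℂ)) ^ (-((t : ℤ) * (n - 2 * (k : ℕ) - t))) else 0 := by
  have hp0 : q ^ (1 / 2 : ℂ) ≠ 0 := cpow_ne_zero' hq _
  have h1 : calJminus q α n z = Matrix.transpose (superdiag (fun i => q ^ (α * (z - 1 / 2)) *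
      (q ^ (1 / 2 : ℂ)) ^ (-((n : ℤ) - 2 * i + 1))) (n + 1)) := by
    ext i k
    simp only [calJminus, superdiag, Matrix.smul_apply, Matrix.diagonal_mul, Matrix.transpose_apply,
      Matrix.of_apply, Jminus, smul_eq_mul, mul_ite, mul_one, mul_zero, eq_comm (a := (i : ℕ))]
    split_ifs with h
    · rw [cpow_half_int q (-((n : ℤ) - 2 * (i : ℕ) + 1))
        (y := -((n : ℂ) - 2 * (i : ℕ) + 1) / 2) (by push_cast; ring)]
    · rfl
  rw [h1, ← Matrix.transpose_pow, Matrix.transpose_apply, superdiag_pow_apply]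
  refine if_congr Iff.rfl ?_ rfl
  induction t with
  | zero => simp
  | succ t ih =>
    rw [Finset.prod_range_succ, ih]
    have e1 : q ^ (α * (z - 1 / 2) * ((t + 1 : ℕ) : ℂ)) =
        q ^ (α * (z - 1 / 2) * t) * q ^ (α * (z - 1 / 2)) := by
      rw [← Complex.cpow_add _ _ hq]; congr 1; push_cast; ring
    rw [e1, mul_mul_mul_comm, ← zpow_add₀ hp0]
    congr 2
    push_cast
    ring

theorem qFacInv_eq {m : ℕ} : qFacInv q m = (qBracketFactorial q m)⁻¹ := by simp [qFacInv]

theorem qFac_natCast {m : ℕ} : qFac q m = qBracketFactorial q m := by simp [qFac]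

theorem qBracketFactorial_ne_zero {N : ℕ} (hq : QGood q N) {m : ℕ} (hm : m ≤ N) :
    qBracketFactorial q m ≠ 0 :=
  Finset.prod_ne_zero_iff.2 fun i hi => hq.2.2 i (by have := Finset.mem_range.1 hi; omega)

theorem calJplus_pow_apply {n : ℕ} (hq : QGood q n) (t : ℕ) (z : ℂ) (i k : Fin (n + 1)) :
    (calJplus q α n z ^ t) i k = if (i : ℕ) + t = k then
      q ^ (α * (z - 1 / 2) * t) * (q ^ (1 / 2 : ℂ)) ^ ((t : ℤ) * (n - 2 * (i : ℕ) - t)) *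
      (qFac q (k : ℕ) * qFac q (n - (i : ℕ)) * qFacInv q (n - (k : ℕ)) * qFacInv q (i : ℕ)) else 0 := by
  have hp0 : q ^ (1 / 2 : ℂ) ≠ 0 := cpow_ne_zero' hq.1 _
  have h1 : calJplus q α n z = superdiag (fun k => q ^ (α * (z - 1 / 2)) *
      (q ^ (1 / 2 : ℂ)) ^ ((n : ℤ) - 2 * k + 1) * (qBracket q k * qBracket q (n + 1 - k))) (n + 1) := by
    ext i k
    simp only [calJplus, superdiag, Matrix.smul_apply, Matrix.mul_diagonal,
      Matrix.of_apply, JplusQ, smul_eq_mul, mul_ite, ite_mul, mul_zero, zero_mul]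
    split_ifs with h
    · rw [cpow_half_int q ((n : ℤ) - 2 * (k : ℕ) + 1)
        (y := ((n : ℂ) - 2 * (k : ℕ) + 1) / 2) (by push_cast; ring)]
      ring
    · rfl
  rw [h1, superdiag_pow_apply]
  split_ifs with hk
  swap
  · rfl
  have hkn := k.isLt
  have e0 : ((n : ℤ) - (k : ℕ)) = ((n - (k : ℕ) : ℕ) : ℤ) := by omega
  have e0' : ((n : ℤ) - (i : ℕ)) = ((n - (i : ℕ) : ℕ) : ℤ) := by omega
  rw [e0, e0', qFac_natCast, qFac_natCast, qFacInv_eq, qFacInv_eq]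
  rw [← hk] at hkn ⊢
  clear e0 e0' hk h1 k
  induction t with
  | zero =>
    have := qBracketFactorial_ne_zero hq (m := i) (by omega)
    have := qBracketFactorial_ne_zero hq (m := n - i) (by omega)
    simp
    field_simp
  | succ t ih =>
    rw [Finset.prod_range_succ, ih (by omega)]
    have e1 : q ^ (α * (z - 1 / 2) * ((t + 1 : ℕ) : ℂ)) =
        q ^ (α * (z - 1 / 2) * t) * q ^ (α * (z - 1 / 2)) := by
      rw [← Complex.cpow_add _ _ hq.1]; congr 1; push_cast; ring
    have e2 : qBracketFactorial q (n - (i + t)) =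
        qBracketFactorial q (n - (i + (t + 1))) * qBracket q (n + 1 - (i + t + 1)) := by
      rw [show n - (i + t) = n - (i + (t + 1)) + 1 by omega, qBracketFactorial_succ]
      congr 2
      omega
    have e3 : qBracketFactorial q (i + (t + 1)) = qBracketFactorial q (i + t) * qBracket q (i + t + 1) := by
      rw [← add_assoc, qBracketFactorial_succ]
    have e4 : (q ^ (1 / 2 : ℂ)) ^ (((t + 1 : ℕ) : ℤ) * (n - 2 * (i : ℕ) - (t + 1 : ℕ))) =
        (q ^ (1 / 2 : ℂ)) ^ ((t : ℤ) * (n - 2 * (i : ℕ) - t)) *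
          (q ^ (1 / 2 : ℂ)) ^ ((n : ℤ) - 2 * ((i : ℕ) + t + 1 : ℕ) + 1) := by
      rw [← zpow_add₀ hp0]; congr 1; push_cast; ring
    have h3 := qBracketFactorial_ne_zero hq (m := n - (i + (t + 1))) (by omega)
    have h4 := qBracketFactorial_ne_zero hq (m := n - (i + t)) (by omega)
    have h5 : qBracket q (n + 1 - (i + t + 1)) ≠ 0 := by
      intro h0
      rw [e2, h0, mul_zero] at h4
      exact h4 rfl
    rw [e1, e2, e3, e4]
    field_simp

namespace FunQ

variable (q α)

/-- The powers of the quantum determinant as units. -/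
noncomputable def Dunit (w : ℂ) : (FunQ q α)ˣ where
  val := D q α w
  inv := D q α (-w)
  val_inv := by rw [← D_add, add_neg_cancel, D_zero]
  inv_val := by rw [← D_add, neg_add_cancel, D_zero]

theorem Dunit_zpow (w : ℂ) (m : ℤ) : ((Dunit q α w ^ m : (FunQ q α)ˣ) : FunQ q α) = D q α (m * w) := by
  have h1 : ∀ w w', Dunit q α (w + w') = Dunit q α w * Dunit q α w' := fun w w' =>
    Units.ext (D_add q α w w')
  let f : Multiplicative ℂ →* (FunQ q α)ˣ :=
    { toFun := fun w => Dunit q α (Multiplicative.toAdd w)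
      map_one' := Units.ext (D_zero q α)
      map_mul' := fun w w' => h1 _ _ }
  have h2 := map_zpow f (Multiplicative.ofAdd w) m
  rw [← ofAdd_zsmul] at h2
  have h3 : f (Multiplicative.ofAdd w) = Dunit q α w := rfl
  rw [← h3, ← h2]
  change D q α (m • w) = _
  rw [zsmul_eq_mul]

/-- `a D ^ (-1/2)`. -/
noncomputable def slA : (FunQ q α)ˣ := aUnit q α * Dunit q α (-1 / 2)

/-- `λ ^ (-1/2) c a⁻¹`. -/
noncomputable def slγ : FunQ q α := q ^ (-(α / 2)) • gamma q α

/-- `λ ^ (-1/2) a⁻¹ b`. -/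
noncomputable def slβ : FunQ q α := q ^ (-(α / 2)) • beta q α

theorem aUnit_Dunit (w : ℂ) : Commute (aUnit q α) (Dunit q α w) := Units.ext (a_D q α w)

theorem slA_zpow (m : ℤ) : ((slA q α ^ m : (FunQ q α)ˣ) : FunQ q α) =
    ((aUnit q α ^ m : (FunQ q α)ˣ) : FunQ q α) * D q α (-(m : ℂ) / 2) := by
  rw [slA, (aUnit_Dunit q α _).mul_zpow, Units.val_mul, Dunit_zpow]
  congr 2
  ring

/-- The inverse of `a`. -/
noncomputable abbrev ainv : FunQ q α := gen q α QGen.ainv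

theorem a_ainv : a q α * ainv q α = 1 := (aUnit q α).val_inv
theorem ainv_a : ainv q α * a q α = 1 := (aUnit q α).inv_val

theorem ainv_D (w : ℂ) : ainv q α * D q α w = D q α w * ainv q α := by
  have := congrArg (fun x : (FunQ q α)ˣ => (x : FunQ q α)) (aUnit_Dunit q α w).inv_left
  exact this

theorem gamma_D (w : ℂ) : gamma q α * D q α w = q ^ (-(2 * α * w)) • (D q α w * gamma q α) := by
  have : gamma q α = c q α * ainv q α := rfl
  rw [this, mul_assoc, ainv_D, ← mul_assoc, c_D, smul_mul_assoc, mul_assoc (D q α w)]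

theorem beta_D (w : ℂ) : beta q α * D q α w = q ^ (2 * α * w) • (D q α w * beta q α) := by
  have : beta q α = ainv q α * b q α := rfl
  rw [this, mul_assoc, b_D, mul_smul_comm, ← mul_assoc, ainv_D, mul_assoc (D q α w)]

theorem gamma_a : gamma q α * a q α = c q α := by
  have : gamma q α = c q α * ainv q α := rfl
  rw [this, mul_assoc, ainv_a, mul_one]

theorem a_beta : a q α * beta q α = b q α := by
  have : beta q α = ainv q α * b q α := rfl
  rw [this, ← mul_assoc, a_ainv, one_mul]

variable {q}

theorem beta_a (hq : q ≠ 0) : beta q α * a q α = (q * q ^ α) • (a q α * beta q α) := by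
  have : beta q α = ainv q α * b q α := rfl
  rw [a_beta, this, mul_assoc, ba α hq, mul_smul_comm, ← mul_assoc, ainv_a, one_mul]

theorem a_gamma : a q α * gamma q α = (q⁻¹ * q ^ α) • (gamma q α * a q α) := by
  have : gamma q α = c q α * ainv q α := rfl
  rw [gamma_a, this, ← mul_assoc, ac, smul_mul_assoc, mul_assoc, a_ainv, mul_one]

theorem beta_gamma (hq : q ≠ 0) : beta q α * gamma q α = gamma q α * beta q α := by
  -- Since a is invertible, it suffices to compare after multiplying by a on both sides, where β̂
  -- and γ̂ turn into b and c.
  have h1 : a q α * (beta q α * gamma q α) * a q α = a q α * (gamma q α * beta q α) * a q α := by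
    rw [← mul_assoc, a_beta, mul_assoc, gamma_a, ← mul_assoc, a_gamma, mul_assoc, beta_a α hq,
      smul_mul_smul_comm, gamma_a, a_beta, bc_eq α hq]
    congr 1
    field_simp
  have h2 : ((aUnit q α : (FunQ q α)ˣ) : FunQ q α) = a q α := rfl
  rw [← h2, Units.mul_left_inj, Units.mul_right_inj] at h1
  exact h1

/-- The λ in γ̂ a = qλ⁻¹ a γ̂ and β̂ a = qλ a β̂ is cancelled by commuting with D^(-1/2), so the
rescaled elements obey relations independent of λ. -/
theorem isGauss (hq : q ≠ 0) : IsGauss q (slA q α) (slγ q α) (slβ q α) := by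
  have hα : q ^ α ≠ 0 := cpow_ne_zero' hq _
  have h1 : ((slA q α : (FunQ q α)ˣ) : FunQ q α) = a q α * D q α (-1 / 2) := rfl
  have e1 : q ^ (-(2 * α * (-1 / 2))) = q ^ α := by congr 1; ring
  have e2 : q ^ (2 * α * (-1 / 2)) = (q ^ α)⁻¹ := by rw [← Complex.cpow_neg]; congr 1; ring
  have e3 : gamma q α * a q α = (q * (q ^ α)⁻¹) • (a q α * gamma q α) := by
    rw [a_gamma, smul_smul]
    have : q * (q ^ α)⁻¹ * (q⁻¹ * q ^ α) = 1 := by field_simp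
    rw [this, one_smul]
  refine ⟨?_, ?_, ?_⟩
  · rw [h1, slγ, smul_mul_assoc, mul_smul_comm, smul_comm q]
    congr 1
    rw [← mul_assoc, e3, smul_mul_assoc, mul_assoc, gamma_D, mul_smul_comm, smul_smul, e1,
      ← mul_assoc]
    congr 1
    field_simp
  · rw [h1, slβ, smul_mul_assoc, mul_smul_comm, smul_comm q]
    congr 1
    rw [← mul_assoc, beta_a α hq, smul_mul_assoc, mul_assoc, beta_D, mul_smul_comm, smul_smul, e2,
      ← mul_assoc]
    congr 1
    field_simp
  · rw [slβ, slγ, smul_mul_smul_comm, smul_mul_smul_comm, beta_gamma α hq]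

end FunQ

theorem qExp_gamma_apply {n : ℕ} (hq : QGood q n) (z : ℂ) (i s : Fin (n + 1)) :
    qExp (q ^ 2) (FunQ.gamma q α) (calJminus q α n z) i s =
      (q ^ (α * (z - 1 / 2) * ((i : ℕ) - (s : ℕ) : ℤ)) *
        (q ^ (1 / 2 : ℂ)) ^ (-(((i : ℕ) - (s : ℕ)) * ((n : ℤ) - 2 * (s : ℕ) - 1))) *
        qFacInv q ((i : ℕ) - (s : ℕ))) • FunQ.gamma q α ^ (((i : ℕ) - (s : ℕ) : ℤ)).toNat := by
  have hp0 : q ^ (1 / 2 : ℂ) ≠ 0 := cpow_ne_zero' hq.1 _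
  have hp : (q ^ (1 / 2 : ℂ)) ^ 2 = q := by rw [← Complex.cpow_nat_mul]; norm_num
  rw [qExp_apply]
  simp only [calJminus_pow_apply hq.1]
  rcases lt_or_ge (i : ℕ) (s : ℕ) with h | h
  · rw [qFacInv_of_neg (by omega), mul_zero, zero_smul]
    refine Finset.sum_eq_zero fun t _ => ?_
    rw [if_neg (by omega), mul_zero, zero_smul]
  · obtain ⟨t, ht⟩ := Nat.exists_eq_add_of_le h
    have hi := i.isLt
    have e1 : ((i : ℕ) : ℤ) - (s : ℕ) = (t : ℕ) := by omega
    rw [Finset.sum_eq_single t, if_pos ht.symm, e1, Int.toNat_natCast, qFacInv_eq (m := t),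
      qBraceFactorial_sq hp hq.1 hq.2.1]
    · congr 1
      have e2 : (q ^ (1 / 2 : ℂ)) ^ (-((t : ℤ) * (n - 2 * (s : ℕ) - 1))) =
          ((q ^ (1 / 2 : ℂ)) ^ ((t : ℤ) * (t - 1)))⁻¹ *
            (q ^ (1 / 2 : ℂ)) ^ (-((t : ℤ) * (n - 2 * (s : ℕ) - t))) := by
        rw [← zpow_neg, ← zpow_add₀ hp0]; congr 1; ring
      rw [e2, mul_inv]
      push_cast
      ring
    · intro b _ hb
      rw [if_neg (by omega), mul_zero, zero_smul]
    · intro h'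
      exact absurd (Finset.mem_range.2 (by omega)) h'

theorem qExp_beta_apply {n : ℕ} (hq : QGood q n) (z : ℂ) (s k : Fin (n + 1)) :
    qExp (q ^ 2)⁻¹ (FunQ.beta q α) (calJplus q α n z) s k =
      (q ^ (α * (z - 1 / 2) * ((k : ℕ) - (s : ℕ) : ℤ)) *
        (q ^ (1 / 2 : ℂ)) ^ ((((k : ℕ) - (s : ℕ)) * ((n : ℤ) - 2 * (s : ℕ) - 1))) *
        (qFac q (k : ℕ) * qFac q (n - (s : ℕ)) * qFacInv q (n - (k : ℕ)) * qFacInv q (s : ℕ)) *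
        qFacInv q ((k : ℕ) - (s : ℕ))) • FunQ.beta q α ^ (((k : ℕ) - (s : ℕ) : ℤ)).toNat := by
  have hp0 : q ^ (1 / 2 : ℂ) ≠ 0 := cpow_ne_zero' hq.1 _
  have hp : (q ^ (1 / 2 : ℂ)) ^ 2 = q := by rw [← Complex.cpow_nat_mul]; norm_num
  rw [qExp_apply]
  simp only [calJplus_pow_apply hq]
  rcases lt_or_ge (k : ℕ) (s : ℕ) with h | h
  · rw [qFacInv_of_neg (m := (k : ℕ) - (s : ℕ)) (by omega), mul_zero, zero_smul]
    refine Finset.sum_eq_zero fun t _ => ?_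
    rw [if_neg (by omega), mul_zero, zero_smul]
  · obtain ⟨t, ht⟩ := Nat.exists_eq_add_of_le h
    have hi := k.isLt
    have e1 : ((k : ℕ) : ℤ) - (s : ℕ) = (t : ℕ) := by omega
    rw [Finset.sum_eq_single t, if_pos ht.symm, e1, Int.toNat_natCast, qFacInv_eq (m := t),
      qBraceFactorial_sq_inv hp hq.1 hq.2.1]
    · congr 1
      have e2 : (q ^ (1 / 2 : ℂ)) ^ (((t : ℤ) * (n - 2 * (s : ℕ) - 1))) =
          ((q ^ (1 / 2 : ℂ)) ^ (-((t : ℤ) * (t - 1))))⁻¹ *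
            (q ^ (1 / 2 : ℂ)) ^ ((t : ℤ) * (n - 2 * (s : ℕ) - t)) := by
        rw [← zpow_neg, ← zpow_add₀ hp0]; congr 1; ring
      rw [e2, mul_inv]
      push_cast
      ring
    · intro b _ hb
      rw [if_neg (by omega), mul_zero, zero_smul]
    · intro h'
      exact absurd (Finset.mem_range.2 (by omega)) h'

theorem gaussWord_smul {R : Type*} [Ring R] [Algebra ℂ R] (A : Rˣ) (γ β : R) (x : ℂ) (v m u : ℤ) :
    gaussWord A (x • γ) (x • β) v m u = (x ^ v.toNat * x ^ u.toNat) • gaussWord A γ β v m u := by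
  simp only [gaussWord, smul_pow, smul_mul_assoc, mul_smul_comm, smul_smul]
  rw [mul_comm]

/-- The standard coloured matrix in terms of the Gauss decomposition in determinant `1`. -/
theorem stdT_apply {n : ℕ} (hq : QGood q n) (z : ℂ) (i k : Fin (n + 1)) :
    stdT q α n z i k = q ^ (α * z * ((k : ℕ) - (i : ℕ) : ℤ)) • (FunQ.D q α z *
      gaussMat (q ^ (1 / 2 : ℂ)) q (FunQ.slA q α) (FunQ.slγ q α) (FunQ.slβ q α) n i k) := by
  have hp0 : q ^ (1 / 2 : ℂ) ≠ 0 := cpow_ne_zero' hq.1 _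
  rw [stdT, Matrix.mul_apply, gaussMat, Matrix.of_apply, gaussEntry,
    Finset.sum_range (fun s : ℕ => gaussCoeff _ q n _ _ s • gaussWord _ _ _ _ _ _), Finset.mul_sum,
    Finset.smul_sum]
  refine Finset.sum_congr rfl fun s _ => ?_
  rw [Matrix.mul_diagonal, qExp_gamma_apply hq, qExp_beta_apply hq]
  rcases lt_or_ge (i : ℕ) (s : ℕ) with h | h
  · rw [qFacInv_of_neg (m := (i : ℕ) - (s : ℕ)) (by omega), gaussCoeff_of_lt_right (by omega)]
    simp
  rcases lt_or_ge (k : ℕ) (s : ℕ) with h' | h'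
  · rw [qFacInv_of_neg (m := (k : ℕ) - (s : ℕ)) (by omega), gaussCoeff_of_lt_left (by omega)]
    simp
  obtain ⟨v, hv⟩ := Nat.exists_eq_add_of_le h
  obtain ⟨u, hu⟩ := Nat.exists_eq_add_of_le h'
  have e1 : ((i : ℕ) : ℤ) - (s : ℕ) = (v : ℕ) := by omega
  have e2 : ((k : ℕ) : ℤ) - (s : ℕ) = (u : ℕ) := by omega
  have e3 : ((k : ℕ) : ℤ) - (i : ℕ) = (u : ℤ) - v := by omega
  have hγ : FunQ.gamma q α ^ v * FunQ.D q α z =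
      q ^ (-(2 * α * z) * v) • (FunQ.D q α z * FunQ.gamma q α ^ v) := by
    have := pow_mul_of_qcomm (A := FunQ.Dunit q α z) (FunQ.gamma_D q α z) v
    rw [Complex.cpow_mul_nat]
    exact this
  have ha : ((FunQ.aUnit q α ^ ((n : ℤ) - 2 * (s : ℕ)) : (FunQ q α)ˣ) : FunQ q α) * FunQ.D q α z =
      FunQ.D q α z * ((FunQ.aUnit q α ^ ((n : ℤ) - 2 * (s : ℕ)) : (FunQ q α)ˣ) : FunQ q α) :=
    congrArg (fun x : (FunQ q α)ˣ => (x : FunQ q α)) ((FunQ.aUnit_Dunit q α z).zpow_left _)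
  have hD : FunQ.gen q α (QGen.D (z - ((n : ℂ) - 2 * (s : ℕ)) / 2)) =
      FunQ.D q α z * FunQ.D q α (-(((n : ℤ) - 2 * (s : ℕ) : ℤ) : ℂ) / 2) := by
    rw [← FunQ.D_add]
    congr 2
    push_cast
    ring
  rw [e1, e2, e3, FunQ.slγ, FunQ.slβ, gaussWord_smul, hD, ← mul_assoc _ (FunQ.D q α z), ha,
    mul_assoc (FunQ.D q α z), ← FunQ.slA_zpow, gaussWord, Int.toNat_natCast, Int.toNat_natCast]
  simp only [smul_mul_assoc, mul_smul_comm, smul_smul]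
  rw [← mul_assoc _ (FunQ.D q α z), hγ, smul_mul_assoc, smul_mul_assoc, smul_smul]
  congr 1
  swap
  · simp only [mul_assoc]
  rw [gaussCoeff, e3, e1, e2, ← Complex.cpow_mul_nat, ← Complex.cpow_mul_nat]
  -- The powers of λ: (z - ½)(u + v) from the two quantum exponentials and -2zv from moving D^z left
  -- through γ̂^v. The total is z(u - v) - (u + v)/2; the last part is the rescaling of γ̂ and β̂.
  have w1 : q ^ (α * (z - 1 / 2) * ((v : ℤ) : ℂ)) * q ^ (α * (z - 1 / 2) * ((u : ℤ) : ℂ)) *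
      q ^ (-(2 * α * z) * v) =
      q ^ (α * z * (((u : ℤ) - v : ℤ) : ℂ)) * q ^ (-(α / 2) * v) * q ^ (-(α / 2) * u) := by
    rw [← Complex.cpow_add _ _ hq.1, ← Complex.cpow_add _ _ hq.1, ← Complex.cpow_add _ _ hq.1,
      ← Complex.cpow_add _ _ hq.1]
    congr 1
    push_cast
    ring
  have w2 : (q ^ (1 / 2 : ℂ)) ^ (-((v : ℤ) * (n - 2 * (s : ℕ) - 1))) *
      (q ^ (1 / 2 : ℂ)) ^ ((u : ℤ) * (n - 2 * (s : ℕ) - 1)) =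
      (q ^ (1 / 2 : ℂ)) ^ (((u : ℤ) - v) * (n - 2 * (s : ℕ) - 1)) := by
    rw [← zpow_add₀ hp0]
    congr 1
    ring
  rw [← w2]
  push_cast at w1 ⊢
  linear_combination ((q ^ (1 / 2 : ℂ)) ^ (-((v : ℤ) * (n - 2 * (s : ℕ) - 1))) *
      (q ^ (1 / 2 : ℂ)) ^ ((u : ℤ) * (n - 2 * (s : ℕ) - 1)) * qFacInv q v * qFacInv q u *
      (qFac q (k : ℕ) * qFac q (n - (s : ℕ)) * qFacInv q (n - (k : ℕ)) * qFacInv q (s : ℕ))) * w1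

end GaussHat

end Jordanian

namespace Jordanian

/-! ### The transformation matrices and the multiplication maps -/

section Trans

variable {h q : ℂ}

theorem JplusQ_pow_apply {n : ℕ} (hq : QGood q n) (t : ℕ) (i k : Fin (n + 1)) :
    (JplusQ q n ^ t) i k = if (i : ℕ) + t = k then
      qFac q (k : ℕ) * qFac q (n - (i : ℕ)) * qFacInv q (n - (k : ℕ)) * qFacInv q (i : ℕ) else 0 := by
  have h1 : JplusQ q n = superdiag (fun k => qBracket q k * qBracket q (n + 1 - k)) (n + 1) := rfl
  rw [h1, superdiag_pow_apply]
  split_ifs with hk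
  swap
  · rfl
  have hkn := k.isLt
  have e0 : ((n : ℤ) - (k : ℕ)) = ((n - (k : ℕ) : ℕ) : ℤ) := by omega
  have e0' : ((n : ℤ) - (i : ℕ)) = ((n - (i : ℕ) : ℕ) : ℤ) := by omega
  rw [e0, e0', qFac_natCast, qFac_natCast, qFacInv_eq, qFacInv_eq]
  rw [← hk] at hkn ⊢
  clear e0 e0' hk h1 k
  induction t with
  | zero =>
    have := qBracketFactorial_ne_zero hq (m := i) (by omega)
    have := qBracketFactorial_ne_zero hq (m := n - i) (by omega)
    simp
    field_simp
  | succ t ih =>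
    rw [Finset.prod_range_succ, ih (by omega)]
    have e2 : qBracketFactorial q (n - (i + t)) =
        qBracketFactorial q (n - (i + (t + 1))) * qBracket q (n + 1 - (i + t + 1)) := by
      rw [show n - (i + t) = n - (i + (t + 1)) + 1 by omega, qBracketFactorial_succ]
      congr 2
      omega
    have e3 : qBracketFactorial q (i + (t + 1)) = qBracketFactorial q (i + t) * qBracket q (i + t + 1) := by
      rw [← add_assoc, qBracketFactorial_succ]
    have h3 := qBracketFactorial_ne_zero hq (m := n - (i + (t + 1))) (by omega)
    have h4 := qBracketFactorial_ne_zero hq (m := n - (i + t)) (by omega)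
    have h5 : qBracket q (n + 1 - (i + t + 1)) ≠ 0 := by
      intro h0
      rw [e2, h0, mul_zero] at h4
      exact h4 rfl
    rw [e2, e3]
    field_simp

/-- The entries of the transforming matrix. -/
noncomputable def transCoeff (h q : ℂ) (n i k : ℤ) : ℂ :=
  (h / (q - 1)) ^ (k - i).toNat * (qFac q k * qFac q (n - i) * qFacInv q (n - k)) *
    (qFacInv q i * qFacInv q (k - i))

theorem transM_apply {n : ℕ} (hq : QGood q n) (i k : Fin (n + 1)) :
    transM h q n i k = transCoeff h q n (i : ℕ) (k : ℕ) := by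
  rw [transM, Matrix.sum_apply]
  simp only [Matrix.smul_apply, smul_pow, smul_eq_mul, JplusQ_pow_apply hq]
  rcases lt_or_ge (k : ℕ) (i : ℕ) with hik | hik
  · rw [transCoeff, qFacInv_of_neg (m := (k : ℕ) - (i : ℕ)) (by omega), mul_zero, mul_zero]
    refine Finset.sum_eq_zero fun t _ => ?_
    rw [if_neg (by omega), mul_zero, mul_zero]
  · obtain ⟨t, ht⟩ := Nat.exists_eq_add_of_le hik
    have hk := k.isLt
    have e1 : ((k : ℕ) : ℤ) - (i : ℕ) = (t : ℕ) := by omega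
    rw [Finset.sum_eq_single t, if_pos ht.symm, transCoeff, e1, Int.toNat_natCast,
      qFacInv_eq (m := t)]
    · ring
    · intro b _ hb
      rw [if_neg (by omega), mul_zero, mul_zero]
    · intro h'
      exact absurd (Finset.mem_range.2 (by omega)) h'

theorem transM_mul_inv {n : ℕ} (hq : QGood q n) : transM h q n * (transM h q n)⁻¹ = 1 := by
  refine Matrix.mul_nonsing_inv _ ?_
  rw [Matrix.det_of_isUpperTriangular]
  · rw [Finset.prod_eq_one]
    · exact isUnit_one
    · intro i _
      have hi := i.isLt
      have h1 : ((n : ℤ) - (i : ℕ)) = ((n - (i : ℕ) : ℕ) : ℤ) := by omega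
      have h2 := qBracketFactorial_ne_zero hq (m := i) (by omega)
      have h3 := qBracketFactorial_ne_zero hq (m := n - i) (by omega)
      rw [transM_apply hq, transCoeff, h1, qFac_natCast, qFac_natCast, qFacInv_eq, qFacInv_eq]
      simp [qFacInv, qBracketFactorial]
      simp only [qBracketFactorial] at h2 h3
      field_simp
  · intro i k hik
    have hik' : (k : ℕ) < i := hik
    rw [transM_apply hq, transCoeff, qFacInv_of_neg (m := (k : ℕ) - (i : ℕ)) (by omega), mul_zero,
      mul_zero]

theorem transM_inv_mul {n : ℕ} (hq : QGood q n) : (transM h q n)⁻¹ * transM h q n = 1 :=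
  mul_eq_one_comm.1 (transM_mul_inv hq)

/-- `q ^ (-w k)` on `e_k`. -/
noncomputable def qDiag (q w : ℂ) (n : ℕ) : Matrix (Fin (n + 1)) (Fin (n + 1)) ℂ :=
  Matrix.diagonal fun k : Fin (n + 1) => q ^ (-(w * (k : ℕ)))

theorem qDiag_mul (hq : q ≠ 0) (w w' : ℂ) (n : ℕ) :
    qDiag q w n * qDiag q w' n = qDiag q (w + w') n := by
  rw [qDiag, qDiag, Matrix.diagonal_mul_diagonal, qDiag]
  congr 1
  ext k
  rw [← Complex.cpow_add _ _ hq]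
  congr 1
  ring

theorem qDiag_zero (n : ℕ) : qDiag q 0 n = 1 := by simp [qDiag]

theorem qDiag_mul_qMulX (w : ℂ) (p : ℂ) (n : ℕ) :
    qDiag q w (n + 1) * qMulX p q n = qMulX p q n * qDiag q w n := by
  ext i k
  rw [qDiag, qDiag, Matrix.diagonal_mul, Matrix.mul_diagonal]
  simp only [qMulX, Matrix.of_apply]
  split_ifs with h
  · rw [h, mul_comm]
  · simp

theorem qDiag_mul_qMulY (hq : q ≠ 0) (w : ℂ) (p : ℂ) (n : ℕ) :
    qDiag q w (n + 1) * qMulY p n = q ^ (-w) • (qMulY p n * qDiag q w n) := by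
  ext i k
  rw [qDiag, qDiag, Matrix.diagonal_mul, Matrix.smul_apply, Matrix.mul_diagonal]
  simp only [qMulY, Matrix.of_apply]
  split_ifs with h
  · have : q ^ (-(w * ((k : ℕ) + 1 : ℕ))) = q ^ (-w) * q ^ (-(w * (k : ℕ))) := by
      rw [← Complex.cpow_add _ _ hq]; congr 1; push_cast; ring
    rw [h, this, smul_eq_mul]
    ring
  · simp

theorem qMulX_mul_apply {l : Type*} {p : ℂ} {n : ℕ} (N : Matrix (Fin (n + 1)) l ℂ)
    (f : ℤ → l → ℂ) (hf : ∀ i k, N i k = f (i : ℕ) k) (i : Fin (n + 1 + 1)) (k : l) :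
    (qMulX p q n * N) i k = qInt q (n + 1 - (i : ℕ)) * p ^ ((i : ℕ) : ℤ) * f (i : ℕ) k := by
  rw [Matrix.mul_apply]
  by_cases hi : (i : ℕ) < n + 1
  · rw [Finset.sum_eq_single ⟨i, hi⟩]
    · simp [qMulX, hf]
    · intro b _ hb
      have : (i : ℕ) ≠ b := fun e => hb (Fin.ext e.symm)
      simp [qMulX, this]
    · simp
  · have h2 : (i : ℕ) = n + 1 := by omega
    rw [Finset.sum_eq_zero]
    · rw [h2]
      push_cast
      rw [sub_self, qInt_zero, zero_mul, zero_mul]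
    · intro b _
      have : (i : ℕ) ≠ b := by omega
      simp [qMulX, this]

theorem qMulY_mul_apply {l : Type*} {p : ℂ} {n : ℕ} (N : Matrix (Fin (n + 1)) l ℂ)
    (f : ℤ → l → ℂ) (hf : ∀ i k, N i k = f (i : ℕ) k) (h0 : ∀ k, f (-1) k = 0)
    (i : Fin (n + 1 + 1)) (k : l) :
    (qMulY p n * N) i k = p ^ (-((n : ℤ) + 1 - (i : ℕ))) * f ((i : ℕ) - 1) k := by
  rw [Matrix.mul_apply]
  by_cases hi : 0 < (i : ℕ)
  · rw [Finset.sum_eq_single ⟨i - 1, by omega⟩]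
    · have h3 : (((i : ℕ) - 1 : ℕ) : ℤ) = (i : ℕ) - 1 := by omega
      have h2 : (i : ℕ) = i - 1 + 1 := by omega
      simp only [qMulY, Matrix.of_apply, if_pos h2, h3, hf]
      congr 2
      ring
    · intro b _ hb
      have : (i : ℕ) ≠ b + 1 := fun e => hb (Fin.ext (by simp; omega))
      simp [qMulY, this]
    · simp
  · have h2 : (i : ℕ) = 0 := by omega
    rw [Finset.sum_eq_zero]
    · rw [h2, Nat.cast_zero, zero_sub, h0, mul_zero]
    · intro b _
      have : (i : ℕ) ≠ b + 1 := by omega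
      simp [qMulY, this]

theorem mul_qMulX_apply {l : Type*} {p : ℂ} {n : ℕ} (N : Matrix l (Fin (n + 1 + 1)) ℂ) (i : l)
    (k : Fin (n + 1)) : (N * qMulX p q n) i k =
      N i k.castSucc * (qInt q (n + 1 - (k : ℕ)) * p ^ ((k : ℕ) : ℤ)) := by
  rw [Matrix.mul_apply, Finset.sum_eq_single k.castSucc]
  · simp [qMulX]
  · intro b _ hb
    have : (b : ℕ) ≠ k := fun e => hb (Fin.ext e)
    simp [qMulX, this]
  · simp

theorem mul_qMulY_apply {l : Type*} {p : ℂ} {n : ℕ} (N : Matrix l (Fin (n + 1 + 1)) ℂ) (i : l)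
    (k : Fin (n + 1)) : (N * qMulY p n) i k = N i k.succ * p ^ (-((n : ℤ) - (k : ℕ))) := by
  rw [Matrix.mul_apply, Finset.sum_eq_single k.succ]
  · simp [qMulY]
  · intro b _ hb
    have : (b : ℕ) ≠ k + 1 := fun e => hb (Fin.ext (by simpa using e))
    simp [qMulY, this]
  · simp

theorem transCoeff_of_lt {n i k : ℤ} (h' : k < i) : transCoeff h q n i k = 0 := by
  rw [transCoeff, qFacInv_of_neg (m := k - i) (by omega), mul_zero, mul_zero]

theorem transCoeff_mul_x {N : ℕ} (hq : QGood q N) {n i k : ℤ} (hn : n + 1 ≤ N) (hk : k ≤ n)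
    (hk0 : 0 ≤ k) : transCoeff h q (n + 1) i k * qInt q (n + 1 - k) =
      qInt q (n + 1 - i) * transCoeff h q n i k := by
  rcases lt_or_ge k i with hki | hki
  · rw [transCoeff_of_lt hki, transCoeff_of_lt hki, zero_mul, mul_zero]
  have e1 : qFac q (n + 1 - i) = qInt q (n + 1 - i) * qFac q (n - i) := by
    have := qFac_add_one (q := q) (m := n - i) (by omega)
    rwa [show n - i + 1 = n + 1 - i by ring] at this
  have e2 : qFacInv q (n - k) = qInt q (n + 1 - k) * qFacInv q (n + 1 - k) := by
    have := qFacInv_sub_one hq (m := n + 1 - k) (by omega)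
    rwa [show n + 1 - k - 1 = n - k by ring] at this
  rw [transCoeff, transCoeff, e1, e2]
  ring

/-- A q-Pascal rule: after cancelling factorials it is [k+1] = [i] q^(-(k+1-i)) + [k+1-i] q^i. -/
theorem transCoeff_mul_y {N : ℕ} (hq : QGood q N) {n i k : ℤ} (hn : n + 1 ≤ N) (hk : k ≤ n)
    (hk0 : 0 ≤ k) (hi0 : 0 ≤ i) : transCoeff h q (n + 1) i (k + 1) =
      q ^ (-(k + 1 - i)) * transCoeff h q n (i - 1) k +
      (h / (q - 1)) * (qInt q (n + 1 - i) * q ^ i * transCoeff h q n i k) := by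
  rcases lt_or_ge (k + 1) i with hki | hki
  · rw [transCoeff_of_lt hki, transCoeff_of_lt (by omega), transCoeff_of_lt (by omega)]
    ring
  have e1 : qInt q (n + 1 - i) * (qFac q (n - i) * qFacInv q (k - i)) =
      qFac q (n + 1 - i) * qFacInv q (k - i) := by
    rcases hki.lt_or_eq with h' | h'
    · have := qFac_add_one (q := q) (m := n - i) (by omega)
      rw [show n - i + 1 = n + 1 - i by ring] at this
      rw [this]
      ring
    · rw [qFacInv_of_neg (m := k - i) (by omega)]
      ring
  have e2 : qFacInv q (k - i) = qInt q (k + 1 - i) * qFacInv q (k + 1 - i) := by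
    have := qFacInv_sub_one hq (m := k + 1 - i) (by omega)
    rwa [show k + 1 - i - 1 = k - i by ring] at this
  have e3 := qFacInv_sub_one hq (m := i) (by omega)
  have e4 := qFac_add_one (q := q) hk0
  have e5 := qInt_add hq.1 (k + 1 - i) i
  rw [show k + 1 - i + i = k + 1 by ring] at e5
  have e6 : qFacInv q (k - i) * ((h / (q - 1)) * (h / (q - 1)) ^ (k - i).toNat) =
      qFacInv q (k - i) * (h / (q - 1)) ^ (k + 1 - i).toNat := by
    rcases hki.lt_or_eq with h' | h'
    · rw [show (k + 1 - i).toNat = (k - i).toNat + 1 by omega, pow_succ]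
      ring
    · rw [qFacInv_of_neg (m := k - i) (by omega)]
      ring
  have e7 : transCoeff h q n (i - 1) k = (h / (q - 1)) ^ (k + 1 - i).toNat *
      (qFac q k * qFac q (n + 1 - i) * qFacInv q (n - k)) *
      (qInt q i * qFacInv q i * qFacInv q (k + 1 - i)) := by
    rw [transCoeff, e3, show k - (i - 1) = k + 1 - i by ring, show n - (i - 1) = n + 1 - i by ring]
  have e8 : (h / (q - 1)) * (qInt q (n + 1 - i) * q ^ i * transCoeff h q n i k) =
      (h / (q - 1)) ^ (k + 1 - i).toNat *
      (qFac q k * qFac q (n + 1 - i) * qFacInv q (n - k)) *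
      (qFacInv q i * (qInt q (k + 1 - i) * qFacInv q (k + 1 - i))) * q ^ i := by
    rw [← e2, transCoeff]
    linear_combination (qFac q k * qFacInv q (n - k) * qFacInv q i * q ^ i) *
      ((h / (q - 1)) * (h / (q - 1)) ^ (k - i).toNat * e1 + qFac q (n + 1 - i) * e6)
  rw [e7, e8, transCoeff, show n + 1 - (k + 1) = n - k by ring, e4, e5]
  ring

end Trans

end Jordanian

namespace Jordanian

/-! ### The multiplication maps in the transformed basis. -/

section TransMul

variable {h q : ℂ}

/-- `q ^ (1/2)`. -/
noncomputable abbrev qHalf (q : ℂ) : ℂ := q ^ (1 / 2 : ℂ)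

theorem qHalf_sq (q : ℂ) : qHalf q ^ 2 = q := by
  rw [← Complex.cpow_nat_mul]
  norm_num

theorem qHalf_zpow (q : ℂ) (x : ℤ) : qHalf q ^ x = q ^ ((x : ℂ) / 2) :=
  (cpow_half_int q x rfl).symm

theorem qDiag_conj_transM_apply {n : ℕ} (hq : QGood q n) (w w' : ℂ) (i k : Fin (n + 1)) :
    (qDiag q w n * transM h q n * qDiag q w' n) i k =
      q ^ (-(w * (i : ℕ))) * transCoeff h q n (i : ℕ) (k : ℕ) * q ^ (-(w' * (k : ℕ))) := by
  rw [qDiag, qDiag, Matrix.mul_diagonal, Matrix.diagonal_mul, transM_apply hq]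

/-- The transforming matrices of consecutive sizes are intertwined by x up to a conjugation by
q^(k/2). These diagonal factors are the source of the matrices M⁻¹ q^(-wk) M. -/
theorem transM_mul_qMulX {n : ℕ} (hq : QGood q (n + 1)) :
    transM h q (n + 1) * qMulX (qHalf q) q n =
      qMulX (qHalf q) q n * (qDiag q (1 / 2) n * transM h q n * qDiag q (-(1 / 2)) n) := by
  ext i k
  rw [mul_qMulX_apply, transM_apply hq,
    qMulX_mul_apply _ (fun (i : ℤ) (k : Fin (n + 1)) => q ^ (-(1 / 2 * (i : ℂ))) * transCoeff h q n i (k : ℕ) *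
      q ^ (-(-(1 / 2) * ((k : ℕ) : ℂ)))) (fun i k => by
        rw [qDiag_conj_transM_apply (hq.mono (Nat.le_succ n))]; push_cast; rfl)]
  have h1 := transCoeff_mul_x (h := h) hq (n := n) (i := (i : ℕ)) (k := (k : ℕ)) (by push_cast; omega)
    (by omega) (by omega)
  have h2 : qHalf q ^ ((i : ℕ) : ℤ) * q ^ (-(1 / 2 * (((i : ℕ) : ℤ) : ℂ))) = 1 := by
    rw [qHalf_zpow, ← Complex.cpow_add _ _ hq.1]
    convert Complex.cpow_zero q using 2
    ring
  have h3 : q ^ (-(-(1 / 2) * ((k : ℕ) : ℂ))) = qHalf q ^ ((k : ℕ) : ℤ) := by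
    rw [qHalf_zpow]
    congr 1
    push_cast
    ring
  rw [h3]
  simp only [Fin.val_castSucc]
  push_cast at h1 ⊢
  push_cast at h2
  linear_combination (qHalf q ^ ((k : ℕ) : ℤ)) * h1 -
    qInt q (n + 1 - (i : ℕ)) * transCoeff h q n (i : ℕ) (k : ℕ) * qHalf q ^ ((k : ℕ) : ℤ) * h2

theorem transM_mul_qMulY {n : ℕ} (hq : QGood q (n + 1)) :
    transM h q (n + 1) * qMulY (qHalf q) n =
      qMulY (qHalf q) n * (qDiag q (-(1 / 2)) n * transM h q n * qDiag q (1 / 2) n) +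
      (h / (q - 1)) • (qMulX (qHalf q) q n * (q ^ (-(n : ℂ) / 2) • (qDiag q (-(1 / 2)) n *
        transM h q n * qDiag q (-(1 / 2)) n))) := by
  ext i k
  rw [Matrix.add_apply, Matrix.smul_apply, mul_qMulY_apply, transM_apply hq,
    qMulY_mul_apply _ (fun (i : ℤ) (k : Fin (n + 1)) => q ^ (-(-(1 / 2) * (i : ℂ))) * transCoeff h q n i (k : ℕ) *
      q ^ (-((1 / 2) * ((k : ℕ) : ℂ)))) (fun i k => by
        rw [qDiag_conj_transM_apply (hq.mono (Nat.le_succ n))]; push_cast; rfl)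
      (fun k => by
        rw [transCoeff, qFacInv_of_neg (m := -1) (by omega)]
        simp),
    qMulX_mul_apply _ (fun (i : ℤ) (k : Fin (n + 1)) => q ^ (-(n : ℂ) / 2) * (q ^ (-(-(1 / 2) * (i : ℂ))) *
      transCoeff h q n i (k : ℕ) *
      q ^ (-(-(1 / 2) * ((k : ℕ) : ℂ))))) (fun i k => by
        rw [Matrix.smul_apply, qDiag_conj_transM_apply (hq.mono (Nat.le_succ n))]; push_cast; rfl)]
  have h1 := transCoeff_mul_y (h := h) hq (n := n) (i := (i : ℕ)) (k := (k : ℕ)) (by push_cast; omega)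
    (by omega) (by omega) (by omega)
  have P (s t : ℂ) : q ^ s * q ^ t = q ^ (s + t) := (Complex.cpow_add _ _ hq.1).symm
  have w1 : qHalf q ^ (-((n : ℤ) + 1 - (i : ℕ))) * (q ^ (-(-(1 / 2) * ((((i : ℕ) : ℤ) - 1 : ℤ) : ℂ))) *
      q ^ (-((1 / 2) * ((k : ℕ) : ℂ)))) =
      qHalf q ^ (-((n : ℤ) - (k : ℕ))) * q ^ (-(((k : ℕ) : ℤ) + 1 - (i : ℕ))) := by
    rw [← Complex.cpow_intCast q, qHalf_zpow, qHalf_zpow, P, P, P]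
    congr 1
    push_cast
    ring
  have w2 : qHalf q ^ ((i : ℕ) : ℤ) * (q ^ (-(n : ℂ) / 2) * (q ^ (-(-(1 / 2) * (((i : ℕ) : ℤ) : ℂ))) *
      q ^ (-(-(1 / 2) * ((k : ℕ) : ℂ))))) =
      qHalf q ^ (-((n : ℤ) - (k : ℕ))) * q ^ ((i : ℕ) : ℤ) := by
    rw [← Complex.cpow_intCast q, qHalf_zpow, qHalf_zpow, P, P, P, P]
    congr 1
    push_cast
    ring
  simp only [Fin.val_succ, smul_eq_mul]
  push_cast at h1 w1 w2 ⊢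
  linear_combination (qHalf q ^ (-((n : ℤ) - (k : ℕ)))) * h1 -
    transCoeff h q n ((i : ℕ) - 1) (k : ℕ) * w1 -
    (h / (q - 1)) * qInt q (n + 1 - (i : ℕ)) * transCoeff h q n (i : ℕ) (k : ℕ) * w2

/-- `M⁻¹ q ^ (-w k) M`. -/
noncomputable def conjDiag (h q w : ℂ) (n : ℕ) : Matrix (Fin (n + 1)) (Fin (n + 1)) ℂ :=
  (transM h q n)⁻¹ * qDiag q w n * transM h q n

theorem conjDiag_mul {n : ℕ} (hq : QGood q n) (w w' : ℂ) :
    conjDiag h q w n * conjDiag h q w' n = conjDiag h q (w + w') n := by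
  have h1 := transM_mul_inv (h := h) hq
  rw [conjDiag, conjDiag, conjDiag, ← qDiag_mul hq.1]
  simp only [Matrix.mul_assoc]
  rw [← Matrix.mul_assoc (transM h q n) (transM h q n)⁻¹, h1, Matrix.one_mul]

theorem conjDiag_zero {n : ℕ} (hq : QGood q n) : conjDiag h q 0 n = 1 := by
  rw [conjDiag, qDiag_zero, Matrix.mul_one, transM_inv_mul hq]

/-- Multiplication by `x` in the new basis. -/
noncomputable def tMulX (h q : ℂ) (n : ℕ) : Matrix (Fin (n + 1 + 1)) (Fin (n + 1)) ℂ :=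
  (transM h q (n + 1))⁻¹ * (qMulX (qHalf q) q n * transM h q n)

/-- Multiplication by `y` in the new basis. -/
noncomputable def tMulY (h q : ℂ) (n : ℕ) : Matrix (Fin (n + 1 + 1)) (Fin (n + 1)) ℂ :=
  (transM h q (n + 1))⁻¹ * ((qMulY (qHalf q) n + (h / (q - 1)) • qMulX (qHalf q) q n) * transM h q n)

theorem conjDiag_mul_tMulX {n : ℕ} (hq : QGood q (n + 1)) (w : ℂ) :
    conjDiag h q w (n + 1) * tMulX h q n = tMulX h q n * conjDiag h q w n := by
  have h1 := transM_mul_inv (h := h) hq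
  have h2 := transM_mul_inv (h := h) (hq.mono (Nat.le_succ n))
  rw [conjDiag, conjDiag, tMulX]
  simp only [Matrix.mul_assoc]
  rw [← Matrix.mul_assoc (transM h q (n + 1)) (transM h q (n + 1))⁻¹, h1, Matrix.one_mul,
    ← Matrix.mul_assoc (transM h q n) (transM h q n)⁻¹, h2, Matrix.one_mul,
    ← Matrix.mul_assoc (qDiag q w (n + 1)), qDiag_mul_qMulX, Matrix.mul_assoc]

/-- On the spin-1/2 factor the diagonal matrix multiplies y by q^(-w) and fixes x. After the change
of basis y becomes y + ηx, which produces the finite coefficient η(1 - q^(-w)) and, in the limit,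
the recursion of exp(hwX). -/
theorem conjDiag_mul_tMulY {n : ℕ} (hq : QGood q (n + 1)) (w : ℂ) :
    conjDiag h q w (n + 1) * tMulY h q n = q ^ (-w) • (tMulY h q n * conjDiag h q w n) +
      ((h / (q - 1)) * (1 - q ^ (-w))) • (tMulX h q n * conjDiag h q w n) := by
  have h1 := transM_mul_inv (h := h) hq
  have h2 := transM_mul_inv (h := h) (hq.mono (Nat.le_succ n))
  rw [conjDiag, conjDiag, tMulX, tMulY]
  simp only [Matrix.mul_assoc]
  rw [← Matrix.mul_assoc (transM h q (n + 1)) (transM h q (n + 1))⁻¹, h1, Matrix.one_mul,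
    ← Matrix.mul_assoc (transM h q n) (transM h q n)⁻¹, h2, Matrix.one_mul, Matrix.add_mul,
    Matrix.smul_mul, Matrix.mul_add, Matrix.mul_smul, ← Matrix.mul_assoc (qDiag q w (n + 1)),
    ← Matrix.mul_assoc (qDiag q w (n + 1)), qDiag_mul_qMulX,
    qDiag_mul_qMulY hq.1, Matrix.smul_mul, Matrix.mul_assoc, Matrix.mul_assoc, Matrix.add_mul,
    Matrix.smul_mul]
  simp only [Matrix.mul_add, Matrix.mul_smul]
  module

/-- The possibly singular matrix M is eliminated in favour of its conjugates of diagonal matrices.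
-/
theorem tMulX_eq {n : ℕ} (hq : QGood q (n + 1)) :
    tMulX h q n = qMulX (qHalf q) q n * (qDiag q (1 / 2) n * conjDiag h q (-(1 / 2)) n) := by
  have h1 := transM_inv_mul (h := h) hq
  have h2 := transM_mul_inv (h := h) (hq.mono (Nat.le_succ n))
  have h3 := transM_mul_qMulX (h := h) hq
  have h4 : qDiag q (-(1 / 2)) n * qDiag q (1 / 2) n = 1 := by
    rw [qDiag_mul hq.1, neg_add_cancel, qDiag_zero]
  have h5 : qDiag q (1 / 2) n * qDiag q (-(1 / 2)) n = 1 := by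
    rw [qDiag_mul hq.1, add_neg_cancel, qDiag_zero]
  have h6 : transM h q (n + 1) * (qMulX (qHalf q) q n * (qDiag q (1 / 2) n * (transM h q n)⁻¹ *
      qDiag q (-(1 / 2)) n)) = qMulX (qHalf q) q n := by
    rw [← Matrix.mul_assoc, h3]
    simp only [Matrix.mul_assoc]
    rw [← Matrix.mul_assoc (qDiag q (-(1 / 2)) n) (qDiag q (1 / 2) n), h4, Matrix.one_mul,
      ← Matrix.mul_assoc (transM h q n) (transM h q n)⁻¹, h2, Matrix.one_mul, h5, Matrix.mul_one]
  conv_lhs => rw [tMulX, ← h6]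
  simp only [← Matrix.mul_assoc]
  rw [h1, Matrix.one_mul, conjDiag]
  simp only [← Matrix.mul_assoc]

/-- Two contributions carry the singular factor η: the change of basis in the spin-1/2 factor and
the commutation of M with y. They combine into η(1 - q^(-n/2) q^k), a finite q-analogue of hJ₀/2. -/
theorem tMulY_eq {n : ℕ} (hq : QGood q (n + 1)) :
    tMulY h q n = qMulY (qHalf q) n * (qDiag q (-(1 / 2)) n * conjDiag h q (1 / 2) n) +
      qMulX (qHalf q) q n * (qDiag q (1 / 2) n * (conjDiag h q (-1) n *
        (((h / (q - 1)) • (1 - q ^ (-(n : ℂ) / 2) • qDiag q (-1) n)) * conjDiag h q (1 / 2) n))) := by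
  have hq' := hq.mono (Nat.le_succ n)
  have h1 := transM_inv_mul (h := h) hq
  have h2 := transM_mul_inv (h := h) hq'
  have h3 := transM_mul_qMulY (h := h) hq
  have h4 : qDiag q (-(1 / 2)) n * qDiag q (1 / 2) n = 1 := by
    rw [qDiag_mul hq.1, neg_add_cancel, qDiag_zero]
  have h5 : qDiag q (1 / 2) n * qDiag q (-(1 / 2)) n = 1 := by
    rw [qDiag_mul hq.1, add_neg_cancel, qDiag_zero]
  have h6 : qDiag q (-(1 / 2)) n * qDiag q (-(1 / 2)) n = qDiag q (-1) n := by
    rw [qDiag_mul hq.1]; norm_num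
  have h6' : qDiag q (-1) n * qDiag q (1 / 2) n = qDiag q (-(1 / 2)) n := by
    rw [qDiag_mul hq.1]; norm_num
  have h9 : qMulX (qHalf q) q n = transM h q (n + 1) * (qMulX (qHalf q) q n * (qDiag q (1 / 2) n *
      (transM h q n)⁻¹ * qDiag q (-(1 / 2)) n)) := by
    rw [← Matrix.mul_assoc, transM_mul_qMulX hq]
    simp only [Matrix.mul_assoc]
    rw [← Matrix.mul_assoc (qDiag q (-(1 / 2)) n) (qDiag q (1 / 2) n), h4, Matrix.one_mul,
      ← Matrix.mul_assoc (transM h q n) (transM h q n)⁻¹, h2, Matrix.one_mul, h5, Matrix.mul_one]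
  have h10 : (transM h q (n + 1))⁻¹ * qMulX (qHalf q) q n = qMulX (qHalf q) q n *
      (qDiag q (1 / 2) n * (transM h q n)⁻¹ * qDiag q (-(1 / 2)) n) := by
    conv_lhs => rw [h9]
    rw [← Matrix.mul_assoc, h1, Matrix.one_mul]
  have h7 : qMulY (qHalf q) n = transM h q (n + 1) * (qMulY (qHalf q) n * (qDiag q (-(1 / 2)) n *
      ((transM h q n)⁻¹ * qDiag q (1 / 2) n))) -
      (h / (q - 1)) • (q ^ (-(n : ℂ) / 2) • (qMulX (qHalf q) q n * (qDiag q (-(1 / 2)) n *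
        (transM h q n * (qDiag q (-1) n * ((transM h q n)⁻¹ * qDiag q (1 / 2) n)))))) := by
    rw [← Matrix.mul_assoc, h3, Matrix.add_mul, Matrix.smul_mul, Matrix.mul_smul]
    simp only [Matrix.mul_assoc, Matrix.smul_mul]
    rw [← Matrix.mul_assoc (qDiag q (1 / 2) n) (qDiag q (-(1 / 2)) n), h5, Matrix.one_mul,
      ← Matrix.mul_assoc (transM h q n) (transM h q n)⁻¹, h2, Matrix.one_mul, h4, Matrix.mul_one,
      ← Matrix.mul_assoc (qDiag q (-(1 / 2)) n) (qDiag q (-(1 / 2)) n) (_ * _), h6, add_sub_cancel_right]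
  have h8 : (transM h q (n + 1))⁻¹ * qMulY (qHalf q) n = qMulY (qHalf q) n * (qDiag q (-(1 / 2)) n *
      ((transM h q n)⁻¹ * qDiag q (1 / 2) n)) -
      (h / (q - 1)) • (q ^ (-(n : ℂ) / 2) • (qMulX (qHalf q) q n *
      (qDiag q (1 / 2) n * ((transM h q n)⁻¹ * (qDiag q (-1) n *
        (transM h q n * (qDiag q (-1) n * ((transM h q n)⁻¹ * qDiag q (1 / 2) n)))))))) := by
    conv_lhs => rw [h7]
    rw [Matrix.mul_sub, ← Matrix.mul_assoc, h1, Matrix.one_mul, Matrix.mul_smul, Matrix.mul_smul,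
      ← Matrix.mul_assoc (transM h q (n + 1))⁻¹ (qMulX (qHalf q) q n), h10]
    simp only [Matrix.mul_assoc]
    rw [← Matrix.mul_assoc (qDiag q (-(1 / 2)) n) (qDiag q (-(1 / 2)) n) (_ * _), h6]
  rw [tMulY, ← Matrix.mul_assoc, Matrix.mul_add, Matrix.mul_smul, h8, h10]
  have h11 : (transM h q n)⁻¹ * (qDiag q (-(1 / 2)) n * transM h q n) =
      conjDiag h q (-1) n * conjDiag h q (1 / 2) n := by
    rw [conjDiag_mul hq', conjDiag, Matrix.mul_assoc]
    norm_num
  simp only [Matrix.add_mul, Matrix.sub_mul, Matrix.smul_mul, Matrix.mul_sub, Matrix.mul_smul,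
    Matrix.mul_assoc, h11, Matrix.one_mul]
  simp only [conjDiag, Matrix.mul_assoc]
  module

/-- A left inverse of `qMulX`. -/
noncomputable def qSectX (q : ℂ) (n : ℕ) : Matrix (Fin (n + 1)) (Fin (n + 1 + 1)) ℂ :=
  Matrix.of fun i k => if (i : ℕ) = k then (qInt q (n + 1 - (k : ℕ)) * qHalf q ^ ((k : ℕ) : ℤ))⁻¹ else 0

theorem qMulX_mul_qSectX {n : ℕ} (hq : QGood q (n + 1)) :
    qMulX (qHalf q) q n * qSectX q n + qMulY (qHalf q) n * sectY n = 1 := by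
  refine sect_spec_of (ξ := fun k => qInt q (n + 1 - (k : ℕ)) * qHalf q ^ ((k : ℕ) : ℤ))
    (υ := fun k => qHalf q ^ (-((n : ℤ) - (k : ℕ)))) ?_ (by simp) rfl rfl rfl
  intro k hk
  refine mul_ne_zero ?_ (zpow_ne_zero _ (cpow_ne_zero' hq.1 _))
  have h1 : ((n : ℤ) + 1 - k) = ((n - k + 1 : ℕ) : ℤ) := by push_cast; omega
  rw [h1, qInt_natCast]
  exact hq.2.2 _ (by omega)

/-- The first component of a right inverse of the multiplication in the new basis. -/
noncomputable def tSectX (h q : ℂ) (n : ℕ) : Matrix (Fin (n + 1)) (Fin (n + 1 + 1)) ℂ :=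
  conjDiag h q (1 / 2) n * qDiag q (-(1 / 2)) n * (qSectX q n -
    qDiag q (1 / 2) n * (conjDiag h q (-1) n *
        (((h / (q - 1)) • (1 - q ^ (-(n : ℂ) / 2) • qDiag q (-1) n)) * (qDiag q (1 / 2) n * sectY n))))

/-- The second component of a right inverse of the multiplication in the new basis. -/
noncomputable def tSectY (h q : ℂ) (n : ℕ) : Matrix (Fin (n + 1)) (Fin (n + 1 + 1)) ℂ :=
  conjDiag h q (-(1 / 2)) n * (qDiag q (1 / 2) n * sectY n)

theorem tMul_tSect {n : ℕ} (hq : QGood q (n + 1)) :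
    tMulX h q n * tSectX h q n + tMulY h q n * tSectY h q n = 1 := by
  have hq' := hq.mono (Nat.le_succ n)
  have h4 : qDiag q (-(1 / 2)) n * qDiag q (1 / 2) n = 1 := by
    rw [qDiag_mul hq.1, neg_add_cancel, qDiag_zero]
  have h5 : qDiag q (1 / 2) n * qDiag q (-(1 / 2)) n = 1 := by
    rw [qDiag_mul hq.1, add_neg_cancel, qDiag_zero]
  have h6 : conjDiag h q (1 / 2) n * conjDiag h q (-(1 / 2)) n = 1 := by
    rw [conjDiag_mul hq', add_neg_cancel, conjDiag_zero hq']
  have h7 : conjDiag h q (-(1 / 2)) n * conjDiag h q (1 / 2) n = 1 := by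
    rw [conjDiag_mul hq', neg_add_cancel, conjDiag_zero hq']
  -- The section is obtained by solving the triangular system: the y-component is matched first, and
  -- its unwanted x-part is subtracted in the x-component.
  rw [← qMulX_mul_qSectX hq, tMulX_eq hq, tMulY_eq hq, tSectX, tSectY]
  simp only [Matrix.mul_assoc, Matrix.add_mul]
  rw [← Matrix.mul_assoc (conjDiag h q (-(1 / 2)) n), h7, Matrix.one_mul,
    ← Matrix.mul_assoc (qDiag q (1 / 2) n) (qDiag q (-(1 / 2)) n), h5, Matrix.one_mul,
    ← Matrix.mul_assoc (conjDiag h q (1 / 2) n) (conjDiag h q (-(1 / 2)) n), h6, Matrix.one_mul,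
    ← Matrix.mul_assoc (qDiag q (-(1 / 2)) n) (qDiag q (1 / 2) n), h4, Matrix.one_mul,
    Matrix.mul_sub]
  abel

end TransMul

end Jordanian

namespace Jordanian

/-! ### The limit of the multiplication maps -/

section Limits

variable {h : ℂ}

theorem eventually_ne_one : ∀ᶠ q in 𝓝[≠] (1 : ℂ), q ≠ 1 := self_mem_nhdsWithin

theorem tendsto_matrix_iff {m n : Type*} {l : Filter ℂ} {f : ℂ → Matrix m n ℂ} {A : Matrix m n ℂ} :
    Tendsto f l (𝓝 A) ↔ ∀ i k, Tendsto (fun q => f q i k) l (𝓝 (A i k)) :=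
  tendsto_pi_nhds.trans (forall_congr' fun _ => tendsto_pi_nhds)

theorem tendsto_matrix_mul {l m n : Type*} [Fintype m] {F : Filter ℂ} {f : ℂ → Matrix l m ℂ}
    {g : ℂ → Matrix m n ℂ} {A : Matrix l m ℂ} {B : Matrix m n ℂ} (hf : Tendsto f F (𝓝 A))
    (hg : Tendsto g F (𝓝 B)) : Tendsto (fun q => f q * g q) F (𝓝 (A * B)) := by
  refine tendsto_matrix_iff.2 fun i k => ?_
  simp only [Matrix.mul_apply]
  exact tendsto_finsetSum _ fun j _ =>
    (tendsto_matrix_iff.1 hf i j).mul (tendsto_matrix_iff.1 hg j k)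

theorem tendsto_qBracket (m : ℕ) : Tendsto (fun q => qBracket q m) (𝓝[≠] 1) (𝓝 m) := by
  have h1 := (tendsto_cpow_sub_cpow 1 m (-m)).div (tendsto_cpow_sub_cpow 1 1 (-1))
    (by norm_num)
  have e : (1 : ℂ) * (m - -m) / (1 * (1 - -1)) = m := by ring
  rw [e] at h1
  refine h1.congr' ?_
  filter_upwards [eventually_ne_one] with q hq1
  have hq1' : q - 1 ≠ 0 := sub_ne_zero.2 hq1
  rw [Pi.div_apply, mul_div_mul_left _ _ (div_ne_zero one_ne_zero hq1'), qBracket, Complex.cpow_natCast,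
    Complex.cpow_neg, Complex.cpow_natCast, Complex.cpow_neg, Complex.cpow_one, inv_pow]

theorem eventually_qGood (N : ℕ) : ∀ᶠ q in 𝓝[≠] (1 : ℂ), QGood q N := by
  have h1 : ∀ m ∈ Finset.range N, ∀ᶠ q in 𝓝[≠] (1 : ℂ), qBracket q (m + 1) ≠ 0 := by
    intro m _
    refine (tendsto_qBracket (m + 1)).eventually_ne ?_
    exact_mod_cast Nat.succ_ne_zero m
  filter_upwards [eventually_good, (Filter.eventually_all_finset _).2 h1] with q h2 h3
  exact ⟨h2.1, h2.2, fun m hm => h3 m (Finset.mem_range.2 hm)⟩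

theorem tendsto_qInt {m : ℤ} (hm : 0 ≤ m) : Tendsto (fun q => qInt q m) (𝓝[≠] 1) (𝓝 m) := by
  obtain ⟨m, rfl⟩ := Int.eq_ofNat_of_zero_le hm
  simpa [qInt_natCast] using tendsto_qBracket m

theorem tendsto_qHalf_zpow (m : ℤ) : Tendsto (fun q => qHalf q ^ m) (𝓝[≠] 1) (𝓝 1) := by
  simpa [qHalf_zpow] using tendsto_cpow ((m : ℂ) / 2)

theorem tendsto_qMulX (n : ℕ) : Tendsto (fun q => qMulX (qHalf q) q n) (𝓝[≠] 1) (𝓝 (mulXcl n)) := by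
  refine tendsto_matrix_iff.2 fun i k => ?_
  simp only [qMulX, mulXcl, Matrix.of_apply]
  split_ifs with hik
  · have := (tendsto_qInt (m := n + 1 - (k : ℕ)) (by omega)).mul (tendsto_qHalf_zpow (k : ℕ))
    simpa using this
  · exact tendsto_const_nhds

theorem tendsto_qMulY (n : ℕ) : Tendsto (fun q => qMulY (qHalf q) n) (𝓝[≠] 1) (𝓝 (mulYcl n)) := by
  refine tendsto_matrix_iff.2 fun i k => ?_
  simp only [qMulY, mulYcl, Matrix.of_apply]
  split_ifs with hik
  · exact tendsto_qHalf_zpow _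
  · exact tendsto_const_nhds

theorem tendsto_qSectX (n : ℕ) : Tendsto (fun q => qSectX q n) (𝓝[≠] 1) (𝓝 (sectX n)) := by
  refine tendsto_matrix_iff.2 fun i k => ?_
  simp only [qSectX, sectX, Matrix.of_apply]
  split_ifs with hik
  · have := (tendsto_qInt (m := n + 1 - (k : ℕ)) (by omega)).mul (tendsto_qHalf_zpow (k : ℕ))
    have h2 : ((n : ℂ) + 1 - (k : ℕ)) ≠ 0 := by
      have : (n : ℂ) + 1 - (k : ℕ) = ((n + 1 - k : ℕ) : ℂ) := by
        rw [Nat.cast_sub (by omega)]; push_cast; ring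
      rw [this]
      exact_mod_cast (by omega : n + 1 - (k : ℕ) ≠ 0)
    refine Tendsto.inv₀ ?_ h2
    simpa using this
  · exact tendsto_const_nhds

theorem tendsto_qDiag (w : ℂ) (n : ℕ) : Tendsto (fun q => qDiag q w n) (𝓝[≠] 1) (𝓝 1) := by
  refine tendsto_matrix_iff.2 fun i k => ?_
  simp only [qDiag, Matrix.diagonal_apply, Matrix.one_apply]
  split_ifs with hik
  · exact tendsto_cpow _
  · exact tendsto_const_nhds

/-- On the vector of index k the entry is h(1 - q^(k - n/2))/(q - 1), with limit h(n/2 - k) =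
(h/2)(n - 2k). -/
theorem tendsto_qCartan (n : ℕ) : Tendsto (fun q => (h / (q - 1)) •
    ((1 : Matrix (Fin (n + 1)) (Fin (n + 1)) ℂ) - q ^ (-(n : ℂ) / 2) • qDiag q (-1) n)) (𝓝[≠] 1)
    (𝓝 ((h / 2) • J0 n)) := by
  refine tendsto_matrix_iff.2 fun i k => ?_
  simp only [qDiag, J0, Matrix.smul_apply, Matrix.sub_apply, Matrix.diagonal_apply, Matrix.one_apply]
  split_ifs with hik
  · have := tendsto_cpow_sub_cpow h 0 (-(n : ℂ) / 2 + (i : ℕ))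
    have e : h * (0 - (-(n : ℂ) / 2 + (i : ℕ))) = (h / 2) • ((n : ℂ) - 2 * (i : ℕ)) := by
      rw [smul_eq_mul]; ring
    rw [e] at this
    refine this.congr' ?_
    filter_upwards [eventually_good] with q hq
    rw [Complex.cpow_zero, Complex.cpow_add _ _ hq.1]
    simp
  · simp

theorem evJ_expArcsinhSer (s : ℂ) (n : ℕ) : evJ n (expArcsinhSer h s) = expX h n s := by
  refine eq_exp_Xmat h s (fun n => evJ n (expArcsinhSer h s)) ?_ (fun n => evJ_mul_mulX h n _) ?_ n
  · rw [evJ, ev_eq_sum, Finset.sum_range_one, PowerSeries.coeff_zero_eq_constantCoeff_apply]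
    simp [constantCoeff_expArcsinhSer]
  · intro n
    have e : PowerSeries.derivative ℂ (expArcsinhSer h s) * sqrtSer h = s • expArcsinhSer h s := by
      rw [derivative_expArcsinhSer, smul_mul_assoc]
      congr 1
      linear_combination expArcsinhSer h s * sqrtSer_mul_sqrtInvSer h
    rw [evJ_mul_mulY, e, evJ_smul, Matrix.add_mul, Matrix.mul_smul, Matrix.smul_mul]

theorem mulX_eq (n : ℕ) : mulX h n = mulXcl n * expX h n (-(h / 2)) := by
  rw [mulX, evJ_expArcsinhSer]

theorem mulY_eq (n : ℕ) : mulY h n = mulYcl n * expX h n (h / 2) +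
    mulXcl n * (expX h n (-h) * ((h / 2) • J0 n * expX h n (h / 2))) := by
  have h1 : evJ n (PowerSeries.X * PowerSeries.derivative ℂ (expArcsinhSer h (h / 2))) =
      (1 / 2 : ℂ) • (evJ n (expArcsinhSer h (h / 2)) * tanhMat h n) := by
    rw [derivative_expArcsinhSer, tanhMat, ← evJ_mul, ← evJ_smul]
    congr 1
    rw [mul_smul_comm, mul_smul_comm, smul_smul]
    congr 1
    · ring
    · ring
  have h2 := J0_mul_evJ n (expArcsinhSer h (h / 2))
  rw [h1, evJ_expArcsinhSer, smul_smul, mul_one_div_cancel two_ne_zero, one_smul, ← Matrix.mul_add] at h2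
  have h3 : expX h n (-h) * expX h n (h / 2) = expX h n (-(h / 2)) := by
    rw [← expX_add]; congr 1; ring
  rw [mulY, mulX_eq, evJ_expArcsinhSer, omegaMat, Matrix.smul_mul, h2, Matrix.mul_smul,
    Matrix.mul_smul (expX h n (-h)), ← Matrix.mul_assoc (expX h n (-h)), h3, Matrix.mul_smul,
    Matrix.mul_assoc]

/-- The multiplication maps from size n + 1 to size n + 2 involve M⁻¹ q^(-wk) M only in size n + 1.
This breaks the circle in the induction that computes the limit of those matrices. -/
theorem tendsto_tMul_of {n : ℕ}
    (hG : ∀ w, Tendsto (fun q => conjDiag h q w n) (𝓝[≠] 1) (𝓝 (expX h n (h * w)))) :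
    Tendsto (fun q => tMulX h q n) (𝓝[≠] 1) (𝓝 (mulX h n)) ∧
    Tendsto (fun q => tMulY h q n) (𝓝[≠] 1) (𝓝 (mulY h n)) ∧
    ∃ s t : Matrix (Fin (n + 1)) (Fin (n + 1 + 1)) ℂ,
      Tendsto (fun q => tSectX h q n) (𝓝[≠] 1) (𝓝 s) ∧
      Tendsto (fun q => tSectY h q n) (𝓝[≠] 1) (𝓝 t) := by
  refine ⟨?_, ?_, ?_⟩
  · have := tendsto_matrix_mul (tendsto_qMulX n)
      (tendsto_matrix_mul (tendsto_qDiag (1 / 2) n) (hG (-(1 / 2))))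
    rw [Matrix.one_mul, show h * -(1 / 2) = -(h / 2) by ring, ← mulX_eq] at this
    refine this.congr' ?_
    filter_upwards [eventually_qGood (n + 1)] with q hq
    rw [tMulX_eq hq]
  · have h1 := tendsto_matrix_mul (tendsto_qMulY n)
      (tendsto_matrix_mul (tendsto_qDiag (-(1 / 2)) n) (hG (1 / 2)))
    have h2 := tendsto_matrix_mul (tendsto_qMulX n) (tendsto_matrix_mul (tendsto_qDiag (1 / 2) n)
      (tendsto_matrix_mul (hG (-1)) (tendsto_matrix_mul (tendsto_qCartan (h := h) n) (hG (1 / 2)))))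
    have := h1.add h2
    rw [Matrix.one_mul, Matrix.one_mul, show h * (1 / 2) = h / 2 by ring, mul_neg_one, ← mulY_eq]
      at this
    refine this.congr' ?_
    filter_upwards [eventually_qGood (n + 1)] with q hq
    rw [tMulY_eq hq]
  · exact ⟨_, _, tendsto_matrix_mul (tendsto_matrix_mul (hG _) (tendsto_qDiag _ _))
      ((tendsto_qSectX n).sub (tendsto_matrix_mul (tendsto_qDiag _ _) (tendsto_matrix_mul (hG _)
        (tendsto_matrix_mul (tendsto_qCartan n) (tendsto_matrix_mul (tendsto_qDiag _ _)
          tendsto_const_nhds))))), tendsto_matrix_mul (hG _) (tendsto_matrix_mul (tendsto_qDiag _ _)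
          tendsto_const_nhds)⟩

/-- The heart of the contraction. If the limit is known for n, the multiplication maps and their
right inverse converge; multiplying the recursion of M⁻¹ q^(-wk) M by this right inverse expresses
size n + 2 through size n + 1, and its limit is the recursion of exp(hwX). -/
theorem tendsto_conjDiag (n : ℕ) (w : ℂ) :
    Tendsto (fun q => conjDiag h q w n) (𝓝[≠] 1) (𝓝 (expX h n (h * w))) := by
  induction n generalizing w with
  | zero =>
    rw [expX_zero_left]
    refine tendsto_const_nhds.congr' ?_
    filter_upwards [eventually_qGood 0] with q hq
    have : qDiag q w 0 = 1 := by
      ext i k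
      fin_cases i; fin_cases k
      simp [qDiag]
    rw [conjDiag, this, Matrix.mul_one, transM_inv_mul hq]
  | succ n ih =>
    obtain ⟨hx, hy, s, t, hs, ht⟩ := tendsto_tMul_of ih
    -- The limits of the sections are again a right inverse, because the identity holds for q near 1
    -- and passes to the limit.
    have h1 : mulX h n * s + mulY h n * t = 1 := by
      refine tendsto_nhds_unique ((tendsto_matrix_mul hx hs).add (tendsto_matrix_mul hy ht)) ?_
      refine tendsto_const_nhds.congr' ?_
      filter_upwards [eventually_qGood (n + 1)] with q hq
      rw [tMul_tSect hq]
    have h2 : expX h (n + 1) (h * w) = mulX h n * expX h n (h * w) * s +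
        ((1 : ℂ) • (mulY h n * expX h n (h * w)) + (h * w) • (mulX h n * expX h n (h * w))) * t := by
      rw [← expX_mul_mulX, one_smul, expX_mul_mulX, ← Matrix.smul_mul, ← Matrix.add_mul,
        ← expX_mul_mulY, ← expX_mul_mulX, Matrix.mul_assoc, Matrix.mul_assoc, ← Matrix.mul_add, h1,
        Matrix.mul_one]
    have h3 : Tendsto (fun q : ℂ => h / (q - 1) * (1 - q ^ (-w))) (𝓝[≠] 1) (𝓝 (h * w)) := by
      have := tendsto_cpow_sub_cpow h 0 (-w)
      simpa using this
    rw [h2]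
    refine ((tendsto_matrix_mul (tendsto_matrix_mul hx (ih w)) hs).add (tendsto_matrix_mul
      (((tendsto_cpow (-w)).smul (tendsto_matrix_mul hy (ih w))).add
        (h3.smul (tendsto_matrix_mul hx (ih w)))) ht)).congr' ?_
    filter_upwards [eventually_qGood (n + 1)] with q hq
    have h4 : conjDiag h q w (n + 1) = conjDiag h q w (n + 1) *
        (tMulX h q n * tSectX h q n + tMulY h q n * tSectY h q n) := by
      rw [tMul_tSect hq, Matrix.mul_one]
    rw [h4, Matrix.mul_add, ← Matrix.mul_assoc, ← Matrix.mul_assoc, conjDiag_mul_tMulX hq,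
      conjDiag_mul_tMulY hq]

end Limits

end Jordanian

namespace Jordanian

/-! ### Change of basis in the fusion relations. -/

section FusionConj

variable {R : Type*} [Ring R] [Algebra ℂ R]

/-- Fusion relations for the conjugate of a fusion family by a triangular change of basis. -/
theorem fusion_conj {n : ℕ} {A B C E : R} {η : ℂ}
    {G' : Matrix (Fin (n + 1 + 1)) (Fin (n + 1 + 1)) R} {G : Matrix (Fin (n + 1)) (Fin (n + 1)) R}
    {X Y : Matrix (Fin (n + 1 + 1)) (Fin (n + 1)) ℂ}
    {M' N' : Matrix (Fin (n + 1 + 1)) (Fin (n + 1 + 1)) ℂ} {M N : Matrix (Fin (n + 1)) (Fin (n + 1)) ℂ}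
    (h' : M' * N' = 1) (hM : M * N = 1)
    (hx : G' * tens (1 : R) X = tens (1 : R) X * (G * tens A (1 : Matrix (Fin (n + 1)) (Fin (n + 1)) ℂ)) +
      tens (1 : R) Y * (G * tens C (1 : Matrix (Fin (n + 1)) (Fin (n + 1)) ℂ)))
    (hy : G' * tens (1 : R) Y = tens (1 : R) X * (G * tens B (1 : Matrix (Fin (n + 1)) (Fin (n + 1)) ℂ)) +
      tens (1 : R) Y * (G * tens E (1 : Matrix (Fin (n + 1)) (Fin (n + 1)) ℂ))) :
    (tens (1 : R) N' * (G' * tens (1 : R) M')) * tens (1 : R) (N' * (X * M)) =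
      tens (1 : R) (N' * (X * M)) * ((tens (1 : R) N * (G * tens (1 : R) M)) *
        tens (A - η • C) (1 : Matrix (Fin (n + 1)) (Fin (n + 1)) ℂ)) +
      tens (1 : R) (N' * ((Y + η • X) * M)) * ((tens (1 : R) N * (G * tens (1 : R) M)) *
        tens C (1 : Matrix (Fin (n + 1)) (Fin (n + 1)) ℂ)) ∧
    (tens (1 : R) N' * (G' * tens (1 : R) M')) * tens (1 : R) (N' * ((Y + η • X) * M)) =
      tens (1 : R) (N' * (X * M)) * ((tens (1 : R) N * (G * tens (1 : R) M)) *
        tens (B + η • A - η • E - (η * η) • C) (1 : Matrix (Fin (n + 1)) (Fin (n + 1)) ℂ)) +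
      tens (1 : R) (N' * ((Y + η • X) * M)) * ((tens (1 : R) N * (G * tens (1 : R) M)) *
        tens (E + η • C) (1 : Matrix (Fin (n + 1)) (Fin (n + 1)) ℂ)) := by
  have tm {l m k : Type} [Fintype m] (P : Matrix l m ℂ) (P' : Matrix m k ℂ) :
      tens (1 : R) (P * P') = tens (1 : R) P * tens (1 : R) P' := by rw [tens_mul_tens, one_mul]
  have c1 : tens (1 : R) M' * tens (1 : R) N' = 1 := by rw [← tm, h', tens_one_one]
  have c2 : tens (1 : R) M * tens (1 : R) N = 1 := by rw [← tm, hM, tens_one_one]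
  have c1' {l : Type} (P : Matrix (Fin (n + 1 + 1)) l R) :
      tens (1 : R) M' * (tens (1 : R) N' * P) = P := by rw [← Matrix.mul_assoc, c1, Matrix.one_mul]
  have c2' {l : Type} (P : Matrix (Fin (n + 1)) l R) :
      tens (1 : R) M * (tens (1 : R) N * P) = P := by rw [← Matrix.mul_assoc, c2, Matrix.one_mul]
  have hx' := matrix_mul_congr_left (p := Fin (n + 1)) hx
  have hy' := matrix_mul_congr_left (p := Fin (n + 1)) hy
  have cm (x : R) : tens x (1 : Matrix (Fin (n + 1)) (Fin (n + 1)) ℂ) * tens (1 : R) M =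
    tens (1 : R) M * tens x (1 : Matrix (Fin (n + 1)) (Fin (n + 1)) ℂ) := tens_comm_one x M
  simp only [Matrix.mul_assoc, Matrix.add_mul] at hx' hy'
  -- The inner factors M N and M' N' cancel, and scalars from the algebra commute with complex
  -- matrices. The new fundamental matrix is (A, B; C, E) conjugated by (1, η; 0, 1).
  simp only [tm, Matrix.mul_assoc, tens_add_left, tens_sub_left, tens_smul_left, tens_add_right,
    tens_smul_right, Matrix.add_mul, Matrix.mul_add, Matrix.mul_sub,
    Matrix.mul_smul, Matrix.smul_mul, c1', c2', hx', hy', cm]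
  constructor <;> module

end FusionConj

/-! ### Entrywise limits of matrices. -/

section MatLim

variable {h α : ℂ}

/-- Entrywise limits. -/
def MatLim {l m : Type*} (h α : ℂ) (X : (q : ℂ) → Matrix l m (FunQ q α)) (Y : Matrix l m (FunH h α)) :
    Prop := ∀ i k, LimSpan h α Set.univ (fun q => X q i k) (Y i k)

theorem limSpan_one : LimSpan h α Set.univ (fun _ => 1) 1 := by
  simpa using LimSpan.of_mem (h := h) (α := α) (Set.mem_univ (1 : FreeAlgebra ℂ HGen))

namespace MatLim

variable {l m n : Type*} {X X' : (q : ℂ) → Matrix l m (FunQ q α)} {Y Y' : Matrix l m (FunH h α)}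

theorem congr (hX : MatLim h α X Y) (e : ∀ᶠ q in 𝓝[≠] (1 : ℂ), X' q = X q) : MatLim h α X' Y :=
  fun i k => .congr (by filter_upwards [e] with q hq; rw [hq]) (hX i k)

theorem add (hX : MatLim h α X Y) (hX' : MatLim h α X' Y') :
    MatLim h α (fun q => X q + X' q) (Y + Y') := fun i k => (hX i k).add (hX' i k)

theorem mul [Fintype m] {Z : (q : ℂ) → Matrix m n (FunQ q α)} {W : Matrix m n (FunH h α)}
    (hX : MatLim h α X Y) (hZ : MatLim h α Z W) : MatLim h α (fun q => X q * Z q) (Y * W) :=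
  fun i k => by
    simp only [Matrix.mul_apply]
    exact LimSpan.sum _ fun j _ => (hX i j).mul (hZ j k)

theorem tens {x : (q : ℂ) → FunQ q α} {y : FunH h α} (hx : LimSpan h α Set.univ x y)
    {N : ℂ → Matrix l m ℂ} {N₁ : Matrix l m ℂ} (hN : Tendsto N (𝓝[≠] 1) (𝓝 N₁)) :
    MatLim h α (fun q => Jordanian.tens (x q) (N q)) (Jordanian.tens y N₁) :=
  fun i k => hx.smul (tendsto_matrix_iff.1 hN i k)

theorem tens_one {N : ℂ → Matrix l m ℂ} {N₁ : Matrix l m ℂ} (hN : Tendsto N (𝓝[≠] 1) (𝓝 N₁)) :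
    MatLim h α (fun q => Jordanian.tens (1 : FunQ q α) (N q)) (Jordanian.tens 1 N₁) :=
  tens limSpan_one hN

theorem one [DecidableEq m] : MatLim h α (fun _ => (1 : Matrix m m (FunQ _ α))) 1 := by
  simpa only [tens_one_one] using tens_one (h := h) (α := α) (tendsto_const_nhds (x := (1 : Matrix m m ℂ)))

theorem unique (hX : MatLim h α X Y) (hX' : MatLim h α X Y') : Y = Y' := by
  ext i k
  exact (hX i k).unique (hX' i k)

end MatLim

theorem isContraction_iff {n : ℕ} {z : ℂ} {T : Matrix (Fin (n + 1)) (Fin (n + 1)) (FunH h α)} :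
    IsContraction h α n z T ↔ MatLim h α (fun q => tildeT h q α n z) T :=
  forall_congr' fun _ => forall_congr' fun _ => tendsToFunH_iff

end MatLim

end Jordanian

namespace Jordanian

/-! ### The generators of determinant one and their limits. -/

section SlGen

namespace FunQ

variable {q : ℂ} (α : ℂ)

theorem slA_eq : ((slA q α : (FunQ q α)ˣ) : FunQ q α) = D q α (-1 / 2) * a q α := by
  rw [← a_D]
  rfl

theorem slγ_slA (hq : q ≠ 0) : slγ q α * slA q α = q ^ (α / 2) • (D q α (-1 / 2) * c q α) := by
  have h1 : ((slA q α : (FunQ q α)ˣ) : FunQ q α) = a q α * D q α (-1 / 2) := rfl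
  rw [h1, slγ, smul_mul_assoc, ← mul_assoc, gamma_a, c_D, smul_smul, ← Complex.cpow_add _ _ hq]
  congr 2
  ring

theorem slA_slβ : (slA q α : FunQ q α) * slβ q α = q ^ (-(α / 2)) • (D q α (-1 / 2) * b q α) := by
  rw [slA_eq, slβ, mul_smul_comm, mul_assoc, a_beta]

theorem ainv_D_one (hq : q ≠ 0) : ainv q α * D q α 1 + c q α * beta q α = d q α := by
  have hα : q ^ α ≠ 0 := cpow_ne_zero' hq _
  have e1 : c q α * beta q α = (q⁻¹ * q ^ (-α)) • (ainv q α * (b q α * c q α)) := by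
    have e2 : ainv q α * (b q α * c q α) = beta q α * (gamma q α * a q α) := by
      rw [gamma_a, ← mul_assoc]
      rfl
    rw [e2, ← mul_assoc, beta_gamma α hq, mul_assoc, beta_a α hq, mul_smul_comm, smul_smul,
      Complex.cpow_neg, ← mul_assoc (gamma q α), gamma_a]
    have : q⁻¹ * (q ^ α)⁻¹ * (q * q ^ α) = 1 := by field_simp
    rw [this, one_smul]
  rw [e1, det, mul_sub, mul_smul_comm, ← mul_assoc _ (a q α), ainv_a, one_mul, sub_add_cancel]

/-- The quantum determinant gives a⁻¹D + c β̂ = d, so the last entry of the Gauss product is d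
rescaled by D^(-1/2). -/
theorem slA_inv_add (hq : q ≠ 0) : (((slA q α)⁻¹ : (FunQ q α)ˣ) : FunQ q α) + slγ q α * slA q α * slβ q α =
    D q α (-1 / 2) * d q α := by
  have hα : q ^ (α / 2) ≠ 0 := cpow_ne_zero' hq _
  have h1 : (((slA q α)⁻¹ : (FunQ q α)ˣ) : FunQ q α) = D q α (-1 / 2) * (ainv q α * D q α 1) := by
    have : (((slA q α)⁻¹ : (FunQ q α)ˣ) : FunQ q α) = D q α (-(-1 / 2)) * ainv q α := by
      rw [slA, mul_inv_rev]
      rfl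
    rw [this, ainv_D, ← mul_assoc, ← D_add]
    norm_num
  rw [h1, slγ_slA α hq, slβ, smul_mul_smul_comm, Complex.cpow_neg, mul_inv_cancel₀ hα, one_smul, mul_assoc,
    ← mul_add, ainv_D_one α hq]

end FunQ

namespace FunH

variable (h α : ℂ)

/-- The limit of the first diagonal generator of determinant one. -/
noncomputable def slA : FunH h α := D h α (-1 / 2) * (a h α - (h * α / 2) • c h α)

/-- The limit of the upper generator of determinant one. -/
noncomputable def slB : FunH h α := D h α (-1 / 2) *
  (b h α + (h * α / 2) • (a h α - d h α) - ((h * α / 2) * (h * α / 2)) • c h α)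

/-- The limit of the lower generator of determinant one. -/
noncomputable def slC : FunH h α := D h α (-1 / 2) * c h α

/-- The limit of the second diagonal generator of determinant one. -/
noncomputable def slE : FunH h α := D h α (-1 / 2) * (d h α + (h * α / 2) • c h α)

end FunH

variable (h α : ℂ)

theorem limSpan_gen (p : FreeAlgebra ℂ HGen) :
    LimSpan h α Set.univ (fun q => evalTilde h q α p) (evalH h α p) := .of_mem (Set.mem_univ p)

theorem limSpan_D (w : ℂ) : LimSpan h α Set.univ (fun q => FunQ.D q α w) (FunH.D h α w) := by
  refine .congr ?_ (limSpan_gen h α (HWord.D w))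
  filter_upwards [eventually_good] with q hq
  rw [(evalTilde_gen h α hq.2).2.2.2.2]

theorem limSpan_c : LimSpan h α Set.univ (fun q => FunQ.c q α) (FunH.c h α) := by
  refine .congr ?_ (limSpan_gen h α HWord.c)
  filter_upwards [eventually_good] with q hq
  rw [(evalTilde_gen h α hq.2).2.2.1]

theorem limSpan_a : LimSpan h α Set.univ (fun q => FunQ.ta q α (h / (q - 1))) (FunH.a h α) := by
  refine .congr ?_ (limSpan_gen h α HWord.a)
  filter_upwards [eventually_good] with q hq
  rw [(evalTilde_gen h α hq.2).1]

theorem limSpan_b : LimSpan h α Set.univ (fun q => FunQ.tb q α (h / (q - 1))) (FunH.b h α) := by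
  refine .congr ?_ (limSpan_gen h α HWord.b)
  filter_upwards [eventually_good] with q hq
  rw [(evalTilde_gen h α hq.2).2.1]

theorem limSpan_d : LimSpan h α Set.univ (fun q => FunQ.td q α (h / (q - 1))) (FunH.d h α) := by
  refine .congr ?_ (limSpan_gen h α HWord.d)
  filter_upwards [eventually_good] with q hq
  rw [(evalTilde_gen h α hq.2).2.2.2.1]

theorem limSpan_slC : LimSpan h α Set.univ (fun q => FunQ.slγ q α * FunQ.slA q α) (FunH.slC h α) := by
  have := ((limSpan_D h α (-1 / 2)).mul (limSpan_c h α)).smul (tendsto_cpow (α / 2))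
  rw [one_smul] at this
  refine .congr ?_ this
  filter_upwards [eventually_good] with q hq
  rw [FunQ.slγ_slA α hq.1]

/-- Conjugation with η acts on D^(-1/2)(a, λ^(-1/2)b; λ^(1/2)c, d), not on (a, b; c, d) itself.
Compared with the new generator a, the mismatch is η(1 - q^(α/2))c, with limit -(hα/2)c. -/
theorem limSpan_slA : LimSpan h α Set.univ
    (fun q => (FunQ.slA q α : FunQ q α) - (h / (q - 1)) • (FunQ.slγ q α * FunQ.slA q α)) (FunH.slA h α) := by
  have h1 := (limSpan_D h α (-1 / 2)).mul
    ((limSpan_a h α).add ((limSpan_c h α).smul (tendsto_eta_one_sub_cpow (h := h) (α / 2))))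
  have e : FunH.slA h α = FunH.D h α (-1 / 2) * (FunH.a h α + -(h * (α / 2)) • FunH.c h α) := by
    rw [FunH.slA]
    congr 1
    module
  rw [e]
  refine .congr ?_ h1
  filter_upwards [eventually_good] with q hq
  rw [FunQ.slγ_slA α hq.1, FunQ.slA_eq, FunQ.ta]
  simp only [mul_add, mul_sub, mul_smul_comm]
  module

theorem limSpan_slE : LimSpan h α Set.univ
    (fun q => (((FunQ.slA q α)⁻¹ : (FunQ q α)ˣ) : FunQ q α) + FunQ.slγ q α * FunQ.slA q α * FunQ.slβ q α +
      (h / (q - 1)) • (FunQ.slγ q α * FunQ.slA q α)) (FunH.slE h α) := by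
  have h1 := (limSpan_D h α (-1 / 2)).mul
    ((limSpan_d h α).sub ((limSpan_c h α).smul (tendsto_eta_one_sub_cpow (h := h) (α / 2))))
  have e : FunH.slE h α = FunH.D h α (-1 / 2) * (FunH.d h α - -(h * (α / 2)) • FunH.c h α) := by
    rw [FunH.slE]
    congr 1
    module
  rw [e]
  refine .congr ?_ h1
  filter_upwards [eventually_good] with q hq
  rw [FunQ.slA_inv_add α hq.1, FunQ.slγ_slA α hq.1, FunQ.td]
  simp only [mul_add, mul_sub, mul_smul_comm]
  module

theorem limSpan_slB : LimSpan h α Set.univ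
    (fun q => (FunQ.slA q α : FunQ q α) * FunQ.slβ q α + (h / (q - 1)) • (FunQ.slA q α : FunQ q α) -
      (h / (q - 1)) • ((((FunQ.slA q α)⁻¹ : (FunQ q α)ˣ) : FunQ q α) + FunQ.slγ q α * FunQ.slA q α * FunQ.slβ q α) -
      ((h / (q - 1)) * (h / (q - 1))) • (FunQ.slγ q α * FunQ.slA q α)) (FunH.slB h α) := by
  -- The coefficient of c is η²(q^(α/2) + q^(-α/2) - 2), a second-order difference. It is written as
  -- the square of η(q^(α/4) - q^(-α/4)), whose limit is hα/2.
  have h2 := tendsto_cpow_sub_cpow h (α / 4) (-(α / 4))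
  have h1 := (limSpan_D h α (-1 / 2)).mul
    ((((limSpan_b h α).smul (tendsto_cpow (-(α / 2)))).add
      (((limSpan_a h α).sub (limSpan_d h α)).smul (tendsto_eta_one_sub_cpow (h := h) (-(α / 2))))).sub
      ((limSpan_c h α).smul (h2.mul h2)))
  have e : FunH.slB h α = FunH.D h α (-1 / 2) * ((1 : ℂ) • FunH.b h α +
      (-(h * -(α / 2))) • (FunH.a h α - FunH.d h α) -
      ((h * (α / 4 - -(α / 4))) * (h * (α / 4 - -(α / 4)))) • FunH.c h α) := by
    rw [FunH.slB]
    congr 1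
    module
  rw [e]
  refine .congr ?_ h1
  filter_upwards [eventually_good] with q hq
  have p1 : q ^ (α / 4) * q ^ (α / 4) = q ^ (α / 2) := by
    rw [← Complex.cpow_add _ _ hq.1]
    congr 1
    ring
  have p2 : q ^ (α / 4) * q ^ (-(α / 4)) = 1 := by
    rw [← Complex.cpow_add _ _ hq.1, add_neg_cancel, Complex.cpow_zero]
  have p3 : q ^ (-(α / 4)) * q ^ (-(α / 4)) = q ^ (-(α / 2)) := by
    rw [← Complex.cpow_add _ _ hq.1]
    congr 1
    ring
  have e3 : h / (q - 1) * (q ^ (α / 4) - q ^ (-(α / 4))) * (h / (q - 1) * (q ^ (α / 4) - q ^ (-(α / 4)))) =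
      h / (q - 1) * (h / (q - 1)) * (q ^ (α / 2) + q ^ (-(α / 2)) - 2) := by
    linear_combination (h / (q - 1)) * (h / (q - 1)) * (p1 + p3 - 2 * p2)
  rw [FunQ.slA_inv_add α hq.1, FunQ.slγ_slA α hq.1, FunQ.slA_slβ α, FunQ.slA_eq, e3, FunQ.ta, FunQ.td, FunQ.tb]
  simp only [mul_add, mul_sub, mul_smul_comm]
  module

end SlGen

/-! ### Existence of the limit. -/

section Existence

variable (h α : ℂ)

/-- The standard matrix of determinant one in the new basis. -/
noncomputable def tildeGauss (h q α : ℂ) (n : ℕ) : Matrix (Fin (n + 1)) (Fin (n + 1)) (FunQ q α) :=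
  tens 1 (transM h q n)⁻¹ *
    (gaussMat (qHalf q) q (FunQ.slA q α) (FunQ.slγ q α) (FunQ.slβ q α) n * tens 1 (transM h q n))

theorem tildeGauss_fusion {q : ℂ} {n : ℕ} (hq : QGood q (n + 1)) :
    tildeGauss h q α (n + 1) * tens (1 : FunQ q α) (tMulX h q n) =
      tens (1 : FunQ q α) (tMulX h q n) * (tildeGauss h q α n *
        tens ((FunQ.slA q α : FunQ q α) - (h / (q - 1)) • (FunQ.slγ q α * FunQ.slA q α))
          (1 : Matrix (Fin (n + 1)) (Fin (n + 1)) ℂ)) +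
      tens (1 : FunQ q α) (tMulY h q n) * (tildeGauss h q α n *
        tens (FunQ.slγ q α * FunQ.slA q α) (1 : Matrix (Fin (n + 1)) (Fin (n + 1)) ℂ)) ∧
    tildeGauss h q α (n + 1) * tens (1 : FunQ q α) (tMulY h q n) =
      tens (1 : FunQ q α) (tMulX h q n) * (tildeGauss h q α n *
        tens ((FunQ.slA q α : FunQ q α) * FunQ.slβ q α + (h / (q - 1)) • (FunQ.slA q α : FunQ q α) -
      (h / (q - 1)) • ((((FunQ.slA q α)⁻¹ : (FunQ q α)ˣ) : FunQ q α) + FunQ.slγ q α * FunQ.slA q α * FunQ.slβ q α) -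
      ((h / (q - 1)) * (h / (q - 1))) • (FunQ.slγ q α * FunQ.slA q α))
          (1 : Matrix (Fin (n + 1)) (Fin (n + 1)) ℂ)) +
      tens (1 : FunQ q α) (tMulY h q n) * (tildeGauss h q α n *
        tens ((((FunQ.slA q α)⁻¹ : (FunQ q α)ˣ) : FunQ q α) + FunQ.slγ q α * FunQ.slA q α * FunQ.slβ q α +
      (h / (q - 1)) • (FunQ.slγ q α * FunQ.slA q α)) (1 : Matrix (Fin (n + 1)) (Fin (n + 1)) ℂ)) :=
  fusion_conj (transM_mul_inv hq) (transM_mul_inv (hq.mono (Nat.le_succ n)))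
    ((FunQ.isGauss α hq.1).mat_fusion_x hq (qHalf_sq q))
    ((FunQ.isGauss α hq.1).mat_fusion_y hq (qHalf_sq q))

theorem tildeGauss_zero {q : ℂ} (hq : QGood q 0) : tildeGauss h q α 0 = 1 := by
  rw [tildeGauss, gaussMat_zero, Matrix.one_mul, tens_mul_tens, transM_inv_mul hq, one_mul, tens_one_one]

/-- By induction: fusion expresses size n + 2 after multiplication by x and y through size n + 1 and
the spin-1/2 generators, and the convergent right inverse recovers the matrix itself. -/
theorem exists_matLim_tildeGauss (n : ℕ) : ∃ T, MatLim h α (fun q => tildeGauss h q α n) T := by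
  induction n with
  | zero =>
    refine ⟨1, MatLim.one.congr ?_⟩
    filter_upwards [eventually_qGood 0] with q hq
    rw [tildeGauss_zero h α hq]
  | succ n ih =>
    obtain ⟨T, hT⟩ := ih
    obtain ⟨hx, hy, s, t, hs, ht⟩ := tendsto_tMul_of (h := h) (tendsto_conjDiag n)
    have o : Tendsto (fun _ : ℂ => (1 : Matrix (Fin (n + 1)) (Fin (n + 1)) ℂ)) (𝓝[≠] 1) (𝓝 1) :=
      tendsto_const_nhds
    have l1 := ((MatLim.tens_one (h := h) (α := α) hx).mul (hT.mul (.tens (limSpan_slA h α) o))).add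
      ((MatLim.tens_one hy).mul (hT.mul (.tens (limSpan_slC h α) o)))
    have l2 := ((MatLim.tens_one (h := h) (α := α) hx).mul (hT.mul (.tens (limSpan_slB h α) o))).add
      ((MatLim.tens_one hy).mul (hT.mul (.tens (limSpan_slE h α) o)))
    refine ⟨_, ((l1.mul (.tens_one hs)).add (l2.mul (.tens_one ht))).congr ?_⟩
    filter_upwards [eventually_qGood (n + 1)] with q hq
    obtain ⟨e1, e2⟩ := tildeGauss_fusion h α hq
    rw [← e1, ← e2, Matrix.mul_assoc, Matrix.mul_assoc, ← Matrix.mul_add, tens_mul_tens, tens_mul_tens,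
      ← tens_add_right, one_mul, tMul_tSect hq, tens_one_one, Matrix.mul_one]

/-- The fusion relations hold for q near 1 and both sides converge; uniqueness of limits turns them
into equations in the Jordanian algebra. -/
theorem exists_isFusion : ∃ T : (n : ℕ) → Matrix (Fin (n + 1)) (Fin (n + 1)) (FunH h α),
    (∀ n, MatLim h α (fun q => tildeGauss h q α n) (T n)) ∧
    IsFusion h (FunH.slA h α) (FunH.slB h α) (FunH.slC h α) (FunH.slE h α) T := by
  choose T hT using exists_matLim_tildeGauss h α
  refine ⟨T, hT, ?_, fun n => ?_, fun n => ?_⟩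
  · refine (hT 0).unique (MatLim.one.congr ?_)
    filter_upwards [eventually_qGood 0] with q hq
    rw [tildeGauss_zero h α hq]
  all_goals
    obtain ⟨hx, hy, s, t, hs, ht⟩ := tendsto_tMul_of (h := h) (tendsto_conjDiag n)
    have o : Tendsto (fun _ : ℂ => (1 : Matrix (Fin (n + 1)) (Fin (n + 1)) ℂ)) (𝓝[≠] 1) (𝓝 1) :=
      tendsto_const_nhds
  · have l1 := ((MatLim.tens_one (h := h) (α := α) hx).mul ((hT n).mul (.tens (limSpan_slA h α) o))).add
      ((MatLim.tens_one hy).mul ((hT n).mul (.tens (limSpan_slC h α) o)))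
    refine ((hT (n + 1)).mul (.tens_one hx)).unique (l1.congr ?_)
    filter_upwards [eventually_qGood (n + 1)] with q hq
    rw [(tildeGauss_fusion h α hq).1]
  · have l2 := ((MatLim.tens_one (h := h) (α := α) hx).mul ((hT n).mul (.tens (limSpan_slB h α) o))).add
      ((MatLim.tens_one hy).mul ((hT n).mul (.tens (limSpan_slE h α) o)))
    refine ((hT (n + 1)).mul (.tens_one hy)).unique (l2.congr ?_)
    filter_upwards [eventually_qGood (n + 1)] with q hq
    rw [(tildeGauss_fusion h α hq).2]

/-- The colour enters only through D^z and conjugation by q^(-αzk); in the new basis this becomes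
conjugation by M⁻¹ q^(-αzk) M, with limit exp(hαzX). -/
theorem tildeT_eq {q : ℂ} {n : ℕ} (hq : QGood q n) (z : ℂ) : tildeT h q α n z =
    tens (FunQ.D q α z) (conjDiag h q (α * z) n) *
      (tildeGauss h q α n * tens 1 (conjDiag h q (-(α * z)) n)) := by
  have h1 : stdT q α n z = tens (FunQ.D q α z) (qDiag q (α * z) n) *
      (gaussMat (qHalf q) q (FunQ.slA q α) (FunQ.slγ q α) (FunQ.slβ q α) n *
        tens 1 (qDiag q (-(α * z)) n)) := by
    have d1 (x : FunQ q α) (w : ℂ) : tens x (qDiag q w n) =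
        Matrix.diagonal fun k : Fin (n + 1) => q ^ (-(w * (k : ℕ))) • x := by
      ext i k
      by_cases hik : i = k
      · subst hik
        simp [tens, qDiag]
      · simp [tens, qDiag, hik]
    ext i k
    rw [stdT_apply hq, d1, d1, Matrix.diagonal_mul, Matrix.mul_diagonal, smul_mul_assoc, mul_smul_comm,
      mul_one, mul_smul_comm, smul_smul, ← Complex.cpow_add _ _ hq.1]
    congr 2
    push_cast
    ring
  have c2 : tens (1 : FunQ q α) (transM h q n) * tens (1 : FunQ q α) (transM h q n)⁻¹ = 1 := by
    rw [tens_mul_tens, transM_mul_inv hq, one_mul, tens_one_one]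
  have c2' {l : Type} (P : Matrix (Fin (n + 1)) l (FunQ q α)) :
      tens (1 : FunQ q α) (transM h q n) * (tens (1 : FunQ q α) (transM h q n)⁻¹ * P) = P := by
    rw [← Matrix.mul_assoc, c2, Matrix.one_mul]
  have e1 : tens (FunQ.D q α z) (conjDiag h q (α * z) n) = tens (1 : FunQ q α) (transM h q n)⁻¹ *
      (tens (FunQ.D q α z) (qDiag q (α * z) n) * tens (1 : FunQ q α) (transM h q n)) := by
    rw [tens_mul_tens, tens_mul_tens, one_mul, mul_one, conjDiag, Matrix.mul_assoc]
  have e2 : tens (1 : FunQ q α) (conjDiag h q (-(α * z)) n) = tens (1 : FunQ q α) (transM h q n)⁻¹ *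
      (tens (1 : FunQ q α) (qDiag q (-(α * z)) n) * tens (1 : FunQ q α) (transM h q n)) := by
    rw [tens_mul_tens, tens_mul_tens, one_mul, mul_one, conjDiag, Matrix.mul_assoc]
  rw [tildeT, conjM, ← tens_one_eq_map, ← tens_one_eq_map, h1, e1, e2, tildeGauss]
  simp only [Matrix.mul_assoc, c2']

theorem isContraction_colT {T : (n : ℕ) → Matrix (Fin (n + 1)) (Fin (n + 1)) (FunH h α)} {n : ℕ}
    (hT : MatLim h α (fun q => tildeGauss h q α n) (T n)) (z : ℂ) :
    IsContraction h α n z (colT h α (FunH.D h α) T n z) := by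
  rw [isContraction_iff]
  have l1 := tendsto_conjDiag (h := h) n (α * z)
  have l2 := tendsto_conjDiag (h := h) n (-(α * z))
  rw [← mul_assoc] at l1
  rw [mul_neg, ← mul_assoc] at l2
  refine ((MatLim.tens (limSpan_D h α z) l1).mul (hT.mul (.tens_one l2))).congr ?_
  filter_upwards [eventually_qGood n] with q hq
  exact tildeT_eq h α hq z

theorem IsContraction.unique {n : ℕ} {z : ℂ} {T T' : Matrix (Fin (n + 1)) (Fin (n + 1)) (FunH h α)}
    (hT : IsContraction h α n z T) (hT' : IsContraction h α n z T') : T = T' :=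
  ((isContraction_iff (h := h)).1 hT).unique (isContraction_iff.1 hT')

end Existence

end Jordanian

namespace Jordanian

/-! ### Relations of the limiting generators of determinant one. -/

section SlRelations

namespace FunH

variable (h α : ℂ)

/-- The conjugate of `a` by a unipotent matrix. -/
noncomputable def shA (s : ℂ) : FunH h α := a h α + s • c h α

/-- The conjugate of `b` by a unipotent matrix. -/
noncomputable def shB (s : ℂ) : FunH h α := b h α - s • (a h α - d h α) - (s * s) • c h α

/-- The conjugate of `d` by a unipotent matrix. -/
noncomputable def shE (s : ℂ) : FunH h α := d h α - s • c h α

/-- Passing D^w shifts the parameter of the unipotent conjugation by 2hαw; this keeps all powers of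
D on the left with uniform formulas. -/
theorem shA_D (s w : ℂ) : shA h α s * D h α w = D h α w * shA h α (s + 2 * h * α * w) := by
  rw [shA, shA, add_mul, a_D, smul_mul_assoc, c_D]
  simp only [mul_add, mul_smul_comm]
  module

theorem shE_D (s w : ℂ) : shE h α s * D h α w = D h α w * shE h α (s + 2 * h * α * w) := by
  rw [shE, shE, sub_mul, d_D, smul_mul_assoc, c_D]
  simp only [mul_sub, mul_smul_comm]
  module

theorem shB_D (s w : ℂ) : shB h α s * D h α w = D h α w * shB h α (s + 2 * h * α * w) := by
  rw [shB, shB]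
  simp only [sub_mul, smul_mul_assoc, a_D, b_D, c_D, d_D]
  simp only [mul_sub, mul_add, mul_smul_comm]
  module

theorem slA_eq : slA h α = D h α (-1 / 2) * shA h α (-(h * α / 2)) := by
  rw [slA, shA]
  congr 1
  module

theorem slE_eq : slE h α = D h α (-1 / 2) * shE h α (-(h * α / 2)) := by
  rw [slE, shE]
  congr 1
  module

theorem slB_eq : slB h α = D h α (-1 / 2) * shB h α (-(h * α / 2)) := by
  rw [slB, shB]
  congr 1
  module

variable {h α} in
theorem D_half_mul {x x' : FunH h α} (hx : x * D h α (-1 / 2) = D h α (-1 / 2) * x') (y : FunH h α) :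
    D h α (-1 / 2) * x * (D h α (-1 / 2) * y) = D h α (-1) * (x' * y) := by
  have e : D h α (-1) = D h α (-1 / 2) * D h α (-1 / 2) := by rw [← D_add]; norm_num
  rw [mul_assoc, ← mul_assoc x, hx, e]
  simp only [mul_assoc]

theorem D_neg_one_mul : D h α (-1) * D h α 1 = 1 := by
  rw [← D_add, neg_add_cancel, D_zero]

/-- In each quadratic relation the two factors D^(-1/2) combine into D^(-1) on the left, the first
entry being shifted by -hα, and the unit is written as D^(-1) D. What remains is a relation between
ordered quadratic monomials in a, b, c, d, in which α drops out. -/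
theorem isSLh : IsSLh h (slA h α) (slB h α) (slC h α) (slE h α) := by
  have pA := fun y => D_half_mul (shA_D h α (-(h * α / 2)) (-1 / 2)) y
  have pB := fun y => D_half_mul (shB_D h α (-(h * α / 2)) (-1 / 2)) y
  have pC := fun y => D_half_mul (c_D h α (-1 / 2)) y
  have pE := fun y => D_half_mul (shE_D h α (-(h * α / 2)) (-1 / 2)) y
  rw [slA_eq, slB_eq, slE_eq, slC]
  constructor <;>
  · simp only [pA, pB, pC, pE, ← D_neg_one_mul h α, ← mul_smul_comm, ← mul_add, ← mul_sub]
    congr 1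
    simp only [shA, shB, shE, mul_add, add_mul, mul_sub, sub_mul, smul_mul_assoc, mul_smul_comm,
      smul_add, smul_sub, smul_smul, a_c, d_c, b_c, a_d, d_a, b_a, b_d]
    module

theorem isDetPow : IsDetPow h α (slA h α) (slB h α) (slC h α) (slE h α) (D h α) := by
  have c (w : ℂ) : D h α (-1 / 2) * D h α w = D h α w * D h α (-1 / 2) := by
    rw [← D_add, ← D_add, add_comm]
  refine ⟨D_add h α, fun w => ?_, fun w => ?_, fun w => ?_, fun w => ?_⟩
  · rw [slA_eq, slC, mul_assoc, shA_D, ← mul_assoc, c, mul_assoc, ← mul_smul_comm, ← mul_add]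
    simp only [shA]
    congr 2
    module
  · rw [slA_eq, slB_eq, slE_eq, slC, mul_assoc, shB_D, ← mul_assoc, c, mul_assoc, ← mul_sub, ← mul_smul_comm,
      ← mul_smul_comm, ← mul_add, ← mul_sub]
    simp only [shA, shB, shE]
    congr 2
    module
  · rw [slC, mul_assoc, c_D, ← mul_assoc, c, mul_assoc]
  · rw [slE_eq, slC, mul_assoc, shE_D, ← mul_assoc, c, mul_assoc, ← mul_smul_comm, ← mul_sub]
    simp only [shE]
    congr 2
    module

end FunH

end SlRelations

/-! ### The multiplication maps from spin 0 and spin 1/2. -/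

section SmallMatrices

variable (h : ℂ)

theorem mulX_zero : mulX h 0 = !![1; 0] := by
  rw [mulX_eq, expX_zero_left, Matrix.mul_one]
  ext i k
  fin_cases i <;> fin_cases k <;> simp [mulXcl]

theorem mulY_zero : mulY h 0 = !![0; 1] := by
  have : J0 0 = 0 := by
    ext i k
    fin_cases i; fin_cases k
    simp [J0]
  rw [mulY_eq, expX_zero_left, expX_zero_left, this]
  ext i k
  fin_cases i <;> fin_cases k <;> simp [mulYcl]

theorem expX_one (s : ℂ) : expX h 1 s = !![1, s; 0, 1] := by
  have h1 := expX_mul_mulX (h := h) 0 s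
  have h2 := expX_mul_mulY (h := h) 0 s
  rw [mulX_zero, expX_zero_left, Matrix.mul_one] at h1
  rw [mulY_zero, mulX_zero, expX_zero_left, Matrix.mul_one] at h2
  ext i k
  have e1 := congrFun (congrFun h1 i) 0
  have e2 := congrFun (congrFun h2 i) 0
  rw [Matrix.mul_apply, Fin.sum_univ_two] at e1 e2
  fin_cases i <;> fin_cases k <;> simp_all

/-- These explicit matrices are the only numerical input from the limiting maps to the spin-1 closed
form. -/
theorem mulX_one : mulX h 1 = !![2, -h; 0, 1; 0, 0] := by
  rw [mulX_eq, expX_one]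
  ext i k
  fin_cases i <;> fin_cases k <;> simp [mulXcl, Matrix.mul_apply, Fin.sum_univ_two]
  · norm_num
  · ring

theorem mulY_one : mulY h 1 = !![h, 3 / 2 * h ^ 2; 1, 0; 0, 1] := by
  have h1 : J0 1 = !![1, 0; 0, -1] := by
    ext i k
    fin_cases i <;> fin_cases k <;> norm_num [J0]
  have h2 : mulXcl 1 = !![2, 0; 0, 1; 0, 0] := by
    ext i k
    fin_cases i <;> fin_cases k <;> norm_num [mulXcl]
  have h3 : mulYcl 1 = !![0, 0; 1, 0; 0, 1] := by
    ext i k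
    fin_cases i <;> fin_cases k <;> norm_num [mulYcl]
  rw [mulY_eq, expX_one, expX_one, h1, h2, h3]
  ext i k
  fin_cases i <;> fin_cases k <;> simp <;> ring

end SmallMatrices

end Jordanian

namespace Jordanian

/-! ### Fusion of the coloured matrices. -/

section Forms

variable {R : Type*} [Ring R] [Algebra ℂ R] {h α : ℂ} {A B C E : R}
  {T : (n : ℕ) → Matrix (Fin (n + 1)) (Fin (n + 1)) R} {D : ℂ → R}

/-- Fusion relations of the coloured matrices. -/
theorem IsFusion.colT_fusion (hT : IsFusion h A B C E T) (n : ℕ) (z : ℂ) :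
    colT h α D T (n + 1) z * tens (1 : R) (mulX h n) =
      tens (1 : R) (mulX h n) * (colT h α D T n z * tens (A + (h * α * z) • C) (1 : Matrix (Fin (n + 1)) (Fin (n + 1)) ℂ)) +
      tens (1 : R) (mulY h n) * (colT h α D T n z * tens C (1 : Matrix (Fin (n + 1)) (Fin (n + 1)) ℂ)) ∧
    colT h α D T (n + 1) z * tens (1 : R) (mulY h n) =
      tens (1 : R) (mulX h n) * (colT h α D T n z * tens (B - (h * α * z) • (A - E) -
        ((h * α * z) * (h * α * z)) • C) (1 : Matrix (Fin (n + 1)) (Fin (n + 1)) ℂ)) +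
      tens (1 : R) (mulY h n) * (colT h α D T n z * tens (E - (h * α * z) • C) (1 : Matrix (Fin (n + 1)) (Fin (n + 1)) ℂ)) := by
  set s := h * α * z with hs
  have fx := matrix_mul_congr_left (p := Fin (n + 1)) (hT.mul_x n)
  have fy := matrix_mul_congr_left (p := Fin (n + 1)) (hT.mul_y n)
  simp only [Matrix.mul_assoc, Matrix.add_mul] at fx fy
  have d1 : tens (1 : R) (expX h (n + 1) (-s)) * tens (1 : R) (mulX h n) =
      tens (1 : R) (mulX h n) * tens (1 : R) (expX h n (-s)) := by
    rw [tens_mul_tens, tens_mul_tens, expX_mul_mulX]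
  have d2 : tens (1 : R) (expX h (n + 1) (-s)) * tens (1 : R) (mulY h n) =
      tens (1 : R) (mulY h n) * tens (1 : R) (expX h n (-s)) -
      s • (tens (1 : R) (mulX h n) * tens (1 : R) (expX h n (-s))) := by
    rw [tens_mul_tens, tens_mul_tens, tens_mul_tens, expX_mul_mulY, Matrix.add_mul,
      Matrix.smul_mul, tens_add_right, tens_smul_right, mul_one]
    module
  have g1 (M : Matrix (Fin (n + 1)) (Fin (n + 1)) R) :
      tens (D z) (expX h (n + 1) s) * (tens (1 : R) (mulX h n) * M) =
      tens (1 : R) (mulX h n) * (tens (D z) (expX h n s) * M) := by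
    rw [tens_mul_tens_assoc, tens_mul_tens_assoc, expX_mul_mulX, one_mul, mul_one]
  have g2 (M : Matrix (Fin (n + 1)) (Fin (n + 1)) R) :
      tens (D z) (expX h (n + 1) s) * (tens (1 : R) (mulY h n) * M) =
      tens (1 : R) (mulY h n) * (tens (D z) (expX h n s) * M) +
      s • (tens (1 : R) (mulX h n) * (tens (D z) (expX h n s) * M)) := by
    rw [tens_mul_tens_assoc, tens_mul_tens_assoc, tens_mul_tens_assoc, expX_mul_mulY, one_mul,
      mul_one, Matrix.add_mul, Matrix.smul_mul, tens_add_right, tens_smul_right, Matrix.add_mul,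
      Matrix.smul_mul]
  have c1 (x : R) : tens (1 : R) (expX h n (-s)) * tens x (1 : Matrix (Fin (n + 1)) (Fin (n + 1)) ℂ) =
      tens x (1 : Matrix (Fin (n + 1)) (Fin (n + 1)) ℂ) * tens (1 : R) (expX h n (-s)) :=
    (tens_comm_one x _).symm
  simp only [colT, ← hs, Matrix.mul_assoc, d1, d2, fx, fy, g1, g2, c1, tens_add_left, tens_sub_left, tens_smul_left,
    Matrix.mul_add, Matrix.mul_sub, Matrix.mul_smul]
  constructor <;> module

theorem IsFusion.colT_zero (hT : IsFusion h A B C E T) (z : ℂ) :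
    colT h α D T 0 z = tens (D z) 1 := by
  rw [colT, hT.zero, expX_zero_left, expX_zero_left, Matrix.one_mul, tens_mul_tens, mul_one,
    Matrix.one_mul]

/-- Fusion of spin 0 with spin 1/2, where the two multiplication maps are the standard basis
columns. -/
theorem IsFusion.colT_one (hT : IsFusion h A B C E T) (z : ℂ) : colT h α D T 1 z =
    D z • !![A + (h * α * z) • C, B - (h * α * z) • (A - E) - ((h * α * z) * (h * α * z)) • C;
      C, E - (h * α * z) • C] := by
  obtain ⟨h1, h2⟩ := hT.colT_fusion (D := D) (α := α) 0 z
  rw [mulX_zero, mulY_zero, hT.colT_zero, tens_mul_tens, tens_mul_tens, Matrix.one_mul] at h1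
  rw [mulX_zero, mulY_zero, hT.colT_zero, tens_mul_tens, tens_mul_tens, Matrix.one_mul] at h2
  generalize colT h α D T (0 + 1) z = N at h1 h2
  have e1 := fun i => congrFun (congrFun h1 i) 0
  have e2 := fun i => congrFun (congrFun h2 i) 0
  simp only [Matrix.add_apply, Matrix.mul_apply] at e1 e2
  ext i k
  have e1 := e1 i
  have e2 := e2 i
  fin_cases i <;> fin_cases k <;> simp_all [tens]

end Forms

end Jordanian

namespace Jordanian

/-! ### The closed forms for spin 1/2 and spin 1. -/

section ClosedForms

variable {h α : ℂ} {T : (n : ℕ) → Matrix (Fin (n + 1)) (Fin (n + 1)) (FunH h α)}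

namespace FunH

/-- The conjugate of the matrix of generators by a unipotent matrix. -/
noncomputable def shMat (h α s : ℂ) : Matrix (Fin (1 + 1)) (Fin (1 + 1)) (FunH h α) :=
  !![shA h α s, shB h α s; c h α, shE h α s]

theorem slA_add (z : ℂ) : slA h α + (h * α * z) • slC h α =
    D h α (-1 / 2) * shA h α (h * α * (z - 1 / 2)) := by
  rw [slA_eq, slC, ← mul_smul_comm, ← mul_add, shA, shA]
  congr 1
  module

theorem slE_sub (z : ℂ) : slE h α - (h * α * z) • slC h α =
    D h α (-1 / 2) * shE h α (h * α * (z - 1 / 2)) := by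
  rw [slE_eq, slC, ← mul_smul_comm, ← mul_sub, shE, shE]
  congr 1
  module

theorem slB_sub (z : ℂ) : slB h α - (h * α * z) • (slA h α - slE h α) -
      ((h * α * z) * (h * α * z)) • slC h α =
    D h α (-1 / 2) * shB h α (h * α * (z - 1 / 2)) := by
  rw [slB_eq, slA_eq, slE_eq, slC, ← mul_sub, ← mul_smul_comm, ← mul_sub, ← mul_smul_comm, ← mul_sub,
    shB, shB, shA, shE]
  congr 1
  module

theorem shMat_D (s w : ℂ) (i k : Fin (1 + 1)) :
    shMat h α s i k * D h α w = D h α w * shMat h α (s + 2 * h * α * w) i k := by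
  fin_cases i <;> fin_cases k
  · exact shA_D h α s w
  · exact shB_D h α s w
  · exact c_D h α w
  · exact shE_D h α s w

end FunH

open FunH

/-- The coloured matrix of spin one half. -/
theorem colT_one_eq (hT : IsFusion h (slA h α) (slB h α) (slC h α) (slE h α) T) (z : ℂ) :
    colT h α (FunH.D h α) T 1 z = FunH.D h α (z - 1 / 2) • shMat h α (h * α * (z - 1 / 2)) := by
  have e : FunH.D h α (z - 1 / 2) = FunH.D h α z * FunH.D h α (-1 / 2) := by
    rw [← D_add]
    congr 1
    ring
  rw [hT.colT_one, slA_add, slE_sub, slB_sub, slC, e, shMat]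
  ext i k
  fin_cases i <;> fin_cases k <;> simp [mul_assoc]

/-- The determinant of the second spin-1/2 factor is moved left through the first one, which lowers
its parameter from hα(z - ½) to hα(z - 3/2). -/
theorem colT_one_mul (hT : IsFusion h (slA h α) (slB h α) (slC h α) (slE h α) T) (z : ℂ)
    (y : FunH h α) : colT h α (FunH.D h α) T 1 z *
      tens (FunH.D h α (-1 / 2) * y) (1 : Matrix (Fin (1 + 1)) (Fin (1 + 1)) ℂ) =
    FunH.D h α (z - 1) • (shMat h α (h * α * (z - 3 / 2)) *
      tens y (1 : Matrix (Fin (1 + 1)) (Fin (1 + 1)) ℂ)) := by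
  have e : FunH.D h α (z - 1) = FunH.D h α (z - 1 / 2) * FunH.D h α (-1 / 2) := by
    rw [← D_add]
    congr 1
    ring
  have e2 : h * α * (z - 3 / 2) = h * α * (z - 1 / 2) + 2 * h * α * (-1 / 2) := by ring
  have t1 (x : FunH h α) : tens x (1 : Matrix (Fin (1 + 1)) (Fin (1 + 1)) ℂ) =
      Matrix.diagonal fun _ => x := by
    ext i k
    by_cases hik : i = k
    · subst hik
      simp [tens]
    · simp [tens, hik]
  rw [colT_one_eq hT, t1, t1]
  ext i k
  rw [Matrix.mul_diagonal, Matrix.smul_apply, Matrix.smul_apply, Matrix.mul_diagonal, smul_eq_mul,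
    smul_eq_mul, mul_assoc, ← mul_assoc _ _ y, shMat_D, ← e2, e]
  simp only [mul_assoc]

theorem colT_two_eq (hT : IsFusion h (slA h α) (slB h α) (slC h α) (slE h α) T) (z : ℂ) :
    ∃ V : Matrix (Fin (1 + 1 + 1)) (Fin (1 + 1 + 1)) (FunH h α),
      colT h α (FunH.D h α) T 2 z = FunH.D h α (z - 1) • V ∧
      V * tens (1 : FunH h α) (mulX h 1) =
        tens (1 : FunH h α) (mulX h 1) * (shMat h α (h * α * (z - 3 / 2)) *
          tens (shA h α (h * α * (z - 1 / 2))) (1 : Matrix (Fin (1 + 1)) (Fin (1 + 1)) ℂ)) +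
        tens (1 : FunH h α) (mulY h 1) * (shMat h α (h * α * (z - 3 / 2)) *
          tens (FunH.c h α) (1 : Matrix (Fin (1 + 1)) (Fin (1 + 1)) ℂ)) ∧
      V * tens (1 : FunH h α) (mulY h 1) =
        tens (1 : FunH h α) (mulX h 1) * (shMat h α (h * α * (z - 3 / 2)) *
          tens (shB h α (h * α * (z - 1 / 2))) (1 : Matrix (Fin (1 + 1)) (Fin (1 + 1)) ℂ)) +
        tens (1 : FunH h α) (mulY h 1) * (shMat h α (h * α * (z - 3 / 2)) *
          tens (shE h α (h * α * (z - 1 / 2))) (1 : Matrix (Fin (1 + 1)) (Fin (1 + 1)) ℂ)) := by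
  obtain ⟨h1, h2⟩ := hT.colT_fusion (D := FunH.D h α) (α := α) 1 z
  have d1 : FunH.D h α (z - 1) * FunH.D h α (-(z - 1)) = 1 := by
    rw [← D_add, add_neg_cancel, D_zero]
  have d2 : FunH.D h α (-(z - 1)) * FunH.D h α (z - 1) = 1 := by
    rw [← D_add, neg_add_cancel, D_zero]
  have s1 (P : Matrix (Fin (1 + 1 + 1)) (Fin (1 + 1)) ℂ) (x : FunH h α)
      (M : Matrix (Fin (1 + 1)) (Fin (1 + 1)) (FunH h α)) : tens (1 : FunH h α) P * (x • M) =
      x • (tens (1 : FunH h α) P * M) := by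
    ext i k
    simp [Matrix.mul_apply, tens, mul_add]
  rw [slA_add, slC, colT_one_mul hT, colT_one_mul hT, s1, s1, ← smul_add] at h1
  rw [slB_sub, slE_sub, colT_one_mul hT, colT_one_mul hT, s1, s1, ← smul_add] at h2
  refine ⟨FunH.D h α (-(z - 1)) • colT h α (FunH.D h α) T 2 z, ?_, ?_, ?_⟩
  · rw [smul_smul, d1, one_smul]
  · rw [Matrix.smul_mul, h1, smul_smul, d2, one_smul]
  · rw [Matrix.smul_mul, h2, smul_smul, d2, one_smul]

/-- Three of the four columns of the two multiplication maps already span the spin-1 space, so V is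
recovered from them by triangular elimination; the first column of `mulY` is redundant. -/
theorem sect_mul_eq {V : Matrix (Fin (1 + 1 + 1)) (Fin (1 + 1 + 1)) (FunH h α)}
    {W W' : Matrix (Fin (1 + 1 + 1)) (Fin (1 + 1)) (FunH h α)}
    (h1 : V * tens (1 : FunH h α) (mulX h 1) = W) (h2 : V * tens (1 : FunH h α) (mulY h 1) = W')
    (i : Fin (1 + 1 + 1)) : V i 0 = (1 / 2 : ℂ) • W i 0 ∧ V i 1 = W i 1 + (h / 2) • W i 0 ∧
      V i 2 = W' i 1 - (3 / 4 * h ^ 2) • W i 0 := by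
  have e1 := congrFun (congrFun h1 i) 0
  have e2 := congrFun (congrFun h1 i) 1
  have e3 := congrFun (congrFun h2 i) 1
  rw [Matrix.mul_apply, Fin.sum_univ_three] at e1 e2 e3
  rw [← e1, ← e2, ← e3, mulX_one, mulY_one]
  simp only [tens, Matrix.map_apply, mul_smul_comm, mul_one]
  simp only [Matrix.of_apply, Matrix.cons_val]
  refine ⟨?_, ?_, ?_⟩ <;> module

theorem tens_mul_apply {P Q : Matrix (Fin (1 + 1)) (Fin (1 + 1)) (FunH h α)} (k : Fin (1 + 1)) :
    (tens (1 : FunH h α) (mulX h 1) * P + tens (1 : FunH h α) (mulY h 1) * Q) 0 k =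
      (2 : ℂ) • P 0 k - h • P 1 k + h • Q 0 k + (3 / 2 * h ^ 2) • Q 1 k ∧
    (tens (1 : FunH h α) (mulX h 1) * P + tens (1 : FunH h α) (mulY h 1) * Q) 1 k = P 1 k + Q 0 k ∧
    (tens (1 : FunH h α) (mulX h 1) * P + tens (1 : FunH h α) (mulY h 1) * Q) 2 k = Q 1 k := by
  have key (i : Fin (1 + 1 + 1)) : (tens (1 : FunH h α) (mulX h 1) * P + tens (1 : FunH h α) (mulY h 1) * Q) i k =
      (mulX h 1 i 0 • P 0 k + mulX h 1 i 1 • P 1 k) + (mulY h 1 i 0 • Q 0 k + mulY h 1 i 1 • Q 1 k) := by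
    rw [Matrix.add_apply, Matrix.mul_apply, Matrix.mul_apply, Fin.sum_univ_two, Fin.sum_univ_two]
    simp only [tens, Matrix.map_apply, smul_mul_assoc, one_mul]
  rw [key, key, key, mulX_one, mulY_one]
  simp only [Matrix.of_apply, Matrix.cons_val]
  refine ⟨?_, ?_, ?_⟩ <;> module

/-- The half-spin closed form. -/
theorem colT_one_closed (hT : IsFusion h (slA h α) (slB h α) (slC h α) (slE h α) T) (z : ℂ) :
    colT h α (FunH.D h α) T 1 z =
      evalH h α (HWord.D (z - 1 / 2)) • (halfForm h α z).map (evalH h α) := by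
  rw [colT_one_eq hT, evalH_ι]
  congr 1
  ext i k
  fin_cases i <;> fin_cases k <;>
    simp only [shMat, halfForm, shA, shB, shE, Matrix.map_apply, Matrix.of_apply, Matrix.cons_val,
      map_add, map_sub, map_smul, evalH_ι, Fin.zero_eta, Fin.mk_one]
  module

/-- The closed form in spin one. -/
theorem colT_two_closed (hT : IsFusion h (slA h α) (slB h α) (slC h α) (slE h α) T) (z : ℂ) :
    colT h α (FunH.D h α) T 2 z =
      evalH h α (HWord.D (z - 1)) • (oneForm h α z).map (evalH h α) := by
  obtain ⟨V, hV, h1, h2⟩ := colT_two_eq hT z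
  rw [hV, evalH_ι]
  congr 1
  have t1 (M : Matrix (Fin (1 + 1)) (Fin (1 + 1)) (FunH h α)) (x : FunH h α) (i k : Fin (1 + 1)) :
      (M * tens x (1 : Matrix (Fin (1 + 1)) (Fin (1 + 1)) ℂ)) i k = M i k * x := by
    rw [Matrix.mul_apply, Finset.sum_eq_single k]
    · simp [tens]
    · intro j _ hj
      simp [tens, hj]
    · simp
  -- After reordering into the monomials D, c², c a, c d, c b, a², a b, d², d b, b², each entry is
  -- an identity of coefficients polynomial in h, α and z.
  ext i k
  obtain ⟨e1, e2, e3⟩ := sect_mul_eq h1 h2 i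
  fin_cases i <;> fin_cases k <;>
    simp only [Fin.zero_eta, Fin.mk_one, Fin.reduceFinMk] at e1 e2 e3 ⊢ <;>
    simp only [e1, e2, e3, tens_mul_apply] <;>
    simp only [t1, shMat, oneForm, Matrix.map_apply, Matrix.of_apply, Matrix.cons_val, map_add, map_sub,
      map_smul, map_mul, pow_two (HWord.a), pow_two (HWord.b), pow_two (HWord.c), pow_two (HWord.d),
      evalH_ι] <;>
    simp only [shA, shB, shE, mul_add, add_mul, mul_sub, sub_mul, smul_mul_assoc, mul_smul_comm,
      smul_add, smul_sub, smul_smul, a_c, d_c, b_c, a_d, d_a, b_a, b_d] <;>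
    module

theorem oneForm_eq_oneFormAlphaZero (h : ℂ) :
    (oneForm h 0 (1 / 2)).map (evalH h 0) = (oneFormAlphaZero h).map (evalH h 0) := by
  ext i k
  fin_cases i <;> fin_cases k <;>
    simp only [Fin.zero_eta, Fin.mk_one, Fin.reduceFinMk] <;>
    simp only [oneForm, oneFormAlphaZero, Matrix.map_apply, Matrix.of_apply, Matrix.cons_val, map_add, map_sub,
      map_smul, map_mul, pow_two (HWord.a), pow_two (HWord.b), pow_two (HWord.c), pow_two (HWord.d),
      evalH_ι] <;>
    try simp only [smul_add, smul_sub, smul_smul, a_c, d_c, b_c, a_d, d_a, b_a, b_d]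
  all_goals module

end ClosedForms

end Jordanian

theorem mainTheorem3 (h α : ℂ) :
    ∃ T : (n : ℕ) → ℂ → Matrix (Fin (n + 1)) (Fin (n + 1)) (Jordanian.FunH h α),
      (∀ (n : ℕ) (z : ℂ), Jordanian.IsContraction h α n z (T n z) ∧
        ∀ T', Jordanian.IsContraction h α n z T' → T' = T n z) ∧
      (∀ (n₁ : ℕ) (z₁ : ℂ) (n₂ : ℕ) (z₂ : ℂ),
        Jordanian.RTT (Jordanian.Rmat h α n₁ z₁ n₂ z₂) (T n₁ z₁) (T n₂ z₂)) ∧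
      (∀ z : ℂ, T 1 z =
        Jordanian.evalH h α (Jordanian.HWord.D (z - 1 / 2)) •
          (Jordanian.halfForm h α z).map (Jordanian.evalH h α)) ∧
      (∀ z : ℂ, T 2 z =
        Jordanian.evalH h α (Jordanian.HWord.D (z - 1)) •
          (Jordanian.oneForm h α z).map (Jordanian.evalH h α)) ∧
      (α = 0 → T 2 (1 / 2) =
        Jordanian.evalH h α (Jordanian.HWord.D (-1 / 2)) •
          (Jordanian.oneFormAlphaZero h).map (Jordanian.evalH h α)) := by
  obtain ⟨T, hT, hF⟩ := Jordanian.exists_isFusion h α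
  refine ⟨Jordanian.colT h α (Jordanian.FunH.D h α) T, fun n z =>
    ⟨Jordanian.isContraction_colT h α (hT n) z, fun T' hT' =>
      hT'.unique h α (Jordanian.isContraction_colT h α (hT n) z)⟩,
    fun n z n' z' => hF.rtt_coloured (Jordanian.FunH.isSLh h α) (Jordanian.FunH.isDetPow h α) n n' z z',
    Jordanian.colT_one_closed hF, Jordanian.colT_two_closed hF, ?_⟩
  rintro rfl
  -- At z = 1/2 the prefactor D^(z-1) is D^(-1/2), and for α = 0 the anticommutator form agrees with
  -- the general one after reordering.
  rw [Jordanian.colT_two_closed hF, Jordanian.oneForm_eq_oneFormAlphaZero]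
  norm_num
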